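/- Let $\Omega=\mathbb R^3\setminus\overline{B(0,1)}$. For radial $f$ on $\Omega$ let $$\mathcal F_Df(\lambda)=\sqrt{\tfrac2\pi}\int_1^\infty \frac{\sin\lambda(r-1)}{r}f(r)\,r^2\,dr\quad(\lambda>0),\qquad \mathcal F_D^{-1}g(r)=\sqrt{\tfrac2\pi}\int_0^\infty \frac{\sin\lambda(r-1)}{r}g(\lambda)\,d\lambda ,$$ be the distorted Fourier transform of the Dirichlet Laplacian $-\Delta_\Omega$ and its inverse, where $\mathcal F_D$ is extended by continuity to $L^2_{rad}(\Omega)$ and to the spaces below; for a function $m$ on $(0,\infty)$ let $m(\sqrt{-\Delta_\Omega})=\mathcal F_D^{-1}m\,\mathcal F_D$. For $-\frac12\le\sigma\le1$ let $\dot H^\sigma_{D,rad}(\Omega)$ be the completion of the radial functions in $C_c^\infty(\Omega)$ in the norm $\|(-\Delta_\Omega)^{\sigma/2}f\|_{L^2(\Omega)}=\big(4\pi\int_0^\infty\lambda^{2\sigma}|\mathcal F_Df(\lambda)|^2d\lambda\big)^{1/2}$; products such as $\dot H^\sigma\times\dot H^{\sigma-1}$ carry the sum of the two norms. Fix a smooth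 $\chi:[0,\infty)\to[0,1]$ with $\chi=1$ on $[0,1]$ and $\chi=0$ on $[2,\infty)$, and put $P^\Omega_{\le 2^J}=\chi(2^{-J}\sqrt{-\Delta_\Omega})$ and $P^\Omega_{>2^J}=I-P^\Omega_{\le 2^J}$. On an interval $I\ni0$, a solution of $\partial_t^2u-\Delta u=F$ in $I\times\Omega$, $u=0$ on $I\times\partial\Omega$, $(u,\partial_tu)(0)=(a,b)$, is a function $u$ for which $F\in L^1_{loc}(I;L^2(\Omega))$ and $$u(t)=\cos(t\sqrt{-\Delta_\Omega})a+\frac{\sin(t\sqrt{-\Delta_\Omega})}{\sqrt{-\Delta_\Omega}}b+\int_0^t\frac{\sin((t-\tau)\sqrt{-\Delta_\Omega})}{\sqrt{-\Delta_\Omega}}F(\tau)\,d\tau\qquad(t\in I),$$ where for a nonlinear equation $F$ is evaluated along the solution. **Proposition.** There are absolute constants $\varepsilon_0,c,C>0$ with the following property. Let $\frac12<s\le1$, let $\chi$ be as above, let $(u_0,u_1)\in\dot H^s_{D,rad}(\Omega)\times\dot H^{s-1}_{D,rad}(\Omega)$ be real valued, and let $J\in\mathbb Z$ satisfy $$2^{J(\frac12-s)}\,\|(u_0,u_1)\|_{\dot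 H^s_{D,rad}\times\dot H^{s-1}_{D,rad}}\le\varepsilon_0 .$$ Let $w\in C(\mathbb R;\dot H^{1/2}_{D,rad}(\Omega)\cap\dot H^s_{D,rad}(\Omega))$ be the global solution of $$\partial_t^2w-\Delta w+w^3=0,\qquad w|_{\partial\Omega}=0,\qquad (w,\partial_tw)(0)=(P^\Omega_{>2^J}u_0,\,P^\Omega_{>2^J}u_1).$$ Put $(v_0,v_1)=(P^\Omega_{\le2^J}u_0,\,P^\Omega_{\le2^J}u_1)$ and let $0<T<\infty$ satisfy $$T\,\|(v_0,v_1)\|^2_{\dot H^1_{D,rad}(\Omega)\times L^2(\Omega)}\le c .$$ Then there is a unique solution $v\in C([0,T);\dot H^1_{D,rad}(\Omega))$ of $$\partial_t^2v-\Delta v+v^3=-3v^2w-3vw^2\ \text{ in }[0,T)\times\Omega,\qquad v|_{\partial\Omega}=0,\qquad (v,\partial_tv)(0)=(v_0,v_1),$$ and $$\sup_{0\le t<T}\|v(t)\|_{\dot H^1_{D,rad}(\Omega)}\le C\,\|(v_0,v_1)\|_{\dot H^1_{D,rad}(\Omega)\times L^2(\Omega)} .$$ -/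

import Mathlib

open MeasureTheory Set Filter Topology
open scoped ContDiff

noncomputable section

namespace ExteriorWave

/-- Three-dimensional Euclidean space. -/
abbrev E3 : Type := EuclideanSpace ℝ (Fin 3)

/-- The exterior domain `Ω = ℝ³ ∖ closedBall 0 1`. -/
def Omega : Set E3 := (Metric.closedBall (0 : E3) 1)ᶜ

/-- The function depends on `|x|` only. -/
def IsRadial (f : E3 → ℝ) : Prop := ∀ x y : E3, ‖x‖ = ‖y‖ → f x = f y

/-- Radial functions in `C_c^∞(Ω)`. -/
structure IsRadialTest (f : E3 → ℝ) : Prop where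
  smooth : ContDiff ℝ ∞ f
  compact : HasCompactSupport f
  support : tsupport f ⊆ Omega
  radial : IsRadial f

/-- The value `f(r)` of a radial function on the sphere `|x| = r`, `r ≥ 0`. -/
def profile (f : E3 → ℝ) (r : ℝ) : ℝ := f (EuclideanSpace.single (0 : Fin 3) r)

/-- The radial generalized Dirichlet eigenfunction `e_lam(r) = sin (lam (r - 1)) / r`. -/
def eigenfn (lam r : ℝ) : ℝ := Real.sin (lam * (r - 1)) / r

/-- Lebesgue measure on the frequency half line `(0, ∞)`. -/
def freqMeasure : Measure ℝ := volume.restrict (Ioi 0)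

/-- The distorted Fourier transform of a radial function, as an integral. -/
def dft (f : E3 → ℝ) (lam : ℝ) : ℝ :=
  Real.sqrt (2 / Real.pi) * ∫ r in Ioi (1 : ℝ), eigenfn lam r * profile f r * r ^ 2

/-- The inverse distorted Fourier transform, a radial function on `Ω`. -/
def invDft (g : ℝ → ℝ) (x : E3) : ℝ :=
  Real.sqrt (2 / Real.pi) * ∫ lam in Ioi (0 : ℝ), eigenfn lam ‖x‖ * g lam

/-- `g` is the distorted Fourier transform of the radial function `f ∈ L²(Ω)`, in the sense of
the continuous extension of the transform from radial `C_c^∞(Ω)` to radial `L²(Ω)`. -/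
def IsDftL2 (f : E3 → ℝ) (g : ℝ → ℝ) : Prop :=
  ∃ φ : ℕ → E3 → ℝ, (∀ n, IsRadialTest (φ n)) ∧
    Tendsto (fun n => eLpNorm (fun x => φ n x - f x) 2 (volume.restrict Omega)) atTop (𝓝 0) ∧
    Tendsto (fun n => eLpNorm (fun lam => dft (φ n) lam - g lam) 2 freqMeasure) atTop (𝓝 0)

/-- The measure `4π lam^{2s} d lam` on `(0, ∞)`. By the Plancherel identity
`‖f‖_{L²(Ω)}² = 4π ∫ |dft f|²`, the norm of `dft f` in the corresponding `L²` space is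
`‖(-Δ_Ω)^{s/2} f‖_{L²(Ω)}`. -/
def sobMeasure (s : ℝ) : Measure ℝ :=
  freqMeasure.withDensity (fun lam => ENNReal.ofReal (4 * Real.pi * lam ^ (2 * s)))

/-- The transforms of the radial test functions, closed up in the norm
`‖(-Δ_Ω)^{s/2} f‖_{L²(Ω)}`. -/
def hdotSubmodule (s : ℝ) : Submodule ℝ (Lp ℝ 2 (sobMeasure s)) :=
  (Submodule.span ℝ {g : Lp ℝ 2 (sobMeasure s) |
    ∃ φ : E3 → ℝ, IsRadialTest φ ∧ (g : ℝ → ℝ) =ᵐ[sobMeasure s] dft φ}).topologicalClosure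

/-- The space `Ḣ^s_{D,rad}(Ω)`: the completion of the radial functions in `C_c^∞(Ω)` in the norm
`‖(-Δ_Ω)^{s/2} f‖_{L²(Ω)}`. The completion is carried out on the frequency side: an element is
given by its distorted Fourier transform, and `HdotRad 0` is `L²_rad(Ω)`. -/
abbrev HdotRad (s : ℝ) : Type := ↥(hdotSubmodule s)

/-- The distorted Fourier transform of an element of `Ḣ^s_{D,rad}(Ω)`. -/
def spec {s : ℝ} (u : HdotRad s) : ℝ → ℝ := ((u : Lp ℝ 2 (sobMeasure s)) : ℝ → ℝ)

/-- The `Ḣ^s_D(Ω)` norm of the element with distorted Fourier transform `g`. -/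
def hdotNorm (s : ℝ) (g : ℝ → ℝ) : ℝ := (eLpNorm g 2 (sobMeasure s)).toReal

/-- The function with distorted Fourier transform `u t` is in `C(I; Ḣ^s_{D,rad}(Ω))`
as a function of `t`. -/
def IsContInto (s : ℝ) (I : Set ℝ) (u : ℝ → ℝ → ℝ) : Prop :=
  ∃ z : ℝ → HdotRad s, ContinuousOn z I ∧ ∀ t ∈ I, spec (z t) =ᵐ[freqMeasure] u t

/-- The smooth cutoffs `χ : [0, ∞) → [0, 1]` of Littlewood-Paley theory. -/
structure IsCutoff (χ : ℝ → ℝ) : Prop where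
  smooth : ContDiffOn ℝ ∞ χ (Ici 0)
  mem_Icc : ∀ lam, 0 ≤ lam → χ lam ∈ Icc (0 : ℝ) 1
  eq_one : ∀ lam, 0 ≤ lam → lam ≤ 1 → χ lam = 1
  eq_zero : ∀ lam, 2 ≤ lam → χ lam = 0

/-- `P_{≤ 2^J} = χ(2^{-J} √(-Δ_Ω))` on the frequency side. -/
def lowFreq (χ : ℝ → ℝ) (J : ℤ) (g : ℝ → ℝ) (lam : ℝ) : ℝ := χ (lam / (2 : ℝ) ^ J) * g lam

/-- `P_{> 2^J} = 1 - P_{≤ 2^J}` on the frequency side. -/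
def highFreq (χ : ℝ → ℝ) (J : ℤ) (g : ℝ → ℝ) (lam : ℝ) : ℝ := g lam - lowFreq χ J g lam

/-- On the time interval `I ∋ 0`, the function whose distorted Fourier transform at time `t` is
`u t` is given by Duhamel's formula
`cos(t√(-Δ_Ω)) a + sin(t√(-Δ_Ω))/√(-Δ_Ω) b + ∫_0^t sin((t-τ)√(-Δ_Ω))/√(-Δ_Ω) F(τ) dτ`,
where `a`, `b` are the transforms of the initial position and velocity and the forcing `F` is
in `L¹_loc(I; L²(Ω))`; `G` is the transform of `F`. This is the solution of
`∂_t² u - Δ u = F` in `I × Ω` with `u = 0` on `I × ∂Ω`. -/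
def IsDuhamel (I : Set ℝ) (a b : ℝ → ℝ) (F : ℝ → E3 → ℝ) (u : ℝ → ℝ → ℝ) : Prop :=
  ∃ G : ℝ → ℝ → ℝ,
    AEStronglyMeasurable (Function.uncurry G) ((volume.restrict I).prod freqMeasure) ∧
    (∀ᵐ τ ∂(volume.restrict I), IsDftL2 (F τ) (G τ)) ∧
    (∀ t ∈ I, ∫⁻ τ in uIoc 0 t, eLpNorm (G τ) 2 freqMeasure < ⊤) ∧
    ∀ t ∈ I, ∀ᵐ lam ∂freqMeasure,
      u t lam = Real.cos (t * lam) * a lam + Real.sin (t * lam) / lam * b lam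
        + ∫ τ in (0 : ℝ)..t, Real.sin ((t - τ) * lam) / lam * G τ lam

/-- `w` (through its distorted Fourier transform `w t`) is a global solution in
`C(ℝ; Ḣ^{1/2} ∩ Ḣ^s)` of `∂_t² w - Δ w + w³ = 0` in `ℝ × Ω`, `w = 0` on `ℝ × ∂Ω`, with data
`(w, ∂_t w)(0)` given by their transforms `(a, b)`. -/
structure IsGlobalCubicSolution (s : ℝ) (a b : ℝ → ℝ) (w : ℝ → ℝ → ℝ) : Prop where
  cont_half : IsContInto (1 / 2) univ w
  cont_s : IsContInto s univ w
  duhamel : IsDuhamel univ a b (fun t x => -(invDft (w t) x) ^ 3) w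

/-- `v ∈ C([0,T); Ḣ^1_{D,rad}(Ω))` is a solution of
`∂_t² v - Δ v + v³ = -3 v² w - 3 v w²` in `[0,T) × Ω`, `v = 0` on `[0,T) × ∂Ω`, with data
`(v, ∂_t v)(0)` given by their transforms `(a, b)`. -/
structure IsPerturbedSolution (T : ℝ) (a b : ℝ → ℝ) (w : ℝ → ℝ → ℝ) (v : ℝ → HdotRad 1) :
    Prop where
  cont : ContinuousOn v (Ico 0 T)
  duhamel : IsDuhamel (Ico 0 T) a b
    (fun t x => -(invDft (spec (v t)) x) ^ 3
      - 3 * (invDft (spec (v t)) x) ^ 2 * invDft (w t) x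
      - 3 * invDft (spec (v t)) x * (invDft (w t) x) ^ 2)
    (fun t => spec (v t))

end ExteriorWave

end

/-! Write a radial function as `f(r) = U(r - 1) / r`. For `U` the Dirichlet Laplacian outside the
ball is the second derivative on the half line `ρ > 0` with `U(0) = 0`, the distorted transform is
the sine transform (`dft_eq_sineT`, `isDftL2_iff`), and a cubic term becomes `U³ / (1 + ρ)²`.
Duhamel's formula turns into integration over the backward light cone reflected at `ρ = 0`
(`sineT_duhamelInt`). All estimates are then explicit one-dimensional ones.

Smallness of `w`. Its data live at frequencies above `2^J`, so their norm in the scale invariant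
space `Ḣ^{1/2} × Ḣ^{-1/2}` is at most `2^{J(1/2-s)}` times the given norm (`IsCutoff.high`), hence
small. The quantity to control is the scale invariant `L⁴` space-time norm of `w`. For free waves it
is bounded by the data (`lintegral_freeWave_quartic_le`): the square of a Fourier transform in time
is the transform of a self-convolution, Bessel's inequality applies, and a Cauchy–Schwarz inequality
isolates an oscillating weight whose radial integral is bounded uniformly. For the retarded integral
a Schur test on the cone gives a bound from `L^{4/3}` to `L⁴` (`lintegral_coneKer_quartic_le`). The
fourth power `Q` of the norm on `[0, t]` therefore obeys `Q ≤ D + 4096 Q³`; being continuous in `t`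
and zero at `t = 0`, it stays below `2D` (`IsGlobalCubicSolution.lintegral_quartic_le`).

Energy of `v`. Let `M` be the energy norm of the data and `Q` the time integral of the `L²` norm of
the forcing; the energy norm of `v` is at most `M + Q`. The term `3v²w` is dominated by `v³` and
`vw²`. For `v³`, the pointwise bound of `V = rv` by `√(2ρ)` times the energy and Hardy's inequality
give a contribution of order `T` times the cube of the energy. For `vw²`, d'Alembert's formula
bounds `|V| / ρ`, uniformly in `ρ`, by a Hardy–Littlewood maximal function of time
(`enorm_wave_le`), which is in `L²` in time with norm at most a multiple of `M + Q`; the remaining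
factor `w²` is small in `L²` of space-time. With `T M²` small this gives `Q ≤ M`
(`truncated_energy_le`), hence the bound by twice the data.

Existence and uniqueness. The nonlinearity is truncated at height `R√(1 + ρ)`, which makes it
globally Lipschitz, and solved by a contraction in the supremum norm (`exists_eq_coneInt`). The
energy bound shows that the truncation height is never exceeded, so the original equation is solved
(`exists_wave_solution`). Uniqueness follows from the Lipschitz bound, Hardy's inequality and
Grönwall's argument (`IsPerturbedSolution.unique`). -/

open MeasureTheory Set Filter Topology
open scoped ContDiff

noncomputable section

namespace ExteriorWave

/-! ### Sine transform of test functions: inversion and Plancherel. -/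

section SineTransform

open scoped FourierTransform SchwartzMap

/-- The sine transform on the half line. -/
def sineT (g : ℝ → ℝ) (x : ℝ) : ℝ :=
  Real.sqrt (2 / Real.pi) * ∫ lam in Ioi (0 : ℝ), Real.sin (lam * x) * g lam

/-- Test functions on the half line `(0, ∞)`. -/
structure IsHalfTest (ψ : ℝ → ℝ) : Prop where
  smooth : ContDiff ℝ ∞ ψ
  compact : HasCompactSupport ψ
  support : tsupport ψ ⊆ Ioi 0

namespace IsHalfTest

variable {ψ : ℝ → ℝ}

theorem eq_zero (h : IsHalfTest ψ) {x : ℝ} (hx : x ≤ 0) : ψ x = 0 := by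
  by_contra hne
  exact absurd (h.support (subset_tsupport _ hne)) (by simpa using hx)

theorem continuous (h : IsHalfTest ψ) : Continuous ψ := h.smooth.continuous

theorem integrable (h : IsHalfTest ψ) : Integrable ψ :=
  h.continuous.integrable_of_hasCompactSupport h.compact

/-- The complexification as a Schwartz function. -/
def toSchwartz (h : IsHalfTest ψ) : 𝓢(ℝ, ℂ) :=
  HasCompactSupport.toSchwartzMap (f := fun x => (ψ x : ℂ)) (h.compact.comp_left (g := fun x : ℝ => (x : ℂ)) rfl)
    (Complex.ofRealCLM.contDiff.comp h.smooth)

theorem toSchwartz_apply (h : IsHalfTest ψ) (x : ℝ) : h.toSchwartz x = ψ x := rfl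

/-- The odd extension as a Schwartz function. -/
def oddExt (h : IsHalfTest ψ) : 𝓢(ℝ, ℂ) :=
  h.toSchwartz - SchwartzMap.compCLMOfContinuousLinearEquiv ℂ
    (ContinuousLinearEquiv.neg ℝ : ℝ ≃L[ℝ] ℝ) h.toSchwartz

theorem oddExt_apply (h : IsHalfTest ψ) (x : ℝ) : h.oddExt x = ((ψ x - ψ (-x) : ℝ) : ℂ) := by
  simp [oddExt, toSchwartz_apply]

/-- The unnormalised sine integral. -/
def sineInt (ψ : ℝ → ℝ) (ξ : ℝ) : ℝ := ∫ x, Real.sin (2 * Real.pi * (x * ξ)) * ψ x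

theorem setIntegral_sin (h : IsHalfTest ψ) (y : ℝ) :
    ∫ x in Ioi (0 : ℝ), Real.sin (x * y) * ψ x = ∫ x, Real.sin (x * y) * ψ x := by
  apply setIntegral_eq_integral_of_forall_compl_eq_zero
  intro x hx
  rw [h.eq_zero (by simpa using hx), mul_zero]

theorem sineT_eq (h : IsHalfTest ψ) (y : ℝ) :
    sineT ψ y = Real.sqrt (2 / Real.pi) * sineInt ψ (y / (2 * Real.pi)) := by
  rw [sineT, h.setIntegral_sin, sineInt]
  congr 2; ext x; congr 2
  field_simp

theorem sineInt_neg (ψ : ℝ → ℝ) (ξ : ℝ) : sineInt ψ (-ξ) = - sineInt ψ ξ := by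
  rw [sineInt, sineInt, ← integral_neg]
  congr 1; ext x; simp [Real.sin_neg]

/-- Only the sine part of the exponential survives against an odd function. Through this identity
the half line inherits inversion, Plancherel and decay from the Fourier transform of Schwartz
functions. -/
theorem fourier_oddExt (h : IsHalfTest ψ) (ξ : ℝ) :
    𝓕 h.oddExt ξ = -2 * Complex.I * (sineInt ψ ξ : ℂ) := by
  have hf (η : ℝ) : 𝓕 (h.toSchwartz : ℝ → ℂ) η
      = ∫ x : ℝ, Complex.exp (-2 * Real.pi * x * η * Complex.I) * ψ x := by
    rw [Real.fourier_real_eq_integral_exp_smul]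
    congr 1; ext x
    simp [toSchwartz_apply]
  have hint (η : ℝ) : Integrable fun x : ℝ => Complex.exp (-2 * Real.pi * x * η * Complex.I) * ψ x := by
    refine (h.integrable.norm).mono' ?_ ?_
    · have := h.continuous
      exact Continuous.aestronglyMeasurable (by fun_prop)
    · filter_upwards with x
      have : (-2 * Real.pi * x * η * Complex.I : ℂ) = ((-2 * Real.pi * x * η : ℝ) : ℂ) * Complex.I := by
        push_cast; ring
      rw [norm_mul, this, Complex.norm_exp_ofReal_mul_I]
      simp
  have hneg : 𝓕 h.oddExt ξ = 𝓕 (h.toSchwartz : ℝ → ℂ) ξ - 𝓕 (h.toSchwartz : ℝ → ℂ) (-ξ) := by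
    rw [SchwartzMap.fourier_coe]
    have e : (h.oddExt : ℝ → ℂ) = fun x => (h.toSchwartz : ℝ → ℂ) x - (h.toSchwartz : ℝ → ℂ) (-x) := by
      ext x; rw [oddExt_apply]; simp [toSchwartz_apply]
    rw [e, Real.fourier_real_eq_integral_exp_smul, Real.fourier_real_eq_integral_exp_smul,
      Real.fourier_real_eq_integral_exp_smul]
    have i1 : Integrable fun x : ℝ => Complex.exp (↑(-2 * Real.pi * x * ξ) * Complex.I) • h.toSchwartz x := by
      simpa [toSchwartz_apply] using hint ξ
    have i2 : Integrable fun x : ℝ => Complex.exp (↑(-2 * Real.pi * x * ξ) * Complex.I) • h.toSchwartz (-x) := by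
      have := (hint (-ξ)).comp_neg
      simpa [toSchwartz_apply] using this
    simp_rw [smul_sub]
    rw [integral_sub i1 i2]
    congr 1
    rw [← integral_neg_eq_self]
    simp
  rw [hneg, hf, hf, ← integral_sub (hint _) (hint _), sineInt, ← integral_complex_ofReal, ← integral_const_mul]
  congr 1; ext x
  push_cast
  rw [Complex.sin]
  have e1 : (-2 * Real.pi * x * ξ * Complex.I : ℂ) = -(2 * Real.pi * (x * ξ)) * Complex.I := by ring
  have e2 : (-2 * Real.pi * x * (-ξ) * Complex.I : ℂ) = (2 * Real.pi * (x * ξ)) * Complex.I := by ring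
  rw [e1, e2]
  linear_combination (Complex.exp (-(2 * Real.pi * (x * ξ)) * Complex.I) - Complex.exp ((2 * Real.pi * (x * ξ)) * Complex.I)) * (ψ x : ℂ) * Complex.I_sq

/-- The sine integral as (the real part of) a Schwartz function. -/
theorem sineInt_eq_re (h : IsHalfTest ψ) (ξ : ℝ) :
    (sineInt ψ ξ : ℂ) = (Complex.I / 2) * 𝓕 h.oddExt ξ := by
  rw [h.fourier_oddExt]
  linear_combination (sineInt ψ ξ : ℂ) * Complex.I_sq

theorem continuous_sineInt (h : IsHalfTest ψ) : Continuous (sineInt ψ) := by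
  have : sineInt ψ = fun ξ => ((Complex.I / 2) * 𝓕 h.oddExt ξ).re := by
    ext ξ; rw [← h.sineInt_eq_re, Complex.ofReal_re]
  rw [this]
  have := (𝓕 h.oddExt).continuous
  fun_prop

theorem continuous_sineT (h : IsHalfTest ψ) : Continuous (sineT ψ) := by
  have : sineT ψ = fun y => Real.sqrt (2 / Real.pi) * sineInt ψ (y / (2 * Real.pi)) := by
    ext y; exact h.sineT_eq y
  rw [this]
  have := h.continuous_sineInt
  fun_prop

theorem integrable_pow_mul_sineInt (h : IsHalfTest ψ) (k : ℕ) :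
    Integrable fun ξ => ‖ξ‖ ^ k * ‖sineInt ψ ξ‖ := by
  have := ((𝓕 h.oddExt).integrable_pow_mul volume k).const_mul (1 / 2)
  refine this.congr ?_
  filter_upwards with ξ
  have : ‖sineInt ψ ξ‖ = ‖(sineInt ψ ξ : ℂ)‖ := by simp
  rw [this, h.sineInt_eq_re]
  simp; ring

theorem integrable_pow_mul_sineT (h : IsHalfTest ψ) (k : ℕ) :
    Integrable fun y => |y| ^ k * |sineT ψ y| := by
  have := (h.integrable_pow_mul_sineInt k).comp_div (R := 2 * Real.pi) (by positivity)
  refine (this.const_mul ((2 * Real.pi) ^ k * Real.sqrt (2 / Real.pi))).congr ?_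
  filter_upwards with y
  rw [h.sineT_eq, abs_mul, abs_of_nonneg (Real.sqrt_nonneg _)]
  simp only [Real.norm_eq_abs, abs_div, abs_of_pos (show 0 < 2 * Real.pi by positivity), div_pow]
  field_simp

theorem integrable_sineT (h : IsHalfTest ψ) : Integrable (sineT ψ) := by
  refine (h.integrable_pow_mul_sineT 0).mono h.continuous_sineT.aestronglyMeasurable ?_
  filter_upwards with y; simp

/-- Fourier inversion for the odd extension. One factor 2 comes from the transform `-2i · sineInt`,
the other from folding the even integrand onto the half line. -/
theorem sineInt_inversion (h : IsHalfTest ψ) {x : ℝ} (hx : 0 < x) :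
    ψ x = 4 * ∫ ξ in Ioi (0 : ℝ), Real.sin (2 * Real.pi * (x * ξ)) * sineInt ψ ξ := by
  have hinv : h.oddExt x = ∫ ξ : ℝ, Complex.exp (2 * Real.pi * ξ * x * Complex.I) * 𝓕 h.oddExt ξ := by
    conv_lhs => rw [← FourierTransform.fourierInv_fourier_eq (F := 𝓢(ℝ, ℂ)) h.oddExt]
    rw [SchwartzMap.fourierInv_coe, Real.fourierInv_eq']
    congr 1; ext ξ
    simp [mul_comm]
    left; congr 1; ring
  have hI : Integrable (sineInt ψ) := by
    refine (h.integrable_pow_mul_sineInt 0).mono h.continuous_sineInt.aestronglyMeasurable ?_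
    filter_upwards with y; simp
  have hre : ψ x = ∫ ξ : ℝ, 2 * (Real.sin (2 * Real.pi * (x * ξ)) * sineInt ψ ξ) := by
    have h1 : ψ x = (h.oddExt x).re := by
      rw [oddExt_apply, Complex.ofReal_re, h.eq_zero (x := -x) (by linarith), sub_zero]
    rw [h1, hinv]
    have hint : Integrable fun ξ : ℝ => Complex.exp (2 * Real.pi * ξ * x * Complex.I) * 𝓕 h.oddExt ξ := by
      refine (𝓕 h.oddExt).integrable.norm.mono' ?_ ?_
      · have := (𝓕 h.oddExt).continuous
        exact Continuous.aestronglyMeasurable (by fun_prop)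
      · filter_upwards with ξ
        have : (2 * Real.pi * ξ * x * Complex.I : ℂ) = ((2 * Real.pi * ξ * x : ℝ) : ℂ) * Complex.I := by
          push_cast; ring
        rw [norm_mul, this, Complex.norm_exp_ofReal_mul_I, one_mul]
    have := integral_re hint
    simp only [RCLike.re_to_complex] at this
    rw [← this]
    congr 1; ext ξ
    rw [h.fourier_oddExt]
    have : (2 * Real.pi * ξ * x * Complex.I : ℂ) = ((2 * Real.pi * (x * ξ) : ℝ) : ℂ) * Complex.I := by
      push_cast; ring
    rw [this, Complex.exp_mul_I, ← Complex.ofReal_cos, ← Complex.ofReal_sin]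
    simp only [Complex.mul_re, Complex.add_re, Complex.add_im, Complex.mul_im, Complex.ofReal_re,
      Complex.ofReal_im, Complex.I_re, Complex.I_im, Complex.neg_re, Complex.neg_im,
      Complex.re_ofNat, Complex.im_ofNat]
    ring
  rw [hre, integral_const_mul]
  have heven : (∫ ξ : ℝ, Real.sin (2 * Real.pi * (x * ξ)) * sineInt ψ ξ)
      = 2 * ∫ ξ in Ioi (0 : ℝ), Real.sin (2 * Real.pi * (x * ξ)) * sineInt ψ ξ := by
    rw [← integral_comp_abs (f := fun ξ => Real.sin (2 * Real.pi * (x * ξ)) * sineInt ψ ξ)]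
    congr 1; ext ξ
    rcases abs_cases ξ with ⟨e, -⟩ | ⟨e, -⟩
    · rw [e]
    · rw [e, sineInt_neg]; simp [Real.sin_neg]
  rw [heven]; ring

/-- Inversion formula for the sine transform of a test function. -/
theorem sineT_sineT (h : IsHalfTest ψ) {x : ℝ} (hx : 0 < x) : sineT (sineT ψ) x = ψ x := by
  rw [h.sineInt_inversion hx, sineT]
  simp_rw [h.sineT_eq]
  have := integral_comp_mul_left_Ioi
    (g := fun ξ => Real.sin (2 * Real.pi * (x * ξ)) * sineInt ψ ξ) 0
    (b := (2 * Real.pi)⁻¹) (by positivity)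
  rw [mul_zero, inv_inv, smul_eq_mul] at this
  have h2 : (fun lam : ℝ => Real.sin (lam * x) * (√(2 / Real.pi) * sineInt ψ (lam / (2 * Real.pi))))
      = fun lam => √(2 / Real.pi) * (Real.sin (2 * Real.pi * (x * ((2 * Real.pi)⁻¹ * lam)))
        * sineInt ψ ((2 * Real.pi)⁻¹ * lam)) := by
    ext lam
    rw [show 2 * Real.pi * (x * ((2 * Real.pi)⁻¹ * lam)) = lam * x by field_simp,
      show (2 * Real.pi)⁻¹ * lam = lam / (2 * Real.pi) by field_simp]
    ring
  rw [h2, integral_const_mul, this, ← mul_assoc, Real.mul_self_sqrt (by positivity), ← mul_assoc]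
  congr 1
  field_simp; norm_num

theorem integral_sq_sineT (h : IsHalfTest ψ) :
    ∫ y in Ioi (0 : ℝ), sineT ψ y ^ 2 = ∫ x in Ioi (0 : ℝ), ψ x ^ 2 := by
  have hP := SchwartzMap.integral_norm_sq_fourier h.oddExt
  have e1 : ∀ ξ, ‖𝓕 h.oddExt ξ‖ ^ 2 = 4 * sineInt ψ |ξ| ^ 2 := by
    intro ξ
    have : sineInt ψ |ξ| ^ 2 = sineInt ψ ξ ^ 2 := by
      rcases abs_cases ξ with ⟨e, -⟩ | ⟨e, -⟩
      · rw [e]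
      · rw [e, sineInt_neg]; ring
    rw [h.fourier_oddExt, this]
    simp [mul_pow]; norm_num
  have e2 : ∀ x, ‖h.oddExt x‖ ^ 2 = ψ |x| ^ 2 := by
    intro x
    rw [oddExt_apply, Complex.norm_real, Real.norm_eq_abs, sq_abs]
    rcases abs_cases x with ⟨e, hx⟩ | ⟨e, hx⟩
    · rw [e, h.eq_zero (x := -x) (by linarith)]; ring
    · rw [e, h.eq_zero (x := x) (by linarith)]; ring
  simp_rw [e1, e2] at hP
  rw [integral_const_mul, integral_comp_abs (f := fun x => sineInt ψ x ^ 2),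
    integral_comp_abs (f := fun x => ψ x ^ 2)] at hP
  simp_rw [h.sineT_eq]
  have := integral_comp_mul_left_Ioi (g := fun ξ => sineInt ψ ξ ^ 2) 0
    (b := (2 * Real.pi)⁻¹) (by positivity)
  rw [mul_zero, inv_inv, smul_eq_mul] at this
  have h2 : (fun y : ℝ => (√(2 / Real.pi) * sineInt ψ (y / (2 * Real.pi))) ^ 2)
      = fun y => (2 / Real.pi) * sineInt ψ ((2 * Real.pi)⁻¹ * y) ^ 2 := by
    ext y
    rw [mul_pow, Real.sq_sqrt (by positivity), show (2 * Real.pi)⁻¹ * y = y / (2 * Real.pi) by field_simp]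
  rw [h2, integral_const_mul, this]
  field_simp
  linarith

end IsHalfTest

end SineTransform

/-! ### The sine transform on square integrable functions. -/

open scoped ENNReal

instance : SFinite freqMeasure := by unfold freqMeasure; infer_instance
instance : IsLocallyFiniteMeasure freqMeasure := by unfold freqMeasure; infer_instance

theorem ae_freqMeasure_pos : ∀ᵐ lam ∂freqMeasure, 0 < lam :=
  ae_restrict_mem measurableSet_Ioi

/-- Cauchy-Schwarz for the Lebesgue integral. -/
theorem sq_lintegral_mul_le {α : Type*} [MeasurableSpace α] {μ : Measure α} {f g : α → ℝ≥0∞}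
    (hf : AEMeasurable f μ) (hg : AEMeasurable g μ) :
    (∫⁻ x, f x * g x ∂μ) ^ 2 ≤ (∫⁻ x, f x ^ 2 ∂μ) * ∫⁻ x, g x ^ 2 ∂μ := by
  have h := ENNReal.lintegral_mul_le_Lp_mul_Lq μ (p := 2) (q := 2)
    (by constructor <;> norm_num) hf hg
  simp only [Pi.mul_apply, ENNReal.rpow_ofNat] at h
  calc _ ≤ ((∫⁻ x, f x ^ 2 ∂μ) ^ (1 / 2 : ℝ) * (∫⁻ x, g x ^ 2 ∂μ) ^ (1 / 2 : ℝ)) ^ 2 := by gcongr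
    _ = _ := by
      rw [mul_pow, ← ENNReal.rpow_natCast, ← ENNReal.rpow_natCast, ← ENNReal.rpow_mul,
        ← ENNReal.rpow_mul]
      norm_num

theorem eLpNorm_two_sq {α : Type*} [MeasurableSpace α] {μ : Measure α} {E : Type*}
    [NormedAddCommGroup E] (f : α → E) :
    eLpNorm f 2 μ ^ 2 = ∫⁻ x, ‖f x‖ₑ ^ 2 ∂μ := by
  rw [eLpNorm_eq_lintegral_rpow_enorm_toReal (by norm_num) (by norm_num), ← ENNReal.rpow_natCast,
    ← ENNReal.rpow_mul]
  simp

theorem tendsto_integral_mul {α : Type*} [MeasurableSpace α] {μ : Measure α} {K : α → ℝ}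
    (hK : MemLp K 2 μ) {f : ℕ → α → ℝ} {g : α → ℝ} (hf : ∀ n, MemLp (f n) 2 μ)
    (hg : MemLp g 2 μ)
    (h : Tendsto (fun n => eLpNorm (fun x => f n x - g x) 2 μ) atTop (𝓝 0)) :
    Tendsto (fun n => ∫ x, K x * f n x ∂μ) atTop (𝓝 (∫ x, K x * g x ∂μ)) := by
  have h1 : Tendsto (fun n => (hf n).toLp) atTop (𝓝 hg.toLp) :=
    (Lp.tendsto_Lp_iff_tendsto_eLpNorm'' f hf g hg).2 h
  have h2 := (tendsto_const_nhds (x := hK.toLp)).inner (𝕜 := ℝ) h1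
  have key : ∀ {u : α → ℝ} (hu : MemLp u 2 μ),
      inner ℝ hK.toLp hu.toLp = ∫ x, K x * u x ∂μ := by
    intro u hu
    rw [L2.inner_def]
    refine integral_congr_ae ?_
    filter_upwards [hK.coeFn_toLp, hu.coeFn_toLp] with x h1 h2
    rw [h1, h2]; simp [mul_comm]
  simpa only [key] using h2

/-- `G` is the sine transform of `U` in the `L²` sense. -/
def IsSine (U G : ℝ → ℝ) : Prop :=
  ∃ ψ : ℕ → ℝ → ℝ, (∀ n, IsHalfTest (ψ n)) ∧
    Tendsto (fun n => eLpNorm (fun x => ψ n x - U x) 2 freqMeasure) atTop (𝓝 0) ∧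
    Tendsto (fun n => eLpNorm (fun y => sineT (ψ n) y - G y) 2 freqMeasure) atTop (𝓝 0)

namespace IsHalfTest

variable {ψ φ : ℝ → ℝ}

theorem memLp (h : IsHalfTest ψ) : MemLp ψ 2 freqMeasure :=
  (h.continuous.memLp_of_hasCompactSupport h.compact).restrict _

theorem integrable_sq_sineT (h : IsHalfTest ψ) : Integrable fun y => sineT ψ y ^ 2 := by
  have hb : ∃ C, ∀ y, ‖sineT ψ y‖ ≤ C := by
    refine ⟨√(2 / Real.pi) * ∫ x in Ioi (0:ℝ), ‖ψ x‖, fun y => ?_⟩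
    rw [sineT, norm_mul, Real.norm_of_nonneg (Real.sqrt_nonneg _)]
    gcongr
    refine norm_integral_le_of_norm_le h.integrable.norm.integrableOn ?_
    filter_upwards with x
    rw [norm_mul]
    exact mul_le_of_le_one_left (norm_nonneg _) (Real.abs_sin_le_one _)
  obtain ⟨C, hC⟩ := hb
  simp_rw [pow_two]
  exact h.integrable_sineT.bdd_mul h.continuous_sineT.aestronglyMeasurable (ae_of_all _ hC)

theorem memLp_sineT (h : IsHalfTest ψ) : MemLp (sineT ψ) 2 freqMeasure :=
  ((memLp_two_iff_integrable_sq h.continuous_sineT.aestronglyMeasurable).2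
    h.integrable_sq_sineT).restrict _

theorem eLpNorm_sineT (h : IsHalfTest ψ) :
    eLpNorm (sineT ψ) 2 freqMeasure = eLpNorm ψ 2 freqMeasure := by
  have key : ∀ {u : ℝ → ℝ}, MemLp u 2 freqMeasure →
      eLpNorm u 2 freqMeasure ^ 2 = ENNReal.ofReal (∫ x in Ioi (0 : ℝ), u x ^ 2) := by
    intro u hu
    have e := ofReal_integral_eq_lintegral_ofReal hu.integrable_sq
      (ae_of_all _ fun x => sq_nonneg _)
    refine (eLpNorm_two_sq u).trans (Eq.trans ?_ e.symm)
    refine lintegral_congr fun x => ?_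
    rw [← ofReal_norm, ← ENNReal.ofReal_pow (norm_nonneg _), Real.norm_eq_abs, sq_abs]
  have := (key h.memLp_sineT).trans ((congrArg _ h.integral_sq_sineT).trans (key h.memLp).symm)
  exact (ENNReal.pow_right_strictMono two_ne_zero).injective this

theorem sub (h : IsHalfTest ψ) (k : IsHalfTest φ) : IsHalfTest fun x => ψ x - φ x :=
  ⟨h.smooth.sub k.smooth, h.compact.sub k.compact,
    (tsupport_sub _ _).trans (union_subset h.support k.support)⟩

theorem add (h : IsHalfTest ψ) (k : IsHalfTest φ) : IsHalfTest fun x => ψ x + φ x :=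
  ⟨h.smooth.add k.smooth, h.compact.add k.compact,
    (tsupport_add _ _).trans (union_subset h.support k.support)⟩

theorem const_mul (h : IsHalfTest ψ) (c : ℝ) : IsHalfTest fun x => c * ψ x :=
  ⟨contDiff_const.mul h.smooth, h.compact.mul_left,
    (tsupport_mul_subset_right).trans h.support⟩

theorem integrable_sin_mul (h : IsHalfTest ψ) (y : ℝ) (s : Set ℝ) :
    IntegrableOn (fun x => Real.sin (x * y) * ψ x) s :=
  (h.integrable.bdd_mul (c := 1) (by fun_prop) (ae_of_all _ fun x => Real.abs_sin_le_one _)).integrableOn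

theorem sineT_sub (h : IsHalfTest ψ) (k : IsHalfTest φ) (y : ℝ) :
    sineT (fun x => ψ x - φ x) y = sineT ψ y - sineT φ y := by
  simp_rw [sineT, mul_sub]
  rw [integral_sub (h.integrable_sin_mul _ _) (k.integrable_sin_mul _ _), mul_sub]

theorem zero : IsHalfTest fun _ => 0 :=
  ⟨contDiff_const, HasCompactSupport.zero, by simp⟩

end IsHalfTest

/-- Test functions are dense in `L²(0, ∞)`. -/
theorem exists_halfTest_tendsto (U : Lp ℝ 2 freqMeasure) :
    ∃ ψ : ℕ → ℝ → ℝ, (∀ n, IsHalfTest (ψ n)) ∧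
      Tendsto (fun n => eLpNorm (fun x => ψ n x - U x) 2 freqMeasure) atTop (𝓝 0) := by
  let D : Submodule ℝ (Lp ℝ 2 freqMeasure) :=
    { carrier := {f | ∃ ψ, ∃ h : IsHalfTest ψ, f = h.memLp.toLp}
      add_mem' := by
        rintro _ _ ⟨ψ, h, rfl⟩ ⟨φ, k, rfl⟩
        exact ⟨_, h.add k, (MemLp.toLp_add _ _).symm⟩
      zero_mem' := ⟨_, IsHalfTest.zero, (MemLp.toLp_zero _).symm⟩
      smul_mem' := by
        rintro c _ ⟨ψ, h, rfl⟩
        exact ⟨_, h.const_mul c, (MemLp.toLp_const_smul c _).symm⟩ }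
  have hD : D.topologicalClosure = ⊤ := by
    rw [Submodule.topologicalClosure_eq_top_iff, Submodule.eq_bot_iff]
    intro f hf
    rw [Submodule.mem_orthogonal] at hf
    have hloc : LocallyIntegrableOn f (Ioi (0 : ℝ)) volume :=
      locallyIntegrableOn_of_locallyIntegrable_restrict
        ((Lp.memLp f).locallyIntegrable (by norm_num))
    -- Fundamental lemma of the calculus of variations: orthogonality to all test functions forces
    -- the function to vanish.
    have h0 := isOpen_Ioi.ae_eq_zero_of_integral_contDiff_smul_eq_zero hloc (by
      intro g hg hc hs
      have ht : IsHalfTest g := ⟨hg, hc, hs⟩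
      have := hf ht.memLp.toLp ⟨g, ht, rfl⟩
      rw [L2.inner_def] at this
      rw [← setIntegral_eq_integral_of_forall_compl_eq_zero (s := Ioi (0:ℝ))
        (fun x hx => by rw [ht.eq_zero (by simpa using hx), zero_smul])]
      refine Eq.trans (integral_congr_ae ?_) this
      filter_upwards [ht.memLp.coeFn_toLp] with x h1
      rw [h1]; simp [mul_comm])
    rw [Lp.eq_zero_iff_ae_eq_zero]
    exact (ae_restrict_iff' measurableSet_Ioi).2 h0
  have hU : U ∈ closure (D : Set (Lp ℝ 2 freqMeasure)) := by
    rw [← Submodule.topologicalClosure_coe, hD]; trivial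
  obtain ⟨u, hu, hlim⟩ := mem_closure_iff_seq_limit.1 hU
  choose ψ hψ hψu using hu
  refine ⟨ψ, hψ, ?_⟩
  obtain rfl : u = fun n => (hψ n).memLp.toLp := funext hψu
  have := (Lp.tendsto_Lp_iff_tendsto_eLpNorm'' ψ (fun n => (hψ n).memLp) U (Lp.memLp U)).1
    (by simpa using hlim)
  exact this

theorem IsSine.congr {U U' G G' : ℝ → ℝ} (h : IsSine U G) (hU : U =ᵐ[freqMeasure] U')
    (hG : G =ᵐ[freqMeasure] G') : IsSine U' G' := by
  obtain ⟨ψ, h1, h2, h3⟩ := h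
  refine ⟨ψ, h1, ?_, ?_⟩
  · refine h2.congr fun n => eLpNorm_congr_ae ?_
    filter_upwards [hU] with x hx; rw [hx]
  · refine h3.congr fun n => eLpNorm_congr_ae ?_
    filter_upwards [hG] with x hx; rw [hx]

theorem eLpNorm_sub_sub_le {α : Type*} [MeasurableSpace α] {μ : Measure α}
    {a b c d : α → ℝ} (ha : AEStronglyMeasurable a μ) (hb : AEStronglyMeasurable b μ)
    (hc : AEStronglyMeasurable c μ) (hd : AEStronglyMeasurable d μ) :
    eLpNorm (fun x => (a x - b x) - (c x - d x)) 2 μ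
      ≤ eLpNorm (fun x => a x - c x) 2 μ + eLpNorm (fun x => b x - d x) 2 μ := by
  have : (fun x => (a x - b x) - (c x - d x)) = (fun x => a x - c x) - (fun x => b x - d x) := by
    ext x; simp only [Pi.sub_apply]; ring
  rw [this]
  exact eLpNorm_sub_le (ha.sub hc) (hb.sub hd) (by norm_num)

theorem IsSine.sub {U U' G G' : ℝ → ℝ} (h : IsSine U G) (h' : IsSine U' G')
    (hU : AEStronglyMeasurable U freqMeasure) (hU' : AEStronglyMeasurable U' freqMeasure)
    (hG : AEStronglyMeasurable G freqMeasure) (hG' : AEStronglyMeasurable G' freqMeasure) :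
    IsSine (fun x => U x - U' x) (fun y => G y - G' y) := by
  obtain ⟨ψ, h1, h2, h3⟩ := h
  obtain ⟨ψ', h1', h2', h3'⟩ := h'
  refine ⟨fun n x => ψ n x - ψ' n x, fun n => (h1 n).sub (h1' n), ?_, ?_⟩
  · refine tendsto_of_tendsto_of_tendsto_of_le_of_le tendsto_const_nhds
      (by simpa using h2.add h2') (fun _ => zero_le) fun n => ?_
    exact eLpNorm_sub_sub_le (h1 n).memLp.1 (h1' n).memLp.1 hU hU'
  · refine tendsto_of_tendsto_of_tendsto_of_le_of_le tendsto_const_nhds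
      (by simpa using h3.add h3') (fun _ => zero_le) fun n => ?_
    simp_rw [(h1 n).sineT_sub (h1' n)]
    exact eLpNorm_sub_sub_le (h1 n).memLp_sineT.1 (h1' n).memLp_sineT.1 hG hG'

theorem tendsto_eLpNorm_of_sub {α : Type*} [MeasurableSpace α] {μ : Measure α}
    {f : ℕ → α → ℝ} {g : α → ℝ} (hf : ∀ n, AEStronglyMeasurable (f n) μ)
    (hg : AEStronglyMeasurable g μ)
    (h : Tendsto (fun n => eLpNorm (fun x => f n x - g x) 2 μ) atTop (𝓝 0)) :
    Tendsto (fun n => eLpNorm (f n) 2 μ) atTop (𝓝 (eLpNorm g 2 μ)) := by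
  have h1 : ∀ n, eLpNorm (f n) 2 μ ≤ eLpNorm g 2 μ + eLpNorm (fun x => f n x - g x) 2 μ := by
    intro n
    have := eLpNorm_add_le hg ((hf n).sub hg) (p := 2) (by norm_num)
    rwa [add_sub_cancel] at this
  have h2 : ∀ n, eLpNorm g 2 μ - eLpNorm (fun x => f n x - g x) 2 μ ≤ eLpNorm (f n) 2 μ := by
    intro n
    rw [tsub_le_iff_right]
    have := eLpNorm_sub_le (hf n) ((hf n).sub hg) (p := 2) (by norm_num)
    rwa [sub_sub_cancel] at this
  refine tendsto_of_tendsto_of_tendsto_of_le_of_le ?_ ?_ h2 h1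
  · simpa using ENNReal.Tendsto.sub (tendsto_const_nhds (x := eLpNorm g 2 μ)) h (Or.inr (by simp))
  · simpa using (tendsto_const_nhds (x := eLpNorm g 2 μ)).add h

theorem IsSine.eLpNorm_eq {U G : ℝ → ℝ} (h : IsSine U G)
    (hU : AEStronglyMeasurable U freqMeasure) (hG : AEStronglyMeasurable G freqMeasure) :
    eLpNorm G 2 freqMeasure = eLpNorm U 2 freqMeasure := by
  obtain ⟨ψ, h1, h2, h3⟩ := h
  have l1 := tendsto_eLpNorm_of_sub (fun n => (h1 n).memLp.1) hU h2
  have l2 := tendsto_eLpNorm_of_sub (fun n => (h1 n).memLp_sineT.1) hG h3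
  simp_rw [fun n => (h1 n).eLpNorm_sineT] at l2
  exact tendsto_nhds_unique l2 l1

theorem memLp_of_tendsto {α : Type*} [MeasurableSpace α] {μ : Measure α}
    {f : ℕ → α → ℝ} {g : α → ℝ} (hf : ∀ n, MemLp (f n) 2 μ)
    (hg : AEStronglyMeasurable g μ)
    (h : Tendsto (fun n => eLpNorm (fun x => f n x - g x) 2 μ) atTop (𝓝 0)) : MemLp g 2 μ := by
  obtain ⟨n, hn⟩ := (h.eventually (gt_mem_nhds (zero_lt_one))).exists
  have := (hf n).sub (⟨(hf n).1.sub hg, hn.trans ENNReal.one_lt_top⟩ :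
    MemLp (fun x => f n x - g x) 2 μ)
  refine this.congr_norm hg (ae_of_all _ fun x => by simp)

theorem IsSine.memLp_left {U G : ℝ → ℝ} (h : IsSine U G)
    (hU : AEStronglyMeasurable U freqMeasure) : MemLp U 2 freqMeasure := by
  obtain ⟨ψ, h1, h2, h3⟩ := h
  exact memLp_of_tendsto (fun n => (h1 n).memLp) hU h2

theorem IsSine.memLp_right {U G : ℝ → ℝ} (h : IsSine U G)
    (hG : AEStronglyMeasurable G freqMeasure) : MemLp G 2 freqMeasure := by
  obtain ⟨ψ, h1, h2, h3⟩ := h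
  exact memLp_of_tendsto (fun n => (h1 n).memLp_sineT) hG h3

/-- By Plancherel the transforms of an approximating sequence of test functions form a Cauchy
sequence; completeness supplies the limit. -/
theorem exists_isSine (U : Lp ℝ 2 freqMeasure) : ∃ G : Lp ℝ 2 freqMeasure, IsSine U G := by
  obtain ⟨ψ, h1, h2⟩ := exists_halfTest_tendsto U
  have hlim : Tendsto (fun n => (h1 n).memLp.toLp) atTop (𝓝 U) := by
    have := (Lp.tendsto_Lp_iff_tendsto_eLpNorm'' ψ (fun n => (h1 n).memLp) U (Lp.memLp U)).2 h2
    simpa using this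
  have hc : CauchySeq fun n => (h1 n).memLp_sineT.toLp := by
    have := hlim.cauchySeq
    rw [Metric.cauchySeq_iff] at this ⊢
    intro ε hε
    obtain ⟨N, hN⟩ := this ε hε
    refine ⟨N, fun m hm n hn => ?_⟩
    convert hN m hm n hn using 1
    rw [dist_eq_norm, dist_eq_norm, ← MemLp.toLp_sub, ← MemLp.toLp_sub, Lp.norm_toLp, Lp.norm_toLp]
    congr 1
    have := ((h1 m).sub (h1 n)).eLpNorm_sineT
    rw [← show (fun y => sineT (ψ m) y - sineT (ψ n) y) = sineT fun x => ψ m x - ψ n x from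
      funext fun y => ((h1 m).sineT_sub (h1 n) y).symm] at this
    exact this
  obtain ⟨G, hG⟩ := cauchySeq_tendsto_of_complete hc
  refine ⟨G, ψ, h1, h2, ?_⟩
  exact (Lp.tendsto_Lp_iff_tendsto_eLpNorm'' _ (fun n => (h1 n).memLp_sineT) G (Lp.memLp G)).1
    (by simpa using hG)

/-- The sine transform on `L²(0, ∞)`. -/
def sineL2 (U : Lp ℝ 2 freqMeasure) : Lp ℝ 2 freqMeasure := (exists_isSine U).choose

theorem isSine_sineL2 (U : Lp ℝ 2 freqMeasure) : IsSine U (sineL2 U) :=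
  (exists_isSine U).choose_spec

theorem IsSine.eLpNorm_sub_eq {U U' G G' : ℝ → ℝ} (h : IsSine U G) (h' : IsSine U' G')
    (hU : AEStronglyMeasurable U freqMeasure) (hU' : AEStronglyMeasurable U' freqMeasure)
    (hG : AEStronglyMeasurable G freqMeasure) (hG' : AEStronglyMeasurable G' freqMeasure) :
    eLpNorm (fun y => G y - G' y) 2 freqMeasure = eLpNorm (fun x => U x - U' x) 2 freqMeasure :=
  (h.sub h' hU hU' hG hG').eLpNorm_eq (hU.sub hU') (hG.sub hG')

/-! ### Polar coordinates for radial functions on the exterior domain. -/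

section Polar

/-- The area of the unit sphere. -/
def sphereConst : ℝ≥0∞ := (volume : Measure E3).toSphere univ

theorem sphereConst_ne_zero : sphereConst ≠ 0 := by
  simp [sphereConst, Real.pi_pos]

theorem sphereConst_ne_top : sphereConst ≠ ⊤ := measure_ne_top _ _

theorem lintegral_norm_E3 {f : ℝ → ℝ≥0∞} (hf : Measurable f) :
    ∫⁻ x : E3, f ‖x‖ = sphereConst * ∫⁻ r in Ioi (0 : ℝ), ENNReal.ofReal (r ^ 2) * f r := by
  have hd : Module.finrank ℝ E3 - 1 = 2 := by simp [E3]
  calc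
    ∫⁻ x : E3, f ‖x‖ = ∫⁻ x : ({(0)}ᶜ : Set E3), f ‖x.1‖ ∂((volume : Measure E3).comap Subtype.val) := by
      rw [lintegral_subtype_comap (measurableSet_singleton _).compl fun x : E3 ↦ f (‖x‖),
        restrict_compl_singleton]
    _ = ∫⁻ x : Metric.sphere (0 : E3) 1 × Ioi (0 : ℝ), f (x.2 : ℝ) ∂(volume : Measure E3).toSphere.prod (.volumeIoiPow (Module.finrank ℝ E3 - 1)) := by
      simpa using (volume : Measure E3).measurePreserving_homeomorphUnitSphereProd.lintegral_comp_emb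
        (Homeomorph.measurableEmbedding _) (f ∘ Subtype.val ∘ Prod.snd)
    _ = sphereConst * ∫⁻ x : Ioi (0 : ℝ), f (x : ℝ) ∂.volumeIoiPow (Module.finrank ℝ E3 - 1) := by
      rw [lintegral_prod _ (by fun_prop)]
      simp [sphereConst, mul_comm]
    _ = _ := by
      rw [hd, Measure.volumeIoiPow, lintegral_withDensity_eq_lintegral_mul _ (by fun_prop) (by fun_prop)]
      congr 1
      exact lintegral_subtype_comap measurableSet_Ioi fun r : ℝ ↦ ENNReal.ofReal (r ^ 2) * f r

/-- The Jacobian `r²` cancels the square of the factor `1 / r`. Thus radial `L²(Ω)` is `L²(0, ∞)` of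
the half line function, up to the area of the sphere. -/
theorem eLpNorm_radial {P : ℝ → ℝ} (hP : Measurable P) :
    eLpNorm (fun x : E3 => P (‖x‖ - 1) / ‖x‖) 2 (volume.restrict Omega) ^ 2
      = sphereConst * eLpNorm P 2 freqMeasure ^ 2 := by
  have hO : MeasurableSet Omega := by unfold Omega; measurability
  rw [eLpNorm_two_sq, eLpNorm_two_sq, ← lintegral_indicator hO]
  have h1 : (Omega.indicator fun x : E3 => ‖P (‖x‖ - 1) / ‖x‖‖ₑ ^ 2)
      = fun x => (Ioi (1 : ℝ)).indicator (fun r => ‖P (r - 1) / r‖ₑ ^ 2) ‖x‖ := by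
    ext x
    simp [Omega, indicator]
  rw [h1, lintegral_norm_E3 (Measurable.indicator (by fun_prop) measurableSet_Ioi)]
  congr 1
  have h2 : (fun r => ENNReal.ofReal (r ^ 2) * (Ioi (1 : ℝ)).indicator (fun r => ‖P (r - 1) / r‖ₑ ^ 2) r)
      = (Ioi (1 : ℝ)).indicator fun r => ‖P (r - 1)‖ₑ ^ 2 := by
    ext r
    by_cases hr : r ∈ Ioi (1 : ℝ)
    · have hr' : 0 < r := lt_trans zero_lt_one hr
      rw [indicator_of_mem hr, indicator_of_mem hr, ← ofReal_norm, ← ofReal_norm,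
        ← ENNReal.ofReal_pow (norm_nonneg _), ← ENNReal.ofReal_pow (norm_nonneg _),
        ← ENNReal.ofReal_mul (by positivity), norm_div, Real.norm_of_nonneg hr'.le, div_pow]
      congr 1; field_simp
    · simp [indicator_of_notMem hr]
  rw [h2, lintegral_indicator measurableSet_Ioi, Measure.restrict_restrict measurableSet_Ioi,
    inter_eq_left.2 (Ioi_subset_Ioi zero_le_one)]
  have := (measurePreserving_add_right (volume : Measure ℝ) 1).setLIntegral_comp_preimage_emb
    (measurableEmbedding_addRight 1) (fun r => ‖P (r - 1)‖ₑ ^ 2) (Ioi 1)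
  rw [← this]
  simp [freqMeasure]

theorem tendsto_eLpNorm_radial_iff {P : ℕ → ℝ → ℝ} (hP : ∀ n, Measurable (P n)) :
    Tendsto (fun n => eLpNorm (fun x : E3 => P n (‖x‖ - 1) / ‖x‖) 2 (volume.restrict Omega)) atTop (𝓝 0)
      ↔ Tendsto (fun n => eLpNorm (P n) 2 freqMeasure) atTop (𝓝 0) := by
  have key : ∀ n, eLpNorm (fun x : E3 => P n (‖x‖ - 1) / ‖x‖) 2 (volume.restrict Omega)
      = sphereConst ^ (1 / 2 : ℝ) * eLpNorm (P n) 2 freqMeasure := by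
    intro n
    refine (ENNReal.pow_right_strictMono two_ne_zero).injective ?_
    beta_reduce
    have e : (sphereConst ^ (1 / 2 : ℝ)) ^ 2 = sphereConst := by
      rw [← ENNReal.rpow_natCast, ← ENNReal.rpow_mul]; norm_num
    rw [eLpNorm_radial (hP n), mul_pow, e]
  have hc0 : sphereConst ^ (1 / 2 : ℝ) ≠ 0 := by
    simp [ENNReal.rpow_eq_zero_iff, sphereConst_ne_zero]
  have hct : sphereConst ^ (1 / 2 : ℝ) ≠ ⊤ :=
    ENNReal.rpow_ne_top_of_nonneg (by norm_num) sphereConst_ne_top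
  simp_rw [key]
  constructor
  · intro h
    have := ENNReal.Tendsto.const_mul (a := (sphereConst ^ (1 / 2 : ℝ))⁻¹) h
      (Or.inr (ENNReal.inv_ne_top.2 hc0))
    simp_rw [← mul_assoc, ENNReal.inv_mul_cancel hc0 hct, one_mul, mul_zero] at this
    exact this
  · intro h
    simpa using ENNReal.Tendsto.const_mul h (Or.inr hct)

end Polar

/-! ### Reduction of the distorted transform to the sine transform. -/

section Radial

/-- The half line function `ρ ↦ (1 + ρ) φ(1 + ρ)` of a radial function. -/
def halfProfile (φ : E3 → ℝ) : ℝ → ℝ :=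
  (Ioi (0 : ℝ)).indicator fun ρ => (1 + ρ) * profile φ (1 + ρ)

theorem norm_single_E3 (r : ℝ) : ‖(EuclideanSpace.single (0 : Fin 3) r : E3)‖ = |r| := by
  simp

theorem contDiff_profile {φ : E3 → ℝ} (h : IsRadialTest φ) : ContDiff ℝ ∞ (profile φ) := by
  unfold profile
  refine h.smooth.comp ?_
  rw [contDiff_euclidean]
  intro i
  fin_cases i
  · simpa using! contDiff_id
  · simpa using! contDiff_const
  · simpa using! contDiff_const

/-- The support is contained in the image of `tsupport φ` under `|x| - 1`, a compact subset of `(0,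
∞)`; the cut at `ρ = 0` in `halfProfile` is therefore invisible to smoothness. -/
theorem IsRadialTest.isHalfTest {φ : E3 → ℝ} (h : IsRadialTest φ) : IsHalfTest (halfProfile φ) := by
  set p : ℝ → ℝ := fun ρ => (1 + ρ) * profile φ (1 + ρ) with hp
  have hps : ContDiff ℝ ∞ p := by
    have := contDiff_profile h
    fun_prop
  set K : Set ℝ := (fun x : E3 => ‖x‖ - 1) '' tsupport φ with hK
  have hKc : IsCompact K := h.compact.isCompact.image (by fun_prop)
  have hKpos : K ⊆ Ioi 0 := by
    rintro _ ⟨x, hx, rfl⟩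
    have := h.support hx
    simpa [Omega] using this
  have hsupp : Function.support (halfProfile φ) ⊆ K := by
    intro ρ hρ
    have hρ0 : ρ ∈ Ioi (0 : ℝ) := by
      by_contra hc
      exact hρ (indicator_of_notMem hc _)
    have : profile φ (1 + ρ) ≠ 0 := by
      intro hc
      apply hρ
      rw [halfProfile, indicator_of_mem hρ0, hc, mul_zero]
    refine ⟨_, subset_tsupport _ this, ?_⟩
    simp only [norm_single_E3]
    rw [abs_of_pos (by linarith [mem_Ioi.1 hρ0])]; ring
  have hts : tsupport (halfProfile φ) ⊆ K := closure_minimal hsupp hKc.isClosed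
  refine ⟨?_, HasCompactSupport.intro hKc fun x hx => ?_, hts.trans hKpos⟩
  · rw [contDiff_iff_contDiffAt]
    intro x
    by_cases hx : x ∈ K
    · refine hps.contDiffAt.congr_of_eventuallyEq ?_
      filter_upwards [isOpen_Ioi.mem_nhds (hKpos hx)] with y hy
      rw [halfProfile, indicator_of_mem hy]
    · refine (contDiffAt_const (c := (0 : ℝ))).congr_of_eventuallyEq ?_
      filter_upwards [hKc.isClosed.isOpen_compl.mem_nhds hx] with y hy
      by_contra hc
      exact hy (hsupp hc)
  · by_contra hc
    exact hx (hsupp hc)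

theorem IsRadialTest.eq_halfProfile {φ : E3 → ℝ} (h : IsRadialTest φ) {x : E3} (hx : x ∈ Omega) :
    φ x = halfProfile φ (‖x‖ - 1) / ‖x‖ := by
  have hx1 : 1 < ‖x‖ := by simpa [Omega] using hx
  rw [halfProfile, indicator_of_mem (by simpa using hx1)]
  have : φ x = profile φ ‖x‖ := h.radial _ _ (by simp)
  rw [this]
  have : (1 + (‖x‖ - 1)) = ‖x‖ := by ring
  rw [this]; field_simp

/-- With `r = 1 + ρ`, one power of the weight `r²` cancels the denominator of the eigenfunction and
the other one builds the half line function. -/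
theorem dft_eq_sineT (φ : E3 → ℝ) : dft φ = sineT (halfProfile φ) := by
  ext lam
  rw [dft, sineT]
  congr 1
  have := (measurePreserving_add_right (volume : Measure ℝ) 1).setIntegral_preimage_emb
    (measurableEmbedding_addRight 1) (fun r => eigenfn lam r * profile φ r * r ^ 2) (Ioi 1)
  rw [← this]
  simp only [preimage_add_const_Ioi, sub_self]
  refine setIntegral_congr_fun measurableSet_Ioi fun ρ hρ => ?_
  have h0 : ρ + 1 ≠ 0 := by linarith [mem_Ioi.1 hρ]
  simp only [halfProfile, indicator_of_mem hρ, eigenfn, add_sub_cancel_right, add_comm 1 ρ,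
    mul_comm ρ lam]
  field_simp

/-- The radial test function with the given half line function. -/
def ofHalf (ψ : ℝ → ℝ) (x : E3) : ℝ := ψ (‖x‖ - 1) / ‖x‖

theorem halfProfile_ofHalf {ψ : ℝ → ℝ} (h : IsHalfTest ψ) : halfProfile (ofHalf ψ) = ψ := by
  ext ρ
  by_cases hρ : ρ ∈ Ioi (0 : ℝ)
  · have h0 : 0 < 1 + ρ := by linarith [mem_Ioi.1 hρ]
    rw [halfProfile, indicator_of_mem hρ, profile, ofHalf, norm_single_E3, abs_of_pos h0,
      add_sub_cancel_left]
    field_simp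
  · rw [halfProfile, indicator_of_notMem hρ, h.eq_zero (by simpa using hρ)]

theorem IsHalfTest.isRadialTest {ψ : ℝ → ℝ} (h : IsHalfTest ψ) : IsRadialTest (ofHalf ψ) := by
  set K : Set ℝ := tsupport ψ with hK
  have hKc : IsCompact K := h.compact.isCompact
  set K' : Set E3 := (fun x : E3 => ‖x‖ - 1) ⁻¹' K with hK'
  have hK'cl : IsClosed K' := hKc.isClosed.preimage (by fun_prop)
  have hK'c : IsCompact K' := by
    obtain ⟨R, hR⟩ := hKc.isBounded.exists_norm_le
    refine Metric.isCompact_of_isClosed_isBounded hK'cl ?_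
    refine (Metric.isBounded_closedBall (x := (0 : E3)) (r := R + 1)).subset fun x hx => ?_
    have := hR _ hx
    rw [mem_closedBall_zero_iff]
    linarith [le_abs_self (‖x‖ - 1), Real.norm_eq_abs (‖x‖ - 1)]
  have hsupp : Function.support (ofHalf ψ) ⊆ K' := by
    intro x hx
    refine subset_tsupport _ fun hc => hx ?_
    rw [ofHalf, hc, zero_div]
  have hts : tsupport (ofHalf ψ) ⊆ K' := closure_minimal hsupp hK'cl
  refine ⟨?_, HasCompactSupport.intro hK'c fun x hx => ?_, hts.trans fun x hx => ?_, fun x y hxy => ?_⟩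
  · rw [contDiff_iff_contDiffAt]
    intro x
    by_cases hx : x ∈ K'
    · have hx0 : 0 < ‖x‖ := by
        have := h.support hx
        linarith [mem_Ioi.1 this]
      have hx0' : x ≠ 0 := norm_pos_iff.1 hx0
      have hn : ContDiffAt ℝ ∞ (fun x : E3 => ‖x‖) x := contDiffAt_norm ℝ hx0'
      exact (h.smooth.contDiffAt.comp x (hn.sub contDiffAt_const)).div hn hx0.ne'
    · refine (contDiffAt_const (c := (0 : ℝ))).congr_of_eventuallyEq ?_
      filter_upwards [hK'cl.isOpen_compl.mem_nhds hx] with y hy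
      by_contra hc
      exact hy (hsupp hc)
  · by_contra hc
    exact hx (hsupp hc)
  · have := h.support hx
    simpa [Omega] using this
  · rw [ofHalf, ofHalf, hxy]

theorem dft_ofHalf {ψ : ℝ → ℝ} (h : IsHalfTest ψ) : dft (ofHalf ψ) = sineT ψ := by
  rw [dft_eq_sineT, halfProfile_ofHalf h]

/-- Radial test functions and half line test functions correspond bijectively, with proportional
`L²` norms and equal transforms, so approximating sequences can be carried either way. Nonlinear
forcing terms are read through this equivalence. -/
theorem isDftL2_iff {f : E3 → ℝ} {P g : ℝ → ℝ} (hP : Measurable P)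
    (hf : ∀ x ∈ Omega, f x = P (‖x‖ - 1) / ‖x‖) : IsDftL2 f g ↔ IsSine P g := by
  have hO : MeasurableSet Omega := by unfold Omega; measurability
  constructor
  · rintro ⟨φ, h1, h2, h3⟩
    refine ⟨fun n => halfProfile (φ n), fun n => (h1 n).isHalfTest, ?_, ?_⟩
    · refine (tendsto_eLpNorm_radial_iff (P := fun n x => halfProfile (φ n) x - P x)
        fun n => (h1 n).isHalfTest.continuous.measurable.sub hP).1 ?_
      refine h2.congr fun n => eLpNorm_congr_ae ?_
      filter_upwards [ae_restrict_mem hO] with x hx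
      rw [(h1 n).eq_halfProfile hx, hf x hx, sub_div]
    · simpa only [dft_eq_sineT] using h3
  · rintro ⟨ψ, h1, h2, h3⟩
    refine ⟨fun n => ofHalf (ψ n), fun n => (h1 n).isRadialTest, ?_, ?_⟩
    · replace h2 := (tendsto_eLpNorm_radial_iff (P := fun n x => ψ n x - P x)
        fun n => (h1 n).continuous.measurable.sub hP).2 h2
      refine h2.congr fun n => eLpNorm_congr_ae ?_
      filter_upwards [ae_restrict_mem hO] with x hx
      rw [ofHalf, hf x hx, sub_div]
    · simpa only [fun n => dft_ofHalf (h1 n)] using h3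

theorem invDft_eq (g : ℝ → ℝ) (x : E3) : invDft g x = sineT g (‖x‖ - 1) / ‖x‖ := by
  have e : ∀ lam : ℝ, eigenfn lam ‖x‖ * g lam
      = ‖x‖⁻¹ * (Real.sin (lam * (‖x‖ - 1)) * g lam) := fun lam => by
    simp only [eigenfn]; ring
  rw [invDft, sineT]
  simp only [e, integral_const_mul]
  ring

end Radial

/-! ### Power integrals and the Schur test behind Hardy's inequality. -/

section Calculus

theorem setLIntegral_Ioc_rpow {a : ℝ} (ha : -1 < a) {c : ℝ} (hc : 0 < c) :
    ∫⁻ x in Ioc 0 c, ENNReal.ofReal (x ^ a) = ENNReal.ofReal (c ^ (a + 1) / (a + 1)) := by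
  have hi := (intervalIntegral.intervalIntegrable_rpow' (a := 0) (b := c) ha).1
  rw [← ofReal_integral_eq_lintegral_ofReal hi, ← intervalIntegral.integral_of_le hc.le,
    integral_rpow (Or.inl ha), Real.zero_rpow (by linarith), sub_zero]
  filter_upwards [ae_restrict_mem measurableSet_Ioc] with x hx
  exact Real.rpow_nonneg hx.1.le _

theorem setLIntegral_Ioi_rpow {a : ℝ} (ha : a < -1) {c : ℝ} (hc : 0 < c) :
    ∫⁻ x in Ioi c, ENNReal.ofReal (x ^ a) = ENNReal.ofReal (-c ^ (a + 1) / (a + 1)) := by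
  rw [← ofReal_integral_eq_lintegral_ofReal (integrableOn_Ioi_rpow_of_lt ha hc),
    integral_Ioi_rpow_of_lt ha hc]
  filter_upwards [ae_restrict_mem measurableSet_Ioi] with x hx
  exact Real.rpow_nonneg (hc.le.trans hx.le) _

theorem lintegral_freq_split {f : ℝ → ℝ≥0∞} {c : ℝ} (hc : 0 < c) :
    ∫⁻ x, f x ∂freqMeasure = (∫⁻ x in Ioc 0 c, f x) + ∫⁻ x in Ioi c, f x := by
  rw [freqMeasure, ← Ioc_union_Ioi_eq_Ioi hc.le, lintegral_union measurableSet_Ioi]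
  exact (Iic_disjoint_Ioi le_rfl).mono_left Ioc_subset_Iic_self

/-- Splitting at `x = c` gives `2√c` from either side. The bound serves both Hardy's inequality and
the weights on the light cone. -/
theorem lintegral_min_mul_rpow {c : ℝ} (hc : 0 < c) :
    ∫⁻ x, ENNReal.ofReal (min c x * x ^ (-3 / 2 : ℝ)) ∂freqMeasure ≤ ENNReal.ofReal (4 * √c) := by
  rw [lintegral_freq_split hc]
  have h1 : ∫⁻ x in Ioc 0 c, ENNReal.ofReal (min c x * x ^ (-3 / 2 : ℝ))
      = ENNReal.ofReal (2 * √c) := by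
    rw [Real.sqrt_eq_rpow, show 2 * c ^ (1 / 2 : ℝ) = c ^ ((-1 / 2 : ℝ) + 1) / ((-1 / 2 : ℝ) + 1) by
      norm_num; ring, ← setLIntegral_Ioc_rpow (by norm_num) hc]
    refine setLIntegral_congr_fun measurableSet_Ioc fun x hx => ?_
    simp only [min_eq_right hx.2]
    rw [show (-1 / 2 : ℝ) = 1 + (-3 / 2) by norm_num, Real.rpow_add hx.1, Real.rpow_one]
  have h2 : ∫⁻ x in Ioi c, ENNReal.ofReal (min c x * x ^ (-3 / 2 : ℝ))
      = ENNReal.ofReal (2 * √c) := by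
    have e : 2 * √c = c * (-c ^ ((-3 / 2 : ℝ) + 1) / ((-3 / 2 : ℝ) + 1)) := by
      rw [Real.sqrt_eq_rpow]
      norm_num
      rw [show c * (c ^ (-(1 / 2) : ℝ) / (1 / 2)) = 2 * (c ^ (1 : ℝ) * c ^ (-(1 / 2) : ℝ)) by
        rw [Real.rpow_one]; ring, ← Real.rpow_add hc]
      norm_num
    rw [e, ENNReal.ofReal_mul hc.le, ← setLIntegral_Ioi_rpow (by norm_num) hc,
      ← lintegral_const_mul _ (by fun_prop)]
    refine setLIntegral_congr_fun measurableSet_Ioi fun x hx => ?_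
    rw [min_eq_left (le_of_lt hx), ENNReal.ofReal_mul hc.le]
  rw [h1, h2, ← ENNReal.ofReal_add (by positivity) (by positivity)]
  exact ENNReal.ofReal_le_ofReal (by linarith)

theorem lintegral_min_inv_sq {c : ℝ} (hc : 0 < c) :
    ∫⁻ x, ENNReal.ofReal (min c x⁻¹) ^ 2 ∂freqMeasure ≤ ENNReal.ofReal (2 * c) := by
  have hc' : 0 < c⁻¹ := inv_pos.2 hc
  rw [lintegral_freq_split hc']
  have h1 : ∫⁻ x in Ioc 0 c⁻¹, ENNReal.ofReal (min c x⁻¹) ^ 2 ≤ ENNReal.ofReal c := by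
    calc _ ≤ ∫⁻ x in Ioc 0 c⁻¹, ENNReal.ofReal c ^ 2 := by
          gcongr with x; exact min_le_left _ _
      _ = _ := by
          rw [setLIntegral_const, Real.volume_Ioc, sub_zero, ← ENNReal.ofReal_pow hc.le,
            ← ENNReal.ofReal_mul (by positivity)]
          congr 1; field_simp
  have h2 : ∫⁻ x in Ioi c⁻¹, ENNReal.ofReal (min c x⁻¹) ^ 2 ≤ ENNReal.ofReal c := by
    have e : c = -c⁻¹ ^ ((-2 : ℝ) + 1) / ((-2 : ℝ) + 1) := by
      norm_num
      rw [Real.rpow_neg_one, inv_inv]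
    conv_rhs => rw [e, ← setLIntegral_Ioi_rpow (by norm_num) hc']
    refine setLIntegral_mono' measurableSet_Ioi fun x hx => ?_
    have hx0 : 0 < x := hc'.trans hx
    rw [← ENNReal.ofReal_pow (le_min hc.le (by positivity))]
    refine ENNReal.ofReal_le_ofReal ?_
    rw [Real.rpow_neg hx0.le, Real.rpow_ofNat, ← inv_pow]
    gcongr
    exact min_le_right _ _
  refine (add_le_add h1 h2).trans ?_
  rw [← ENNReal.ofReal_add hc.le hc.le]
  exact ENNReal.ofReal_le_ofReal (by linarith)

/-- The Hardy kernel `min(1, 1/(xy))` acts boundedly on `L²(0, ∞)`. -/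
theorem lintegral_hardy_kernel {H : ℝ → ℝ≥0∞} (hH : AEMeasurable H freqMeasure) :
    ∫⁻ x, (∫⁻ y, ENNReal.ofReal (min x⁻¹ y * y⁻¹) * H y ∂freqMeasure) ^ 2 ∂freqMeasure
      ≤ 16 * ∫⁻ y, H y ^ 2 ∂freqMeasure := by
  have ksymm : ∀ x y : ℝ, 0 < x → 0 < y → min x⁻¹ y * y⁻¹ = min y⁻¹ x * x⁻¹ := by
    intro x y hx hy
    rcases le_total x⁻¹ y with h | h
    · rw [min_eq_left h, min_eq_left (inv_le_of_inv_le₀ hx h)]; ring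
    · rw [min_eq_right h, min_eq_right ((le_inv_comm₀ hy hx).1 h)]
      field_simp
  have hint : ∀ x : ℝ, 0 < x → ∫⁻ y, ENNReal.ofReal (min x⁻¹ y * y⁻¹) * ENNReal.ofReal (y ^ (-1 / 2 : ℝ))
      ∂freqMeasure ≤ ENNReal.ofReal (4 * x ^ (-1 / 2 : ℝ)) := by
    intro x hx
    have := lintegral_min_mul_rpow (inv_pos.2 hx)
    have e : √(x⁻¹) = x ^ (-1 / 2 : ℝ) := by
      rw [Real.sqrt_eq_rpow, Real.inv_rpow hx.le, ← Real.rpow_neg hx.le]; norm_num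
    rw [e] at this
    refine le_trans (le_of_eq ?_) this
    refine lintegral_congr_ae ?_
    filter_upwards [ae_freqMeasure_pos] with y hy
    rw [← ENNReal.ofReal_mul (mul_nonneg (le_min (by positivity) hy.le) (by positivity)), mul_assoc,
      ← Real.rpow_neg_one y, ← Real.rpow_add hy]
    norm_num
  have hpos : ∀ y : ℝ, 0 < y → ENNReal.ofReal (y ^ (-1 / 2 : ℝ)) * ENNReal.ofReal (y ^ (1 / 2 : ℝ)) = 1 := by
    intro y hy
    rw [← ENNReal.ofReal_mul (by positivity), ← Real.rpow_add hy]; norm_num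
  -- Schur's test with the weight `y ^ (-1/2)`, which the kernel reproduces up to the factor 4
  -- (`hint`). By the symmetry `ksymm` the same holds in the other variable, whence 16.
  have hstep : ∀ x : ℝ, 0 < x → (∫⁻ y, ENNReal.ofReal (min x⁻¹ y * y⁻¹) * H y ∂freqMeasure) ^ 2
      ≤ ENNReal.ofReal (4 * x ^ (-1 / 2 : ℝ)) * ∫⁻ y, ENNReal.ofReal (min x⁻¹ y * y⁻¹)
        * (ENNReal.ofReal (y ^ (1 / 2 : ℝ)) * H y ^ 2) ∂freqMeasure := by
    intro x hx
    have hcs := sq_lintegral_mul_le (μ := freqMeasure)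
      (f := fun y => ENNReal.ofReal (√(min x⁻¹ y * y⁻¹ * y ^ (-1 / 2 : ℝ))))
      (g := fun y => ENNReal.ofReal (√(min x⁻¹ y * y⁻¹ * y ^ (1 / 2 : ℝ))) * H y)
      (by fun_prop) (by fun_prop)
    refine le_trans (le_of_eq ?_) (hcs.trans (mul_le_mul' (le_trans (le_of_eq ?_) (hint x hx)) (le_of_eq ?_)))
    · congr 1
      refine lintegral_congr_ae ?_
      filter_upwards [ae_freqMeasure_pos] with y hy
      have hm : 0 ≤ min x⁻¹ y := le_min (by positivity) hy.le
      rw [← mul_assoc, ← ENNReal.ofReal_mul (by positivity), ← Real.sqrt_mul (by positivity)]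
      congr 2
      rw [show min x⁻¹ y * y⁻¹ * y ^ (-1 / 2 : ℝ) * (min x⁻¹ y * y⁻¹ * y ^ (1 / 2 : ℝ))
        = (min x⁻¹ y * y⁻¹) ^ 2 * (y ^ (-1 / 2 : ℝ) * y ^ (1 / 2 : ℝ)) by ring, ← Real.rpow_add hy]
      norm_num
      rw [Real.sqrt_sq (by positivity)]
    · refine lintegral_congr_ae ?_
      filter_upwards [ae_freqMeasure_pos] with y hy
      have hm : 0 ≤ min x⁻¹ y := le_min (by positivity) hy.le
      rw [← ENNReal.ofReal_pow (by positivity), Real.sq_sqrt (by positivity),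
        ENNReal.ofReal_mul (by positivity)]
    · refine lintegral_congr_ae ?_
      filter_upwards [ae_freqMeasure_pos] with y hy
      have hm : 0 ≤ min x⁻¹ y := le_min (by positivity) hy.le
      rw [mul_pow, ← ENNReal.ofReal_pow (by positivity), Real.sq_sqrt (by positivity),
        ENNReal.ofReal_mul (by positivity), mul_assoc]
  calc _ ≤ ∫⁻ x, ENNReal.ofReal (4 * x ^ (-1 / 2 : ℝ)) * ∫⁻ y, ENNReal.ofReal (min x⁻¹ y * y⁻¹)
        * (ENNReal.ofReal (y ^ (1 / 2 : ℝ)) * H y ^ 2) ∂freqMeasure ∂freqMeasure := by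
        refine lintegral_mono_ae ?_
        filter_upwards [ae_freqMeasure_pos] with x hx using hstep x hx
    _ = ∫⁻ x, ∫⁻ y, ENNReal.ofReal (4 * x ^ (-1 / 2 : ℝ)) * (ENNReal.ofReal (min x⁻¹ y * y⁻¹)
        * (ENNReal.ofReal (y ^ (1 / 2 : ℝ)) * H y ^ 2)) ∂freqMeasure ∂freqMeasure := by
        refine lintegral_congr fun x => ?_
        rw [lintegral_const_mul'' _ (by fun_prop)]
    _ = ∫⁻ y, ∫⁻ x, ENNReal.ofReal (4 * x ^ (-1 / 2 : ℝ)) * (ENNReal.ofReal (min x⁻¹ y * y⁻¹)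
        * (ENNReal.ofReal (y ^ (1 / 2 : ℝ)) * H y ^ 2)) ∂freqMeasure ∂freqMeasure := by
        have hH2 : AEMeasurable (fun p : ℝ × ℝ => H p.2) (freqMeasure.prod freqMeasure) :=
          hH.comp_snd
        exact lintegral_lintegral_swap (by fun_prop)
    _ ≤ ∫⁻ y, 16 * H y ^ 2 ∂freqMeasure := by
        refine lintegral_mono_ae ?_
        filter_upwards [ae_freqMeasure_pos] with y hy
        calc _ = ∫⁻ x, (4 * ENNReal.ofReal (y ^ (1 / 2 : ℝ)) * H y ^ 2)
              * (ENNReal.ofReal (min y⁻¹ x * x⁻¹) * ENNReal.ofReal (x ^ (-1 / 2 : ℝ))) ∂freqMeasure := by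
              refine lintegral_congr_ae ?_
              filter_upwards [ae_freqMeasure_pos] with x hx
              rw [ksymm x y hx hy, ENNReal.ofReal_mul (by norm_num)]
              norm_num
              ring
          _ = (4 * ENNReal.ofReal (y ^ (1 / 2 : ℝ)) * H y ^ 2) * ∫⁻ x, 
              (ENNReal.ofReal (min y⁻¹ x * x⁻¹) * ENNReal.ofReal (x ^ (-1 / 2 : ℝ))) ∂freqMeasure :=
              lintegral_const_mul _ (by fun_prop)
          _ ≤ (4 * ENNReal.ofReal (y ^ (1 / 2 : ℝ)) * H y ^ 2) * ENNReal.ofReal (4 * y ^ (-1 / 2 : ℝ)) := by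
              gcongr; exact hint y hy
          _ = 16 * H y ^ 2 * (ENNReal.ofReal (y ^ (-1 / 2 : ℝ)) * ENNReal.ofReal (y ^ (1 / 2 : ℝ))) := by
              rw [ENNReal.ofReal_mul (by norm_num)]
              norm_num
              ring
          _ = _ := by rw [hpos y hy, mul_one]
    _ = _ := lintegral_const_mul'' _ (by fun_prop)

end Calculus

/-! ### Pointwise and Hardy bounds for sine integrals. -/

section SineBounds

variable {g : ℝ → ℝ}

theorem sqrt_two_div_pi_le_one : √(2 / Real.pi) ≤ 1 := by
  rw [Real.sqrt_le_one]
  rw [div_le_one Real.pi_pos]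
  linarith [Real.pi_gt_three]

theorem abs_sin_mul_le {y x : ℝ} (hy : 0 < y) (hx : 0 ≤ x) : |Real.sin (y * x)| ≤ min x y⁻¹ * y := by
  rw [min_mul_of_nonneg _ _ hy.le, inv_mul_cancel₀ hy.ne']
  refine le_min ?_ (Real.abs_sin_le_one _)
  refine Real.abs_sin_le_abs.trans (le_of_eq ?_)
  rw [abs_of_nonneg (by positivity), mul_comm]

/-- No integrability is required: where the integral diverges, the left side is zero by convention.
-/
theorem enorm_sineT_le (g : ℝ → ℝ) (x : ℝ) :
    ‖sineT g x‖ₑ ≤ ∫⁻ y, ‖Real.sin (y * x)‖ₑ * ‖g y‖ₑ ∂freqMeasure := by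
  rw [sineT, enorm_mul]
  calc _ ≤ 1 * ‖∫ lam in Ioi (0 : ℝ), Real.sin (lam * x) * g lam‖ₑ := by
        gcongr
        rw [← ofReal_norm, ← ENNReal.ofReal_one]
        apply ENNReal.ofReal_le_ofReal
        rw [Real.norm_of_nonneg (Real.sqrt_nonneg _)]
        exact sqrt_two_div_pi_le_one
    _ ≤ _ := by
        rw [one_mul]
        refine (enorm_integral_le_lintegral_enorm _).trans (le_of_eq ?_)
        simp [freqMeasure, enorm_mul]

theorem enorm_sin_mul_le {y x : ℝ} (hy : 0 < y) (hx : 0 ≤ x) (a : ℝ) :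
    ‖Real.sin (y * x)‖ₑ * ‖a‖ₑ ≤ ENNReal.ofReal (min x y⁻¹) * ‖y * a‖ₑ := by
  rw [enorm_mul, ← mul_assoc]
  gcongr
  rw [← ofReal_norm, ← ofReal_norm, Real.norm_of_nonneg hy.le, ← ENNReal.ofReal_mul (le_min hx (by positivity))]
  exact ENNReal.ofReal_le_ofReal (abs_sin_mul_le hy hx)

/-- Pointwise bound for functions in the homogeneous Sobolev space of order one. -/
theorem enorm_sineT_sq_le (hg : AEStronglyMeasurable (fun y => y * g y) freqMeasure) {x : ℝ}
    (hx : 0 ≤ x) :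
    ‖sineT g x‖ₑ ^ 2 ≤ ENNReal.ofReal (2 * x) * eLpNorm (fun y => y * g y) 2 freqMeasure ^ 2 := by
  rcases hx.eq_or_lt with rfl | hx
  · simp [sineT]
  rw [eLpNorm_two_sq]
  calc _ ≤ (∫⁻ y, ENNReal.ofReal (min x y⁻¹) * ‖y * g y‖ₑ ∂freqMeasure) ^ 2 := by
        refine pow_le_pow_left₀ zero_le ((enorm_sineT_le g x).trans (lintegral_mono_ae ?_)) 2
        filter_upwards [ae_freqMeasure_pos] with y hy
        exact enorm_sin_mul_le hy hx.le _
    _ ≤ _ := by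
        refine (sq_lintegral_mul_le (by fun_prop) hg.enorm).trans ?_
        gcongr
        exact lintegral_min_inv_sq hx

/-- Hardy's inequality. -/
theorem lintegral_sineT_div_sq_le (hg : AEStronglyMeasurable (fun y => y * g y) freqMeasure) :
    ∫⁻ x, (ENNReal.ofReal x⁻¹ * ‖sineT g x‖ₑ) ^ 2 ∂freqMeasure
      ≤ 16 * eLpNorm (fun y => y * g y) 2 freqMeasure ^ 2 := by
  rw [eLpNorm_two_sq]
  refine le_trans (lintegral_mono_ae ?_) (lintegral_hardy_kernel hg.enorm)
  filter_upwards [ae_freqMeasure_pos] with x hx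
  gcongr
  calc _ ≤ ENNReal.ofReal x⁻¹ * ∫⁻ y, ENNReal.ofReal (min x y⁻¹) * ‖y * g y‖ₑ ∂freqMeasure := by
        gcongr
        refine (enorm_sineT_le g x).trans (lintegral_mono_ae ?_)
        filter_upwards [ae_freqMeasure_pos] with y hy
        exact enorm_sin_mul_le hy hx.le _
    _ = ∫⁻ y, ENNReal.ofReal x⁻¹ * (ENNReal.ofReal (min x y⁻¹) * ‖y * g y‖ₑ) ∂freqMeasure :=
        (lintegral_const_mul'' _ ((by fun_prop : AEMeasurable _ _).mul hg.enorm)).symm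
    _ = _ := by
        refine lintegral_congr_ae ?_
        filter_upwards [ae_freqMeasure_pos] with y hy
        rw [← mul_assoc, ← ENNReal.ofReal_mul (by positivity)]
        congr 2
        rcases le_total x y⁻¹ with h | h
        · rw [min_eq_left h, min_eq_right ((le_inv_comm₀ hx hy).1 h)]; field_simp
        · rw [min_eq_right h, min_eq_left (inv_le_of_inv_le₀ hy h)]

/-- Functions with an absolutely convergent sine integral, locally uniformly. -/
def SineAdm (g : ℝ → ℝ) : Prop := Integrable (fun y => min 1 y * g y) freqMeasure

/-- The weighted `L¹` norm controlling the sine integral. -/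
def sineNorm (g : ℝ → ℝ) : ℝ := ∫ y, |min 1 y * g y| ∂freqMeasure

theorem sineNorm_nonneg (g : ℝ → ℝ) : 0 ≤ sineNorm g := integral_nonneg fun _ => abs_nonneg _

theorem abs_sin_mul_le' {y : ℝ} (hy : 0 < y) (x a : ℝ) :
    |Real.sin (y * x) * a| ≤ (1 + |x|) * |min 1 y * a| := by
  rw [abs_mul, abs_mul, ← mul_assoc, abs_of_nonneg (show 0 ≤ min 1 y by positivity)]
  gcongr
  rcases le_total 1 y with h | h
  · rw [min_eq_left h]; linarith [Real.abs_sin_le_one (y * x), abs_nonneg x]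
  · rw [min_eq_right h]
    have := Real.abs_sin_le_abs (x := y * x)
    rw [abs_mul, abs_of_pos hy] at this
    nlinarith

theorem SineAdm.aestronglyMeasurable (h : SineAdm g) : AEStronglyMeasurable g freqMeasure := by
  have : AEStronglyMeasurable (fun y => (min 1 y)⁻¹ * (min 1 y * g y)) freqMeasure :=
    AEStronglyMeasurable.mul (by fun_prop) h.1
  refine this.congr ?_
  filter_upwards [ae_freqMeasure_pos] with y hy
  have : 0 < min 1 y := by positivity
  field_simp

theorem SineAdm.integrable_sin (h : SineAdm g) (x : ℝ) :
    Integrable (fun y => Real.sin (y * x) * g y) freqMeasure := by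
  refine (h.abs.const_mul (1 + |x|)).mono' ?_ ?_
  · exact AEStronglyMeasurable.mul (by fun_prop) h.aestronglyMeasurable
  · filter_upwards [ae_freqMeasure_pos] with y hy
    exact abs_sin_mul_le' hy x _

theorem SineAdm.abs_sineT_le (h : SineAdm g) (x : ℝ) : |sineT g x| ≤ (1 + |x|) * sineNorm g := by
  rw [sineT, abs_mul, abs_of_nonneg (Real.sqrt_nonneg _), sineNorm]
  calc _ ≤ 1 * ∫ y, |Real.sin (y * x) * g y| ∂freqMeasure := by
        gcongr
        · exact sqrt_two_div_pi_le_one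
        · exact abs_integral_le_integral_abs
    _ ≤ _ := by
        rw [one_mul, ← integral_const_mul]
        refine integral_mono_ae (h.integrable_sin x).abs (h.abs.const_mul _) ?_
        filter_upwards [ae_freqMeasure_pos] with y hy
        exact abs_sin_mul_le' hy x _

theorem SineAdm.sub {g' : ℝ → ℝ} (h : SineAdm g) (h' : SineAdm g') :
    SineAdm fun y => g y - g' y := by
  have := Integrable.sub h h'
  simpa [SineAdm, mul_sub] using! this

theorem SineAdm.sineT_sub {g' : ℝ → ℝ} (h : SineAdm g) (h' : SineAdm g') (x : ℝ) :
    sineT (fun y => g y - g' y) x = sineT g x - sineT g' x := by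
  simp_rw [sineT, mul_sub]
  rw [← mul_sub]
  congr 1
  exact integral_sub (h.integrable_sin x) (h'.integrable_sin x)

theorem sineT_congr {g' : ℝ → ℝ} (h : g =ᵐ[freqMeasure] g') (x : ℝ) : sineT g x = sineT g' x := by
  rw [sineT, sineT]
  congr 1
  refine integral_congr_ae ?_
  filter_upwards [h] with y hy
  rw [hy]

theorem SineAdm.continuous_sineT (h : SineAdm g) : Continuous (sineT g) := by
  refine continuous_const.mul (continuous_iff_continuousAt.2 fun x₀ => ?_)
  refine continuousAt_of_dominated (bound := fun y => (2 + |x₀|) * |min 1 y * g y|) ?_ ?_ ?_ ?_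
  · exact Eventually.of_forall fun x => (h.integrable_sin x).1
  · filter_upwards [Metric.ball_mem_nhds x₀ one_pos] with x hx
    filter_upwards [ae_freqMeasure_pos] with y hy
    refine (abs_sin_mul_le' hy x _).trans ?_
    have h1 : |x| ≤ 1 + |x₀| := by
      rw [Metric.mem_ball, Real.dist_eq] at hx
      have := abs_add_le (x - x₀) x₀
      rw [sub_add_cancel] at this
      linarith
    exact mul_le_mul_of_nonneg_right (by linarith) (abs_nonneg _)
  · exact h.abs.const_mul _
  · exact ae_of_all _ fun y => by fun_prop

theorem memLp_min_one_inv : MemLp (fun y : ℝ => min 1 y⁻¹) 2 freqMeasure := by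
  refine ⟨by fun_prop, ?_⟩
  have : eLpNorm (fun y : ℝ => min 1 y⁻¹) 2 freqMeasure ^ 2 < ⊤ := by
    rw [eLpNorm_two_sq]
    refine lt_of_le_of_lt (le_trans (le_of_eq ?_) (lintegral_min_inv_sq one_pos)) ENNReal.ofReal_lt_top
    refine lintegral_congr_ae ?_
    filter_upwards [ae_freqMeasure_pos] with y hy
    rw [← ofReal_norm, Real.norm_of_nonneg (le_min zero_le_one (by positivity))]
  exact (ENNReal.pow_lt_top_iff.1 this).resolve_right (by norm_num)

/-- Cauchy–Schwarz with `min 1 y⁻¹`, which is square integrable. Every element of the space of order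
one thus has an absolutely convergent sine integral and a continuous radial field. -/
theorem sineAdm_of_memLp (hg : MemLp (fun y => y * g y) 2 freqMeasure) : SineAdm g := by
  have := memLp_min_one_inv.integrable_mul hg
  refine this.congr ?_
  filter_upwards [ae_freqMeasure_pos] with y hy
  simp only [Pi.mul_apply]
  rw [← mul_assoc, min_mul_of_nonneg _ _ hy.le, inv_mul_cancel₀ hy.ne', one_mul, min_comm]

end SineBounds

/-! ### Parseval's formula against indicator functions of intervals. -/

section Pairing

/-- The sine transform of the indicator function of `(a, b]`. -/
def cosKer (a b y : ℝ) : ℝ := √(2 / Real.pi) * ((Real.cos (y * a) - Real.cos (y * b)) / y)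

theorem abs_cosKer_le (a b : ℝ) {y : ℝ} (hy : 0 < y) :
    |cosKer a b y| ≤ (2 + |a - b|) * min 1 y⁻¹ := by
  rw [cosKer, abs_mul, abs_of_nonneg (Real.sqrt_nonneg _), abs_div, abs_of_pos hy]
  have h1 : |Real.cos (y * a) - Real.cos (y * b)| ≤ 2 := by
    have := abs_sub (Real.cos (y * a)) (Real.cos (y * b))
    linarith [Real.abs_cos_le_one (y * a), Real.abs_cos_le_one (y * b)]
  have h2 : |Real.cos (y * a) - Real.cos (y * b)| ≤ y * |a - b| := by
    have := Real.abs_cos_sub_cos_le (y * a) (y * b)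
    rwa [← mul_sub, abs_mul, abs_of_pos hy] at this
  have h3 : |Real.cos (y * a) - Real.cos (y * b)| / y ≤ (2 + |a - b|) * min 1 y⁻¹ := by
    rw [mul_min_of_nonneg _ _ (by positivity), le_min_iff]
    constructor
    · rw [div_le_iff₀ hy]; nlinarith [abs_nonneg (a - b)]
    · rw [div_eq_mul_inv]; gcongr; linarith [abs_nonneg (a - b)]
  calc _ ≤ 1 * (|Real.cos (y * a) - Real.cos (y * b)| / y) := by
        gcongr; exact sqrt_two_div_pi_le_one
    _ ≤ _ := by rwa [one_mul]

theorem memLp_cosKer (a b : ℝ) : MemLp (cosKer a b) 2 freqMeasure := by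
  refine (memLp_min_one_inv.const_mul (2 + |a - b|)).of_le ?_ ?_
  · exact (Measurable.aestronglyMeasurable (by unfold cosKer; fun_prop))
  · filter_upwards [ae_freqMeasure_pos] with y hy
    rw [Real.norm_eq_abs, Real.norm_eq_abs]
    exact (abs_cosKer_le a b hy).trans (le_abs_self _)

theorem integral_sin_mul (a b : ℝ) {y : ℝ} (hy : 0 < y) :
    ∫ x in a..b, Real.sin (y * x) = (Real.cos (y * a) - Real.cos (y * b)) / y := by
  rw [intervalIntegral.integral_comp_mul_left (fun x => Real.sin x) hy.ne', integral_sin]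
  simp; ring

/-- The inversion formula is integrated over the interval and the integrals are exchanged. Inversion
holds at positive points only, hence the condition `0 ≤ a`. -/
theorem IsHalfTest.pairing {ψ : ℝ → ℝ} (h : IsHalfTest ψ) {a b : ℝ} (ha : 0 ≤ a) (hab : a ≤ b) :
    ∫ y, cosKer a b y * sineT ψ y ∂freqMeasure = ∫ x in a..b, ψ x := by
  have h1 : ∫ x in a..b, ψ x = ∫ x in Ioc a b, √(2 / Real.pi) * ∫ y in Ioi (0 : ℝ), Real.sin (y * x) * sineT ψ y := by
    rw [intervalIntegral.integral_of_le hab]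
    refine setIntegral_congr_fun measurableSet_Ioc fun x hx => ?_
    exact (h.sineT_sineT (ha.trans_lt hx.1)).symm
  rw [h1, integral_const_mul, integral_integral_swap, ← integral_const_mul]
  · refine integral_congr_ae ?_
    filter_upwards [ae_freqMeasure_pos] with y hy
    rw [integral_mul_const, ← intervalIntegral.integral_of_le hab, integral_sin_mul a b hy, cosKer]
    ring
  · have h2 : Integrable (fun p : ℝ × ℝ => (1 : ℝ) * sineT ψ p.2)
        ((volume.restrict (Ioc a b)).prod (volume.restrict (Ioi 0))) :=
      Integrable.mul_prod (integrable_const 1) h.integrable_sineT.integrableOn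
    refine h2.mono ?_ (ae_of_all _ fun p => ?_)
    · have := h.continuous_sineT
      exact Continuous.aestronglyMeasurable (by fun_prop)
    · simp only [Function.uncurry, norm_mul, norm_one]
      gcongr
      exact Real.abs_sin_le_one _

/-- Integrals of a function over intervals, in terms of its sine transform. -/
theorem IsSine.pairing {U G : ℝ → ℝ} (h : IsSine U G) (hU : AEStronglyMeasurable U freqMeasure)
    (hG : AEStronglyMeasurable G freqMeasure) {a b : ℝ} (ha : 0 ≤ a) (hab : a ≤ b) :
    ∫ y, cosKer a b y * G y ∂freqMeasure = ∫ x in a..b, U x := by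
  have hUm := h.memLp_left hU
  have hGm := h.memLp_right hG
  obtain ⟨ψ, h1, h2, h3⟩ := h
  have t1 := tendsto_integral_mul (memLp_cosKer a b) (fun n => (h1 n).memLp_sineT) hGm h3
  have hK : MemLp ((Ioc a b).indicator fun _ => (1 : ℝ)) 2 freqMeasure := by
    refine memLp_indicator_const 2 measurableSet_Ioc 1 (Or.inr ?_)
    exact ((Measure.restrict_apply_le _ _).trans_lt measure_Ioc_lt_top).ne
  have t2 := tendsto_integral_mul hK (fun n => (h1 n).memLp) hUm h2
  have e : ∀ u : ℝ → ℝ, ∫ x, (Ioc a b).indicator (fun _ => (1 : ℝ)) x * u x ∂freqMeasure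
      = ∫ x in a..b, u x := by
    intro u
    have : (fun x => (Ioc a b).indicator (fun _ => (1 : ℝ)) x * u x) = (Ioc a b).indicator u := by
      ext x; by_cases hx : x ∈ Ioc a b <;> simp [hx]
    rw [this, integral_indicator measurableSet_Ioc, freqMeasure,
      Measure.restrict_restrict measurableSet_Ioc, inter_eq_left.2, intervalIntegral.integral_of_le hab]
    exact fun x hx => ha.trans_lt hx.1
  simp only [e] at t2
  simp only [fun n => (h1 n).pairing ha hab] at t1
  exact tendsto_nhds_unique t1 t2

end Pairing

/-! ### A uniqueness theorem for sine transforms, by Weyl's lemma on the line. -/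

section Density

variable {g θ ψ : ℝ → ℝ}

/-- Symmetry of the sine kernel and Fubini. The weight `1 + |x|` pays for the growth of `sineT g`,
since only `min 1 y * g y` is integrable. -/
theorem SineAdm.integral_sineT_mul (h : SineAdm g)
    (hθ : Integrable (fun x => (1 + |x|) * θ x) freqMeasure) :
    ∫ x, sineT g x * θ x ∂freqMeasure = ∫ y, g y * sineT θ y ∂freqMeasure := by
  have hθm : AEStronglyMeasurable θ freqMeasure := by
    have : AEStronglyMeasurable (fun y => (1 + |y|)⁻¹ * ((1 + |y|) * θ y)) freqMeasure :=
      AEStronglyMeasurable.mul (by fun_prop) hθ.1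
    refine this.congr (ae_of_all _ fun y => ?_)
    have : 0 < 1 + |y| := by positivity
    field_simp
  have hint : Integrable (fun p : ℝ × ℝ => Real.sin (p.2 * p.1) * g p.2 * θ p.1)
      (freqMeasure.prod freqMeasure) := by
    have h2 := Integrable.mul_prod hθ.abs h.abs
    refine h2.mono' ?_ ?_
    · have a1 := h.aestronglyMeasurable.comp_snd (μ := freqMeasure)
      have a2 := hθm.comp_fst (ν := freqMeasure)
      exact (AEStronglyMeasurable.mul (by fun_prop) a1).mul a2
    · have : ∀ᵐ p : ℝ × ℝ ∂(freqMeasure.prod freqMeasure), 0 < p.2 :=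
        Measure.quasiMeasurePreserving_snd.ae ae_freqMeasure_pos
      filter_upwards [this] with p hp
      rw [Real.norm_eq_abs, abs_mul, abs_mul (1 + |p.1|), abs_of_nonneg (show 0 ≤ 1 + |p.1| by positivity)]
      calc _ ≤ (1 + |p.1|) * |min 1 p.2 * g p.2| * |θ p.1| := by
            gcongr; exact abs_sin_mul_le' hp _ _
        _ = _ := by ring
  have s := integral_integral_swap (f := fun x y => Real.sin (y * x) * g y * θ x) hint
  have e1 : ∀ x, sineT g x * θ x = √(2 / Real.pi) * ∫ y, Real.sin (y * x) * g y * θ x ∂freqMeasure := by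
    intro x; rw [integral_mul_const, sineT, freqMeasure]; ring
  have e2 : ∀ y, g y * sineT θ y = √(2 / Real.pi) * ∫ x, Real.sin (y * x) * g y * θ x ∂freqMeasure := by
    intro y
    rw [sineT, mul_left_comm, ← integral_const_mul, freqMeasure]
    congr 1
    refine integral_congr_ae (ae_of_all _ fun x => ?_)
    simp only [mul_comm x y]; ring
  simp_rw [e1, e2, integral_const_mul, s]

theorem IsHalfTest.deriv (h : IsHalfTest ψ) : IsHalfTest (deriv ψ) :=
  ⟨(contDiff_infty_iff_deriv.1 h.smooth).2, h.compact.deriv, (tsupport_deriv_subset).trans h.support⟩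

theorem IsHalfTest.integrable_weight (h : IsHalfTest ψ) {V : ℝ → ℝ} (hV : Continuous V) :
    Integrable (fun x => V x * ψ x) :=
  (hV.mul h.continuous).integrable_of_hasCompactSupport h.compact.mul_left

theorem IsHalfTest.hasDerivAt (h : IsHalfTest ψ) (x : ℝ) : HasDerivAt ψ (_root_.deriv ψ x) x :=
  (h.smooth.differentiable (by simp) x).hasDerivAt

theorem IsHalfTest.integral_mul_deriv (h : IsHalfTest ψ) {V V' : ℝ → ℝ} (hV : ∀ x, HasDerivAt V (V' x) x)
    (hV' : Continuous V') : ∫ x, V x * _root_.deriv ψ x = - ∫ x, V' x * ψ x := by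
  have hVc : Continuous V := continuous_iff_continuousAt.2 fun x => (hV x).continuousAt
  exact integral_mul_deriv_eq_deriv_mul_of_integrable (fun x _ => hV x)
    (fun x _ => h.hasDerivAt x) (h.deriv.integrable_weight hVc) (h.integrable_weight hV')
    (h.integrable_weight hVc)

theorem IsHalfTest.setIntegral_eq (h : IsHalfTest ψ) (V : ℝ → ℝ) :
    ∫ x, V x * ψ x ∂freqMeasure = ∫ x, V x * ψ x := by
  apply setIntegral_eq_integral_of_forall_compl_eq_zero
  intro x hx
  rw [h.eq_zero (by simpa using hx), mul_zero]

theorem IsHalfTest.sineT_deriv_deriv (h : IsHalfTest ψ) (y : ℝ) :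
    sineT (_root_.deriv (_root_.deriv ψ)) y = -(y ^ 2 * sineT ψ y) := by
  rw [sineT, sineT, h.deriv.deriv.setIntegral_sin, h.setIntegral_sin,
    h.deriv.integral_mul_deriv (V' := fun x => Real.cos (x * y) * y)
      (fun x => by simpa using! (Real.hasDerivAt_sin (x * y)).comp x ((hasDerivAt_id x).mul_const y))
      (by fun_prop),
    h.integral_mul_deriv (V' := fun x => (-Real.sin (x * y) * y) * y)
      (fun x => by
        simpa using! ((Real.hasDerivAt_cos (x * y)).comp x ((hasDerivAt_id x).mul_const y)).mul_const y)
      (by fun_prop), neg_neg]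
  have : (fun x => -Real.sin (x * y) * y * y * ψ x) = fun x => -y ^ 2 * (Real.sin (x * y) * ψ x) := by
    ext x; ring
  rw [this, integral_const_mul]
  ring

theorem exists_halfTest_integral_one : ∃ φ : ℝ → ℝ, IsHalfTest φ ∧ ∫ x, φ x = 1 := by
  let f : ContDiffBump (2 : ℝ) := ⟨1 / 2, 1, by norm_num, by norm_num⟩
  refine ⟨f.normed volume, ⟨f.contDiff_normed, f.hasCompactSupport_normed, ?_⟩, f.integral_normed⟩
  rw [f.tsupport_normed_eq]
  intro x hx
  rw [Metric.mem_closedBall, Real.dist_eq] at hx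
  have := abs_le.1 hx
  show 0 < x
  have h1 : f.rOut = 1 := rfl
  linarith [this.1]

/-- The primitive starting at 0 vanishes to the left of the support, and to the right of it because
the total integral is zero. -/
theorem IsHalfTest.exists_primitive (h : IsHalfTest ψ) (h0 : ∫ x, ψ x = 0) :
    ∃ φ, IsHalfTest φ ∧ _root_.deriv φ = ψ := by
  obtain ⟨R, hR⟩ := h.compact.isCompact.isBounded.exists_norm_le
  obtain ⟨a, ha, ha'⟩ : ∃ a > 0, ∀ x ∈ tsupport ψ, a ≤ x := by
    rcases (tsupport ψ).eq_empty_or_nonempty with he | hne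
    · exact ⟨1, one_pos, fun x hx => by simp [he] at hx⟩
    · obtain ⟨m, hm, hm'⟩ := h.compact.isCompact.exists_isMinOn hne continuousOn_id
      exact ⟨m, h.support hm, fun x hx => hm' hx⟩
  set b := max R a with hb
  have hz : ∀ x, x ∉ Icc a b → ψ x = 0 := by
    intro x hx
    by_contra hc
    have hx' := subset_tsupport _ (Function.mem_support.2 hc)
    exact hx ⟨ha' x hx', (le_abs_self x).trans ((hR x hx').trans (le_max_left _ _))⟩
  have hder : ∀ x, HasDerivAt (fun x => ∫ t in (0 : ℝ)..x, ψ t) (ψ x) x := fun x =>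
    intervalIntegral.integral_hasDerivAt_right (h.continuous.intervalIntegrable _ _)
      (h.continuous.stronglyMeasurableAtFilter _ _) h.continuous.continuousAt
  have hd : _root_.deriv (fun x => ∫ t in (0 : ℝ)..x, ψ t) = ψ := funext fun x => (hder x).deriv
  have hout : ∀ x, x ∉ Icc a b → ∫ t in (0 : ℝ)..x, ψ t = 0 := by
    intro x hx
    rcases lt_or_ge x a with hxa | hxa
    · rw [intervalIntegral.integral_congr (g := fun _ => 0)]
      · simp
      · intro t ht
        refine hz t fun hc => ?_
        have := ht.2
        have : t ≤ max 0 x := ht.2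
        have := hc.1
        have : max 0 x < a := max_lt ha hxa
        linarith
    · have hxb : b < x := by
        by_contra hc
        exact hx ⟨hxa, not_lt.1 hc⟩
      rw [intervalIntegral.integral_of_le (by linarith), ← h0]
      apply setIntegral_eq_integral_of_forall_compl_eq_zero
      intro t ht
      refine hz t fun hc => ht ⟨by linarith [hc.1], by linarith [hc.2]⟩
  refine ⟨fun x => ∫ t in (0 : ℝ)..x, ψ t, ⟨?_, HasCompactSupport.intro isCompact_Icc hout, ?_⟩, hd⟩
  · rw [contDiff_infty_iff_deriv, hd]
    exact ⟨fun x => (hder x).differentiableAt, h.smooth⟩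
  · refine (closure_minimal (t := Icc a b) (fun x hx => ?_) isClosed_Icc).trans fun x hx => ha.trans_le hx.1
    by_contra hc
    exact hx (hout x hc)

/-- A continuous function whose second derivative vanishes weakly on the half line is affine. -/
theorem exists_affine_of_weak {V : ℝ → ℝ} (hV : Continuous V)
    (h : ∀ ψ, IsHalfTest ψ → ∫ x, V x * deriv (deriv ψ) x = 0) :
    ∃ a b : ℝ, ∀ x, 0 < x → V x = a + b * x := by
  obtain ⟨φ, hφ, hφ1⟩ := exists_halfTest_integral_one
  -- Du Bois-Reymond's decomposition: a test function is the derivative of a test function up to a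
  -- multiple of a fixed `φ` of integral one. It is used once for each of the two derivatives to be
  -- removed.
  have hdec : ∀ η, IsHalfTest η → ∃ P, IsHalfTest P ∧ ∀ x, η x = deriv P x + (∫ t, η t) * φ x := by
    intro η hη
    obtain ⟨P, hP, hP'⟩ := (hη.sub (hφ.const_mul (∫ t, η t))).exists_primitive (by
      rw [integral_sub hη.integrable (hφ.integrable.const_mul _), integral_const_mul, hφ1]; ring)
    exact ⟨P, hP, fun x => by rw [hP']; ring⟩
  set b : ℝ := ∫ x, V x * deriv φ x with hb
  have h1 : ∀ η, IsHalfTest η → ∫ x, V x * deriv η x = b * ∫ x, η x := by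
    intro η hη
    obtain ⟨P, hP, hP'⟩ := hdec η hη
    have hd : deriv η = fun x => deriv (deriv P) x + (∫ t, η t) * deriv φ x := by
      ext x
      have e : η = fun x => deriv P x + (∫ t, η t) * φ x := funext hP'
      conv_lhs => rw [e]
      exact ((hP.deriv.hasDerivAt x).add ((hφ.hasDerivAt x).const_mul _)).deriv
    have e2 : (fun x => V x * deriv η x)
        = fun x => V x * deriv (deriv P) x + (∫ t, η t) * (V x * deriv φ x) := by
      rw [hd]; ext x; ring
    rw [e2, integral_add (hP.deriv.deriv.integrable_weight hV)
      ((hφ.deriv.integrable_weight hV).const_mul _), h P hP, integral_const_mul, ← hb]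
    ring
  set W : ℝ → ℝ := fun x => V x + b * x with hW
  have hWc : Continuous W := by fun_prop
  have h2 : ∀ η, IsHalfTest η → ∫ x, W x * deriv η x = 0 := by
    intro η hη
    have e2 : (fun x => W x * deriv η x) = fun x => V x * deriv η x + (b * x) * deriv η x := by
      ext x; simp only [hW]; ring
    rw [e2, integral_add (hη.deriv.integrable_weight hV) (hη.deriv.integrable_weight (by fun_prop)),
      h1 η hη, hη.integral_mul_deriv (V' := fun _ => b)
        (fun x => by simpa using (hasDerivAt_id x).const_mul b) continuous_const, integral_const_mul]
    ring
  set c : ℝ := ∫ x, W x * φ x with hc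
  have h3 : ∀ η, IsHalfTest η → ∫ x, η x • (W x - c) = 0 := by
    intro η hη
    obtain ⟨P, hP, hP'⟩ := hdec η hη
    have e2 : (fun x => η x • (W x - c))
        = fun x => (W x * deriv P x + (∫ t, η t) * (W x * φ x)) - c * η x := by
      ext x
      have := hP' x
      simp only [smul_eq_mul]
      linear_combination (W x) * this
    have i1 : Integrable fun x => W x * deriv P x + (∫ t, η t) * (W x * φ x) :=
      (hP.deriv.integrable_weight hWc).add ((hφ.integrable_weight hWc).const_mul _)
    rw [e2, integral_sub i1
      (hη.integrable.const_mul _), integral_add (hP.deriv.integrable_weight hWc)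
      ((hφ.integrable_weight hWc).const_mul _), h2 P hP, integral_const_mul, integral_const_mul]
    ring
  have h4 := isOpen_Ioi.ae_eq_zero_of_integral_contDiff_smul_eq_zero (U := Ioi (0 : ℝ))
    (f := fun x => W x - c) (μ := volume)
    ((hWc.sub continuous_const).locallyIntegrable.locallyIntegrableOn _)
    (fun η e1 e2 e3 => h3 η ⟨e1, e2, e3⟩)
  have h5 : EqOn (fun x => W x - c) (fun _ => 0) (Ioi (0 : ℝ)) :=
    Measure.eqOn_open_of_ae_eq ((ae_restrict_iff' measurableSet_Ioi).2 h4) isOpen_Ioi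
      (hWc.sub continuous_const).continuousOn continuousOn_const
  refine ⟨c, -b, fun x hx => ?_⟩
  have := h5 hx
  simp only [hW] at this
  linarith

/-- Since `y² sineT ψ` is minus the transform of `ψ''`, the hypothesis says that `sineT g` has
vanishing second derivative in the weak sense, so it is affine on the half line. It vanishes at 0
and grows at most like `√x` by `enorm_sineT_sq_le`, so it is zero. Pairing with `sineT ψ` and
inverting then shows that `g` is orthogonal to all test functions. -/
theorem ae_eq_zero_of_orthogonal (hg : MemLp (fun y => y * g y) 2 freqMeasure)
    (h : ∀ ψ, IsHalfTest ψ → ∫ y, g y * (y ^ 2 * sineT ψ y) ∂freqMeasure = 0) :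
    g =ᵐ[freqMeasure] 0 := by
  have hadm := sineAdm_of_memLp hg
  have hVc := hadm.continuous_sineT
  have hwt : ∀ ψ, IsHalfTest ψ → Integrable (fun x => (1 + |x|) * ψ x) freqMeasure := fun ψ hψ =>
    (hψ.integrable_weight (V := fun x => 1 + |x|) (by fun_prop)).integrableOn
  obtain ⟨a, b, hab⟩ := exists_affine_of_weak hVc (by
    intro ψ hψ
    rw [← hψ.deriv.deriv.setIntegral_eq, hadm.integral_sineT_mul (hwt _ hψ.deriv.deriv)]
    simp_rw [hψ.sineT_deriv_deriv, mul_neg]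
    rw [integral_neg, h ψ hψ, neg_zero])
  have ha : a = 0 := by
    have l1 : Tendsto (sineT g) (𝓝[>] 0) (𝓝 (sineT g 0)) := hVc.continuousAt.tendsto.mono_left nhdsWithin_le_nhds
    have l2 : Tendsto (fun x => a + b * x) (𝓝[>] 0) (𝓝 (a + b * 0)) :=
      (Continuous.tendsto (by fun_prop) _).mono_left nhdsWithin_le_nhds
    have l3 := l2.congr' (f₂ := sineT g) (by
      filter_upwards [self_mem_nhdsWithin] with x hx using (hab x hx).symm)
    have := tendsto_nhds_unique l1 l3
    simpa [sineT] using this.symm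
  have hb : b = 0 := by
    set K := eLpNorm (fun y => y * g y) 2 freqMeasure with hK
    by_contra hb
    have hx : ∀ x : ℝ, 0 < x → b ^ 2 * x ≤ 2 * (K ^ 2).toReal := by
      intro x hx
      have := enorm_sineT_sq_le hg.1 hx.le
      rw [hab x hx, ha, zero_add, ← hK, ← ofReal_norm, ← ENNReal.ofReal_pow (norm_nonneg _),
        ← ENNReal.ofReal_toReal (ENNReal.pow_ne_top hg.2.ne), ← ENNReal.ofReal_mul (by positivity),
        ENNReal.ofReal_le_ofReal_iff (by positivity), Real.norm_eq_abs, sq_abs] at this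
      have h2 : x * (b ^ 2 * x) ≤ x * (2 * (K ^ 2).toReal) := by linarith
      exact le_of_mul_le_mul_left h2 hx
    have hb2 : 0 < b ^ 2 := by positivity
    have := hx ((2 * (K ^ 2).toReal + 1) / b ^ 2) (by positivity)
    rw [mul_div_cancel₀ _ hb2.ne'] at this
    linarith
  have hV0 : ∀ x, 0 < x → sineT g x = 0 := fun x hx => by rw [hab x hx, ha, hb]; ring
  have hloc : LocallyIntegrableOn g (Ioi (0 : ℝ)) volume := by
    rw [locallyIntegrableOn_iff isOpen_Ioi.isLocallyClosed]
    intro k hk hkc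
    have hcont : ContinuousOn (fun y : ℝ => (min 1 y)⁻¹) k := by
      refine ContinuousOn.inv₀ (by fun_prop) fun y hy => ?_
      have : 0 < min 1 y := lt_min one_pos (hk hy)
      exact this.ne'
    have h1 : IntegrableOn (fun y => (min 1 y)⁻¹ * (min 1 y * g y)) k :=
      IntegrableOn.continuousOn_mul hcont (IntegrableOn.mono_set hadm hk) hkc
    refine h1.congr_fun (fun y hy => ?_) hkc.measurableSet
    have : 0 < min 1 y := lt_min one_pos (hk hy)
    field_simp
  refine (ae_restrict_iff' measurableSet_Ioi).2 ?_
  refine isOpen_Ioi.ae_eq_zero_of_integral_contDiff_smul_eq_zero hloc fun ψ e1 e2 e3 => ?_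
  have hψ : IsHalfTest ψ := ⟨e1, e2, e3⟩
  have hint : Integrable (fun x => (1 + |x|) * sineT ψ x) freqMeasure := by
    refine Integrable.integrableOn (s := Ioi 0) ?_
    have h0 := hψ.integrable_sineT
    have h1 := hψ.integrable_pow_mul_sineT 1
    refine (h0.abs.add h1).mono' ?_ (ae_of_all _ fun x => ?_)
    · exact AEStronglyMeasurable.mul (by fun_prop) hψ.continuous_sineT.aestronglyMeasurable
    · simp only [Pi.add_apply, norm_mul, Real.norm_eq_abs, pow_one]
      rw [abs_of_nonneg (show 0 ≤ 1 + |x| by positivity)]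
      exact le_of_eq (by ring)
  have h1 := hadm.integral_sineT_mul hint
  have h2 : ∫ x, sineT g x * sineT ψ x ∂freqMeasure = 0 := by
    rw [integral_congr_ae (g := fun _ => 0)]
    · simp
    · filter_upwards [ae_freqMeasure_pos] with x hx
      rw [hV0 x hx, zero_mul]
  rw [h2] at h1
  simp only [smul_eq_mul, mul_comm (ψ _)]
  rw [← hψ.setIntegral_eq, h1]
  refine integral_congr_ae ?_
  filter_upwards [ae_freqMeasure_pos] with x hx
  rw [hψ.sineT_sineT hx]

end Density

/-! ### Homogeneous Sobolev spaces on the frequency side. -/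

section Sobolev

variable {s : ℝ} {g : ℝ → ℝ}

theorem sobMeasure_ac (s : ℝ) : sobMeasure s ≪ freqMeasure := withDensity_absolutelyContinuous _ _

theorem measurable_sobDensity (s : ℝ) :
    Measurable fun lam : ℝ => ENNReal.ofReal (4 * Real.pi * lam ^ (2 * s)) := by fun_prop

theorem sobMeasure_ac' (s : ℝ) : freqMeasure ≪ sobMeasure s := by
  refine withDensity_absolutelyContinuous' (measurable_sobDensity s).aemeasurable ?_
  filter_upwards [ae_freqMeasure_pos] with y hy
  have : 0 < 4 * Real.pi * y ^ (2 * s) := by have := Real.rpow_pos_of_pos hy (2 * s); positivity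
  simpa using this

theorem ae_sobMeasure_iff {p : ℝ → Prop} : (∀ᵐ y ∂(sobMeasure s), p y) ↔ ∀ᵐ y ∂freqMeasure, p y :=
  ⟨fun h => (sobMeasure_ac' s).ae_le h, fun h => (sobMeasure_ac s).ae_le h⟩

theorem aestronglyMeasurable_sob_iff :
    AEStronglyMeasurable g (sobMeasure s) ↔ AEStronglyMeasurable g freqMeasure :=
  ⟨fun h => h.mono_ac (sobMeasure_ac' s), fun h => h.mono_ac (sobMeasure_ac s)⟩

theorem eLpNorm_sob_sq (s : ℝ) (g : ℝ → ℝ) :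
    eLpNorm g 2 (sobMeasure s) ^ 2
      = ENNReal.ofReal (4 * Real.pi) * eLpNorm (fun y => y ^ s * g y) 2 freqMeasure ^ 2 := by
  rw [eLpNorm_two_sq, eLpNorm_two_sq, sobMeasure,
    lintegral_withDensity_eq_lintegral_mul_non_measurable _ (measurable_sobDensity s)
      (ae_of_all _ fun _ => ENNReal.ofReal_lt_top), ← lintegral_const_mul' _ _ ENNReal.ofReal_ne_top]
  refine lintegral_congr_ae ?_
  filter_upwards [ae_freqMeasure_pos] with y hy
  simp only [Pi.mul_apply]
  rw [enorm_mul, mul_pow, ← mul_assoc, ENNReal.ofReal_mul (by positivity), ← ofReal_norm (y ^ s),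
    ← ENNReal.ofReal_pow (norm_nonneg _), Real.norm_of_nonneg (by positivity), ← Real.rpow_mul_natCast hy.le]
  congr 4
  push_cast; ring

theorem eLpNorm_sob (s : ℝ) (g : ℝ → ℝ) :
    eLpNorm g 2 (sobMeasure s)
      = ENNReal.ofReal (√(4 * Real.pi)) * eLpNorm (fun y => y ^ s * g y) 2 freqMeasure := by
  refine (ENNReal.pow_right_strictMono two_ne_zero).injective ?_
  rw [eLpNorm_sob_sq, mul_pow, ← ENNReal.ofReal_pow (Real.sqrt_nonneg _), Real.sq_sqrt (by positivity)]

theorem memLp_sob_iff : MemLp g 2 (sobMeasure s) ↔ MemLp (fun y => y ^ s * g y) 2 freqMeasure := by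
  have hpos : ENNReal.ofReal (√(4 * Real.pi)) ≠ 0 := by simp [Real.pi_pos]
  have key : AEStronglyMeasurable g (sobMeasure s) ↔
      AEStronglyMeasurable (fun y => y ^ s * g y) freqMeasure := by
    rw [aestronglyMeasurable_sob_iff]
    constructor
    · intro h
      exact AEStronglyMeasurable.mul (Measurable.aestronglyMeasurable (by fun_prop)) h
    · intro h
      have : AEStronglyMeasurable (fun y => (y ^ s)⁻¹ * (y ^ s * g y)) freqMeasure :=
        AEStronglyMeasurable.mul (Measurable.aestronglyMeasurable (by fun_prop)) h
      refine this.congr ?_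
      filter_upwards [ae_freqMeasure_pos] with y hy
      have := Real.rpow_pos_of_pos hy s
      field_simp
  rw [MemLp, MemLp, key, eLpNorm_sob]
  refine and_congr_right fun _ => ?_
  constructor
  · intro h
    rcases ENNReal.mul_lt_top_iff.1 h with h | h | h
    · exact h.2
    · exact absurd h hpos
    · rw [h]; exact ENNReal.zero_lt_top
  · intro h; exact ENNReal.mul_lt_top ENNReal.ofReal_lt_top h

theorem memLp_spec (u : HdotRad s) : MemLp (fun y => y ^ s * spec u y) 2 freqMeasure :=
  memLp_sob_iff.1 (Lp.memLp (u : Lp ℝ 2 (sobMeasure s)))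

theorem norm_sub_hdot (u v : HdotRad s) :
    ‖u - v‖ = √(4 * Real.pi) * (eLpNorm (fun y => y ^ s * (spec u y - spec v y)) 2 freqMeasure).toReal := by
  rw [Submodule.coe_norm, Submodule.coe_sub, Lp.norm_def, eLpNorm_congr_ae (Lp.coeFn_sub _ _),
    eLpNorm_sob, ENNReal.toReal_mul, ENNReal.toReal_ofReal (Real.sqrt_nonneg _)]
  rfl

theorem norm_hdot (u : HdotRad s) :
    ‖u‖ = √(4 * Real.pi) * (eLpNorm (fun y => y ^ s * spec u y) 2 freqMeasure).toReal := by
  rw [Submodule.coe_norm, Lp.norm_def, eLpNorm_sob, ENNReal.toReal_mul,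
    ENNReal.toReal_ofReal (Real.sqrt_nonneg _)]
  rfl

theorem hdotNorm_eq (s : ℝ) (g : ℝ → ℝ) :
    hdotNorm s g = √(4 * Real.pi) * (eLpNorm (fun y => y ^ s * g y) 2 freqMeasure).toReal := by
  rw [hdotNorm, eLpNorm_sob, ENNReal.toReal_mul, ENNReal.toReal_ofReal (Real.sqrt_nonneg _)]

theorem memLp_mul_iff_one : MemLp g 2 (sobMeasure 1) ↔ MemLp (fun y => y * g y) 2 freqMeasure := by
  rw [memLp_sob_iff]; simp only [Real.rpow_one]

theorem integral_sob (s : ℝ) (F : ℝ → ℝ) :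
    ∫ y, F y ∂(sobMeasure s) = ∫ y, 4 * Real.pi * y ^ (2 * s) * F y ∂freqMeasure := by
  rw [sobMeasure, integral_withDensity_eq_integral_toReal_smul (measurable_sobDensity s)
    (ae_of_all _ fun _ => ENNReal.ofReal_lt_top)]
  refine integral_congr_ae ?_
  filter_upwards [ae_freqMeasure_pos] with y hy
  have : 0 < 4 * Real.pi * y ^ (2 * s) := by
    have := Real.rpow_pos_of_pos hy (2 * s); positivity
  rw [ENNReal.toReal_ofReal this.le, smul_eq_mul]

/-- Test functions are dense in the weighted space, so the space of order one is all of it. -/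
theorem hdotSubmodule_one : hdotSubmodule 1 = ⊤ := by
  rw [hdotSubmodule, Submodule.topologicalClosure_eq_top_iff, Submodule.eq_bot_iff]
  intro f hf
  rw [Submodule.mem_orthogonal] at hf
  have hfm : MemLp (fun y => y * f y) 2 freqMeasure := memLp_mul_iff_one.1 (Lp.memLp f)
  rw [Lp.eq_zero_iff_ae_eq_zero]
  refine ae_sobMeasure_iff.2 (ae_eq_zero_of_orthogonal hfm fun ψ hψ => ?_)
  have hm : MemLp (sineT ψ) 2 (sobMeasure 1) := by
    rw [memLp_mul_iff_one]
    have h2 := hψ.deriv.memLp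
    have hint : Integrable (fun y => (y * sineT ψ y) ^ 2) freqMeasure := by
      refine Integrable.integrableOn (s := Ioi 0) ?_
      have h1 := hψ.integrable_pow_mul_sineT 2
      have hb : ∃ C, ∀ y, |sineT ψ y| ≤ C := by
        refine ⟨∫ x in Ioi (0:ℝ), ‖ψ x‖, fun y => ?_⟩
        rw [sineT, abs_mul, abs_of_nonneg (Real.sqrt_nonneg _)]
        refine (mul_le_of_le_one_left (abs_nonneg _) sqrt_two_div_pi_le_one).trans ?_
        rw [← Real.norm_eq_abs]
        refine norm_integral_le_of_norm_le hψ.integrable.norm.integrableOn ?_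
        filter_upwards with x
        rw [norm_mul]
        exact mul_le_of_le_one_left (norm_nonneg _) (Real.abs_sin_le_one _)
      obtain ⟨C, hC⟩ := hb
      refine (h1.const_mul C).mono' ?_ (ae_of_all _ fun y => ?_)
      · have := hψ.continuous_sineT
        exact Continuous.aestronglyMeasurable (by fun_prop)
      · rw [Real.norm_eq_abs, abs_pow, abs_mul, mul_pow]
        calc |y| ^ 2 * |sineT ψ y| ^ 2 = |sineT ψ y| * (|y| ^ 2 * |sineT ψ y|) := by ring
          _ ≤ _ := by gcongr; exact hC y
    refine (memLp_two_iff_integrable_sq ?_).2 hint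
    have := hψ.continuous_sineT
    exact Continuous.aestronglyMeasurable (by fun_prop)
  have h1 := hf hm.toLp (Submodule.subset_span ⟨ofHalf ψ, hψ.isRadialTest, by
    rw [dft_ofHalf hψ]; exact hm.coeFn_toLp⟩)
  -- The inner product carries the density `4π y²`; attaching `y²` to the test transform gives the
  -- form required by `ae_eq_zero_of_orthogonal`.
  rw [L2.inner_def, integral_sob] at h1
  have h2 : ∫ y, 4 * Real.pi * (f y * (y ^ 2 * sineT ψ y)) ∂freqMeasure = 0 := by
    rw [← h1]
    refine integral_congr_ae ?_
    have := (ae_sobMeasure_iff (s := 1)).1 hm.coeFn_toLp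
    filter_upwards [ae_freqMeasure_pos, this] with y hy he
    rw [mul_one, Real.rpow_ofNat, he]
    simp; ring
  rw [integral_const_mul] at h2
  have : (4 * Real.pi) ≠ 0 := by positivity
  simpa [this, Real.pi_ne_zero] using h2

theorem memLp_one_of_freq (H : Lp ℝ 2 freqMeasure) : MemLp (fun y => y⁻¹ * H y) 2 (sobMeasure 1) := by
  rw [memLp_mul_iff_one]
  refine (Lp.memLp H).ae_eq ?_
  filter_upwards [ae_freqMeasure_pos] with y hy
  field_simp

/-- The element of the space of order one whose transform times the frequency is `H`. -/
def ofFreq (H : Lp ℝ 2 freqMeasure) : HdotRad 1 :=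
  ⟨(memLp_one_of_freq H).toLp, by rw [hdotSubmodule_one]; trivial⟩

theorem spec_ofFreq (H : Lp ℝ 2 freqMeasure) : spec (ofFreq H) =ᵐ[freqMeasure] fun y => y⁻¹ * H y :=
  ae_sobMeasure_iff.1 (memLp_one_of_freq H).coeFn_toLp

theorem memLp_spec_one (v : HdotRad 1) : MemLp (fun y => y * spec v y) 2 freqMeasure := by
  simpa only [Real.rpow_one] using memLp_spec v

/-- The transform times the frequency. -/
def toFreq (v : HdotRad 1) : Lp ℝ 2 freqMeasure := (memLp_spec_one v).toLp

theorem toFreq_ae (v : HdotRad 1) : toFreq v =ᵐ[freqMeasure] fun y => y * spec v y :=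
  (memLp_spec_one v).coeFn_toLp

theorem norm_sub_toFreq (u v : HdotRad 1) : ‖u - v‖ = √(4 * Real.pi) * ‖toFreq u - toFreq v‖ := by
  rw [norm_sub_hdot, Lp.norm_def, eLpNorm_congr_ae (Lp.coeFn_sub _ _)]
  congr 2
  refine eLpNorm_congr_ae ?_
  filter_upwards [toFreq_ae u, toFreq_ae v] with y h1 h2
  simp only [Pi.sub_apply, Real.rpow_one, h1, h2]; ring

theorem toFreq_ofFreq (H : Lp ℝ 2 freqMeasure) : toFreq (ofFreq H) = H := by
  refine Lp.ext ?_
  filter_upwards [toFreq_ae (ofFreq H), spec_ofFreq H, ae_freqMeasure_pos] with y h1 h2 hy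
  rw [h1, h2]
  field_simp

theorem continuous_ofFreq : Continuous ofFreq := by
  have : LipschitzWith (Real.toNNReal √(4 * Real.pi)) ofFreq := by
    refine LipschitzWith.of_dist_le_mul fun H K => ?_
    rw [dist_eq_norm, dist_eq_norm, norm_sub_toFreq, toFreq_ofFreq, toFreq_ofFreq,
      Real.coe_toNNReal _ (Real.sqrt_nonneg _)]
  exact this.continuous

theorem toFreq_injective : Function.Injective toFreq := by
  intro u v h
  have := norm_sub_toFreq u v
  rw [h, sub_self, norm_zero, mul_zero, norm_eq_zero, sub_eq_zero] at this
  exact this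

theorem one_le_sqrt_four_pi : 1 ≤ √(4 * Real.pi) := by
  rw [Real.one_le_sqrt]; linarith [Real.pi_gt_three]

theorem continuous_toFreq : Continuous toFreq := by
  have : LipschitzWith 1 toFreq := by
    refine LipschitzWith.of_dist_le_mul fun H K => ?_
    rw [dist_eq_norm, dist_eq_norm, norm_sub_toFreq, NNReal.coe_one, one_mul]
    exact le_mul_of_one_le_left (norm_nonneg _) one_le_sqrt_four_pi
  exact this.continuous

end Sobolev

/-! ### Slow growth of fields in the intersection of two Sobolev spaces. -/

section Rough

variable {s : ℝ} {g : ℝ → ℝ}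

/-- Integrability of the transform against a weight that is slightly better than bounded. -/
def RoughAdm (g : ℝ → ℝ) : Prop := Integrable (fun y => min 1 y ^ (1 / 8 : ℝ) * g y) freqMeasure

/-- The norm that controls `sineT g x` by `(1 + x)^{1/8}`. -/
def roughNorm (g : ℝ → ℝ) : ℝ := ∫ y, |min 1 y ^ (1 / 8 : ℝ) * g y| ∂freqMeasure

theorem roughNorm_nonneg (g : ℝ → ℝ) : 0 ≤ roughNorm g := integral_nonneg fun _ => abs_nonneg _

theorem min_one_le_rpow {y : ℝ} (hy : 0 < y) : min 1 y ≤ min 1 y ^ (1 / 8 : ℝ) :=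
  Real.self_le_rpow_of_le_one (le_min zero_le_one hy.le) (min_le_left _ _) (by norm_num)

theorem RoughAdm.aestronglyMeasurable (h : RoughAdm g) : AEStronglyMeasurable g freqMeasure := by
  have : AEStronglyMeasurable (fun y => (min 1 y ^ (1 / 8 : ℝ))⁻¹ * (min 1 y ^ (1 / 8 : ℝ) * g y))
      freqMeasure := AEStronglyMeasurable.mul (Measurable.aestronglyMeasurable (by fun_prop)) h.1
  refine this.congr ?_
  filter_upwards [ae_freqMeasure_pos] with y hy
  have : 0 < min 1 y ^ (1 / 8 : ℝ) := Real.rpow_pos_of_pos (lt_min one_pos hy) _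
  field_simp

theorem RoughAdm.sineAdm (h : RoughAdm g) : SineAdm g := by
  refine Integrable.mono h (AEStronglyMeasurable.mul (by fun_prop) h.aestronglyMeasurable) ?_
  filter_upwards [ae_freqMeasure_pos] with y hy
  rw [norm_mul, norm_mul]
  have h0 : 0 < min 1 y := lt_min one_pos hy
  gcongr
  rw [Real.norm_of_nonneg h0.le, Real.norm_of_nonneg (by positivity)]
  exact min_one_le_rpow hy

theorem RoughAdm.sineNorm_le (h : RoughAdm g) : sineNorm g ≤ roughNorm g := by
  refine integral_mono_ae h.sineAdm.abs (Integrable.abs h) ?_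
  filter_upwards [ae_freqMeasure_pos] with y hy
  have h0 : 0 < min 1 y := lt_min one_pos hy
  simp only [abs_mul]
  gcongr
  exact min_one_le_rpow hy

/-- Interpolation between `|sin| ≤ 1` and `|sin (y x)| ≤ (1 + x) min 1 y`. With the exponent 1/8 the
fourth power of the field grows like `(1 + x)^{1/2}`, which the weight `(1 + x)^{-2}` of the quartic
norm makes integrable. -/
theorem RoughAdm.abs_sineT_le (h : RoughAdm g) {x : ℝ} (hx : 0 ≤ x) :
    |sineT g x| ≤ (1 + x) ^ (1 / 8 : ℝ) * roughNorm g := by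
  have key : ∀ y : ℝ, 0 < y → |Real.sin (y * x)| ≤ (1 + x) ^ (1 / 8 : ℝ) * min 1 y ^ (1 / 8 : ℝ) := by
    intro y hy
    have h0 : 0 < min 1 y := lt_min one_pos hy
    rw [← Real.mul_rpow (by positivity) h0.le]
    have h1 : |Real.sin (y * x)| ≤ (1 + x) * min 1 y := by
      have := abs_sin_mul_le' hy x 1
      rw [mul_one, mul_one, abs_of_pos h0, abs_of_nonneg hx] at this
      exact this
    rcases le_total ((1 + x) * min 1 y) 1 with h2 | h2
    · exact h1.trans (Real.self_le_rpow_of_le_one (by positivity) h2 (by norm_num))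
    · exact (Real.abs_sin_le_one _).trans (Real.one_le_rpow h2 (by norm_num))
  rw [sineT, abs_mul, abs_of_nonneg (Real.sqrt_nonneg _), roughNorm]
  refine (mul_le_of_le_one_left (abs_nonneg _) sqrt_two_div_pi_le_one).trans ?_
  refine abs_integral_le_integral_abs.trans ?_
  rw [← integral_const_mul]
  refine integral_mono_ae (h.sineAdm.integrable_sin x).abs ((Integrable.abs h).const_mul _) ?_
  filter_upwards [ae_freqMeasure_pos] with y hy
  have h0 : 0 < min 1 y := lt_min one_pos hy
  rw [abs_mul, abs_mul, ← mul_assoc, abs_of_nonneg (show 0 ≤ min 1 y ^ (1 / 8 : ℝ) by positivity)]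
  gcongr
  exact key y hy

theorem RoughAdm.sub {g' : ℝ → ℝ} (h : RoughAdm g) (h' : RoughAdm g') :
    RoughAdm fun y => g y - g' y := by
  have := Integrable.sub h h'
  simpa [RoughAdm, mul_sub] using! this

theorem memLp_rough_low : MemLp ((Ioc (0:ℝ) 1).indicator fun y => y ^ (-3 / 8 : ℝ)) 2 freqMeasure := by
  have hm : Measurable ((Ioc (0:ℝ) 1).indicator fun y : ℝ => y ^ (-3 / 8 : ℝ)) :=
    Measurable.indicator (by fun_prop) measurableSet_Ioc
  refine (memLp_two_iff_integrable_sq hm.aestronglyMeasurable).2 ?_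
  have : IntegrableOn (fun y : ℝ => y ^ (-3 / 4 : ℝ)) (Ioc 0 1) :=
    (intervalIntegral.intervalIntegrable_rpow' (a := 0) (b := 1) (by norm_num)).1
  have h2 := (this.integrable_indicator measurableSet_Ioc).integrableOn (s := Ioi 0)
  refine Integrable.congr h2 (ae_of_all _ fun y => ?_)
  by_cases hy : y ∈ Ioc (0:ℝ) 1
  · simp only [indicator_of_mem hy]
    rw [← Real.rpow_mul_natCast hy.1.le]; norm_num
  · simp [indicator_of_notMem hy]

theorem memLp_rpow_neg_Ioi (hs : 1 / 2 < s) {c : ℝ} (hc : 0 < c) :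
    MemLp ((Ioi c).indicator fun y => y ^ (-s)) 2 freqMeasure := by
  have hm : Measurable ((Ioi c).indicator fun y : ℝ => y ^ (-s)) :=
    Measurable.indicator (by fun_prop) measurableSet_Ioi
  refine (memLp_two_iff_integrable_sq hm.aestronglyMeasurable).2 ?_
  have : IntegrableOn (fun y : ℝ => y ^ (-(2 * s))) (Ioi c) :=
    integrableOn_Ioi_rpow_of_lt (by linarith) hc
  have h2 := (this.integrable_indicator measurableSet_Ioi).integrableOn (s := Ioi 0)
  refine Integrable.congr h2 (ae_of_all _ fun y => ?_)
  by_cases hy : y ∈ Ioi c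
  · simp only [indicator_of_mem hy]
    rw [← Real.rpow_mul_natCast (hc.trans hy).le]
    congr 1; push_cast; ring
  · simp [indicator_of_notMem hy]

/-- Cauchy–Schwarz on two frequency ranges. Below 1 the weight of `Ḣ^{1/2}` leaves `y^{1/8 - 1/2} =
y^{-3/8}`, square integrable at 0; above 1 the weight of `Ḣ^s` leaves `y^{-s}`, square integrable at
infinity because `s > 1/2`. -/
theorem exists_roughNorm_le (hs : 1 / 2 < s) : ∃ K : ℝ, 0 ≤ K ∧ ∀ g : ℝ → ℝ,
    MemLp (fun y => y ^ (1 / 2 : ℝ) * g y) 2 freqMeasure → MemLp (fun y => y ^ s * g y) 2 freqMeasure →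
    RoughAdm g ∧ roughNorm g ≤ K * ((eLpNorm (fun y => y ^ (1 / 2 : ℝ) * g y) 2 freqMeasure).toReal
      + (eLpNorm (fun y => y ^ s * g y) 2 freqMeasure).toReal) := by
  set k1 := (Ioc (0:ℝ) 1).indicator fun y => y ^ (-3 / 8 : ℝ) with hk1
  set k2 := (Ioi (1:ℝ)).indicator fun y => y ^ (-s) with hk2
  have m1 : MemLp k1 2 freqMeasure := memLp_rough_low
  have m2 : MemLp k2 2 freqMeasure := memLp_rpow_neg_Ioi hs one_pos
  refine ⟨(eLpNorm k1 2 freqMeasure).toReal + (eLpNorm k2 2 freqMeasure).toReal, by positivity,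
    fun g h1 h2 => ?_⟩
  have e : (fun y => k1 y * (y ^ (1 / 2 : ℝ) * g y) + k2 y * (y ^ s * g y))
      =ᵐ[freqMeasure] fun y => min 1 y ^ (1 / 8 : ℝ) * g y := by
    filter_upwards [ae_freqMeasure_pos] with y hy
    rcases le_or_gt y 1 with h | h
    · rw [hk1, hk2, indicator_of_mem (show y ∈ Ioc (0:ℝ) 1 from ⟨hy, h⟩),
        indicator_of_notMem (by simpa using h), min_eq_right h, zero_mul, add_zero, ← mul_assoc,
        ← Real.rpow_add hy]
      norm_num
    · rw [hk1, hk2, indicator_of_notMem (show y ∉ Ioc (0:ℝ) 1 from fun hc => absurd hc.2 (not_le.2 h)),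
        indicator_of_mem (by simpa using h), min_eq_left h.le, zero_mul, zero_add, ← mul_assoc,
        ← Real.rpow_add hy]
      norm_num
  have i1 : Integrable (fun y => k1 y * (y ^ (1 / 2 : ℝ) * g y)) freqMeasure := m1.integrable_mul h1
  have i2 : Integrable (fun y => k2 y * (y ^ s * g y)) freqMeasure := m2.integrable_mul h2
  have hadm : RoughAdm g := (i1.add i2).congr e
  have cs : ∀ {k f : ℝ → ℝ}, MemLp k 2 freqMeasure → MemLp f 2 freqMeasure →
      ∫ y, |k y * f y| ∂freqMeasure ≤ (eLpNorm k 2 freqMeasure).toReal * (eLpNorm f 2 freqMeasure).toReal := by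
    intro k f hk hf
    have h0 := sq_lintegral_mul_le hk.1.enorm hf.1.enorm
    rw [← eLpNorm_two_sq, ← eLpNorm_two_sq, ← mul_pow] at h0
    have h1 := (ENNReal.pow_le_pow_left_iff two_ne_zero).1 h0
    have e2 : ∫ y, |k y * f y| ∂freqMeasure = (∫⁻ y, ‖k y‖ₑ * ‖f y‖ₑ ∂freqMeasure).toReal := by
      have := integral_norm_eq_lintegral_enorm (hk.1.mul hf.1)
      simpa only [Pi.mul_apply, Real.norm_eq_abs, enorm_mul] using this
    rw [← ENNReal.toReal_mul, e2]
    exact ENNReal.toReal_mono (ENNReal.mul_ne_top hk.2.ne hf.2.ne) h1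
  refine ⟨hadm, ?_⟩
  calc roughNorm g = ∫ y, |k1 y * (y ^ (1 / 2 : ℝ) * g y) + k2 y * (y ^ s * g y)| ∂freqMeasure := by
        refine integral_congr_ae ?_
        filter_upwards [e] with y hy
        rw [hy]
    _ ≤ ∫ y, (|k1 y * (y ^ (1 / 2 : ℝ) * g y)| + |k2 y * (y ^ s * g y)|) ∂freqMeasure :=
        integral_mono (i1.add i2).abs (i1.abs.add i2.abs) fun y => abs_add_le _ _
    _ = (∫ y, |k1 y * (y ^ (1 / 2 : ℝ) * g y)| ∂freqMeasure) + ∫ y, |k2 y * (y ^ s * g y)| ∂freqMeasure :=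
        integral_add i1.abs i2.abs
    _ ≤ _ := by
        have a1 := cs m1 h1
        have a2 := cs m2 h2
        nlinarith [ENNReal.toReal_nonneg (a := eLpNorm k1 2 freqMeasure),
          ENNReal.toReal_nonneg (a := eLpNorm k2 2 freqMeasure),
          mul_nonneg (ENNReal.toReal_nonneg (a := eLpNorm k1 2 freqMeasure))
            (ENNReal.toReal_nonneg (a := eLpNorm (fun y => y ^ s * g y) 2 freqMeasure)),
          mul_nonneg (ENNReal.toReal_nonneg (a := eLpNorm k2 2 freqMeasure))
            (ENNReal.toReal_nonneg (a := eLpNorm (fun y => y ^ (1 / 2 : ℝ) * g y) 2 freqMeasure))]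

end Rough

/-! ### Minkowski's integral inequality. -/

section Minkowski

variable {α β : Type*} [MeasurableSpace α] [MeasurableSpace β] {μ : Measure α} {ν : Measure β}

theorem lintegral_mul_le_sqrt {f g : β → ℝ≥0∞} (hf : AEMeasurable f ν) (hg : AEMeasurable g ν) :
    ∫⁻ y, f y * g y ∂ν ≤ (∫⁻ y, f y ^ 2 ∂ν) ^ (1 / 2 : ℝ) * (∫⁻ y, g y ^ 2 ∂ν) ^ (1 / 2 : ℝ) := by
  have h := sq_lintegral_mul_le hf hg
  rw [← ENNReal.mul_rpow_of_nonneg _ _ (by norm_num)]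
  calc _ = ((∫⁻ y, f y * g y ∂ν) ^ 2) ^ (1 / 2 : ℝ) := by
        rw [← ENNReal.rpow_natCast, ← ENNReal.rpow_mul]; norm_num
    _ ≤ _ := by gcongr

/-- Minkowski's integral inequality for the `L²` norm. -/
theorem lintegral_sq_lintegral_le [SFinite μ] [SFinite ν]
    {f : α → β → ℝ≥0∞} (hf : Measurable (Function.uncurry f)) :
    ∫⁻ y, (∫⁻ x, f x y ∂μ) ^ 2 ∂ν ≤ (∫⁻ x, (∫⁻ y, f x y ^ 2 ∂ν) ^ (1 / 2 : ℝ) ∂μ) ^ 2 := by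
  have m1 : ∀ y, Measurable fun x => f x y := fun y => hf.comp (measurable_id.prodMk measurable_const)
  have m2 : ∀ x, Measurable fun y => f x y := fun x => hf.comp (measurable_const.prodMk measurable_id)
  have m3 : Measurable fun x => (∫⁻ y, f x y ^ 2 ∂ν) ^ (1 / 2 : ℝ) :=
    (Measurable.lintegral_prod_right' (f := fun p : α × β => f p.1 p.2 ^ 2) (hf.pow_const 2)).pow_const _
  have m4 : Measurable fun p : β × α × α => f p.2.1 p.1 * f p.2.2 p.1 :=
    (hf.comp (measurable_snd.fst.prodMk measurable_fst)).mul
      (hf.comp (measurable_snd.snd.prodMk measurable_fst))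
  -- The square of the inner integral is a double integral over two copies of `μ`; after exchanging
  -- the order, Cauchy–Schwarz in `y` factorises it.
  calc ∫⁻ y, (∫⁻ x, f x y ∂μ) ^ 2 ∂ν
      = ∫⁻ y, ∫⁻ p : α × α, f p.1 y * f p.2 y ∂(μ.prod μ) ∂ν := by
        refine lintegral_congr fun y => ?_
        rw [pow_two, lintegral_prod_mul (m1 y).aemeasurable (m1 y).aemeasurable]
    _ = ∫⁻ p : α × α, ∫⁻ y, f p.1 y * f p.2 y ∂ν ∂(μ.prod μ) :=
        lintegral_lintegral_swap m4.aemeasurable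
    _ ≤ ∫⁻ p : α × α, (∫⁻ y, f p.1 y ^ 2 ∂ν) ^ (1 / 2 : ℝ) * (∫⁻ y, f p.2 y ^ 2 ∂ν) ^ (1 / 2 : ℝ)
          ∂(μ.prod μ) := by
        refine lintegral_mono fun p => lintegral_mul_le_sqrt (m2 _).aemeasurable (m2 _).aemeasurable
    _ = _ := by
        rw [lintegral_prod_mul m3.aemeasurable m3.aemeasurable, pow_two]

theorem eLpNorm_two_eq {E : Type*} [NormedAddCommGroup E] (f : β → E) :
    eLpNorm f 2 ν = (∫⁻ y, ‖f y‖ₑ ^ 2 ∂ν) ^ (1 / 2 : ℝ) := by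
  rw [← eLpNorm_two_sq, ← ENNReal.rpow_natCast, ← ENNReal.rpow_mul]; norm_num

theorem eLpNorm_integral_le [SFinite μ] [SFinite ν] {F : α → β → ℝ} (hF : Measurable (Function.uncurry F)) :
    eLpNorm (fun y => ∫ x, F x y ∂μ) 2 ν ≤ ∫⁻ x, eLpNorm (F x) 2 ν ∂μ := by
  have h := lintegral_sq_lintegral_le (μ := μ) (ν := ν) (f := fun x y => ‖F x y‖ₑ) hF.enorm
  simp_rw [← eLpNorm_two_eq] at h
  refine (ENNReal.pow_le_pow_left_iff two_ne_zero).1 (le_trans ?_ h)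
  rw [eLpNorm_two_sq]
  gcongr with y
  exact enorm_integral_le_lintegral_enorm _

end Minkowski

/-! ### Duhamel's integral on the frequency side and in physical space. -/

section Duhamel

variable {G : ℝ → ℝ → ℝ} {t : ℝ}

/-- The inhomogeneous part of Duhamel's formula. -/
def duhamelInt (G : ℝ → ℝ → ℝ) (t lam : ℝ) : ℝ :=
  ∫ τ in (0 : ℝ)..t, Real.sin ((t - τ) * lam) / lam * G τ lam

theorem mul_duhamelInt (ht : 0 ≤ t) {y : ℝ} (hy : 0 < y) :
    y * duhamelInt G t y = ∫ τ in Ioc 0 t, Real.sin ((t - τ) * y) * G τ y := by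
  rw [duhamelInt, intervalIntegral.integral_of_le ht, ← integral_const_mul]
  congr 1; ext τ
  field_simp

theorem measurable_duhamelInt (hG : Measurable (Function.uncurry G)) (ht : 0 ≤ t) :
    Measurable (duhamelInt G t) := by
  unfold duhamelInt
  simp_rw [intervalIntegral.integral_of_le ht]
  have hG' : Measurable fun p : ℝ × ℝ => G p.2 p.1 := hG.comp measurable_swap
  exact (StronglyMeasurable.integral_prod_right' (f := fun p : ℝ × ℝ => Real.sin ((t - p.2) * p.1) / p.1 * G p.2 p.1)
    (Measurable.stronglyMeasurable (by fun_prop))).measurable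

theorem eLpNorm_duhamelInt_le (hG : Measurable (Function.uncurry G)) (ht : 0 ≤ t) :
    eLpNorm (fun y => y * duhamelInt G t y) 2 freqMeasure
      ≤ ∫⁻ τ in Ioc 0 t, eLpNorm (G τ) 2 freqMeasure := by
  have hG' : Measurable fun p : ℝ × ℝ => G p.1 p.2 := hG
  calc _ = eLpNorm (fun y => ∫ τ in Ioc 0 t, Real.sin ((t - τ) * y) * G τ y) 2 freqMeasure := by
        refine eLpNorm_congr_ae ?_
        filter_upwards [ae_freqMeasure_pos] with y hy using mul_duhamelInt ht hy
    _ ≤ ∫⁻ τ in Ioc 0 t, eLpNorm (fun y => Real.sin ((t - τ) * y) * G τ y) 2 freqMeasure :=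
        eLpNorm_integral_le (F := fun τ y => Real.sin ((t - τ) * y) * G τ y) (by
          unfold Function.uncurry; fun_prop)
    _ ≤ _ := by
        refine lintegral_mono fun τ => eLpNorm_mono fun y => ?_
        rw [norm_mul]
        exact mul_le_of_le_one_left (norm_nonneg _) (Real.abs_sin_le_one _)

theorem memLp_duhamelInt (hG : Measurable (Function.uncurry G)) (ht : 0 ≤ t)
    (hfin : ∫⁻ τ in Ioc 0 t, eLpNorm (G τ) 2 freqMeasure < ⊤) :
    MemLp (fun y => y * duhamelInt G t y) 2 freqMeasure :=
  ⟨(measurable_id.mul (measurable_duhamelInt hG ht)).aestronglyMeasurable,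
    (eLpNorm_duhamelInt_le hG ht).trans_lt hfin⟩

theorem integrable_duhamel_prod (hG : Measurable (Function.uncurry G))
    (hfin : ∫⁻ τ in Ioc 0 t, eLpNorm (G τ) 2 freqMeasure < ⊤) (x : ℝ) :
    Integrable (fun p : ℝ × ℝ => Real.sin (p.2 * x) * (Real.sin ((t - p.1) * p.2) / p.2 * G p.1 p.2))
      ((volume.restrict (Ioc 0 t)).prod freqMeasure) := by
  have hG' : Measurable fun p : ℝ × ℝ => G p.1 p.2 := hG
  have hm : Measurable (fun p : ℝ × ℝ => Real.sin (p.2 * x) * (Real.sin ((t - p.1) * p.2) / p.2 * G p.1 p.2)) := by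
    fun_prop
  refine ⟨hm.aestronglyMeasurable, ?_⟩
  rw [hasFiniteIntegral_iff_enorm, lintegral_prod _ hm.enorm.aemeasurable]
  have key : ∀ τ, ∫⁻ y, ‖Real.sin (y * x) * (Real.sin ((t - τ) * y) / y * G τ y)‖ₑ ∂freqMeasure
      ≤ ENNReal.ofReal (1 + |x|) * eLpNorm (fun y : ℝ => min 1 y⁻¹) 2 freqMeasure * eLpNorm (G τ) 2 freqMeasure := by
    intro τ
    calc _ ≤ ∫⁻ y, ENNReal.ofReal (1 + |x|) * (‖min 1 y⁻¹‖ₑ * ‖G τ y‖ₑ) ∂freqMeasure := by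
          refine lintegral_mono_ae ?_
          filter_upwards [ae_freqMeasure_pos] with y hy
          have h0 : 0 ≤ min 1 y⁻¹ := le_min zero_le_one (by positivity)
          rw [← enorm_mul, ← ofReal_norm, ← ofReal_norm, ← ENNReal.ofReal_mul (by positivity)]
          refine ENNReal.ofReal_le_ofReal ?_
          have e : Real.sin (y * x) * (Real.sin ((t - τ) * y) / y * G τ y)
              = (Real.sin ((t - τ) * y) * (Real.sin (y * x) * y⁻¹)) * G τ y := by
            field_simp
          have h1 := abs_sin_mul_le' hy x y⁻¹
          rw [min_mul_of_nonneg _ _ (inv_nonneg.2 hy.le), mul_inv_cancel₀ hy.ne', one_mul, min_comm,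
            abs_of_nonneg h0] at h1
          have h2 : ‖Real.sin ((t - τ) * y) * (Real.sin (y * x) * y⁻¹)‖ ≤ (1 + |x|) * min 1 y⁻¹ := by
            rw [norm_mul]
            exact (mul_le_of_le_one_left (norm_nonneg _) (Real.abs_sin_le_one _)).trans h1
          calc _ = ‖Real.sin ((t - τ) * y) * (Real.sin (y * x) * y⁻¹)‖ * ‖G τ y‖ := by rw [e, norm_mul]
            _ ≤ (1 + |x|) * min 1 y⁻¹ * ‖G τ y‖ := by gcongr
            _ = _ := by rw [norm_mul, Real.norm_of_nonneg h0, mul_assoc]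
      _ = ENNReal.ofReal (1 + |x|) * ∫⁻ y, (‖min 1 y⁻¹‖ₑ * ‖G τ y‖ₑ) ∂freqMeasure :=
          lintegral_const_mul' _ _ ENNReal.ofReal_ne_top
      _ ≤ _ := by
          rw [mul_assoc, eLpNorm_two_eq, eLpNorm_two_eq]
          gcongr
          exact lintegral_mul_le_sqrt (by fun_prop) (by fun_prop)
  refine (lintegral_mono key).trans_lt ?_
  rw [lintegral_const_mul' _ _ (ENNReal.mul_ne_top ENNReal.ofReal_ne_top memLp_min_one_inv.2.ne)]
  exact ENNReal.mul_lt_top (ENNReal.mul_lt_top ENNReal.ofReal_lt_top memLp_min_one_inv.2) hfin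

/-- The inhomogeneous part of Duhamel's formula in physical space. -/
theorem sineT_duhamelInt (hG : Measurable (Function.uncurry G)) (ht : 0 ≤ t)
    (hfin : ∫⁻ τ in Ioc 0 t, eLpNorm (G τ) 2 freqMeasure < ⊤) {P : ℝ → ℝ → ℝ}
    (hP : ∀ᵐ τ ∂(volume.restrict (Ioc 0 t)), AEStronglyMeasurable (P τ) freqMeasure)
    (hs : ∀ᵐ τ ∂(volume.restrict (Ioc 0 t)), IsSine (P τ) (G τ)) {x : ℝ} (hx : 0 ≤ x) :
    sineT (duhamelInt G t) x
      = (1 / 2) * ∫ τ in Ioc 0 t, ∫ ρ in |x - (t - τ)|..(x + (t - τ)), P τ ρ := by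
  have hG1 : ∀ τ, Measurable (G τ) := fun τ => hG.comp (measurable_const.prodMk measurable_id)
  have swap := integral_integral_swap (f := fun τ y => Real.sin (y * x) * (Real.sin ((t - τ) * y) / y * G τ y))
    (integrable_duhamel_prod hG hfin x)
  have e1 : sineT (duhamelInt G t) x = √(2 / Real.pi) * ∫ y, (∫ τ in Ioc 0 t,
      Real.sin (y * x) * (Real.sin ((t - τ) * y) / y * G τ y)) ∂freqMeasure := by
    rw [sineT]
    congr 1
    refine integral_congr_ae (ae_of_all _ fun y => ?_)
    simp only [duhamelInt]
    rw [intervalIntegral.integral_of_le ht, ← integral_const_mul]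
  rw [e1, ← swap, ← integral_const_mul, ← integral_const_mul]
  refine integral_congr_ae ?_
  filter_upwards [hP, hs, ae_restrict_mem measurableSet_Ioc] with τ h1 h2 h3
  have hs0 : 0 ≤ t - τ := by linarith [h3.2]
  have hab : |x - (t - τ)| ≤ x + (t - τ) := by rw [abs_le]; constructor <;> linarith
  rw [← h2.pairing h1 (hG1 τ).aestronglyMeasurable (abs_nonneg _) hab, ← integral_const_mul,
    ← integral_const_mul]
  refine integral_congr_ae (ae_of_all _ fun y => ?_)
  simp only [cosKer]
  -- Evenness of the cosine permits the reflected endpoint `|x - (t - τ)|`, as the pairing formula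
  -- needs a nonnegative one. This is the reflection of the light cone at the boundary; `c2` turns
  -- the product of sines into the kernel `cosKer`.
  have c1 : Real.cos (y * |x - (t - τ)|) = Real.cos (y * (x - (t - τ))) := by
    rcases abs_choice (x - (t - τ)) with h | h <;> rw [h]
    rw [mul_neg, Real.cos_neg]
  have c2 : Real.cos (y * (x - (t - τ))) - Real.cos (y * (x + (t - τ)))
      = 2 * (Real.sin (y * x) * Real.sin ((t - τ) * y)) := by
    rw [mul_sub, mul_add, Real.cos_sub, Real.cos_add, mul_comm (t - τ) y]; ring
  rw [c1, c2]
  ring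

/-- A jointly measurable forcing in Duhamel's formula. -/
theorem IsDuhamel.exists_measurable {I : Set ℝ} {a b : ℝ → ℝ} {F : ℝ → E3 → ℝ} {u : ℝ → ℝ → ℝ}
    (h : IsDuhamel I a b F u) (hI0 : ∀ t ∈ I, Ioc 0 t ⊆ I) :
    ∃ G : ℝ → ℝ → ℝ, Measurable (Function.uncurry G) ∧
      (∀ᵐ τ ∂(volume.restrict I), IsDftL2 (F τ) (G τ)) ∧
      (∀ t ∈ I, 0 ≤ t → ∫⁻ τ in Ioc 0 t, eLpNorm (G τ) 2 freqMeasure < ⊤) ∧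
      ∀ t ∈ I, 0 ≤ t → ∀ᵐ lam ∂freqMeasure, u t lam = Real.cos (t * lam) * a lam
        + Real.sin (t * lam) / lam * b lam + duhamelInt G t lam := by
  obtain ⟨G, h1, h2, h3, h4⟩ := h
  set M := h1.mk with hM
  have hMm : Measurable M := h1.stronglyMeasurable_mk.measurable
  -- The joint null set is sliced both ways: for almost every time to keep the `L²` statements, for
  -- almost every frequency to keep the Duhamel integral.
  have e1 : ∀ᵐ τ ∂(volume.restrict I), ∀ᵐ y ∂freqMeasure, G τ y = M (τ, y) :=
    Measure.ae_ae_of_ae_prod h1.ae_eq_mk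
  have e2 : ∀ᵐ y ∂freqMeasure, ∀ᵐ τ ∂(volume.restrict I), G τ y = M (τ, y) := by
    have : ∀ᵐ q : ℝ × ℝ ∂(freqMeasure.prod (volume.restrict I)), G q.2 q.1 = M (q.2, q.1) :=
      (Measure.measurePreserving_swap (μ := freqMeasure) (ν := volume.restrict I)).quasiMeasurePreserving.ae h1.ae_eq_mk
    exact Measure.ae_ae_of_ae_prod this
  have hle : ∀ t ∈ I, volume.restrict (Ioc 0 t) ≤ volume.restrict I := fun t ht =>
    Measure.restrict_mono (hI0 t ht) le_rfl
  refine ⟨fun τ y => M (τ, y), hMm, ?_, ?_, ?_⟩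
  · filter_upwards [h2, e1] with τ k1 k2
    obtain ⟨φ, a1, a2, a3⟩ := k1
    refine ⟨φ, a1, a2, a3.congr fun n => eLpNorm_congr_ae ?_⟩
    filter_upwards [k2] with y hy
    rw [hy]
  · intro t ht ht0
    have := h3 t ht
    rw [uIoc_of_le ht0] at this
    refine lt_of_le_of_lt (le_of_eq (lintegral_congr_ae ?_)) this
    filter_upwards [ae_mono (hle t ht) e1] with τ hτ
    exact eLpNorm_congr_ae (hτ.mono fun y hy => hy.symm)
  · intro t ht ht0
    filter_upwards [h4 t ht, e2] with y k1 k2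
    rw [k1, duhamelInt, intervalIntegral.integral_of_le ht0, intervalIntegral.integral_of_le ht0]
    congr 1
    refine integral_congr_ae ?_
    filter_upwards [ae_mono (hle t ht) k2] with τ hτ
    rw [hτ]

end Duhamel

/-! ### Joint continuity of a field in time and radius. -/

section Fields

variable {S : Set ℝ} {g : ℝ → ℝ → ℝ}

theorem continuousOn_sineT_uncurry (hg : ∀ t ∈ S, SineAdm (g t))
    (hc : ∀ t₀ ∈ S, Tendsto (fun t => sineNorm (fun y => g t y - g t₀ y)) (𝓝[S] t₀) (𝓝 0)) :
    ContinuousOn (fun p : ℝ × ℝ => sineT (g p.1) p.2) (S ×ˢ univ) := by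
  rintro ⟨t₀, x₀⟩ ⟨ht₀, -⟩
  have h1 : Tendsto (fun p : ℝ × ℝ => sineT (g t₀) p.2) (𝓝[S ×ˢ univ] (t₀, x₀)) (𝓝 (sineT (g t₀) x₀)) :=
    (((hg t₀ ht₀).continuous_sineT.comp continuous_snd).tendsto (t₀, x₀)).mono_left nhdsWithin_le_nhds
  have hfst : Tendsto (fun p : ℝ × ℝ => p.1) (𝓝[S ×ˢ univ] (t₀, x₀)) (𝓝[S] t₀) :=
    tendsto_nhdsWithin_iff.2 ⟨(continuous_fst.tendsto (t₀, x₀)).mono_left nhdsWithin_le_nhds,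
      eventually_nhdsWithin_of_forall fun p hp => hp.1⟩
  have h2 : Tendsto (fun p : ℝ × ℝ => (1 + |p.2|) * sineNorm (fun y => g p.1 y - g t₀ y))
      (𝓝[S ×ˢ univ] (t₀, x₀)) (𝓝 ((1 + |x₀|) * 0)) := by
    refine Tendsto.mul ?_ ((hc t₀ ht₀).comp hfst)
    exact ((by fun_prop : Continuous fun p : ℝ × ℝ => 1 + |p.2|).tendsto (t₀, x₀)).mono_left
      nhdsWithin_le_nhds
  rw [mul_zero] at h2
  have h3 : Tendsto (fun p : ℝ × ℝ => sineT (g p.1) p.2 - sineT (g t₀) p.2)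
      (𝓝[S ×ˢ univ] (t₀, x₀)) (𝓝 0) := by
    refine squeeze_zero_norm' ?_ h2
    filter_upwards [self_mem_nhdsWithin] with p hp
    rw [← (hg p.1 hp.1).sineT_sub (hg t₀ ht₀)]
    exact ((hg p.1 hp.1).sub (hg t₀ ht₀)).abs_sineT_le p.2
  have := h3.add h1
  simpa [ContinuousWithinAt] using this

end Fields

/-! ### Qualitative control of the cubic wave. -/

section CubicField

variable {s : ℝ} {a b : ℝ → ℝ} {w : ℝ → ℝ → ℝ}

theorem norm_rpow_spec_sub {σ : ℝ} (u v : HdotRad σ) :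
    (eLpNorm (fun y => y ^ σ * (spec u y - spec v y)) 2 freqMeasure).toReal ≤ ‖u - v‖ := by
  rw [norm_sub_hdot]
  exact le_mul_of_one_le_left ENNReal.toReal_nonneg one_le_sqrt_four_pi

theorem norm_rpow_spec {σ : ℝ} (u : HdotRad σ) :
    (eLpNorm (fun y => y ^ σ * spec u y) 2 freqMeasure).toReal ≤ ‖u‖ := by
  rw [norm_hdot]
  exact le_mul_of_one_le_left ENNReal.toReal_nonneg one_le_sqrt_four_pi

/-- Membership in both `C(ℝ; Ḣ^{1/2})` and `C(ℝ; Ḣ^s)` enters only through these three facts. They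
yield a continuous field and a finite quartic norm on bounded time intervals, without any smallness.
-/
theorem IsGlobalCubicSolution.rough (hw : IsGlobalCubicSolution s a b w) (hs : 1 / 2 < s) :
    (∀ t, RoughAdm (w t)) ∧
      (∀ t₀, Tendsto (fun t => roughNorm (fun y => w t y - w t₀ y)) (𝓝 t₀) (𝓝 0)) ∧
      ∀ T, ∃ N, 0 ≤ N ∧ ∀ t ∈ Icc 0 T, roughNorm (w t) ≤ N := by
  obtain ⟨z, hz, ez⟩ := hw.cont_half
  obtain ⟨x, hx, ex⟩ := hw.cont_s
  rw [continuousOn_univ] at hz hx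
  obtain ⟨K, hK, h⟩ := exists_roughNorm_le hs
  have mz : ∀ t, MemLp (fun y => y ^ (1 / 2 : ℝ) * w t y) 2 freqMeasure := fun t =>
    (memLp_spec (z t)).ae_eq ((ez t trivial).mono fun y hy => by simp only; rw [hy])
  have mx : ∀ t, MemLp (fun y => y ^ s * w t y) 2 freqMeasure := fun t =>
    (memLp_spec (x t)).ae_eq ((ex t trivial).mono fun y hy => by simp only; rw [hy])
  have hadm := fun t => (h _ (mz t) (mx t)).1
  refine ⟨hadm, fun t₀ => ?_, fun T => ?_⟩
  · have hb : ∀ t, roughNorm (fun y => w t y - w t₀ y) ≤ K * (‖z t - z t₀‖ + ‖x t - x t₀‖) := by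
      intro t
      refine ((h (fun y => w t y - w t₀ y) ?_ ?_).2).trans ?_
      · simpa only [mul_sub] using! (mz t).sub (mz t₀)
      · simpa only [mul_sub] using! (mx t).sub (mx t₀)
      gcongr
      · refine le_trans (le_of_eq ?_) (norm_rpow_spec_sub (z t) (z t₀))
        congr 1
        refine eLpNorm_congr_ae ?_
        filter_upwards [ez t trivial, ez t₀ trivial] with y h1 h2
        rw [h1, h2]
      · refine le_trans (le_of_eq ?_) (norm_rpow_spec_sub (x t) (x t₀))
        congr 1
        refine eLpNorm_congr_ae ?_
        filter_upwards [ex t trivial, ex t₀ trivial] with y h1 h2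
        rw [h1, h2]
    refine squeeze_zero (fun t => roughNorm_nonneg _) hb ?_
    have h1 : Tendsto (fun t => K * (‖z t - z t₀‖ + ‖x t - x t₀‖)) (𝓝 t₀)
        (𝓝 (K * (‖z t₀ - z t₀‖ + ‖x t₀ - x t₀‖))) :=
      ((by fun_prop : Continuous fun t => K * (‖z t - z t₀‖ + ‖x t - x t₀‖)).tendsto t₀)
    simpa using h1
  · obtain ⟨N, hN⟩ := isCompact_Icc.exists_bound_of_continuousOn (s := Icc 0 T)
      (f := fun t => K * (‖z t‖ + ‖x t‖)) (by fun_prop)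
    refine ⟨max N 0, le_max_right _ _, fun t ht => le_max_of_le_left ?_⟩
    refine le_trans ?_ ((le_abs_self _).trans (hN t ht))
    refine ((h (w t) (mz t) (mx t)).2).trans ?_
    gcongr
    · refine le_trans (le_of_eq ?_) (norm_rpow_spec (z t))
      congr 1
      refine eLpNorm_congr_ae ?_
      filter_upwards [ez t trivial] with y h1
      rw [h1]
    · refine le_trans (le_of_eq ?_) (norm_rpow_spec (x t))
      congr 1
      refine eLpNorm_congr_ae ?_
      filter_upwards [ex t trivial] with y h1
      rw [h1]

theorem IsGlobalCubicSolution.continuous_field (hw : IsGlobalCubicSolution s a b w) (hs : 1 / 2 < s) :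
    Continuous fun p : ℝ × ℝ => sineT (w p.1) p.2 := by
  obtain ⟨h1, h2, -⟩ := hw.rough hs
  have := continuousOn_sineT_uncurry (S := univ) (g := w) (fun t _ => (h1 t).sineAdm) (fun t₀ _ => by
    rw [nhdsWithin_univ]
    exact squeeze_zero (fun t => sineNorm_nonneg _) (fun t => ((h1 t).sub (h1 t₀)).sineNorm_le) (h2 t₀))
  rwa [univ_prod_univ, continuousOn_univ] at this

end CubicField

/-! ### Bessel's inequality for the Fourier transform of integrable functions. -/

section Bessel

theorem integral_cos_mul_gaussian {ε : ℝ} (hε : 0 < ε) (x : ℝ) :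
    ∫ t, Real.exp (-ε * t ^ 2) * Real.cos (t * x) = √(Real.pi / ε) * Real.exp (-(4 * ε)⁻¹ * x ^ 2) := by
  have h := fourierIntegral_gaussian (b := (ε : ℂ)) (by simpa using hε) (x : ℂ)
  have hi : Integrable fun t : ℝ => Complex.exp (Complex.I * x * t) * Complex.exp (-ε * t ^ 2) := by
    refine (integrable_cexp_neg_mul_sq (b := (ε : ℂ)) (by simpa using hε)).mono
      (by fun_prop) (ae_of_all _ fun t => ?_)
    rw [norm_mul]
    have : ‖Complex.exp (Complex.I * x * t)‖ = 1 := by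
      rw [show Complex.I * x * t = ((x * t : ℝ) : ℂ) * Complex.I by push_cast; ring]
      exact Complex.norm_exp_ofReal_mul_I _
    rw [this, one_mul]
  have h2 := Complex.reCLM.integral_comp_comm hi
  rw [h] at h2
  have e1 : ∀ t : ℝ, Complex.reCLM (Complex.exp (Complex.I * x * t) * Complex.exp (-ε * t ^ 2))
      = Real.exp (-ε * t ^ 2) * Real.cos (t * x) := by
    intro t
    rw [show (-ε * t ^ 2 : ℂ) = ((-ε * t ^ 2 : ℝ) : ℂ) by push_cast; ring, ← Complex.ofReal_exp,
      show Complex.I * x * t = ((t * x : ℝ) : ℂ) * Complex.I by push_cast; ring]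
    rw [Complex.reCLM_apply, Complex.re_mul_ofReal, Complex.exp_ofReal_mul_I_re, mul_comm]
  have e2 : ((Real.pi : ℂ) / ε) ^ (1 / 2 : ℂ) * Complex.exp (-(x : ℂ) ^ 2 / (4 * ε))
      = ((√(Real.pi / ε) * Real.exp (-(4 * ε)⁻¹ * x ^ 2) : ℝ) : ℂ) := by
    rw [Real.sqrt_eq_rpow, Complex.ofReal_mul, Complex.ofReal_cpow (by positivity)]
    push_cast
    congr 2
    field_simp
  rw [e2] at h2
  simp_rw [e1] at h2
  rw [h2, Complex.reCLM_apply, Complex.ofReal_re]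

theorem lintegral_gaussian_kernel {ε : ℝ} (hε : 0 < ε) :
    ∫⁻ x, ENNReal.ofReal (√(Real.pi / ε) * Real.exp (-(4 * ε)⁻¹ * x ^ 2)) = ENNReal.ofReal (2 * Real.pi) := by
  have hb : 0 < (4 * ε)⁻¹ := by positivity
  rw [← ofReal_integral_eq_lintegral_ofReal ((integrable_exp_neg_mul_sq hb).const_mul _)
    (ae_of_all _ fun x => by positivity), integral_const_mul, integral_gaussian, ← Real.sqrt_mul (by positivity)]
  congr 1
  rw [show Real.pi / ε * (Real.pi / (4 * ε)⁻¹) = (2 * Real.pi) ^ 2 by field_simp; ring]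
  exact Real.sqrt_sq (by positivity)

variable {c : ℝ → ℝ}

theorem sq_add_sq_eq_integral_prod (t : ℝ) (hc : Integrable c) :
    (∫ x, Real.cos (t * x) * c x) ^ 2 + (∫ x, Real.sin (t * x) * c x) ^ 2
      = ∫ z : ℝ × ℝ, Real.cos (t * (z.1 - z.2)) * (c z.1 * c z.2) ∂(volume.prod volume) := by
  have h1 : Integrable fun x => Real.cos (t * x) * c x :=
    hc.mono ((by fun_prop : Continuous fun x => Real.cos (t * x)).aestronglyMeasurable.mul hc.1)
      (ae_of_all _ fun x => by
        rw [norm_mul]; exact mul_le_of_le_one_left (norm_nonneg _) (Real.abs_cos_le_one _))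
  have h2 : Integrable fun x => Real.sin (t * x) * c x :=
    hc.mono ((by fun_prop : Continuous fun x => Real.sin (t * x)).aestronglyMeasurable.mul hc.1)
      (ae_of_all _ fun x => by
        rw [norm_mul]; exact mul_le_of_le_one_left (norm_nonneg _) (Real.abs_sin_le_one _))
  rw [pow_two, pow_two, ← integral_prod_mul, ← integral_prod_mul, ← integral_add (h1.mul_prod h1) (h2.mul_prod h2)]
  congr 1; ext z
  rw [mul_sub, Real.cos_sub]; ring

/-- With a Gaussian factor in time Fubini is legitimate, and the time integral becomes a positive
kernel `k (x - x')` of total mass `2π`. The inequality `|c c'| ≤ (c² + c'²) / 2` then bounds the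
quadratic form. The right side may be infinite, as `c` is only integrable. -/
theorem lintegral_gaussian_fourier_le (hcm : Measurable c) (hc : Integrable c) {ε : ℝ} (hε : 0 < ε) :
    ∫⁻ t, ENNReal.ofReal (Real.exp (-ε * t ^ 2)
        * ((∫ x, Real.cos (t * x) * c x) ^ 2 + (∫ x, Real.sin (t * x) * c x) ^ 2))
      ≤ ENNReal.ofReal (2 * Real.pi) * ∫⁻ x, ‖c x‖ₑ ^ 2 := by
  have hi : Integrable (fun p : ℝ × ℝ × ℝ => Real.exp (-ε * p.1 ^ 2)
      * (Real.cos (p.1 * (p.2.1 - p.2.2)) * (c p.2.1 * c p.2.2))) (volume.prod (volume.prod volume)) := by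
    refine ((integrable_exp_neg_mul_sq hε).mul_prod (hc.mul_prod hc)).mono
      (Measurable.aestronglyMeasurable (by fun_prop)) (ae_of_all _ fun p => ?_)
    rw [norm_mul, norm_mul (Real.cos _), norm_mul (Real.exp _) (c _ * c _)]
    gcongr
    exact mul_le_of_le_one_left (norm_nonneg _) (Real.abs_cos_le_one _)
  have e1 : ∀ t : ℝ, Real.exp (-ε * t ^ 2)
        * ((∫ x, Real.cos (t * x) * c x) ^ 2 + (∫ x, Real.sin (t * x) * c x) ^ 2)
      = ∫ z : ℝ × ℝ, Real.exp (-ε * t ^ 2) * (Real.cos (t * (z.1 - z.2)) * (c z.1 * c z.2))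
          ∂(volume.prod volume) := by
    intro t
    rw [sq_add_sq_eq_integral_prod t hc, integral_const_mul]
  have hi1 := hi.integral_prod_left
  simp only [← e1] at hi1
  rw [← ofReal_integral_eq_lintegral_ofReal hi1 (ae_of_all _ fun t => by positivity)]
  simp_rw [e1]
  rw [integral_integral_swap hi]
  set k : ℝ → ℝ := fun x => √(Real.pi / ε) * Real.exp (-(4 * ε)⁻¹ * x ^ 2) with hk
  have hk0 : ∀ x, 0 ≤ k x := fun x => by positivity
  have hkm : Measurable k := by fun_prop
  have e2 : ∀ z : ℝ × ℝ, ∫ t, Real.exp (-ε * t ^ 2) * (Real.cos (t * (z.1 - z.2)) * (c z.1 * c z.2))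
      = k (z.1 - z.2) * (c z.1 * c z.2) := by
    intro z
    simp_rw [← mul_assoc (Real.exp _)]
    rw [integral_mul_const, integral_cos_mul_gaussian hε]
  simp_rw [e2]
  have e3 : ∀ z : ℝ × ℝ, ‖k (z.1 - z.2) * (c z.1 * c z.2)‖ₑ ≤ ENNReal.ofReal (1 / 2) *
      (ENNReal.ofReal (k (z.1 - z.2)) * ‖c z.1‖ₑ ^ 2 + ENNReal.ofReal (k (z.1 - z.2)) * ‖c z.2‖ₑ ^ 2) := by
    intro z
    rw [← ofReal_norm, ← ofReal_norm, ← ofReal_norm, ← ENNReal.ofReal_pow (norm_nonneg _),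
      ← ENNReal.ofReal_pow (norm_nonneg _), ← ENNReal.ofReal_mul (hk0 _), ← ENNReal.ofReal_mul (hk0 _),
      ← ENNReal.ofReal_add (by have := hk0 (z.1 - z.2); positivity) (by have := hk0 (z.1 - z.2); positivity),
      ← ENNReal.ofReal_mul (by norm_num)]
    refine ENNReal.ofReal_le_ofReal ?_
    rw [norm_mul (k _), norm_mul (c _), Real.norm_of_nonneg (hk0 _)]
    nlinarith [mul_nonneg (hk0 (z.1 - z.2)) (sq_nonneg (‖c z.1‖ - ‖c z.2‖))]
  have hA : ∫⁻ z : ℝ × ℝ, ENNReal.ofReal (k (z.1 - z.2)) * ‖c z.1‖ₑ ^ 2 ∂(volume.prod volume)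
      = ENNReal.ofReal (2 * Real.pi) * ∫⁻ x, ‖c x‖ₑ ^ 2 := by
    rw [lintegral_prod _ (by fun_prop), ← lintegral_const_mul _ (by fun_prop)]
    refine lintegral_congr fun x => ?_
    dsimp only
    rw [lintegral_mul_const _ (by fun_prop), lintegral_sub_left_eq_self (fun y => ENNReal.ofReal (k y)),
      lintegral_gaussian_kernel hε]
  have hB : ∫⁻ z : ℝ × ℝ, ENNReal.ofReal (k (z.1 - z.2)) * ‖c z.2‖ₑ ^ 2 ∂(volume.prod volume)
      = ENNReal.ofReal (2 * Real.pi) * ∫⁻ x, ‖c x‖ₑ ^ 2 := by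
    rw [lintegral_prod_symm _ (by fun_prop), ← lintegral_const_mul _ (by fun_prop)]
    refine lintegral_congr fun y => ?_
    dsimp only
    rw [lintegral_mul_const _ (by fun_prop), lintegral_sub_right_eq_self (fun y => ENNReal.ofReal (k y)),
      lintegral_gaussian_kernel hε]
  calc ENNReal.ofReal (∫ z : ℝ × ℝ, k (z.1 - z.2) * (c z.1 * c z.2) ∂(volume.prod volume))
      ≤ ‖∫ z : ℝ × ℝ, k (z.1 - z.2) * (c z.1 * c z.2) ∂(volume.prod volume)‖ₑ := Real.ofReal_le_enorm _
    _ ≤ ∫⁻ z : ℝ × ℝ, ‖k (z.1 - z.2) * (c z.1 * c z.2)‖ₑ ∂(volume.prod volume) :=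
        enorm_integral_le_lintegral_enorm _
    _ ≤ _ := lintegral_mono e3
    _ = ENNReal.ofReal (2 * Real.pi) * ∫⁻ x, ‖c x‖ₑ ^ 2 := by
        rw [lintegral_const_mul _ (by fun_prop), lintegral_add_left (by fun_prop), hA, hB, ← two_mul, ← mul_assoc,
          show (2 : ℝ≥0∞) = ENNReal.ofReal 2 by norm_num, ← ENNReal.ofReal_mul (by norm_num)]
        norm_num

/-- Bessel's inequality for the Fourier transform. -/
theorem lintegral_fourier_le (hcm : Measurable c) (hc : Integrable c) :
    ∫⁻ t, ENNReal.ofReal ((∫ x, Real.cos (t * x) * c x) ^ 2 + (∫ x, Real.sin (t * x) * c x) ^ 2)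
      ≤ ENNReal.ofReal (2 * Real.pi) * ∫⁻ x, ‖c x‖ₑ ^ 2 := by
  set D : ℝ → ℝ := fun t => (∫ x, Real.cos (t * x) * c x) ^ 2 + (∫ x, Real.sin (t * x) * c x) ^ 2 with hD
  have hDm : Measurable D := by
    refine Measurable.add (Measurable.pow_const ?_ 2) (Measurable.pow_const ?_ 2)
    · exact (StronglyMeasurable.integral_prod_right' (f := fun p : ℝ × ℝ => Real.cos (p.1 * p.2) * c p.2)
        (Measurable.stronglyMeasurable (by fun_prop))).measurable
    · exact (StronglyMeasurable.integral_prod_right' (f := fun p : ℝ × ℝ => Real.sin (p.1 * p.2) * c p.2)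
        (Measurable.stronglyMeasurable (by fun_prop))).measurable
  -- The Gaussian factor is removed by Fatou's lemma along `ε = 1 / (n + 1)`.
  have hlim : ∀ t, Tendsto (fun n : ℕ => ENNReal.ofReal (Real.exp (-(1 / ((n : ℝ) + 1)) * t ^ 2) * D t)) atTop
      (𝓝 (ENNReal.ofReal (D t))) := by
    intro t
    refine ENNReal.tendsto_ofReal ?_
    have h1 : Tendsto (fun n : ℕ => Real.exp (-(1 / ((n : ℝ) + 1)) * t ^ 2) * D t) atTop
        (𝓝 (Real.exp (-0 * t ^ 2) * D t)) :=
      ((Real.continuous_exp.tendsto _).comp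
        ((tendsto_one_div_add_atTop_nhds_zero_nat (𝕜 := ℝ)).neg.mul_const (t ^ 2))).mul_const _
    simpa using h1
  calc ∫⁻ t, ENNReal.ofReal (D t)
      = ∫⁻ t, liminf (fun n : ℕ => ENNReal.ofReal (Real.exp (-(1 / ((n : ℝ) + 1)) * t ^ 2) * D t)) atTop :=
        lintegral_congr fun t => (hlim t).liminf_eq.symm
    _ ≤ liminf (fun n : ℕ => ∫⁻ t, ENNReal.ofReal (Real.exp (-(1 / ((n : ℝ) + 1)) * t ^ 2) * D t)) atTop :=
        lintegral_liminf_le fun n => by fun_prop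
    _ ≤ liminf (fun n : ℕ => ENNReal.ofReal (2 * Real.pi) * ∫⁻ x, ‖c x‖ₑ ^ 2) atTop :=
        liminf_le_liminf (Eventually.of_forall fun n =>
          lintegral_gaussian_fourier_le hcm hc (by positivity))
    _ = _ := by simp

end Bessel

/-! ### Fourth powers of Fourier transforms through self-convolution. -/

section SelfConv

variable {b : ℝ → ℝ}

/-- The convolution of a function with itself. -/
def selfConv (b : ℝ → ℝ) (ν : ℝ) : ℝ := ∫ x, b x * b (ν - x)

theorem integrable_selfConv_prod (hb : Integrable b) :
    Integrable (fun p : ℝ × ℝ => b p.2 * b (p.1 - p.2)) (volume.prod volume) := by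
  simpa using! hb.convolution_integrand (ContinuousLinearMap.mul ℝ ℝ) hb

theorem integrable_selfConv (hb : Integrable b) : Integrable (selfConv b) :=
  (integrable_selfConv_prod hb).integral_prod_left

theorem measurable_selfConv (hb : Measurable b) : Measurable (selfConv b) :=
  (StronglyMeasurable.integral_prod_right' (f := fun p : ℝ × ℝ => b p.2 * b (p.1 - p.2))
    (Measurable.stronglyMeasurable (by fun_prop))).measurable

theorem integrable_bdd_mul {α : Type*} [MeasurableSpace α] {μ : Measure α} {φ f : α → ℝ}
    (hf : Integrable f μ) (hφ : Measurable φ) (h1 : ∀ x, |φ x| ≤ 1) :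
    Integrable (fun x => φ x * f x) μ :=
  hf.mono (hφ.aestronglyMeasurable.mul hf.1) (ae_of_all _ fun x => by
    rw [norm_mul]; exact mul_le_of_le_one_left (norm_nonneg _) (h1 x))

theorem integral_mul_selfConv (hb : Integrable b) {φ : ℝ → ℝ} (hφ : Measurable φ) (h1 : ∀ x, |φ x| ≤ 1) :
    ∫ ν, φ ν * selfConv b ν = ∫ z : ℝ × ℝ, φ (z.1 + z.2) * (b z.1 * b z.2) ∂(volume.prod volume) := by
  have hi : Integrable (fun z : ℝ × ℝ => φ (z.1 + z.2) * (b z.1 * b z.2)) (volume.prod volume) :=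
    integrable_bdd_mul (hb.mul_prod hb) (by fun_prop) fun _ => h1 _
  have hj : Integrable (fun p : ℝ × ℝ => φ p.1 * (b p.2 * b (p.1 - p.2))) (volume.prod volume) :=
    integrable_bdd_mul (integrable_selfConv_prod hb) (by fun_prop) fun _ => h1 _
  rw [integral_prod _ hi]
  calc ∫ ν, φ ν * selfConv b ν = ∫ ν, ∫ x, φ ν * (b x * b (ν - x)) := by
        simp_rw [selfConv, integral_const_mul]
    _ = ∫ x, ∫ ν, φ ν * (b x * b (ν - x)) := integral_integral_swap hj
    _ = ∫ x, ∫ y, φ (x + y) * (b x * b y) := by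
        congr 1; ext x
        rw [← integral_sub_right_eq_self (fun y => φ (x + y) * (b x * b y)) x]
        simp

/-- Together with `two_mul_mul_eq_selfConv` this is the real form of "the square of a Fourier
transform is the transform of the self-convolution", split into real and imaginary parts by the
addition theorems. -/
theorem sq_sub_sq_eq_selfConv (hb : Integrable b) (t : ℝ) :
    (∫ x, Real.cos (t * x) * b x) ^ 2 - (∫ x, Real.sin (t * x) * b x) ^ 2
      = ∫ ν, Real.cos (t * ν) * selfConv b ν := by
  have h1 : Integrable fun x => Real.cos (t * x) * b x :=
    integrable_bdd_mul hb (by fun_prop) fun x => Real.abs_cos_le_one _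
  have h2 : Integrable fun x => Real.sin (t * x) * b x :=
    integrable_bdd_mul hb (by fun_prop) fun x => Real.abs_sin_le_one _
  rw [integral_mul_selfConv hb (φ := fun ν => Real.cos (t * ν)) (by fun_prop) fun x => Real.abs_cos_le_one _,
    pow_two, pow_two, ← integral_prod_mul, ← integral_prod_mul,
    ← integral_sub (h1.mul_prod h1) (h2.mul_prod h2)]
  congr 1; ext z
  rw [mul_add, Real.cos_add]; ring

theorem two_mul_mul_eq_selfConv (hb : Integrable b) (t : ℝ) :
    2 * (∫ x, Real.cos (t * x) * b x) * (∫ x, Real.sin (t * x) * b x)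
      = ∫ ν, Real.sin (t * ν) * selfConv b ν := by
  have h1 : Integrable fun x => Real.cos (t * x) * b x :=
    integrable_bdd_mul hb (by fun_prop) fun x => Real.abs_cos_le_one _
  have h2 : Integrable fun x => Real.sin (t * x) * b x :=
    integrable_bdd_mul hb (by fun_prop) fun x => Real.abs_sin_le_one _
  rw [integral_mul_selfConv hb (φ := fun ν => Real.sin (t * ν)) (by fun_prop) fun x => Real.abs_sin_le_one _]
  have e : (fun z : ℝ × ℝ => Real.sin (t * (z.1 + z.2)) * (b z.1 * b z.2)) = fun z : ℝ × ℝ =>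
      (Real.sin (t * z.1) * b z.1) * (Real.cos (t * z.2) * b z.2)
      + (Real.cos (t * z.1) * b z.1) * (Real.sin (t * z.2) * b z.2) := by
    ext z; rw [mul_add, Real.sin_add]; ring
  rw [e, integral_add (h2.mul_prod h1) (h1.mul_prod h2),
    integral_prod_mul (fun x => Real.sin (t * x) * b x) (fun x => Real.cos (t * x) * b x),
    integral_prod_mul (fun x => Real.cos (t * x) * b x) (fun x => Real.sin (t * x) * b x)]
  ring

/-- The fourth power of the modulus of a Fourier transform in `L¹`. -/
theorem lintegral_fourier_quartic_le (hbm : Measurable b) (hb : Integrable b) :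
    ∫⁻ t, ENNReal.ofReal (((∫ x, Real.cos (t * x) * b x) ^ 2 + (∫ x, Real.sin (t * x) * b x) ^ 2) ^ 2)
      ≤ ENNReal.ofReal (2 * Real.pi) * ∫⁻ ν, ‖selfConv b ν‖ₑ ^ 2 := by
  refine le_trans (le_of_eq (lintegral_congr fun t => ?_))
    (lintegral_fourier_le (measurable_selfConv hbm) (integrable_selfConv hb))
  rw [← sq_sub_sq_eq_selfConv hb, ← two_mul_mul_eq_selfConv hb]
  congr 1; ring

end SelfConv

/-! ### The space-time estimate for free radial waves. -/

section Strichartz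

variable {α : ℝ → ℝ}

/-- Cauchy–Schwarz separates the amplitude `A` from the oscillating weight `σ`. Only `σ` will depend
on the radius, so the radial integral can be carried out on it alone. -/
theorem enorm_selfConv_sq_le {A σ : ℝ → ℝ≥0∞} {b : ℝ → ℝ} (hA : Measurable A) (hσ : Measurable σ)
    (h : ∀ x, ‖b x‖ₑ ≤ A x * σ x) (ν : ℝ) :
    ‖selfConv b ν‖ₑ ^ 2 ≤ (∫⁻ x, A x ^ 2 * A (ν - x) ^ 2) * ∫⁻ x, σ x ^ 2 * σ (ν - x) ^ 2 := by
  have h1 : ‖selfConv b ν‖ₑ ≤ ∫⁻ x, (A x * A (ν - x)) * (σ x * σ (ν - x)) := by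
    refine (enorm_integral_le_lintegral_enorm _).trans (lintegral_mono fun x => ?_)
    rw [enorm_mul]
    calc _ ≤ (A x * σ x) * (A (ν - x) * σ (ν - x)) := mul_le_mul' (h _) (h _)
      _ = _ := by ring
  refine (pow_le_pow_left' h1 2).trans ?_
  refine (sq_lintegral_mul_le (by fun_prop) (by fun_prop)).trans (le_of_eq ?_)
  simp_rw [mul_pow]

theorem lintegral_self_conv_eq {B : ℝ → ℝ≥0∞} (hB : Measurable B) :
    ∫⁻ ν, ∫⁻ x, B x * B (ν - x) = (∫⁻ x, B x) ^ 2 := by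
  rw [lintegral_lintegral_swap (Measurable.aemeasurable (by fun_prop)), pow_two,
    ← lintegral_mul_const _ hB]
  refine lintegral_congr fun x => ?_
  rw [lintegral_const_mul _ (by fun_prop), lintegral_sub_right_eq_self B]

/-- The oscillating weight in the space-time estimate of free waves. -/
def oscWeight (ρ : ℝ) : ℝ → ℝ≥0∞ :=
  (Ioi (0 : ℝ)).indicator fun x => ENNReal.ofReal (|Real.sin (x * ρ)| * x ^ (-1 / 2 : ℝ))

theorem measurable_oscWeight : Measurable fun p : ℝ × ℝ => oscWeight p.1 p.2 := by
  have : (fun p : ℝ × ℝ => oscWeight p.1 p.2) = (Prod.snd ⁻¹' Ioi (0 : ℝ)).indicator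
      fun p : ℝ × ℝ => ENNReal.ofReal (|Real.sin (p.2 * p.1)| * p.2 ^ (-1 / 2 : ℝ)) := rfl
  rw [this]
  refine Measurable.indicator ?_ (measurable_snd measurableSet_Ioi)
  exact ((Real.continuous_sin.measurable.comp (measurable_snd.mul measurable_fst)).abs.mul
    (measurable_snd.pow_const _)).ennreal_ofReal

theorem measurable_oscWeight_right (ρ : ℝ) : Measurable (oscWeight ρ) :=
  Measurable.of_uncurry_left (f := oscWeight) (show Measurable (Function.uncurry oscWeight) from measurable_oscWeight)

theorem oscWeight_of_nonpos (ρ : ℝ) {x : ℝ} (hx : x ≤ 0) : oscWeight ρ x = 0 :=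
  indicator_of_notMem (by simpa using hx) _

theorem oscWeight_of_pos (ρ : ℝ) {x : ℝ} (hx : 0 < x) :
    oscWeight ρ x = ENNReal.ofReal (|Real.sin (x * ρ)| * x ^ (-1 / 2 : ℝ)) :=
  indicator_of_mem (show x ∈ Ioi (0 : ℝ) from hx) _

attribute [irreducible] oscWeight

theorem oscWeight_sq {ρ x : ℝ} (hx : 0 < x) :
    oscWeight ρ x ^ 2 = ENNReal.ofReal (Real.sin (x * ρ) ^ 2 * x⁻¹) := by
  have h0 : 0 ≤ |Real.sin (x * ρ)| * x ^ (-1 / 2 : ℝ) := by positivity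
  rw [oscWeight_of_pos ρ hx, ← ENNReal.ofReal_pow h0, mul_pow, sq_abs,
    ← Real.rpow_natCast (x ^ _), ← Real.rpow_mul hx.le]
  norm_num [Real.rpow_neg_one]

/-- With `m = min x y`, the product of the squared sines is at most `(min m ρ⁻¹ · ρ)²`, so the
integral is at most `2m / (x y)`. This is `2 / max x y`, which does not exceed `4 / (x + y)`. -/
theorem lintegral_oscWeight_pair_le {x y : ℝ} (hx : 0 < x) (hy : 0 < y) :
    ∫⁻ ρ, ENNReal.ofReal ρ⁻¹ ^ 2 * (oscWeight ρ x ^ 2 * oscWeight ρ y ^ 2) ∂freqMeasure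
      ≤ ENNReal.ofReal (4 / (x + y)) := by
  set m := min x y with hm
  have hm0 : 0 < m := lt_min hx hy
  calc _ ≤ ∫⁻ ρ, ENNReal.ofReal (x⁻¹ * y⁻¹) * ENNReal.ofReal (min m ρ⁻¹) ^ 2 ∂freqMeasure := by
        refine lintegral_mono_ae ?_
        filter_upwards [ae_freqMeasure_pos] with ρ hρ
        rw [oscWeight_sq hx, oscWeight_sq hy, ← ENNReal.ofReal_pow (by positivity),
          ← ENNReal.ofReal_mul (by positivity), ← ENNReal.ofReal_mul (by positivity),
          ← ENNReal.ofReal_pow (by positivity), ← ENNReal.ofReal_mul (by positivity)]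
        refine ENNReal.ofReal_le_ofReal ?_
        have key : ∀ z, 0 < z → Real.sin (z * ρ) ^ 2 ≤ (min z ρ⁻¹ * ρ) ^ 2 := by
          intro z hz
          have := abs_sin_mul_le (y := ρ) (x := z) hρ hz.le
          rw [← sq_abs (Real.sin _), mul_comm z ρ]
          exact pow_le_pow_left₀ (abs_nonneg _) this 2
        have hs1 : ∀ z, Real.sin (z * ρ) ^ 2 ≤ 1 := fun z => by
          nlinarith [Real.sin_sq_add_cos_sq (z * ρ), sq_nonneg (Real.cos (z * ρ))]
        have hprod : Real.sin (x * ρ) ^ 2 * Real.sin (y * ρ) ^ 2 ≤ (min m ρ⁻¹ * ρ) ^ 2 := by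
          rcases le_total x y with h | h
          · rw [hm, min_eq_left h]
            exact (mul_le_of_le_one_right (sq_nonneg _) (hs1 y)).trans (key x hx)
          · rw [hm, min_eq_right h]
            exact (mul_le_of_le_one_left (sq_nonneg _) (hs1 x)).trans (key y hy)
        calc ρ⁻¹ ^ 2 * (Real.sin (x * ρ) ^ 2 * x⁻¹ * (Real.sin (y * ρ) ^ 2 * y⁻¹))
            = (x⁻¹ * y⁻¹) * (ρ⁻¹ ^ 2 * (Real.sin (x * ρ) ^ 2 * Real.sin (y * ρ) ^ 2)) := by ring
          _ ≤ (x⁻¹ * y⁻¹) * (ρ⁻¹ ^ 2 * (min m ρ⁻¹ * ρ) ^ 2) := by gcongr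
          _ = (x⁻¹ * y⁻¹) * min m ρ⁻¹ ^ 2 := by field_simp
    _ = ENNReal.ofReal (x⁻¹ * y⁻¹) * ∫⁻ ρ, ENNReal.ofReal (min m ρ⁻¹) ^ 2 ∂freqMeasure :=
        lintegral_const_mul' _ _ ENNReal.ofReal_ne_top
    _ ≤ ENNReal.ofReal (x⁻¹ * y⁻¹) * ENNReal.ofReal (2 * m) := by
        gcongr; exact lintegral_min_inv_sq hm0
    _ ≤ _ := by
        rw [← ENNReal.ofReal_mul (by positivity)]
        refine ENNReal.ofReal_le_ofReal ?_
        rw [le_div_iff₀ (by positivity), ← mul_inv, inv_mul_eq_div, div_mul_eq_mul_div, div_le_iff₀ (by positivity)]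
        rcases le_total x y with h | h
        · rw [hm, min_eq_left h]; nlinarith [mul_pos hx hy]
        · rw [hm, min_eq_right h]; nlinarith [mul_pos hx hy]

/-- Along `x + y = ν` the pair bound is the constant `4 / ν`, and `x` ranges over an interval of
length `ν`. The independence of `ν` expresses the scale invariance of the estimate. -/
theorem lintegral_oscWeight_conv_le (ν : ℝ) :
    ∫⁻ ρ, ENNReal.ofReal ρ⁻¹ ^ 2 * (∫⁻ x, oscWeight ρ x ^ 2 * oscWeight ρ (ν - x) ^ 2) ∂freqMeasure ≤ 4 := by
  have hm := measurable_oscWeight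
  have hm1 := measurable_oscWeight_right
  have hm2 : Measurable fun p : ℝ × ℝ => ENNReal.ofReal p.1⁻¹ ^ 2 * (oscWeight p.1 p.2 ^ 2 * oscWeight p.1 (ν - p.2) ^ 2) := by
    have a1 : Measurable fun p : ℝ × ℝ => oscWeight p.1 (ν - p.2) :=
      hm.comp (measurable_fst.prodMk (measurable_const.sub measurable_snd))
    have a2 : Measurable fun p : ℝ × ℝ => ENNReal.ofReal p.1⁻¹ := measurable_fst.inv.ennreal_ofReal
    exact (a2.pow_const 2).mul ((hm.pow_const 2).mul (a1.pow_const 2))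
  calc _ = ∫⁻ ρ, (∫⁻ x, ENNReal.ofReal ρ⁻¹ ^ 2 * (oscWeight ρ x ^ 2 * oscWeight ρ (ν - x) ^ 2)) ∂freqMeasure := by
        refine lintegral_congr fun ρ => ?_
        rw [lintegral_const_mul' _ _ (by finiteness)]
    _ = ∫⁻ x, (∫⁻ ρ, ENNReal.ofReal ρ⁻¹ ^ 2 * (oscWeight ρ x ^ 2 * oscWeight ρ (ν - x) ^ 2) ∂freqMeasure) :=
        lintegral_lintegral_swap hm2.aemeasurable
    _ ≤ ∫⁻ x, (Ioo 0 ν).indicator (fun _ => ENNReal.ofReal (4 / ν)) x := by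
        refine lintegral_mono fun x => ?_
        by_cases hx : x ∈ Ioo 0 ν
        · rw [indicator_of_mem hx]
          have := lintegral_oscWeight_pair_le hx.1 (sub_pos.2 hx.2)
          rwa [add_sub_cancel] at this
        · refine (lintegral_congr (g := fun _ => 0) fun ρ => ?_).trans_le (by simp)
          simp only [mem_Ioo, not_and_or, not_lt] at hx
          rcases hx with hx | hx
          · have := oscWeight_of_nonpos ρ hx
            simp [this]
          · have := oscWeight_of_nonpos ρ (sub_nonpos.2 hx)
            simp [this]
    _ ≤ 4 := by
        rw [lintegral_indicator_const measurableSet_Ioo, Real.volume_Ioo, sub_zero]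
        rcases le_or_gt ν 0 with h | h
        · simp [ENNReal.ofReal_of_nonpos h]
        · rw [← ENNReal.ofReal_mul (by positivity), div_mul_cancel₀ _ h.ne']
          norm_num

/-- The `L⁴` space-time estimate for free radial waves. -/
theorem lintegral_freeWave_quartic_le (hα : Measurable α) (hint : Integrable α freqMeasure) :
    ∫⁻ ρ, ENNReal.ofReal ρ⁻¹ ^ 2 * (∫⁻ t, ENNReal.ofReal
        (((∫ y, Real.cos (t * y) * (Real.sin (y * ρ) * α y) ∂freqMeasure) ^ 2
          + (∫ y, Real.sin (t * y) * (Real.sin (y * ρ) * α y) ∂freqMeasure) ^ 2) ^ 2)) ∂freqMeasure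
      ≤ ENNReal.ofReal (8 * Real.pi) * (∫⁻ y, ENNReal.ofReal y * ‖α y‖ₑ ^ 2 ∂freqMeasure) ^ 2 := by
  set b : ℝ → ℝ → ℝ := fun ρ => (Ioi (0 : ℝ)).indicator fun y => Real.sin (y * ρ) * α y with hb
  have hbm : ∀ ρ, Measurable (b ρ) := fun ρ => Measurable.indicator (by fun_prop) measurableSet_Ioi
  have hbi : ∀ ρ, Integrable (b ρ) := fun ρ => by
    rw [hb, integrable_indicator_iff measurableSet_Ioi]
    exact integrable_bdd_mul hint (by fun_prop) fun x => Real.abs_sin_le_one _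
  have hbj : ∀ (φ : ℝ → ℝ) ρ, ∫ y, φ y * (Real.sin (y * ρ) * α y) ∂freqMeasure = ∫ y, φ y * b ρ y := by
    intro φ ρ
    rw [freqMeasure, ← integral_indicator measurableSet_Ioi]
    congr 1; ext y
    by_cases hy : y ∈ Ioi (0 : ℝ) <;> simp [hb, hy]
  set A : ℝ → ℝ≥0∞ := (Ioi (0 : ℝ)).indicator fun y => ENNReal.ofReal (y ^ (1 / 2 : ℝ)) * ‖α y‖ₑ with hA
  have hAm : Measurable A := Measurable.indicator (by fun_prop) measurableSet_Ioi
  have hA2 : ∫⁻ x, A x ^ 2 = ∫⁻ y, ENNReal.ofReal y * ‖α y‖ₑ ^ 2 ∂freqMeasure := by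
    rw [freqMeasure, ← lintegral_indicator measurableSet_Ioi]
    refine lintegral_congr fun y => ?_
    by_cases hy : y ∈ Ioi (0 : ℝ)
    · rw [hA, indicator_of_mem hy, indicator_of_mem hy, mul_pow, ← ENNReal.ofReal_pow (Real.rpow_nonneg (le_of_lt hy) _),
        ← Real.rpow_natCast, ← Real.rpow_mul (le_of_lt hy)]
      norm_num
    · rw [hA, indicator_of_notMem hy, indicator_of_notMem hy]; simp
  have hm := measurable_oscWeight
  have hm1 := measurable_oscWeight_right
  have hle : ∀ ρ x, ‖b ρ x‖ₑ ≤ A x * oscWeight ρ x := by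
    intro ρ x
    by_cases hx : x ∈ Ioi (0 : ℝ)
    · have hx' : (0 : ℝ) < x := hx
      have hbx : b ρ x = Real.sin (x * ρ) * α x := indicator_of_mem hx _
      rw [hbx, hA, oscWeight_of_pos ρ hx', indicator_of_mem hx,
        ← ofReal_norm, ← ofReal_norm, ← ENNReal.ofReal_mul (by positivity), ← ENNReal.ofReal_mul (by positivity)]
      refine ENNReal.ofReal_le_ofReal (le_of_eq ?_)
      have : x ^ (1 / 2 : ℝ) * x ^ (-1 / 2 : ℝ) = 1 := by
        rw [← Real.rpow_add hx']; norm_num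
      rw [norm_mul, Real.norm_eq_abs, Real.norm_eq_abs]
      linear_combination (-(|Real.sin (x * ρ)| * |α x|)) * this
    · simp [hb, hx]
  have hσ3 : Measurable fun q : ℝ × ℝ => ∫⁻ x, oscWeight q.1 x ^ 2 * oscWeight q.1 (q.2 - x) ^ 2 := by
    refine Measurable.lintegral_prod_right' (f := fun p : (ℝ × ℝ) × ℝ => oscWeight p.1.1 p.2 ^ 2 * oscWeight p.1.1 (p.1.2 - p.2) ^ 2) ?_
    have a1 : Measurable fun p : (ℝ × ℝ) × ℝ => oscWeight p.1.1 p.2 :=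
      hm.comp (measurable_fst.fst.prodMk measurable_snd)
    have a2 : Measurable fun p : (ℝ × ℝ) × ℝ => oscWeight p.1.1 (p.1.2 - p.2) :=
      hm.comp (measurable_fst.fst.prodMk (measurable_fst.snd.sub measurable_snd))
    exact (a1.pow_const 2).mul (a2.pow_const 2)
  have hD : Measurable fun ν => ∫⁻ x, A x ^ 2 * A (ν - x) ^ 2 :=
    Measurable.lintegral_prod_right' (f := fun p : ℝ × ℝ => A p.2 ^ 2 * A (p.1 - p.2) ^ 2) (by fun_prop)
  calc _ ≤ ∫⁻ ρ, ENNReal.ofReal ρ⁻¹ ^ 2 * (ENNReal.ofReal (2 * Real.pi) * ∫⁻ ν,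
          (∫⁻ x, A x ^ 2 * A (ν - x) ^ 2) * ∫⁻ x, oscWeight ρ x ^ 2 * oscWeight ρ (ν - x) ^ 2) ∂freqMeasure := by
        refine lintegral_mono fun ρ => ?_
        gcongr
        simp_rw [hbj (fun y => Real.cos (_ * y)), hbj (fun y => Real.sin (_ * y))]
        refine (lintegral_fourier_quartic_le (hbm ρ) (hbi ρ)).trans ?_
        gcongr with ν
        exact enorm_selfConv_sq_le hAm (hm1 ρ) (hle ρ) ν
    _ = ENNReal.ofReal (2 * Real.pi) * ∫⁻ ρ, (∫⁻ ν, (∫⁻ x, A x ^ 2 * A (ν - x) ^ 2) * (ENNReal.ofReal ρ⁻¹ ^ 2 *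
          ∫⁻ x, oscWeight ρ x ^ 2 * oscWeight ρ (ν - x) ^ 2)) ∂freqMeasure := by
        rw [← lintegral_const_mul' _ _ ENNReal.ofReal_ne_top]
        refine lintegral_congr fun ρ => ?_
        rw [mul_left_comm, ← lintegral_const_mul' _ _ (by finiteness)]
        congr 1
        refine lintegral_congr fun ν => ?_
        rw [mul_left_comm]
    _ = ENNReal.ofReal (2 * Real.pi) * ∫⁻ ν, (∫⁻ ρ, (∫⁻ x, A x ^ 2 * A (ν - x) ^ 2) * (ENNReal.ofReal ρ⁻¹ ^ 2 *
          ∫⁻ x, oscWeight ρ x ^ 2 * oscWeight ρ (ν - x) ^ 2) ∂freqMeasure) := by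
        congr 1
        refine lintegral_lintegral_swap (Measurable.aemeasurable ?_)
        exact (hD.comp measurable_snd).mul (((measurable_fst.inv.ennreal_ofReal).pow_const 2).mul hσ3)
    -- The amplitude factor does not depend on `ρ`, so the uniform bound 4 for the weight comes out
    -- and a total self-convolution integral of `A²` remains.
    _ ≤ ENNReal.ofReal (2 * Real.pi) * ∫⁻ ν, (∫⁻ x, A x ^ 2 * A (ν - x) ^ 2) * 4 := by
        gcongr with ν
        have hmeas : Measurable fun ρ : ℝ => ENNReal.ofReal ρ⁻¹ ^ 2 *
            ∫⁻ x, oscWeight ρ x ^ 2 * oscWeight ρ (ν - x) ^ 2 :=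
          ((measurable_inv.ennreal_ofReal).pow_const 2).mul (hσ3.comp (measurable_id.prodMk measurable_const))
        rw [lintegral_const_mul _ hmeas]
        gcongr
        exact lintegral_oscWeight_conv_le ν
    _ = _ := by
        rw [lintegral_mul_const _ hD, lintegral_self_conv_eq (B := fun x => A x ^ 2) (hAm.pow_const 2), hA2,
          mul_comm _ (4 : ℝ≥0∞), ← mul_assoc, show (4 : ℝ≥0∞) = ENNReal.ofReal 4 by norm_num,
          ← ENNReal.ofReal_mul (by positivity)]
        congr 2; ring

end Strichartz

/-! ### The retarded integral: a Schur test on the reflected light cone. -/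

section Kernel

/-- A Schur test from `L^{4/3}` to `L⁴`, with `p³` as the input. Cauchy–Schwarz applied to `(m p) ·
p²` produces one factor `∫ p⁴`. A second application splits `m² ≤ s r`, where `r²` is integrable in
the second variable and `s²` in the first. -/
theorem lintegral_kernel_quartic_le {X : Type*} [MeasurableSpace X] {μ : Measure X} [SFinite μ]
    {m s r : X → X → ℝ≥0∞} {p : X → ℝ≥0∞} {B : ℝ≥0∞}
    (hm : Measurable (Function.uncurry m)) (hs : Measurable (Function.uncurry s))
    (hr : Measurable (Function.uncurry r)) (hp : Measurable p) (h : ∀ x y, m x y ^ 2 ≤ s x y * r x y)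
    (hsB : ∀ y, ∫⁻ x, s x y ^ 2 ∂μ ≤ B) (hrB : ∀ x, ∫⁻ y, r x y ^ 2 ∂μ ≤ B) :
    ∫⁻ x, (∫⁻ y, m x y * p y ^ 3 ∂μ) ^ 4 ∂μ ≤ B ^ 2 * (∫⁻ y, p y ^ 4 ∂μ) ^ 3 := by
  set A := ∫⁻ y, p y ^ 4 ∂μ with hA
  have m1 : ∀ x, Measurable (m x) := fun x => hm.of_uncurry_left
  have s1 : ∀ x, Measurable (s x) := fun x => hs.of_uncurry_left
  have r1 : ∀ x, Measurable (r x) := fun x => hr.of_uncurry_left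
  have hs' : Measurable fun q : X × X => s q.1 q.2 := hs
  have key : ∀ x, (∫⁻ y, m x y * p y ^ 3 ∂μ) ^ 4 ≤ A ^ 2 * B * ∫⁻ y, s x y ^ 2 * p y ^ 4 ∂μ := by
    intro x
    have h1 : (∫⁻ y, m x y * p y ^ 3 ∂μ) ^ 2 ≤ (∫⁻ y, m x y ^ 2 * p y ^ 2 ∂μ) * A := by
      calc _ = (∫⁻ y, (m x y * p y) * p y ^ 2 ∂μ) ^ 2 := by
            congr 1; refine lintegral_congr fun y => ?_; ring
        _ ≤ (∫⁻ y, (m x y * p y) ^ 2 ∂μ) * ∫⁻ y, (p y ^ 2) ^ 2 ∂μ :=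
            sq_lintegral_mul_le ((m1 x).mul hp).aemeasurable (hp.pow_const 2).aemeasurable
        _ = _ := by simp_rw [mul_pow, ← pow_mul]; rfl
    have h2 : (∫⁻ y, m x y ^ 2 * p y ^ 2 ∂μ) ^ 2 ≤ (∫⁻ y, s x y ^ 2 * p y ^ 4 ∂μ) * B := by
      calc _ ≤ (∫⁻ y, (s x y * p y ^ 2) * r x y ∂μ) ^ 2 := by
            refine pow_le_pow_left' (lintegral_mono fun y => ?_) 2
            calc m x y ^ 2 * p y ^ 2 ≤ (s x y * r x y) * p y ^ 2 := by gcongr; exact h x y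
              _ = _ := by ring
        _ ≤ (∫⁻ y, (s x y * p y ^ 2) ^ 2 ∂μ) * ∫⁻ y, r x y ^ 2 ∂μ :=
            sq_lintegral_mul_le ((s1 x).mul (hp.pow_const 2)).aemeasurable (r1 x).aemeasurable
        _ ≤ _ := by
            simp_rw [mul_pow, ← pow_mul]
            gcongr
            exact hrB x
    calc _ = ((∫⁻ y, m x y * p y ^ 3 ∂μ) ^ 2) ^ 2 := by rw [← pow_mul]
      _ ≤ ((∫⁻ y, m x y ^ 2 * p y ^ 2 ∂μ) * A) ^ 2 := by gcongr
      _ = (∫⁻ y, m x y ^ 2 * p y ^ 2 ∂μ) ^ 2 * A ^ 2 := mul_pow _ _ _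
      _ ≤ ((∫⁻ y, s x y ^ 2 * p y ^ 4 ∂μ) * B) * A ^ 2 := by gcongr
      _ = _ := by ring
  have hsp : Measurable fun q : X × X => s q.1 q.2 ^ 2 * p q.2 ^ 4 := by fun_prop
  calc _ ≤ ∫⁻ x, A ^ 2 * B * ∫⁻ y, s x y ^ 2 * p y ^ 4 ∂μ ∂μ := lintegral_mono key
    _ = A ^ 2 * B * ∫⁻ x, ∫⁻ y, s x y ^ 2 * p y ^ 4 ∂μ ∂μ :=
        lintegral_const_mul _ (Measurable.lintegral_prod_right' hsp)
    _ = A ^ 2 * B * ∫⁻ y, ∫⁻ x, s x y ^ 2 * p y ^ 4 ∂μ ∂μ := by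
        rw [lintegral_lintegral_swap hsp.aemeasurable]
    _ ≤ A ^ 2 * B * ∫⁻ y, B * p y ^ 4 ∂μ := by
        gcongr with y
        have hsy : Measurable fun x => s x y := hs'.comp (measurable_id.prodMk measurable_const)
        rw [lintegral_mul_const _ (hsy.pow_const 2)]
        gcongr
        exact hsB y
    _ = _ := by
        rw [lintegral_const_mul _ (hp.pow_const 4)]; ring

/-- The backward light cone reflected at the boundary, as a relation between the space-time points
`(t, ρ)` and `(τ, ρ')`. -/
def coneSet : Set ((ℝ × ℝ) × (ℝ × ℝ)) :=
  {q | |q.1.2 - q.2.2| ≤ q.1.1 - q.2.1 ∧ q.1.1 - q.2.1 ≤ q.1.2 + q.2.2}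

theorem measurableSet_coneSet : MeasurableSet coneSet := by
  have h1 : MeasurableSet {q : (ℝ × ℝ) × (ℝ × ℝ) | |q.1.2 - q.2.2| ≤ q.1.1 - q.2.1} :=
    measurableSet_le (by fun_prop) (by fun_prop)
  have h2 : MeasurableSet {q : (ℝ × ℝ) × (ℝ × ℝ) | q.1.1 - q.2.1 ≤ q.1.2 + q.2.2} :=
    measurableSet_le (by fun_prop) (by fun_prop)
  exact h1.inter h2

/-- The indicator of `coneSet` with a power weight. -/
def coneKer (a b : ℝ) (x y : ℝ × ℝ) : ℝ≥0∞ :=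
  coneSet.indicator (fun q => ENNReal.ofReal (q.1.2 ^ a) * ENNReal.ofReal (q.2.2 ^ b)) (x, y)

theorem measurable_coneKer (a b : ℝ) : Measurable (Function.uncurry (coneKer a b)) := by
  have : Measurable fun q : (ℝ × ℝ) × (ℝ × ℝ) => ENNReal.ofReal (q.1.2 ^ a) * ENNReal.ofReal (q.2.2 ^ b) :=
    (measurable_fst.snd.pow_const a).ennreal_ofReal.mul (measurable_snd.snd.pow_const b).ennreal_ofReal
  exact this.indicator measurableSet_coneSet

theorem coneKer_mul (a b a' b' : ℝ) {x y : ℝ × ℝ} (hx : 0 < x.2) (hy : 0 < y.2) :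
    coneKer a b x y * coneKer a' b' x y = coneKer (a + a') (b + b') x y := by
  unfold coneKer
  by_cases h : (x, y) ∈ coneSet
  · simp only [indicator_of_mem h]
    rw [Real.rpow_add hx, Real.rpow_add hy, ENNReal.ofReal_mul (by positivity), ENNReal.ofReal_mul (by positivity)]
    ring
  · simp only [indicator_of_notMem h, zero_mul]

/-- At fixed radii the cone admits time differences between `|ρ - σ|` and `ρ + σ`. The short length
`2 min ρ σ` of this range compensates the singular power weights in the radii. -/
theorem volume_cone (ρ σ u : ℝ) :
    volume (Icc (u + |ρ - σ|) (u + (ρ + σ))) = ENNReal.ofReal (2 * min ρ σ) := by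
  rw [Real.volume_Icc]
  congr 1
  rcases le_total ρ σ with h | h
  · rw [min_eq_left h, abs_of_nonpos (by linarith)]; ring
  · rw [min_eq_right h, abs_of_nonneg (by linarith)]; ring

theorem lintegral_min_weight {σ : ℝ} (hσ : 0 < σ) :
    ∫⁻ ρ, ENNReal.ofReal (ρ ^ (-3 / 2 : ℝ)) * ENNReal.ofReal (σ ^ (-1 / 2 : ℝ)) * ENNReal.ofReal (2 * min ρ σ)
      ∂freqMeasure ≤ 8 := by
  calc _ = ∫⁻ ρ, ENNReal.ofReal (2 * σ ^ (-1 / 2 : ℝ)) * ENNReal.ofReal (min σ ρ * ρ ^ (-3 / 2 : ℝ)) ∂freqMeasure := by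
        refine lintegral_congr_ae ?_
        filter_upwards [ae_freqMeasure_pos] with ρ hρ
        have : 0 < min ρ σ := lt_min hρ hσ
        rw [← ENNReal.ofReal_mul (by positivity), ← ENNReal.ofReal_mul (by positivity),
          ← ENNReal.ofReal_mul (by positivity), min_comm]
        congr 1; ring
    _ ≤ ENNReal.ofReal (2 * σ ^ (-1 / 2 : ℝ)) * ENNReal.ofReal (4 * √σ) := by
        rw [lintegral_const_mul' _ _ ENNReal.ofReal_ne_top]
        gcongr
        exact lintegral_min_mul_rpow hσ
    _ = 8 := by
        rw [← ENNReal.ofReal_mul (by positivity), Real.sqrt_eq_rpow]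
        have : σ ^ (-1 / 2 : ℝ) * σ ^ (1 / 2 : ℝ) = 1 := by rw [← Real.rpow_add hσ]; norm_num
        rw [show 2 * σ ^ (-1 / 2 : ℝ) * (4 * σ ^ (1 / 2 : ℝ)) = 8 by linear_combination 8 * this]
        norm_num

/-- Space-time measure on `(0, T] × (0, ∞)`. -/
def slabMeasure (T : ℝ) : Measure (ℝ × ℝ) := (volume.restrict (Ioc 0 T)).prod freqMeasure

instance (T : ℝ) : SFinite (slabMeasure T) := by unfold slabMeasure; infer_instance

theorem ae_slabMeasure_pos (T : ℝ) : ∀ᵐ x ∂(slabMeasure T), 0 < x.2 :=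
  Measure.quasiMeasurePreserving_snd.ae ae_freqMeasure_pos

theorem lintegral_slabMeasure (T : ℝ) {f : ℝ × ℝ → ℝ≥0∞} (hf : Measurable f) :
    ∫⁻ x, f x ∂(slabMeasure T) = ∫⁻ t in Ioc 0 T, (∫⁻ ρ, f (t, ρ) ∂freqMeasure) :=
  lintegral_prod _ hf.aemeasurable

theorem lintegral_slabMeasure_symm (T : ℝ) {f : ℝ × ℝ → ℝ≥0∞} (hf : Measurable f) :
    ∫⁻ x, f x ∂(slabMeasure T) = ∫⁻ ρ, (∫⁻ t in Ioc 0 T, f (t, ρ)) ∂freqMeasure :=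
  lintegral_prod_symm _ hf.aemeasurable

theorem lintegral_coneKer_fst_le (T : ℝ) {y : ℝ × ℝ} (hy : 0 < y.2) :
    ∫⁻ x, coneKer (-3 / 2) (-1 / 2) x y ∂(slabMeasure T) ≤ 8 := by
  have hm : Measurable fun x => coneKer (-3 / 2) (-1 / 2) x y :=
    (measurable_coneKer (-3 / 2) (-1 / 2)).comp (measurable_id.prodMk measurable_const)
  rw [lintegral_slabMeasure_symm T hm]
  refine le_trans (lintegral_mono_ae ?_) (lintegral_min_weight hy)
  filter_upwards [ae_freqMeasure_pos] with ρ hρ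
  rw [← volume_cone ρ y.2 y.1, ← lintegral_indicator_const measurableSet_Icc]
  refine (setLIntegral_le_lintegral _ _).trans (lintegral_mono fun t => ?_)
  unfold coneKer
  by_cases h : ((t, ρ), y) ∈ coneSet
  · rw [indicator_of_mem h, indicator_of_mem]
    obtain ⟨h1, h2⟩ := h
    simp only at h1 h2
    constructor <;> linarith
  · rw [indicator_of_notMem h]; exact zero_le

theorem lintegral_coneKer_snd_le (T : ℝ) {x : ℝ × ℝ} (hx : 0 < x.2) :
    ∫⁻ y, coneKer (-1 / 2) (-3 / 2) x y ∂(slabMeasure T) ≤ 8 := by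
  have hm : Measurable fun y => coneKer (-1 / 2) (-3 / 2) x y :=
    (measurable_coneKer (-1 / 2) (-3 / 2)).of_uncurry_left
  rw [lintegral_slabMeasure_symm T hm]
  refine le_trans (lintegral_mono_ae ?_) (lintegral_min_weight hx)
  filter_upwards [ae_freqMeasure_pos] with σ hσ
  have hv : volume (Icc (x.1 - (σ + x.2)) (x.1 - |σ - x.2|)) = ENNReal.ofReal (2 * min σ x.2) := by
    rw [← volume_cone σ x.2 0, Real.volume_Icc, Real.volume_Icc]
    congr 1; ring
  rw [← hv, ← lintegral_indicator_const measurableSet_Icc]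
  refine (setLIntegral_le_lintegral _ _).trans (lintegral_mono fun t => ?_)
  unfold coneKer
  by_cases h : (x, (t, σ)) ∈ coneSet
  · rw [indicator_of_mem h, indicator_of_mem, mul_comm]
    obtain ⟨h1, h2⟩ := h
    simp only at h1 h2
    rw [abs_sub_comm] at h1
    constructor <;> linarith
  · rw [indicator_of_notMem h]; exact zero_le

theorem lintegral_coneKer_quartic_le (T : ℝ) {p : ℝ × ℝ → ℝ≥0∞} (hp : Measurable p) :
    ∫⁻ x, (∫⁻ y, coneKer (-1 / 2) (-1 / 2) x y * p y ^ 3 ∂(slabMeasure T)) ^ 4 ∂(slabMeasure T)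
      ≤ 64 * (∫⁻ y, p y ^ 4 ∂(slabMeasure T)) ^ 3 := by
  -- the kernels are cut off to the half plane, where the exponents add up
  set S : Set ((ℝ × ℝ) × (ℝ × ℝ)) := {q | 0 < q.1.2 ∧ 0 < q.2.2} with hS
  have hSm : MeasurableSet S := by
    have h1 : MeasurableSet {q : (ℝ × ℝ) × (ℝ × ℝ) | 0 < q.1.2} := measurableSet_lt measurable_const (by fun_prop)
    have h2 : MeasurableSet {q : (ℝ × ℝ) × (ℝ × ℝ) | 0 < q.2.2} := measurableSet_lt measurable_const (by fun_prop)
    exact h1.inter h2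
  set k : ℝ → ℝ → ℝ × ℝ → ℝ × ℝ → ℝ≥0∞ := fun a b x y => S.indicator (Function.uncurry (coneKer a b)) (x, y) with hk
  have hkm : ∀ a b, Measurable (Function.uncurry (k a b)) := fun a b => (measurable_coneKer a b).indicator hSm
  have hkmul : ∀ a b a' b' x y, k a b x y * k a' b' x y = k (a + a') (b + b') x y := by
    intro a b a' b' x y
    by_cases h : (x, y) ∈ S
    · simp only [hk, indicator_of_mem h, Function.uncurry]
      exact coneKer_mul _ _ _ _ h.1 h.2
    · simp only [hk, indicator_of_notMem h, zero_mul]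
  have hkle : ∀ a b x y, k a b x y ≤ coneKer a b x y := fun a b x y =>
    indicator_le_self S (Function.uncurry (coneKer a b)) (x, y)
  have hkz : ∀ a b x y, ¬ (0 < x.2 ∧ 0 < y.2) → k a b x y = 0 := fun a b x y h =>
    indicator_of_notMem (show (x, y) ∉ S from h) _
  have e1 : (-3 / 4 : ℝ) + -3 / 4 = -3 / 2 := by norm_num
  have e2 : (-1 / 4 : ℝ) + -1 / 4 = -1 / 2 := by norm_num
  -- The square of the kernel with exponents `(-1/2, -1/2)` is the product of those with `(-3/4,
  -- -1/4)` and `(-1/4, -3/4)`. Their squares integrate to at most 8 in the first and in the second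
  -- variable respectively; hence `64 = 8²`.
  have main := lintegral_kernel_quartic_le (μ := slabMeasure T) (m := k (-1 / 2) (-1 / 2))
    (s := k (-3 / 4) (-1 / 4)) (r := k (-1 / 4) (-3 / 4)) (B := 8) (hkm _ _) (hkm _ _) (hkm _ _) hp
    (fun x y => by rw [pow_two, hkmul, hkmul]; norm_num)
    (fun y => by
      simp_rw [pow_two, hkmul, e1, e2]
      by_cases hy : 0 < y.2
      · exact (lintegral_mono fun x => hkle _ _ x y).trans (lintegral_coneKer_fst_le T hy)
      · simp [hkz _ _ _ _ (fun h => hy h.2)])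
    (fun x => by
      simp_rw [pow_two, hkmul, e1, e2]
      by_cases hx : 0 < x.2
      · exact (lintegral_mono fun y => hkle _ _ x y).trans (lintegral_coneKer_snd_le T hx)
      · simp [hkz _ _ _ _ (fun h => hx h.1)])
  refine le_trans (le_of_eq ?_) (main.trans (by norm_num))
  refine lintegral_congr_ae ?_
  filter_upwards [ae_slabMeasure_pos T] with x hx
  congr 1
  refine lintegral_congr_ae ?_
  filter_upwards [ae_slabMeasure_pos T] with y hy
  have : (x, y) ∈ S := ⟨hx, hy⟩
  simp only [hk, indicator_of_mem this, Function.uncurry]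

/-- The triangle inequalities are symmetric: with `s = t - τ`, the condition `|ρ - s| ≤ σ ≤ ρ + s`
is the same as `|ρ - σ| ≤ s ≤ ρ + σ`. The domain of integration therefore lies in `coneSet`. -/
theorem enorm_cone_integral_le (P : ℝ → ℝ → ℝ) {t T ρ : ℝ} (htT : t ≤ T) (hρ : 0 ≤ ρ)
    (hP : Measurable (Function.uncurry P)) :
    ‖(1 / 2) * ∫ τ in Ioc 0 t, ∫ σ in |ρ - (t - τ)|..(ρ + (t - τ)), P τ σ‖ₑ
      ≤ ∫⁻ y, coneKer 0 0 (t, ρ) y * ‖P y.1 y.2‖ₑ ∂(slabMeasure T) := by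
  have hP' : Measurable fun q : ℝ × ℝ => P q.1 q.2 := hP
  have hm : Measurable fun y : ℝ × ℝ => coneKer 0 0 (t, ρ) y * ‖P y.1 y.2‖ₑ :=
    (measurable_coneKer 0 0).of_uncurry_left.mul hP'.enorm
  rw [lintegral_slabMeasure T hm, enorm_mul]
  have h1 : ‖(1 / 2 : ℝ)‖ₑ ≤ 1 := by
    rw [← ofReal_norm, ENNReal.ofReal_le_one]; norm_num
  refine (mul_le_of_le_one_left' h1).trans ((enorm_integral_le_lintegral_enorm _).trans ?_)
  refine le_trans (setLIntegral_mono' measurableSet_Ioc fun τ hτ => ?_)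
    (lintegral_mono_set (Ioc_subset_Ioc_right htT))
  have hle : |ρ - (t - τ)| ≤ ρ + (t - τ) := by
    rw [abs_le]; constructor <;> linarith [hτ.2]
  rw [intervalIntegral.integral_of_le hle]
  refine (enorm_integral_le_lintegral_enorm _).trans ?_
  rw [freqMeasure, ← lintegral_indicator measurableSet_Ioc, ← lintegral_indicator measurableSet_Ioi]
  refine lintegral_mono fun σ => ?_
  by_cases hσ : σ ∈ Ioc |ρ - (t - τ)| (ρ + (t - τ))
  · have hσ0 : σ ∈ Ioi (0 : ℝ) := (abs_nonneg _).trans_lt hσ.1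
    rw [indicator_of_mem hσ, indicator_of_mem hσ0]
    have hc : ((t, ρ), (τ, σ)) ∈ coneSet := by
      have := abs_lt.1 hσ.1
      refine ⟨abs_le.2 ⟨?_, ?_⟩, ?_⟩ <;> simp only <;> linarith [hσ.2]
    simp [coneKer, indicator_of_mem hc]
  · rw [indicator_of_notMem hσ]; exact zero_le

end Kernel

/-! ### Application of the space-time estimate to the two free waves. -/

section FreeWaves

variable {α : ℝ → ℝ}

theorem measurable_sineT_family {g : ℝ → ℝ → ℝ} (hg : Measurable (Function.uncurry g)) :
    Measurable fun p : ℝ × ℝ => sineT (g p.1) p.2 := by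
  have hg' : Measurable fun q : ℝ × ℝ => g q.1 q.2 := hg
  refine Measurable.const_mul ?_ _
  refine (StronglyMeasurable.integral_prod_right' (f := fun q : (ℝ × ℝ) × ℝ =>
    Real.sin (q.2 * q.1.2) * g q.1.1 q.2) (Measurable.stronglyMeasurable ?_)).measurable
  exact (by fun_prop : Measurable fun q : (ℝ × ℝ) × ℝ => Real.sin (q.2 * q.1.2)).mul
    (hg'.comp (measurable_fst.fst.prodMk measurable_snd))

/-- The cosine and the sine wave are each dominated by the sum of squares in
`lintegral_freeWave_quartic_le`. That estimate integrates over all times, so the bound does not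
depend on `T`. -/
theorem lintegral_free_quartic_le (hint : Integrable α freqMeasure) {φ : ℝ → ℝ}
    (hφ : φ = Real.cos ∨ φ = Real.sin) (T : ℝ) :
    ∫⁻ x, ENNReal.ofReal x.2⁻¹ ^ 2 * ‖sineT (fun y => φ (x.1 * y) * α y) x.2‖ₑ ^ 4 ∂(slabMeasure T)
      ≤ ENNReal.ofReal (8 * Real.pi) * (∫⁻ y, ENNReal.ofReal y * ‖α y‖ₑ ^ 2 ∂freqMeasure) ^ 2 := by
  set β := hint.1.mk with hβ
  have hβm : Measurable β := hint.1.stronglyMeasurable_mk.measurable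
  have e : α =ᵐ[freqMeasure] β := hint.1.ae_eq_mk
  have hβi : Integrable β freqMeasure := hint.congr e
  have hφm : Measurable φ := by
    rcases hφ with h | h <;> rw [h] <;> fun_prop
  have e1 : ∀ x : ℝ × ℝ, sineT (fun y => φ (x.1 * y) * α y) x.2 = sineT (fun y => φ (x.1 * y) * β y) x.2 := by
    intro x
    refine sineT_congr ?_ _
    filter_upwards [e] with y hy
    rw [hy]
  have e2 : ∫⁻ y, ENNReal.ofReal y * ‖α y‖ₑ ^ 2 ∂freqMeasure = ∫⁻ y, ENNReal.ofReal y * ‖β y‖ₑ ^ 2 ∂freqMeasure := by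
    refine lintegral_congr_ae ?_
    filter_upwards [e] with y hy
    rw [hy]
  simp_rw [e1]
  rw [e2]
  have hm : Measurable fun x : ℝ × ℝ => sineT (fun y => φ (x.1 * y) * β y) x.2 :=
    measurable_sineT_family (g := fun t y => φ (t * y) * β y)
      ((hφm.comp (measurable_fst.mul measurable_snd)).mul (hβm.comp measurable_snd))
  have hm2 : Measurable fun x : ℝ × ℝ =>
      ENNReal.ofReal x.2⁻¹ ^ 2 * ‖sineT (fun y => φ (x.1 * y) * β y) x.2‖ₑ ^ 4 :=
    ((measurable_snd.inv.ennreal_ofReal).pow_const 2).mul (hm.enorm.pow_const 4)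
  rw [lintegral_slabMeasure_symm T hm2]
  refine le_trans (lintegral_mono fun ρ => ?_) (lintegral_freeWave_quartic_le hβm hβi)
  dsimp only
  rw [lintegral_const_mul' _ _ (by finiteness)]
  refine mul_le_mul' le_rfl ?_
  refine (setLIntegral_le_lintegral _ _).trans (lintegral_mono fun t => ?_)
  have h1 : ‖sineT (fun y => φ (t * y) * β y) ρ‖ ≤ ‖∫ y, φ (t * y) * (Real.sin (y * ρ) * β y) ∂freqMeasure‖ := by
    rw [sineT, norm_mul, Real.norm_of_nonneg (Real.sqrt_nonneg _)]
    refine (mul_le_of_le_one_left (norm_nonneg _) sqrt_two_div_pi_le_one).trans (le_of_eq ?_)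
    congr 1
    refine integral_congr_ae (ae_of_all _ fun y => ?_)
    ring
  rw [← ofReal_norm, ← ENNReal.ofReal_pow (norm_nonneg _)]
  refine ENNReal.ofReal_le_ofReal ((pow_le_pow_left₀ (norm_nonneg _) h1 4).trans ?_)
  rw [Real.norm_eq_abs, show (4 : ℕ) = 2 * 2 from rfl, pow_mul, sq_abs]
  refine pow_le_pow_left₀ (sq_nonneg _) ?_ 2
  rcases hφ with h | h <;> rw [h]
  · exact le_add_of_nonneg_right (sq_nonneg _)
  · exact le_add_of_nonneg_left (sq_nonneg _)

theorem SineAdm.add {g h : ℝ → ℝ} (hg : SineAdm g) (hh : SineAdm h) : SineAdm (fun y => g y + h y) := by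
  unfold SineAdm at *
  simpa only [mul_add] using! Integrable.add hg hh

theorem SineAdm.sineT_add {g h : ℝ → ℝ} (hg : SineAdm g) (hh : SineAdm h) (x : ℝ) :
    sineT (fun y => g y + h y) x = sineT g x + sineT h x := by
  have := (hg.add hh).sineT_sub hh x
  simp only [add_sub_cancel_right] at this
  linarith

theorem sineAdm_of_integrable (hα : Integrable α freqMeasure) : SineAdm α := by
  refine hα.mono (Measurable.aestronglyMeasurable (by fun_prop) |>.mul hα.1) ?_
  filter_upwards [ae_freqMeasure_pos] with y hy
  rw [norm_mul, Real.norm_of_nonneg (le_min zero_le_one hy.le)]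
  exact mul_le_of_le_one_left (norm_nonneg _) (min_le_left _ _)

end FreeWaves

/-! ### The continuity argument. -/

section Barrier

/-- To exceed `2D`, the continuous function would have to take the value `2D`, where the inequality
reads `D ≤ 32768 D³`, contradicting `hsmall`. Here `32768 = 4096 · 2³`. -/
theorem le_two_mul_of_barrier {Q : ℝ → ℝ} {D T : ℝ} (hT : 0 ≤ T) (hQ : ContinuousOn Q (Icc 0 T)) (h0 : Q 0 = 0)
    (hD : 0 < D) (hsmall : 32768 * D ^ 2 < 1) (h : ∀ t ∈ Icc 0 T, Q t ≤ D + 4096 * Q t ^ 3) : Q T ≤ 2 * D := by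
  by_contra! hc
  obtain ⟨t, ht, e⟩ := intermediate_value_Icc hT hQ (show 2 * D ∈ Icc (Q 0) (Q T) from
    ⟨by rw [h0]; positivity, hc.le⟩)
  have := h t ht
  rw [e] at this
  nlinarith [mul_pos hD hD]

theorem lintegral_one_add_rpow_lt_top : ∫⁻ ρ, ENNReal.ofReal ((1 + ρ) ^ (-3 / 2 : ℝ)) ∂freqMeasure < ⊤ := by
  have h : IntegrableOn (fun x : ℝ => (x + 1) ^ (-3 / 2 : ℝ)) (Ioi 0) :=
    integrableOn_add_rpow_Ioi_of_lt (by norm_num) (by norm_num)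
  simp_rw [add_comm (1 : ℝ)]
  exact Integrable.lintegral_lt_top h

end Barrier

/-! ### The integral equation in physical space. -/

section FieldEquation

variable {g : ℝ → ℝ}

theorem SineAdm.bdd_mul (hg : SineAdm g) {φ : ℝ → ℝ} (hφ : Measurable φ) (h1 : ∀ x, |φ x| ≤ 1) :
    SineAdm fun y => φ y * g y := by
  refine (integrable_bdd_mul hg hφ h1).congr (ae_of_all _ fun y => ?_)
  ring

/-- Duhamel's formula in physical space. -/
theorem IsDuhamel.field_eq {I : Set ℝ} {a b : ℝ → ℝ} {F : ℝ → E3 → ℝ} {u P : ℝ → ℝ → ℝ}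
    (h : IsDuhamel I a b F u) (hI0 : ∀ t ∈ I, Ioc 0 t ⊆ I)
    (hP : ∀ τ ∈ I, Measurable (P τ)) (hF : ∀ τ ∈ I, ∀ x ∈ Omega, F τ x = P τ (‖x‖ - 1) / ‖x‖)
    (ha : SineAdm a) (hb : SineAdm fun y => b y / y) {t : ℝ} (ht : t ∈ I) (ht0 : 0 ≤ t) {ρ : ℝ} (hρ : 0 ≤ ρ) :
    sineT (u t) ρ = sineT (fun y => Real.cos (t * y) * a y) ρ + sineT (fun y => Real.sin (t * y) * (b y / y)) ρ
      + (1 / 2) * ∫ τ in Ioc 0 t, ∫ σ in |ρ - (t - τ)|..(ρ + (t - τ)), P τ σ := by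
  obtain ⟨G, hG, h1, h2, h3⟩ := h.exists_measurable hI0
  have hmem : ∀ᵐ τ ∂(volume.restrict (Ioc 0 t)), τ ∈ I := by
    filter_upwards [ae_restrict_mem measurableSet_Ioc] with τ hτ using hI0 t ht hτ
  have hs : ∀ᵐ τ ∂(volume.restrict (Ioc 0 t)), IsSine (P τ) (G τ) := by
    filter_upwards [hmem, ae_mono (Measure.restrict_mono (hI0 t ht) le_rfl) h1] with τ k1 k2
    exact (isDftL2_iff (hP τ k1) (hF τ k1)).1 k2
  have hPm : ∀ᵐ τ ∂(volume.restrict (Ioc 0 t)), AEStronglyMeasurable (P τ) freqMeasure := by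
    filter_upwards [hmem] with τ k1 using (hP τ k1).aestronglyMeasurable
  have ac : SineAdm fun y => Real.cos (t * y) * a y :=
    ha.bdd_mul (by fun_prop) fun x => Real.abs_cos_le_one _
  have bc : SineAdm fun y => Real.sin (t * y) * (b y / y) :=
    hb.bdd_mul (by fun_prop) fun x => Real.abs_sin_le_one _
  have dc : SineAdm (duhamelInt G t) := sineAdm_of_memLp (memLp_duhamelInt hG ht0 (h2 t ht ht0))
  rw [← sineT_duhamelInt hG ht0 (h2 t ht ht0) hPm hs hρ, ← ac.sineT_add bc, ← (ac.add bc).sineT_add dc]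
  refine sineT_congr ?_ _
  filter_upwards [h3 t ht ht0] with y hy
  rw [hy]; ring

end FieldEquation

/-! ### Small global space-time norm of the cubic wave. -/

section CubicField

variable {s : ℝ} {a b : ℝ → ℝ} {w : ℝ → ℝ → ℝ}

theorem invDft_profile (g : ℝ → ℝ) (x : E3) : invDft g x = sineT g (‖x‖ - 1) / (1 + (‖x‖ - 1)) := by
  rw [invDft_eq]; congr 1; ring

/-- The radial profile of the cubic nonlinearity. -/
def cubicProfile (w : ℝ → ℝ → ℝ) (τ ρ : ℝ) : ℝ := -(sineT (w τ) ρ) ^ 3 / (1 + ρ) ^ 2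

/-- The scale invariant density of the wave `w`. -/
def fieldDensity (w : ℝ → ℝ → ℝ) (x : ℝ × ℝ) : ℝ≥0∞ :=
  ‖sineT (w x.1) x.2‖ₑ * ENNReal.ofReal ((1 + x.2) ^ (-1 / 2 : ℝ))

theorem IsGlobalCubicSolution.measurable_field (hw : IsGlobalCubicSolution s a b w) (hs : 1 / 2 < s) :
    Measurable fun p : ℝ × ℝ => sineT (w p.1) p.2 := (hw.continuous_field hs).measurable

theorem IsGlobalCubicSolution.measurable_cubicProfile (hw : IsGlobalCubicSolution s a b w) (hs : 1 / 2 < s) :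
    Measurable (Function.uncurry (cubicProfile w)) :=
  ((hw.measurable_field hs).pow_const 3).neg.div ((measurable_const.add measurable_snd).pow_const 2)

theorem IsGlobalCubicSolution.measurable_fieldDensity (hw : IsGlobalCubicSolution s a b w) (hs : 1 / 2 < s) :
    Measurable (fieldDensity w) :=
  (hw.measurable_field hs).enorm.mul ((measurable_const.add measurable_snd).pow_const _).ennreal_ofReal

theorem IsGlobalCubicSolution.field_eq (hw : IsGlobalCubicSolution s a b w) (hs : 1 / 2 < s)
    (ha : Integrable a freqMeasure) (hb : Integrable (fun y => b y / y) freqMeasure) {t ρ : ℝ} (ht : 0 ≤ t)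
    (hρ : 0 ≤ ρ) :
    sineT (w t) ρ = sineT (fun y => Real.cos (t * y) * a y) ρ + sineT (fun y => Real.sin (t * y) * (b y / y)) ρ
      + (1 / 2) * ∫ τ in Ioc 0 t, ∫ σ in |ρ - (t - τ)|..(ρ + (t - τ)), cubicProfile w τ σ := by
  refine hw.duhamel.field_eq (fun _ _ => subset_univ _)
    (fun τ _ => (hw.measurable_cubicProfile hs).of_uncurry_left) (fun τ _ x hx => ?_)
    (sineAdm_of_integrable ha) (sineAdm_of_integrable hb) trivial ht hρ
  have hx1 : 1 < ‖x‖ := by simpa [Omega] using hx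
  rw [invDft_profile, cubicProfile]
  have : 1 + (‖x‖ - 1) = ‖x‖ := by ring
  rw [this]
  have : ‖x‖ ≠ 0 := by positivity
  field_simp

theorem add_add_pow_four_le (x y z : ℝ) : (x + y + z) ^ 4 ≤ 64 * (x ^ 4 + y ^ 4 + z ^ 4) := by
  have h : ∀ u v : ℝ, (u + v) ^ 4 ≤ 8 * (u ^ 4 + v ^ 4) := by
    intro u v
    nlinarith [sq_nonneg (u - v), sq_nonneg (u ^ 2 - v ^ 2), sq_nonneg (u + v), sq_nonneg (u ^ 2 + v ^ 2 - 2 * u * v),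
      mul_nonneg (sq_nonneg (u - v)) (sq_nonneg (u + v)), mul_nonneg (sq_nonneg (u - v)) (sq_nonneg u),
      mul_nonneg (sq_nonneg (u - v)) (sq_nonneg v)]
  have h1 := h (x + y) z
  have h2 := h x y
  have : 0 ≤ z ^ 4 := by positivity
  linarith

theorem enorm_add_add_pow_four_le (x y z : ℝ) :
    ‖x + y + z‖ₑ ^ 4 ≤ 64 * (‖x‖ₑ ^ 4 + ‖y‖ₑ ^ 4 + ‖z‖ₑ ^ 4) := by
  have e : ∀ u : ℝ, ‖u‖ₑ ^ 4 = ENNReal.ofReal (u ^ 4) := fun u => by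
    rw [← ofReal_norm, ← ENNReal.ofReal_pow (norm_nonneg _), Real.norm_eq_abs]
    congr 1
    exact Even.pow_abs (by decide) u
  rw [e, e, e, e, ← ENNReal.ofReal_add (by positivity) (by positivity),
    ← ENNReal.ofReal_add (by positivity) (by positivity), show (64 : ℝ≥0∞) = ENNReal.ofReal 64 by norm_num,
    ← ENNReal.ofReal_mul (by positivity)]
  exact ENNReal.ofReal_le_ofReal (add_add_pow_four_le x y z)

/-- The weight `(1 + ρ)^{-2}` natural for the exterior domain is weaker than `ρ^{-2}`, for which the
half line estimate of free waves holds. -/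
theorem fieldDensity_pow_four_le (w : ℝ → ℝ → ℝ) {x : ℝ × ℝ} (hx : 0 < x.2) :
    fieldDensity w x ^ 4 ≤ ENNReal.ofReal x.2⁻¹ ^ 2 * ‖sineT (w x.1) x.2‖ₑ ^ 4 := by
  rw [fieldDensity, mul_pow, mul_comm]
  refine mul_le_mul' ?_ le_rfl
  rw [← ENNReal.ofReal_pow (by positivity), ← ENNReal.ofReal_pow (by positivity), ← Real.rpow_natCast,
    ← Real.rpow_mul (by positivity), ← Real.rpow_natCast, ← Real.rpow_neg_one, ← Real.rpow_mul hx.le]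
  refine ENNReal.ofReal_le_ofReal ?_
  rw [show (-1 / 2 * ((4 : ℕ) : ℝ)) = -1 * ((2 : ℕ) : ℝ) by norm_num]
  exact Real.rpow_le_rpow_of_nonpos hx (by linarith) (by norm_num)

/-- Of the four factors `(1 + ρ)^{-1/2}` in `(1 + ρ)^{-2}`, three are spent on `fieldDensity³` and
the fourth is weakened to `ρ^{-1/2}`, the weight of the cone kernel in its second variable. -/
theorem enorm_cubicProfile_le (w : ℝ → ℝ → ℝ) {y : ℝ × ℝ} (hy : 0 < y.2) :
    ‖cubicProfile w y.1 y.2‖ₑ ≤ ENNReal.ofReal (y.2 ^ (-1 / 2 : ℝ)) * fieldDensity w y ^ 3 := by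
  have h1 : 0 < 1 + y.2 := by linarith
  rw [cubicProfile, fieldDensity, ← ofReal_norm, ← ofReal_norm, ← ENNReal.ofReal_mul (norm_nonneg _),
    ← ENNReal.ofReal_pow (by positivity), ← ENNReal.ofReal_mul (by positivity)]
  refine ENNReal.ofReal_le_ofReal ?_
  rw [norm_div, norm_neg, norm_pow, norm_pow, Real.norm_of_nonneg h1.le, mul_pow, ← Real.rpow_natCast (_ ^ _) 3,
    ← Real.rpow_mul h1.le, div_eq_mul_inv, mul_left_comm]
  gcongr
  calc ((1 + y.2) ^ 2)⁻¹ = (1 + y.2) ^ (-1 / 2 : ℝ) * (1 + y.2) ^ (-3 / 2 : ℝ) := by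
        rw [← Real.rpow_add h1, ← Real.rpow_natCast, ← Real.rpow_neg h1.le]; norm_num
    _ ≤ y.2 ^ (-1 / 2 : ℝ) * (1 + y.2) ^ (-1 / 2 * ((3 : ℕ) : ℝ)) := by
        refine mul_le_mul (Real.rpow_le_rpow_of_nonpos hy (by linarith) (by norm_num)) (le_of_eq ?_)
          (by positivity) (by positivity)
        norm_num

theorem weighted_cone_le (w : ℝ → ℝ → ℝ) {x y : ℝ × ℝ} (hy : 0 < y.2) :
    ENNReal.ofReal (x.2 ^ (-1 / 2 : ℝ)) * (coneKer 0 0 x y * ‖cubicProfile w y.1 y.2‖ₑ)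
      ≤ coneKer (-1 / 2) (-1 / 2) x y * fieldDensity w y ^ 3 := by
  unfold coneKer
  by_cases h : (x, y) ∈ coneSet
  · simp only [indicator_of_mem h, Real.rpow_zero, ENNReal.ofReal_one, one_mul]
    rw [mul_assoc]
    gcongr
    exact enorm_cubicProfile_le w hy
  · simp [indicator_of_notMem h]

/-- Two free waves and the retarded integral are added: the first 64 bounds the fourth power of a
sum of three terms, and `4096 = 64 · 64` includes the constant of the cone kernel. The inequality is
useful only once the left side is known to be finite. -/
theorem IsGlobalCubicSolution.quartic_le (hw : IsGlobalCubicSolution s a b w) (hs : 1 / 2 < s)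
    (ha : Integrable a freqMeasure) (hb : Integrable (fun y => b y / y) freqMeasure) (T : ℝ) :
    ∫⁻ x, fieldDensity w x ^ 4 ∂(slabMeasure T)
      ≤ 64 * (ENNReal.ofReal (8 * Real.pi) * (∫⁻ y, ENNReal.ofReal y * ‖a y‖ₑ ^ 2 ∂freqMeasure) ^ 2
        + ENNReal.ofReal (8 * Real.pi) * (∫⁻ y, ENNReal.ofReal y * ‖b y / y‖ₑ ^ 2 ∂freqMeasure) ^ 2)
        + 4096 * (∫⁻ x, fieldDensity w x ^ 4 ∂(slabMeasure T)) ^ 3 := by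
  have hp := hw.measurable_fieldDensity hs
  have hK := lintegral_coneKer_quartic_le T hp
  set K : ℝ × ℝ → ℝ≥0∞ := fun x => ∫⁻ y, coneKer (-1 / 2) (-1 / 2) x y * fieldDensity w y ^ 3 ∂(slabMeasure T) with hKd
  have hKm : Measurable K := by
    have h1 : Measurable fun q : (ℝ × ℝ) × (ℝ × ℝ) => coneKer (-1 / 2) (-1 / 2) q.1 q.2 := measurable_coneKer _ _
    have h2 : Measurable fun q : (ℝ × ℝ) × (ℝ × ℝ) => coneKer (-1 / 2) (-1 / 2) q.1 q.2 * fieldDensity w q.2 ^ 3 :=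
      h1.mul ((hp.comp measurable_snd).pow_const 3)
    exact Measurable.lintegral_prod_right' h2
  set A : ℝ × ℝ → ℝ≥0∞ := fun x => ENNReal.ofReal x.2⁻¹ ^ 2 * ‖sineT (fun y => Real.cos (x.1 * y) * a y) x.2‖ₑ ^ 4
  set B : ℝ × ℝ → ℝ≥0∞ := fun x => ENNReal.ofReal x.2⁻¹ ^ 2 * ‖sineT (fun y => Real.sin (x.1 * y) * (b y / y)) x.2‖ₑ ^ 4
  have hA := lintegral_free_quartic_le ha (Or.inl rfl) T
  have hB := lintegral_free_quartic_le hb (Or.inr rfl) T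
  have hpt : ∀ᵐ x ∂(slabMeasure T), fieldDensity w x ^ 4 ≤ 64 * (A x + B x + K x ^ 4) := by
    have hT : ∀ᵐ x ∂(slabMeasure T), x.1 ∈ Ioc 0 T :=
      Measure.quasiMeasurePreserving_fst.ae (ae_restrict_mem measurableSet_Ioc)
    filter_upwards [ae_slabMeasure_pos T, hT] with x hx hxT
    refine (fieldDensity_pow_four_le w hx).trans ?_
    rw [hw.field_eq hs ha hb hxT.1.le hx.le]
    refine (mul_le_mul_right (enorm_add_add_pow_four_le _ _ _) _).trans ?_
    have aux : ∀ o a b c : ℝ≥0∞, o * (64 * (a + b + c)) = 64 * (o * a + o * b + o * c) := by intros; ring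
    rw [aux]
    refine mul_le_mul' le_rfl (add_le_add le_rfl ?_)
    have e1 : ENNReal.ofReal x.2⁻¹ ^ 2 = ENNReal.ofReal (x.2 ^ (-1 / 2 : ℝ)) ^ 4 := by
      rw [← ENNReal.ofReal_pow (by positivity), ← ENNReal.ofReal_pow (by positivity), ← Real.rpow_natCast,
        ← Real.rpow_neg_one, ← Real.rpow_mul hx.le, ← Real.rpow_natCast, ← Real.rpow_mul hx.le]
      norm_num
    rw [e1, ← mul_pow]
    refine pow_le_pow_left' ?_ 4
    calc _ ≤ ENNReal.ofReal (x.2 ^ (-1 / 2 : ℝ)) *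
          ∫⁻ y, coneKer 0 0 (x.1, x.2) y * ‖cubicProfile w y.1 y.2‖ₑ ∂(slabMeasure T) := by
          gcongr
          exact enorm_cone_integral_le _ hxT.2 hx.le (hw.measurable_cubicProfile hs)
      _ = ∫⁻ y, ENNReal.ofReal (x.2 ^ (-1 / 2 : ℝ)) * (coneKer 0 0 (x.1, x.2) y * ‖cubicProfile w y.1 y.2‖ₑ)
            ∂(slabMeasure T) := (lintegral_const_mul' _ _ ENNReal.ofReal_ne_top).symm
      _ ≤ K x := by
          refine lintegral_mono_ae ?_
          filter_upwards [ae_slabMeasure_pos T] with y hy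
          exact weighted_cone_le w hy
  calc _ ≤ ∫⁻ x, 64 * (A x + B x + K x ^ 4) ∂(slabMeasure T) := lintegral_mono_ae hpt
    _ = 64 * ((∫⁻ x, A x + B x ∂(slabMeasure T)) + ∫⁻ x, K x ^ 4 ∂(slabMeasure T)) := by
        rw [lintegral_const_mul' _ _ (by norm_num), lintegral_add_right _ (hKm.pow_const 4)]
    _ ≤ 64 * ((∫⁻ x, A x ∂(slabMeasure T) + ∫⁻ x, B x ∂(slabMeasure T)) + ∫⁻ x, K x ^ 4 ∂(slabMeasure T)) := by
        have hAae : AEMeasurable A (slabMeasure T) := by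
          have ha' := ha.aestronglyMeasurable
          have : Measurable fun x : ℝ × ℝ => sineT (fun y => Real.cos (x.1 * y) * ha'.mk a y) x.2 :=
            measurable_sineT_family (g := fun t y => Real.cos (t * y) * ha'.mk a y)
              ((by fun_prop : Measurable fun q : ℝ × ℝ => Real.cos (q.1 * q.2)).mul
                (ha'.stronglyMeasurable_mk.measurable.comp measurable_snd))
          refine Measurable.aemeasurable ?_
          have e : A = fun x => ENNReal.ofReal x.2⁻¹ ^ 2 *
              ‖sineT (fun y => Real.cos (x.1 * y) * ha'.mk a y) x.2‖ₑ ^ 4 := by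
            ext x
            have : sineT (fun y => Real.cos (x.1 * y) * a y) x.2
                = sineT (fun y => Real.cos (x.1 * y) * ha'.mk a y) x.2 :=
              sineT_congr (by filter_upwards [ha'.ae_eq_mk] with y hy; rw [← hy]) _
            change ENNReal.ofReal x.2⁻¹ ^ 2 * ‖sineT (fun y => Real.cos (x.1 * y) * a y) x.2‖ₑ ^ 4 = _
            rw [this]
          rw [e]
          exact ((measurable_snd.inv.ennreal_ofReal).pow_const 2).mul (this.enorm.pow_const 4)
        rw [lintegral_add_left' hAae]
    _ ≤ 64 * ((ENNReal.ofReal (8 * Real.pi) * (∫⁻ y, ENNReal.ofReal y * ‖a y‖ₑ ^ 2 ∂freqMeasure) ^ 2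
        + ENNReal.ofReal (8 * Real.pi) * (∫⁻ y, ENNReal.ofReal y * ‖b y / y‖ₑ ^ 2 ∂freqMeasure) ^ 2)
        + 64 * (∫⁻ x, fieldDensity w x ^ 4 ∂(slabMeasure T)) ^ 3) := by gcongr
    _ = _ := by ring

theorem lintegral_slabMeasure_add {f : ℝ × ℝ → ℝ≥0∞} (hf : Measurable f) {t t' : ℝ} (ht : 0 ≤ t) (htt' : t ≤ t') :
    ∫⁻ x, f x ∂(slabMeasure t') = ∫⁻ x, f x ∂(slabMeasure t) + ∫⁻ τ in Ioc t t', (∫⁻ ρ, f (τ, ρ) ∂freqMeasure) := by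
  rw [lintegral_slabMeasure _ hf, lintegral_slabMeasure _ hf, ← Ioc_union_Ioc_eq_Ioc ht htt',
    lintegral_union measurableSet_Ioc (by
      rw [Set.disjoint_left]; intro x hx hx'; exact absurd hx.2 (not_le.2 hx'.1))]

/-- The growth `(1 + ρ)^{1/8}` of the field leaves `(1 + ρ)^{1/2 - 2}` in the fourth power of the
density. This crude bound makes the quartic norm finite and Lipschitz in time, as the continuity
argument requires. -/
theorem IsGlobalCubicSolution.exists_lintegral_fieldDensity_le (hw : IsGlobalCubicSolution s a b w)
    (hs : 1 / 2 < s) (T : ℝ) :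
    ∃ B : ℝ, 0 ≤ B ∧ ∀ τ ∈ Icc 0 T, ∫⁻ ρ, fieldDensity w (τ, ρ) ^ 4 ∂freqMeasure ≤ ENNReal.ofReal B := by
  obtain ⟨h1, -, h3⟩ := hw.rough hs
  obtain ⟨N, hN0, hN⟩ := h3 T
  have hfin := lintegral_one_add_rpow_lt_top
  refine ⟨N ^ 4 * (∫⁻ ρ, ENNReal.ofReal ((1 + ρ) ^ (-3 / 2 : ℝ)) ∂freqMeasure).toReal, by positivity, fun τ hτ => ?_⟩
  rw [ENNReal.ofReal_mul (by positivity), ENNReal.ofReal_toReal hfin.ne,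
    ← lintegral_const_mul' _ _ ENNReal.ofReal_ne_top]
  refine lintegral_mono_ae ?_
  filter_upwards [ae_freqMeasure_pos] with ρ hρ
  have h0 : 0 < 1 + ρ := by linarith
  rw [fieldDensity, ← ofReal_norm, ← ENNReal.ofReal_mul (norm_nonneg _), ← ENNReal.ofReal_pow (by positivity),
    ← ENNReal.ofReal_mul (by positivity)]
  refine ENNReal.ofReal_le_ofReal ?_
  have hb := ((h1 τ).abs_sineT_le hρ.le).trans (mul_le_mul_of_nonneg_left (hN τ hτ) (by positivity))
  rw [mul_pow, Real.norm_eq_abs]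
  calc _ ≤ ((1 + ρ) ^ (1 / 8 : ℝ) * N) ^ 4 * ((1 + ρ) ^ (-1 / 2 : ℝ)) ^ 4 := by gcongr
    _ = N ^ 4 * ((1 + ρ) ^ (1 / 2 : ℝ) * (1 + ρ) ^ (-2 : ℝ)) := by
        rw [mul_pow, ← Real.rpow_natCast (_ ^ (1 / 8 : ℝ)), ← Real.rpow_natCast (_ ^ (-1 / 2 : ℝ)),
          ← Real.rpow_mul h0.le, ← Real.rpow_mul h0.le]
        norm_num
        ring
    _ = _ := by rw [← Real.rpow_add h0]; norm_num

/-- Global small-data space-time bound for the cubic wave. -/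
theorem IsGlobalCubicSolution.lintegral_quartic_le (hw : IsGlobalCubicSolution s a b w) (hs : 1 / 2 < s)
    (ha : Integrable a freqMeasure) (hb : Integrable (fun y => b y / y) freqMeasure) {D : ℝ} (hD0 : 0 < D)
    (hD : 32768 * D ^ 2 < 1)
    (hdata : 64 * (ENNReal.ofReal (8 * Real.pi) * (∫⁻ y, ENNReal.ofReal y * ‖a y‖ₑ ^ 2 ∂freqMeasure) ^ 2
        + ENNReal.ofReal (8 * Real.pi) * (∫⁻ y, ENNReal.ofReal y * ‖b y / y‖ₑ ^ 2 ∂freqMeasure) ^ 2) ≤ ENNReal.ofReal D)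
    {T : ℝ} (hT : 0 ≤ T) :
    ∫⁻ x, fieldDensity w x ^ 4 ∂(slabMeasure T) ≤ ENNReal.ofReal (2 * D) := by
  obtain ⟨B, hB0, hB⟩ := hw.exists_lintegral_fieldDensity_le hs T
  have hp4 := (hw.measurable_fieldDensity hs).pow_const 4
  set Q : ℝ → ℝ≥0∞ := fun t => ∫⁻ x, fieldDensity w x ^ 4 ∂(slabMeasure t) with hQ
  -- Finiteness and continuity of `Q` rest on the constant `B`, whose size does not enter the final
  -- bound.
  have hinc : ∀ t ∈ Icc 0 T, ∀ t' ∈ Icc 0 T, t ≤ t' → Q t' ≤ Q t + ENNReal.ofReal (B * (t' - t)) := by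
    intro t ht t' ht' htt'
    simp only [hQ]
    rw [lintegral_slabMeasure_add hp4 ht.1 htt']
    gcongr
    refine (setLIntegral_mono' measurableSet_Ioc fun τ hτ => hB τ ⟨ht.1.trans hτ.1.le, hτ.2.trans ht'.2⟩).trans ?_
    rw [setLIntegral_const, Real.volume_Ioc, ENNReal.ofReal_mul hB0]
  have hmono : ∀ t ∈ Icc 0 T, ∀ t' ∈ Icc 0 T, t ≤ t' → Q t ≤ Q t' := by
    intro t ht t' ht' htt'
    simp only [hQ]
    rw [lintegral_slabMeasure_add hp4 ht.1 htt']
    exact le_self_add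
  have hQ0 : Q 0 = 0 := by simp [hQ, slabMeasure]
  have hfin : ∀ t ∈ Icc 0 T, Q t ≠ ⊤ := by
    intro t ht
    have := hinc 0 ⟨le_rfl, hT⟩ t ht ht.1
    rw [hQ0, zero_add] at this
    exact (this.trans_lt ENNReal.ofReal_lt_top).ne
  have hcont : ContinuousOn (fun t => (Q t).toReal) (Icc 0 T) := by
    refine LipschitzOnWith.continuousOn (K := B.toNNReal) (LipschitzOnWith.of_le_add_mul _ fun t ht t' ht' => ?_)
    rw [Real.coe_toNNReal _ hB0, Real.dist_eq]
    rcases le_total t t' with h | h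
    · have := ENNReal.toReal_mono (hfin t' ht') (hmono t ht t' ht' h)
      have h2 : 0 ≤ B * |t - t'| := by positivity
      linarith
    · have := ENNReal.toReal_mono (by finiteness [hfin t' ht']) (hinc t' ht' t ht h)
      rwa [ENNReal.toReal_add (hfin t' ht') ENNReal.ofReal_ne_top,
        ENNReal.toReal_ofReal (mul_nonneg hB0 (by linarith)), ← abs_of_nonneg (sub_nonneg.2 h)] at this
  have key := le_two_mul_of_barrier hT hcont (by simp [hQ0]) hD0 hD fun t ht => by
    have h := (hw.quartic_le hs ha hb t).trans (add_le_add_left hdata _)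
    have := ENNReal.toReal_mono (by finiteness [hfin t ht]) h
    rwa [ENNReal.toReal_add ENNReal.ofReal_ne_top (by finiteness [hfin t ht]), ENNReal.toReal_ofReal hD0.le,
      ENNReal.toReal_mul, ENNReal.toReal_pow] at this
  change Q T ≤ _
  rw [← ENNReal.ofReal_toReal (hfin T ⟨hT, le_rfl⟩)]
  exact ENNReal.ofReal_le_ofReal key

end CubicField

/-! ### The Hardy–Littlewood maximal inequality on the line. -/

section Maximal

variable {f : ℝ → ℝ≥0∞}

/-- The centered Hardy–Littlewood maximal function. -/
def maxFn (f : ℝ → ℝ≥0∞) (t : ℝ) : ℝ≥0∞ :=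
  ⨆ q : {q : ℚ // 0 < q}, (∫⁻ y in Metric.closedBall t (q : ℚ), f y) / ENNReal.ofReal (2 * (q : ℚ))

/-- Restricting to rational radii makes the supremum countable. -/
theorem measurable_maxFn (hf : Measurable f) : Measurable (maxFn f) := by
  refine Measurable.iSup fun q => Measurable.div_const ?_ _
  have e : (fun t : ℝ => ∫⁻ y in Metric.closedBall t (q : ℚ), f y)
      = fun t => ∫⁻ y, {p : ℝ × ℝ | dist p.2 p.1 ≤ (q : ℚ)}.indicator (fun p => f p.2) (t, y) := by
    ext t
    rw [← lintegral_indicator Metric.isClosed_closedBall.measurableSet]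
    rfl
  rw [e]
  refine Measurable.lintegral_prod_right' (f := {p : ℝ × ℝ | dist p.2 p.1 ≤ (q : ℚ)}.indicator fun p => f p.2) ?_
  exact (hf.comp measurable_snd).indicator (measurableSet_le (by fun_prop) measurable_const)

/-- A rational radius is chosen between `ρ` and `2ρ`; this doubles the length `2ρ` to `4ρ`. -/
theorem setLIntegral_le_maxFn (f : ℝ → ℝ≥0∞) (t : ℝ) {ρ : ℝ} (hρ : 0 < ρ) :
    ∫⁻ y in Ioc (t - ρ) (t + ρ), f y ≤ ENNReal.ofReal (4 * ρ) * maxFn f t := by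
  obtain ⟨q, h1, h2⟩ := exists_rat_btwn (show ρ < 2 * ρ by linarith)
  have hq : (0 : ℝ) < q := hρ.trans h1
  have hq' : 0 < q := by exact_mod_cast hq
  calc _ ≤ ∫⁻ y in Metric.closedBall t q, f y := by
        refine lintegral_mono_set fun y hy => ?_
        rw [Metric.mem_closedBall, Real.dist_eq, abs_le]
        constructor <;> linarith [hy.1, hy.2]
    _ = ENNReal.ofReal (2 * q) * ((∫⁻ y in Metric.closedBall t q, f y) / ENNReal.ofReal (2 * q)) := by
        rw [ENNReal.mul_div_cancel (by simpa using hq) ENNReal.ofReal_ne_top]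
    _ ≤ _ := by
        refine mul_le_mul' (ENNReal.ofReal_le_ofReal (by linarith)) ?_
        exact le_iSup (fun q : {q : ℚ // 0 < q} =>
          (∫⁻ y in Metric.closedBall t (q : ℚ), f y) / ENNReal.ofReal (2 * (q : ℚ))) ⟨q, hq'⟩

/-- The weak type `(1, 1)` inequality. -/
theorem mul_volume_averages_le (hfin : ∫⁻ y, f y ≠ ⊤) {l : ℝ} (hl : 0 < l) :
    ENNReal.ofReal l * volume {t : ℝ | ∃ r : ℝ, 0 < r ∧
      ENNReal.ofReal l * ENNReal.ofReal (2 * r) < ∫⁻ y in Metric.closedBall t r, f y} ≤ 5 * ∫⁻ y, f y := by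
  set E := {t : ℝ | ∃ r : ℝ, 0 < r ∧
      ENNReal.ofReal l * ENNReal.ofReal (2 * r) < ∫⁻ y in Metric.closedBall t r, f y} with hE
  choose! r hr0 hr using fun t (ht : t ∈ E) => ht
  have hR : ∀ t ∈ E, r t ≤ (∫⁻ y, f y).toReal / (2 * l) := by
    intro t ht
    rw [le_div_iff₀ (by positivity)]
    have h1 := (hr t ht).le.trans (setLIntegral_le_lintegral _ _)
    rw [← ENNReal.ofReal_mul hl.le, ENNReal.ofReal_le_iff_le_toReal hfin] at h1
    linarith
  -- Vitali's covering lemma; the enlargement factor is the constant 5 of the weak type bound.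
  obtain ⟨u, huE, hdisj, hcov⟩ := Vitali.exists_disjoint_subfamily_covering_enlargement_closedBall
    E (fun t => t) r _ hR 5 (by norm_num)
  have hu : u.Countable := hdisj.countable_of_nonempty_interior fun t ht => by
    rw [interior_closedBall _ (hr0 t (huE ht)).ne']
    exact Metric.nonempty_ball.2 (hr0 t (huE ht))
  have hsub : E ⊆ ⋃ t ∈ u, Metric.closedBall t (5 * r t) := by
    intro a ha
    obtain ⟨b, hb, hab⟩ := hcov a ha
    exact mem_biUnion hb (hab (Metric.mem_closedBall_self (hr0 a ha).le))
  have := hu.to_subtype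
  calc ENNReal.ofReal l * volume E
      ≤ ENNReal.ofReal l * ∑' t : u, volume (Metric.closedBall (t : ℝ) (5 * r t)) := by
        gcongr
        exact (measure_mono hsub).trans (measure_biUnion_le _ hu _)
    _ = ∑' t : u, 5 * (ENNReal.ofReal l * ENNReal.ofReal (2 * r t)) := by
        rw [← ENNReal.tsum_mul_left]
        refine tsum_congr fun t => ?_
        rw [Real.volume_closedBall, show 2 * (5 * r (t : ℝ)) = 5 * (2 * r t) by ring,
          ENNReal.ofReal_mul (by norm_num), show ENNReal.ofReal 5 = 5 by norm_num]
        ring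
    _ ≤ ∑' t : u, 5 * ∫⁻ y in Metric.closedBall (t : ℝ) (r t), f y := by
        gcongr with t
        exact (hr t (huE t.2)).le
    _ = 5 * ∫⁻ y in ⋃ t ∈ u, Metric.closedBall t (r t), f y := by
        rw [ENNReal.tsum_mul_left, lintegral_biUnion hu (fun _ _ => Metric.isClosed_closedBall.measurableSet) hdisj]
    _ ≤ 5 * ∫⁻ y, f y := by
        gcongr
        exact Measure.restrict_le_self

/-- The values of `f` below `l / 2` contribute at most `l / 2` to an average, so the part above `l /
2` has average exceeding `l / 2`. This part is integrable by Chebyshev's inequality, and the weak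
type bound applies to it. -/
theorem mul_volume_maxFn_le (hf : Measurable f) (hfin : ∫⁻ y, f y ^ 2 ≠ ⊤) {l : ℝ} (hl : 0 < l) :
    ENNReal.ofReal l * volume {t : ℝ | ENNReal.ofReal l < maxFn f t}
      ≤ 10 * ∫⁻ y, {y | ENNReal.ofReal (l / 2) < f y}.indicator f y := by
  set S := {y | ENNReal.ofReal (l / 2) < f y} with hS
  have hSm : MeasurableSet S := measurableSet_lt measurable_const hf
  have hl2 : 0 < l / 2 := by positivity
  have hl2' : ENNReal.ofReal (l / 2) ≠ 0 := by simpa using hl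
  have hg : ∫⁻ y, S.indicator f y ≠ ⊤ := by
    have h1 : ∀ y, S.indicator f y ≤ (ENNReal.ofReal (l / 2))⁻¹ * f y ^ 2 := by
      intro y
      by_cases hy : y ∈ S
      · rw [indicator_of_mem hy, pow_two, ← mul_assoc]
        refine le_mul_of_one_le_left' ?_
        rw [← ENNReal.inv_mul_cancel hl2' ENNReal.ofReal_ne_top]
        gcongr
        exact le_of_lt hy
      · rw [indicator_of_notMem hy]; exact zero_le
    refine ((lintegral_mono h1).trans_lt ?_).ne
    rw [lintegral_const_mul _ (hf.pow_const 2)]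
    exact ENNReal.mul_lt_top (ENNReal.inv_lt_top.2 (pos_iff_ne_zero.2 hl2')) hfin.lt_top
  have hsub : {t : ℝ | ENNReal.ofReal l < maxFn f t} ⊆ {t : ℝ | ∃ r : ℝ, 0 < r ∧
      ENNReal.ofReal (l / 2) * ENNReal.ofReal (2 * r) < ∫⁻ y in Metric.closedBall t r, S.indicator f y} := by
    intro t ht
    obtain ⟨⟨q, hq⟩, h⟩ := lt_iSup_iff.1 (show ENNReal.ofReal l < ⨆ q : {q : ℚ // 0 < q}, _ from ht)
    have hq' : (0 : ℝ) < q := by exact_mod_cast hq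
    refine ⟨q, hq', ?_⟩
    have h' : ENNReal.ofReal l * ENNReal.ofReal (2 * q) < ∫⁻ y in Metric.closedBall t q, f y :=
      (ENNReal.lt_div_iff_mul_lt (Or.inl (by simpa using hq)) (Or.inl ENNReal.ofReal_ne_top)).1 h
    have h2 : ∫⁻ y in Metric.closedBall t q, f y
        ≤ (∫⁻ y in Metric.closedBall t q, S.indicator f y) + ENNReal.ofReal (l / 2) * ENNReal.ofReal (2 * q) := by
      calc _ ≤ ∫⁻ y in Metric.closedBall t q, (S.indicator f y + ENNReal.ofReal (l / 2)) := by
            refine lintegral_mono fun y => ?_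
            by_cases hy : y ∈ S
            · rw [indicator_of_mem hy]; exact le_self_add
            · rw [indicator_of_notMem hy, zero_add]; exact not_lt.1 hy
        _ = _ := by
            rw [lintegral_add_right _ measurable_const, setLIntegral_const, Real.volume_closedBall]
    have h3 := h'.trans_le h2
    rw [show l = l / 2 + l / 2 by ring, ENNReal.ofReal_add hl2.le hl2.le, add_mul] at h3
    simp only [← show l = l / 2 + l / 2 by ring] at h3
    exact (ENNReal.add_lt_add_iff_right (by finiteness)).1 h3
  calc _ ≤ 2 * (ENNReal.ofReal (l / 2) * volume {t : ℝ | ∃ r : ℝ, 0 < r ∧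
      ENNReal.ofReal (l / 2) * ENNReal.ofReal (2 * r) < ∫⁻ y in Metric.closedBall t r, S.indicator f y}) := by
        rw [← mul_assoc, show (2 : ℝ≥0∞) = ENNReal.ofReal 2 by norm_num, ← ENNReal.ofReal_mul (by norm_num),
          show 2 * (l / 2) = l by ring]
        gcongr
    _ ≤ 2 * (5 * ∫⁻ y, S.indicator f y) := by
        exact mul_le_mul' le_rfl (mul_volume_averages_le hg hl2)
    _ = _ := by rw [← mul_assoc]; norm_num

theorem setLIntegral_two_mul_lt {x : ℝ} (hx : 0 ≤ x) :
    ENNReal.ofReal x ^ 2 ≤ ∫⁻ l in Ioi (0 : ℝ), {l : ℝ | l ≤ x}.indicator (fun l => ENNReal.ofReal (2 * l)) l := by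
  rcases hx.eq_or_lt with rfl | hx
  · simp
  have h := setLIntegral_Ioc_rpow (a := 1) (by norm_num) hx
  calc ENNReal.ofReal x ^ 2 = 2 * ∫⁻ l in Ioc 0 x, ENNReal.ofReal (l ^ (1 : ℝ)) := by
        rw [h, show (2 : ℝ≥0∞) = ENNReal.ofReal 2 by norm_num, ← ENNReal.ofReal_mul (by norm_num),
          ← ENNReal.ofReal_pow hx.le]
        congr 1
        norm_num
        ring
    _ = ∫⁻ l in Ioc 0 x, ENNReal.ofReal (2 * l) := by
        rw [← lintegral_const_mul' _ _ (by norm_num)]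
        refine lintegral_congr fun l => ?_
        rw [Real.rpow_one, ENNReal.ofReal_mul (by norm_num)]; norm_num
    _ ≤ _ := by
        rw [← lintegral_indicator measurableSet_Ioc, ← lintegral_indicator measurableSet_Ioi]
        refine lintegral_mono fun l => ?_
        by_cases hl : l ∈ Ioc 0 x
        · rw [indicator_of_mem hl, indicator_of_mem (show l ∈ Ioi (0 : ℝ) from hl.1),
            indicator_of_mem (show l ∈ {l : ℝ | l ≤ x} from hl.2)]
        · rw [indicator_of_notMem hl]; exact zero_le

theorem sq_le_layer (x : ℝ≥0∞) :
    x ^ 2 ≤ ∫⁻ l in Ioi (0 : ℝ), {l : ℝ | ENNReal.ofReal l < x}.indicator (fun l => ENNReal.ofReal (2 * l)) l := by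
  set c := ∫⁻ l in Ioi (0 : ℝ), {l : ℝ | ENNReal.ofReal l < x}.indicator (fun l => ENNReal.ofReal (2 * l)) l
  have h : ∀ y < x, y ≤ c ^ (1 / 2 : ℝ) := by
    intro y hy
    have hyt : y ≠ ⊤ := hy.ne_top
    have h1 := setLIntegral_two_mul_lt (x := y.toReal) ENNReal.toReal_nonneg
    rw [ENNReal.ofReal_toReal hyt] at h1
    have h2 : y ^ 2 ≤ c := by
      refine h1.trans (lintegral_mono fun l => indicator_le_indicator_of_subset (fun z hz => ?_) (fun _ => zero_le) l)
      exact (ENNReal.ofReal_le_of_le_toReal hz).trans_lt hy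
    calc y = (y ^ 2) ^ (1 / 2 : ℝ) := by
          rw [← ENNReal.rpow_natCast, ← ENNReal.rpow_mul]; norm_num
      _ ≤ _ := by gcongr
  calc x ^ 2 ≤ (c ^ (1 / 2 : ℝ)) ^ 2 := by
        gcongr; exact le_of_forall_lt_imp_le_of_dense h
    _ = c := by rw [← ENNReal.rpow_natCast, ← ENNReal.rpow_mul]; norm_num

theorem lintegral_layer_le (x : ℝ≥0∞) :
    x * ∫⁻ l in Ioi (0 : ℝ), {l : ℝ | ENNReal.ofReal (l / 2) < x}.indicator 1 l ≤ 2 * x ^ 2 := by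
  rcases eq_or_ne x ⊤ with rfl | hx
  · simp
  rw [pow_two, mul_left_comm]
  gcongr
  calc _ ≤ ∫⁻ l, (Ioc 0 (2 * x.toReal)).indicator 1 l := by
        rw [← lintegral_indicator measurableSet_Ioi]
        refine lintegral_mono fun l => ?_
        by_cases hl : l ∈ Ioi (0 : ℝ)
        · rw [indicator_of_mem hl]
          by_cases hx' : l ∈ {l : ℝ | ENNReal.ofReal (l / 2) < x}
          · have : l / 2 < x.toReal := (ENNReal.ofReal_lt_iff_lt_toReal (by have : 0 < l := hl; positivity) hx).1 hx'
            rw [indicator_of_mem hx', indicator_of_mem (show l ∈ Ioc 0 (2 * x.toReal) from ⟨hl, by linarith⟩)]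
          · rw [indicator_of_notMem hx']; exact zero_le
        · rw [indicator_of_notMem hl]; exact zero_le
    _ = 2 * x := by
        rw [lintegral_indicator_one measurableSet_Ioc, Real.volume_Ioc, sub_zero, ENNReal.ofReal_mul (by norm_num),
          ENNReal.ofReal_toReal hx]
        norm_num

/-- The Hardy–Littlewood maximal inequality in `L²`. -/
theorem lintegral_maxFn_sq_le (hf : Measurable f) : ∫⁻ t, maxFn f t ^ 2 ≤ 40 * ∫⁻ y, f y ^ 2 := by
  rcases eq_or_ne (∫⁻ y, f y ^ 2) ⊤ with hfin | hfin
  · simp [hfin]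
  have hM := measurable_maxFn hf
  have m1 : Measurable fun p : ℝ × ℝ => {l : ℝ | ENNReal.ofReal l < maxFn f p.1}.indicator
      (fun l => ENNReal.ofReal (2 * l)) p.2 := by
    change Measurable ({p : ℝ × ℝ | ENNReal.ofReal p.2 < maxFn f p.1}.indicator fun p => ENNReal.ofReal (2 * p.2))
    exact Measurable.indicator (by fun_prop) (measurableSet_lt (by fun_prop) (hM.comp measurable_fst))
  have m2 : Measurable fun p : ℝ × ℝ => {y | ENNReal.ofReal (p.1 / 2) < f y}.indicator f p.2 := by
    change Measurable ({p : ℝ × ℝ | ENNReal.ofReal (p.1 / 2) < f p.2}.indicator fun p => f p.2)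
    exact (hf.comp measurable_snd).indicator (measurableSet_lt (by fun_prop) (hf.comp measurable_snd))
  calc ∫⁻ t, maxFn f t ^ 2
      ≤ ∫⁻ t, ∫⁻ l in Ioi (0 : ℝ), {l : ℝ | ENNReal.ofReal l < maxFn f t}.indicator
          (fun l => ENNReal.ofReal (2 * l)) l := lintegral_mono fun t => sq_le_layer _
    _ = ∫⁻ l in Ioi (0 : ℝ), ∫⁻ t, {l : ℝ | ENNReal.ofReal l < maxFn f t}.indicator
          (fun l => ENNReal.ofReal (2 * l)) l := lintegral_lintegral_swap m1.aemeasurable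
    _ ≤ ∫⁻ l in Ioi (0 : ℝ), 20 * ∫⁻ y, {y | ENNReal.ofReal (l / 2) < f y}.indicator f y := by
        refine setLIntegral_mono' measurableSet_Ioi fun l hl => ?_
        have hl0 : (0 : ℝ) < l := hl
        have e : ∀ t, {l : ℝ | ENNReal.ofReal l < maxFn f t}.indicator (fun l => ENNReal.ofReal (2 * l)) l
            = {t : ℝ | ENNReal.ofReal l < maxFn f t}.indicator (fun _ => ENNReal.ofReal (2 * l)) t := fun t => rfl
        simp_rw [e]
        rw [lintegral_indicator_const (measurableSet_lt measurable_const hM), ENNReal.ofReal_mul (by norm_num),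
          mul_assoc, show (20 : ℝ≥0∞) = ENNReal.ofReal 2 * 10 by norm_num, mul_assoc]
        exact mul_le_mul' le_rfl (mul_volume_maxFn_le hf hfin hl0)
    _ = 20 * ∫⁻ y, ∫⁻ l in Ioi (0 : ℝ), {y | ENNReal.ofReal (l / 2) < f y}.indicator f y := by
        rw [lintegral_const_mul' _ _ (by norm_num), lintegral_lintegral_swap m2.aemeasurable]
    _ ≤ 20 * ∫⁻ y, 2 * f y ^ 2 := by
        gcongr with y
        refine le_trans (le_of_eq ?_) (lintegral_layer_le (f y))
        rw [← lintegral_const_mul]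
        · refine lintegral_congr fun l => ?_
          by_cases h : ENNReal.ofReal (l / 2) < f y
          · rw [indicator_of_mem (show y ∈ {y | ENNReal.ofReal (l / 2) < f y} from h),
              indicator_of_mem (show l ∈ {l : ℝ | ENNReal.ofReal (l / 2) < f y} from h)]
            simp
          · rw [indicator_of_notMem (show y ∉ {y | ENNReal.ofReal (l / 2) < f y} from h),
              indicator_of_notMem (show l ∉ {l : ℝ | ENNReal.ofReal (l / 2) < f y} from h), mul_zero]
        · exact measurable_one.indicator (measurableSet_lt (by fun_prop) measurable_const)
    _ = _ := by
        rw [lintegral_const_mul _ (hf.pow_const 2), ← mul_assoc]; norm_num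

end Maximal

/-! ### Picard iteration for a bounded Lipschitz nonlinearity. -/

section Volterra

/-- The wave generated by the radial forcing profile `P`, in physical space. -/
def coneInt (P : ℝ → ℝ → ℝ) (t ρ : ℝ) : ℝ :=
  (1 / 2) * ∫ τ in Ioc 0 t, ∫ σ in |ρ - (t - τ)|..(ρ + (t - τ)), P τ σ

theorem continuous_parametric_interval {X : Type*} [TopologicalSpace X] {f : X → ℝ → ℝ}
    (hf : Continuous (Function.uncurry f)) {a b : X → ℝ} (ha : Continuous a) (hb : Continuous b) :
    Continuous fun x => ∫ σ in a x..b x, f x σ := by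
  have e : (fun x => ∫ σ in a x..b x, f x σ) = fun x => (∫ σ in (0 : ℝ)..b x, f x σ) - ∫ σ in (0 : ℝ)..a x, f x σ := by
    ext x
    have hc : Continuous (f x) := hf.comp (Continuous.prodMk continuous_const continuous_id)
    rw [intervalIntegral.integral_interval_sub_left (hc.intervalIntegrable _ _) (hc.intervalIntegrable _ _)]
  rw [e]
  exact (intervalIntegral.continuous_parametric_intervalIntegral_of_continuous hf hb).sub
    (intervalIntegral.continuous_parametric_intervalIntegral_of_continuous hf ha)

/-- Projection of the time variable to `[0, T]`. -/
def clampTime (T t : ℝ) : ℝ := max 0 (min t T)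

theorem clampTime_of_mem {T t : ℝ} (ht : t ∈ Icc 0 T) : clampTime T t = t := by
  rw [clampTime, min_eq_left ht.2, max_eq_right ht.1]

theorem clampTime_mem {T : ℝ} (hT : 0 ≤ T) (t : ℝ) : clampTime T t ∈ Icc 0 T :=
  ⟨le_max_left _ _, max_le hT (min_le_right _ _)⟩

theorem continuous_clampTime (T : ℝ) : Continuous (clampTime T) := by unfold clampTime; fun_prop

theorem mul_exp_neg_le {K s : ℝ} (hK : 0 < K) : s * Real.exp (-(K * s)) ≤ 1 / K := by
  rw [Real.exp_neg, ← div_eq_mul_inv, div_le_div_iff₀ (Real.exp_pos _) hK]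
  have := Real.add_one_le_exp (K * s)
  linarith

variable {N : ℝ → ℝ → ℝ → ℝ} {B L T : ℝ}

/-- The Picard map of the wave equation with the nonlinearity `N`, cut off to times in `[0, T]` and
with an exponential weight in time. -/
def picardMap (N : ℝ → ℝ → ℝ → ℝ) (T K : ℝ) (f : ℝ × ℝ → ℝ) (p : ℝ × ℝ) : ℝ :=
  Real.exp (-(K * clampTime T p.1)) * ((1 / 2) * ∫ τ in (0 : ℝ)..T,
    ∫ σ in |(|p.2| - max (clampTime T p.1 - τ) 0)|..(|p.2| + max (clampTime T p.1 - τ) 0),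
      N τ σ (Real.exp (K * clampTime T τ) * f (τ, σ)))

/-- For `τ` beyond the current time the positive part makes the inner interval collapse to a point.
The outer integral can thus run over the fixed interval `[0, T]`, and continuity in the parameters
is immediate. -/
theorem continuous_picardMap (hN : Continuous fun q : ℝ × ℝ × ℝ => N q.1 q.2.1 q.2.2) (K : ℝ) {f : ℝ × ℝ → ℝ}
    (hf : Continuous f) : Continuous (picardMap N T K f) := by
  have hc := continuous_clampTime T
  unfold picardMap
  refine Continuous.mul (by fun_prop) (continuous_const.mul ?_)
  refine intervalIntegral.continuous_parametric_intervalIntegral_of_continuous' (f := fun (p : ℝ × ℝ) τ =>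
    ∫ σ in |(|p.2| - max (clampTime T p.1 - τ) 0)|..(|p.2| + max (clampTime T p.1 - τ) 0),
      N τ σ (Real.exp (K * clampTime T τ) * f (τ, σ))) ?_ _ _
  refine continuous_parametric_interval (X := (ℝ × ℝ) × ℝ)
    (f := fun q σ => N q.2 σ (Real.exp (K * clampTime T q.2) * f (q.2, σ))) ?_ ?_ ?_
  · exact hN.comp (by fun_prop : Continuous fun q : ((ℝ × ℝ) × ℝ) × ℝ =>
      ((q.1.2, q.2, Real.exp (K * clampTime T q.1.2) * f (q.1.2, q.2)) : ℝ × ℝ × ℝ))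
  · fun_prop
  · fun_prop

theorem norm_inner_interval_le {g : ℝ → ℝ} {C ρ s : ℝ} (hC : 0 ≤ C) (hs : 0 ≤ s) (hg : ∀ σ, |g σ| ≤ C) :
    ‖∫ σ in |(|ρ| - s)|..(|ρ| + s), g σ‖ ≤ C * (2 * s) := by
  refine (intervalIntegral.norm_integral_le_of_norm_le_const fun σ _ => hg σ).trans ?_
  gcongr
  have : |(|ρ| - s)| ≤ |ρ| + s := by
    rw [abs_le]; constructor <;> linarith [abs_nonneg ρ]
  rw [abs_of_nonneg (by linarith)]
  linarith [neg_abs_le (|ρ| - s), le_abs_self (|ρ| - s)]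

theorem abs_picardMap_le (hB : ∀ τ σ x, |N τ σ x| ≤ B) (hT : 0 ≤ T) {K : ℝ} (hK : 0 ≤ K)
    (f : ℝ × ℝ → ℝ) (p : ℝ × ℝ) : |picardMap N T K f p| ≤ B * T * T := by
  have hB0 : 0 ≤ B := (abs_nonneg _).trans (hB 0 0 0)
  have ht := clampTime_mem hT p.1
  rw [picardMap, abs_mul, abs_mul, abs_of_pos (Real.exp_pos _)]
  have h1 : ‖∫ τ in (0 : ℝ)..T, ∫ σ in |(|p.2| - max (clampTime T p.1 - τ) 0)|..(|p.2| + max (clampTime T p.1 - τ) 0),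
      N τ σ (Real.exp (K * clampTime T τ) * f (τ, σ))‖ ≤ B * (2 * T) * |T - 0| := by
    refine intervalIntegral.norm_integral_le_of_norm_le_const fun τ hτ => ?_
    rw [uIoc_of_le hT] at hτ
    refine (norm_inner_interval_le hB0 (le_max_right _ _) fun σ => hB _ _ _).trans ?_
    gcongr
    exact max_le (by linarith [ht.2, hτ.1]) hT
  rw [Real.norm_eq_abs, sub_zero, abs_of_nonneg hT] at h1
  have h2 : Real.exp (-(K * clampTime T p.1)) ≤ 1 := by
    rw [Real.exp_le_one_iff]; nlinarith [ht.1, mul_nonneg hK ht.1]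
  calc _ ≤ 1 * (|1 / 2| * (B * (2 * T) * T)) := by gcongr
    _ = _ := by rw [abs_of_pos (by norm_num : (0 : ℝ) < 1 / 2)]; ring

/-- The weight yields the gain `1 / K`: undoing it at time `τ` costs `exp (K τ)`, restoring it at
time `t` gives `exp (-K t)`, the cone has width `2 (t - τ)`, and `s exp (-K s) ≤ 1 / K`. The
contraction therefore works on all of `[0, T]` at once. -/
theorem abs_picardMap_sub_le (hN : Continuous fun q : ℝ × ℝ × ℝ => N q.1 q.2.1 q.2.2)
    (hL0 : 0 ≤ L) (hL : ∀ τ σ x x', |N τ σ x - N τ σ x'| ≤ L * |x - x'|) (hT : 0 ≤ T) {K : ℝ} (hK : 0 < K)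
    {f g : ℝ × ℝ → ℝ} (hf : Continuous f) (hg : Continuous g) {δ : ℝ} (hδ : 0 ≤ δ) (h : ∀ p, |f p - g p| ≤ δ)
    (p : ℝ × ℝ) : |picardMap N T K f p - picardMap N T K g p| ≤ L * T / K * δ := by
  have ht := clampTime_mem hT p.1
  have hc := continuous_clampTime T
  set J : (ℝ × ℝ → ℝ) → ℝ → ℝ := fun f τ =>
    ∫ σ in |(|p.2| - max (clampTime T p.1 - τ) 0)|..(|p.2| + max (clampTime T p.1 - τ) 0),
      N τ σ (Real.exp (K * clampTime T τ) * f (τ, σ)) with hJ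
  have hcont : ∀ f : ℝ × ℝ → ℝ, Continuous f → ∀ τ, Continuous fun σ =>
      N τ σ (Real.exp (K * clampTime T τ) * f (τ, σ)) := fun f hf τ =>
    hN.comp (by fun_prop : Continuous fun σ : ℝ =>
      ((τ, σ, Real.exp (K * clampTime T τ) * f (τ, σ)) : ℝ × ℝ × ℝ))
  have hJc : ∀ f, Continuous f → Continuous (J f) := by
    intro f hf
    refine continuous_parametric_interval (X := ℝ)
      (f := fun τ σ => N τ σ (Real.exp (K * clampTime T τ) * f (τ, σ))) ?_ (by fun_prop) (by fun_prop)
    exact hN.comp (by fun_prop : Continuous fun q : ℝ × ℝ =>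
      ((q.1, q.2, Real.exp (K * clampTime T q.1) * f (q.1, q.2)) : ℝ × ℝ × ℝ))
  have hE : ∀ f, picardMap N T K f p = (1 / 2) * ∫ τ in (0 : ℝ)..T, Real.exp (-(K * clampTime T p.1)) * J f τ := by
    intro f
    rw [picardMap, intervalIntegral.integral_const_mul]; ring
  have h1 : ‖∫ τ in (0 : ℝ)..T, (Real.exp (-(K * clampTime T p.1)) * J f τ
      - Real.exp (-(K * clampTime T p.1)) * J g τ)‖ ≤ L * δ * 2 / K * |T - 0| := by
    refine intervalIntegral.norm_integral_le_of_norm_le_const fun τ hτ => ?_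
    rw [uIoc_of_le hT] at hτ
    set s := max (clampTime T p.1 - τ) 0 with hs
    have hs0 : 0 ≤ s := le_max_right _ _
    have h2 : ‖J f τ - J g τ‖ ≤ (L * (Real.exp (K * τ) * δ)) * (2 * s) := by
      simp only [hJ]
      rw [← intervalIntegral.integral_sub ((hcont f hf τ).intervalIntegrable _ _)
        ((hcont g hg τ).intervalIntegrable _ _)]
      refine norm_inner_interval_le (by positivity) hs0 fun σ => ?_
      refine (hL _ _ _ _).trans ?_
      rw [← mul_sub, abs_mul, abs_of_pos (Real.exp_pos _), clampTime_of_mem ⟨hτ.1.le, hτ.2⟩]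
      gcongr
      exact h _
    rw [← mul_sub, norm_mul, Real.norm_of_nonneg (Real.exp_pos _).le]
    have h3 : Real.exp (-(K * clampTime T p.1)) * Real.exp (K * τ) * s ≤ 1 / K := by
      rcases le_total (clampTime T p.1 - τ) 0 with h0 | h0
      · rw [hs, max_eq_right h0, mul_zero]; positivity
      · rw [hs, max_eq_left h0, ← Real.exp_add, mul_comm,
          show -(K * clampTime T p.1) + K * τ = -(K * (clampTime T p.1 - τ)) by ring]
        exact mul_exp_neg_le hK
    calc _ ≤ Real.exp (-(K * clampTime T p.1)) * ((L * (Real.exp (K * τ) * δ)) * (2 * s)) := by gcongr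
      _ = L * δ * 2 * (Real.exp (-(K * clampTime T p.1)) * Real.exp (K * τ) * s) := by ring
      _ ≤ L * δ * 2 * (1 / K) := by gcongr
      _ = _ := by ring
  rw [hE, hE, ← mul_sub, ← intervalIntegral.integral_sub
    (((hJc f hf).const_mul _).intervalIntegrable _ _) (((hJc g hg).const_mul _).intervalIntegrable _ _),
    abs_mul, abs_of_pos (by norm_num : (0 : ℝ) < 1 / 2)]
  rw [Real.norm_eq_abs, sub_zero, abs_of_nonneg hT] at h1
  calc _ ≤ (1 / 2) * (L * δ * 2 / K * T) := by gcongr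
    _ = _ := by ring

/-- Solvability of the wave equation with a bounded Lipschitz nonlinearity. -/
theorem exists_eq_coneInt (hN : Continuous fun q : ℝ × ℝ × ℝ => N q.1 q.2.1 q.2.2)
    (hB : ∀ τ σ x, |N τ σ x| ≤ B) (hL0 : 0 ≤ L) (hL : ∀ τ σ x x', |N τ σ x - N τ σ x'| ≤ L * |x - x'|)
    (hT : 0 ≤ T) :
    ∃ D : ℝ → ℝ → ℝ, Continuous (Function.uncurry D) ∧ (∃ C, ∀ t ρ, |D t ρ| ≤ C) ∧
      ∀ t ∈ Icc 0 T, ∀ ρ, 0 ≤ ρ → D t ρ = coneInt (fun τ σ => N τ σ (D τ σ)) t ρ := by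
  -- Chosen so that `L T / K ≤ 1 / 2`, and positive even when `L T = 0`.
  set K : ℝ := 2 * (L * T) + 1 with hK
  have hK0 : 0 < K := by positivity
  have hc := continuous_clampTime T
  set Φ : BoundedContinuousFunction (ℝ × ℝ) ℝ → BoundedContinuousFunction (ℝ × ℝ) ℝ := fun f =>
    BoundedContinuousFunction.ofNormedAddCommGroup (picardMap N T K f)
      (continuous_picardMap hN K f.continuous) (B * T * T) (abs_picardMap_le hB hT hK0.le f) with hΦ
  have hcontr : ContractingWith (1 / 2) Φ := by
    refine ⟨by rw [← NNReal.coe_lt_coe]; norm_num, LipschitzWith.of_dist_le_mul fun f g => ?_⟩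
    rw [BoundedContinuousFunction.dist_le (by positivity)]
    intro p
    rw [Real.dist_eq]
    refine (abs_picardMap_sub_le hN hL0 hL hT hK0 f.continuous g.continuous dist_nonneg
      (fun p => f.dist_coe_le_dist p) p).trans ?_
    gcongr
    rw [div_le_iff₀ hK0]
    push_cast
    nlinarith [mul_nonneg hL0 hT]
  set f := hcontr.fixedPoint with hf
  have hfix : Φ f = f := hcontr.fixedPoint_isFixedPt
  refine ⟨fun t ρ => Real.exp (K * clampTime T t) * f (t, ρ), ?_, ?_, ?_⟩
  · have := f.continuous
    exact (by fun_prop : Continuous fun q : ℝ × ℝ => Real.exp (K * clampTime T q.1) * f (q.1, q.2))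
  · refine ⟨Real.exp (K * T) * ‖f‖, fun t ρ => ?_⟩
    rw [abs_mul, abs_of_pos (Real.exp_pos _)]
    gcongr
    · exact (clampTime_mem hT t).2
    · exact f.norm_coe_le_norm (t, ρ)
  · intro t ht ρ hρ
    have h1 : f (t, ρ) = picardMap N T K f (t, ρ) := by
      conv_lhs => rw [← hfix]
      rfl
    simp only
    rw [h1, picardMap, ← mul_assoc, ← Real.exp_add]
    simp only
    rw [clampTime_of_mem ht, abs_of_nonneg hρ, add_neg_cancel, Real.exp_zero, one_mul, coneInt,
      intervalIntegral.integral_of_le hT]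
    congr 1
    refine (setIntegral_eq_of_subset_of_forall_sdiff_eq_zero measurableSet_Ioc (Ioc_subset_Ioc_right ht.2) ?_).trans ?_
    · intro τ hτ
      have h2 : t < τ := by
        by_contra! h; exact hτ.2 ⟨hτ.1.1, h⟩
      rw [max_eq_right (by linarith), sub_zero, add_zero, abs_of_nonneg hρ, intervalIntegral.integral_same]
    · refine setIntegral_congr_fun measurableSet_Ioc fun τ hτ => ?_
      rw [max_eq_left (by linarith [hτ.2])]

end Volterra

/-! ### Joint measurability of the transforms of a family of functions. -/

section SineFamily

theorem IsHalfTest.pairing_right {ψ : ℝ → ℝ} (h : IsHalfTest ψ) {a b : ℝ} (hab : a ≤ b) :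
    ∫ x, cosKer a b x * ψ x ∂freqMeasure = ∫ y in a..b, sineT ψ y := by
  have h1 : ∫ y in a..b, sineT ψ y = ∫ y in Ioc a b, √(2 / Real.pi) * ∫ x in Ioi (0 : ℝ), Real.sin (x * y) * ψ x := by
    rw [intervalIntegral.integral_of_le hab]; rfl
  rw [h1, integral_const_mul, integral_integral_swap, ← integral_const_mul]
  · refine integral_congr_ae ?_
    filter_upwards [ae_freqMeasure_pos] with y hy
    rw [integral_mul_const, ← intervalIntegral.integral_of_le hab, integral_sin_mul a b hy, cosKer]
    ring
  · have h2 : Integrable (fun p : ℝ × ℝ => (1 : ℝ) * ψ p.2)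
        ((volume.restrict (Ioc a b)).prod (volume.restrict (Ioi 0))) :=
      Integrable.mul_prod (integrable_const 1) h.integrable.integrableOn
    refine h2.mono ?_ (ae_of_all _ fun p => ?_)
    · have := h.continuous
      exact Continuous.aestronglyMeasurable (by fun_prop)
    · simp only [Function.uncurry, norm_mul, norm_one]
      gcongr
      exact Real.abs_sin_le_one _

/-- Integrals of the sine transform of a function over intervals. -/
theorem IsSine.pairing_right {U G : ℝ → ℝ} (h : IsSine U G) (hU : AEStronglyMeasurable U freqMeasure)
    (hG : AEStronglyMeasurable G freqMeasure) {a b : ℝ} (ha : 0 ≤ a) (hab : a ≤ b) :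
    ∫ x, cosKer a b x * U x ∂freqMeasure = ∫ y in a..b, G y := by
  have hUm := h.memLp_left hU
  have hGm := h.memLp_right hG
  obtain ⟨ψ, h1, h2, h3⟩ := h
  have t1 := tendsto_integral_mul (memLp_cosKer a b) (fun n => (h1 n).memLp) hUm h2
  have hK : MemLp ((Ioc a b).indicator fun _ => (1 : ℝ)) 2 freqMeasure := by
    refine memLp_indicator_const 2 measurableSet_Ioc 1 (Or.inr ?_)
    exact ((Measure.restrict_apply_le _ _).trans_lt measure_Ioc_lt_top).ne
  have t2 := tendsto_integral_mul hK (fun n => (h1 n).memLp_sineT) hGm h3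
  have e : ∀ u : ℝ → ℝ, ∫ x, (Ioc a b).indicator (fun _ => (1 : ℝ)) x * u x ∂freqMeasure
      = ∫ x in a..b, u x := by
    intro u
    have : (fun x => (Ioc a b).indicator (fun _ => (1 : ℝ)) x * u x) = (Ioc a b).indicator u := by
      ext x; by_cases hx : x ∈ Ioc a b <;> simp [hx]
    rw [this, integral_indicator measurableSet_Ioc, freqMeasure,
      Measure.restrict_restrict measurableSet_Ioc, inter_eq_left.2, intervalIntegral.integral_of_le hab]
    exact fun x hx => ha.trans_lt hx.1
  simp only [e] at t2
  simp only [fun n => (h1 n).pairing_right hab] at t1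
  exact tendsto_nhds_unique t1 t2

/-- The primitive of the sine transform of a slowly decaying function. -/
def sinePrim (P : ℝ → ℝ → ℝ) (τ y : ℝ) : ℝ := ∫ x, cosKer 0 y x * P τ x ∂freqMeasure

theorem min_one_inv_le {x : ℝ} (hx : 0 < x) : min 1 x⁻¹ ≤ 2 * (1 + x)⁻¹ := by
  rw [← div_eq_mul_inv, le_div_iff₀ (by positivity)]
  rcases le_total 1 x with h | h
  · rw [min_eq_right (inv_le_one_of_one_le₀ h)]
    have := inv_le_one_of_one_le₀ h
    rw [mul_add, inv_mul_cancel₀ hx.ne']; linarith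
  · rw [min_eq_left ((one_le_inv₀ hx).2 h)]; linarith

/-- The decay `(1 + x)^{-1/2}` of the functions and the decay `1 / x` of `cosKer` combine to the
integrable majorant `(1 + x)^{-3/2}`. -/
theorem continuous_sinePrim {P : ℝ → ℝ → ℝ} {C : ℝ} (hP : Continuous (Function.uncurry P))
    (hb : ∀ τ, ∀ x, 0 < x → |P τ x| ≤ C * (1 + x) ^ (-1 / 2 : ℝ)) :
    Continuous (Function.uncurry (sinePrim P)) := by
  have hP' : Continuous fun q : ℝ × ℝ => P q.1 q.2 := hP
  refine continuous_iff_continuousAt.2 fun ⟨τ₀, y₀⟩ => ?_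
  refine continuousAt_of_dominated (F := fun (q : ℝ × ℝ) x => cosKer 0 q.2 x * P q.1 x)
    (bound := fun x => (3 + |y₀|) * (2 * C) * (1 + x) ^ (-3 / 2 : ℝ)) ?_ ?_ ?_ ?_
  · refine Eventually.of_forall fun q => AEStronglyMeasurable.mul ?_ ?_
    · exact (memLp_cosKer 0 q.2).1
    · exact (by fun_prop : Continuous fun x => P q.1 x).aestronglyMeasurable
  · filter_upwards [Metric.ball_mem_nhds (τ₀, y₀) one_pos] with q hq
    filter_upwards [ae_freqMeasure_pos] with x hx
    have hx1 : 0 < 1 + x := by linarith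
    have h1 : |q.2| ≤ 1 + |y₀| := by
      have h2 : dist q.2 y₀ < 1 := (le_max_right _ _).trans_lt hq
      rw [Real.dist_eq] at h2
      have := abs_add_le (q.2 - y₀) y₀
      rw [sub_add_cancel] at this
      linarith
    rw [norm_mul]
    calc _ ≤ ((2 + |0 - q.2|) * min 1 x⁻¹) * (C * (1 + x) ^ (-1 / 2 : ℝ)) :=
          mul_le_mul (abs_cosKer_le 0 q.2 hx) (hb _ _ hx) (abs_nonneg _)
            (mul_nonneg (by positivity) (le_min zero_le_one (by positivity)))
      _ ≤ ((3 + |y₀|) * (2 * (1 + x)⁻¹)) * (C * (1 + x) ^ (-1 / 2 : ℝ)) := by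
          have hC : 0 ≤ C * (1 + x) ^ (-1 / 2 : ℝ) := (abs_nonneg _).trans (hb τ₀ x hx)
          rw [zero_sub, abs_neg]
          gcongr ?_ * _
          refine mul_le_mul (by linarith) (min_one_inv_le hx) (le_min zero_le_one (by positivity)) (by positivity)
      _ = (3 + |y₀|) * (2 * C) * ((1 + x) ^ (-1 : ℝ) * (1 + x) ^ (-1 / 2 : ℝ)) := by
          rw [Real.rpow_neg_one]; ring
      _ = _ := by rw [← Real.rpow_add hx1]; norm_num
  · refine Integrable.const_mul ?_ _
    have h : IntegrableOn (fun x : ℝ => (x + 1) ^ (-3 / 2 : ℝ)) (Ioi 0) :=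
      integrableOn_add_rpow_Ioi_of_lt (by norm_num) (by norm_num)
    simp_rw [add_comm (1 : ℝ)]
    exact h
  · refine ae_of_all _ fun x => Continuous.continuousAt ?_
    unfold cosKer
    fun_prop

/-- The sine transforms of a continuous family of functions, as a jointly measurable function. -/
theorem exists_measurable_isSine {P : ℝ → ℝ → ℝ} {C : ℝ} (hP : Continuous (Function.uncurry P))
    (hb : ∀ τ, ∀ x, 0 < x → |P τ x| ≤ C * (1 + x) ^ (-1 / 2 : ℝ)) (hL : ∀ τ, MemLp (P τ) 2 freqMeasure) :
    ∃ G : ℝ → ℝ → ℝ, Measurable (Function.uncurry G) ∧ ∀ τ, IsSine (P τ) (G τ) := by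
  -- The `L²` transform exists for each `τ` only up to null sets. The derivative in `y` of its
  -- jointly continuous primitive is a jointly measurable choice, and Lebesgue's differentiation
  -- theorem identifies it with the transform for every `τ`.
  refine ⟨fun τ y => deriv (sinePrim P τ) y, measurable_deriv_with_param (continuous_sinePrim hP hb), fun τ => ?_⟩
  set H := sineL2 (hL τ).toLp with hH
  have h1 : IsSine (P τ) H := (isSine_sineL2 _).congr (hL τ).coeFn_toLp (ae_eq_refl _)
  refine h1.congr (ae_eq_refl _) ?_
  set H0 := (Ioi (0 : ℝ)).indicator H with hH0
  have hloc : LocallyIntegrable H0 volume := by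
    intro x
    have hm : MemLp H0 2 volume := (memLp_indicator_iff_restrict measurableSet_Ioi).2 (Lp.memLp H)
    exact (hm.locallyIntegrable (by norm_num)) x
  have h2 : ∀ᵐ y ∂freqMeasure, ∀ c, HasDerivAt (fun y => ∫ t in c..y, H0 t) (H0 y) y :=
    ae_restrict_of_ae (LocallyIntegrable.ae_hasDerivAt_integral hloc)
  filter_upwards [h2, ae_freqMeasure_pos] with y hy hy0
  have e : ∀ z, 0 < z → sinePrim P τ z = ∫ t in (0 : ℝ)..z, H0 t := by
    intro z hz
    rw [sinePrim, h1.pairing_right (hL τ).1 (Lp.aestronglyMeasurable H) le_rfl hz.le,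
      intervalIntegral.integral_of_le hz.le, intervalIntegral.integral_of_le hz.le]
    refine setIntegral_congr_fun measurableSet_Ioc fun t ht => ?_
    rw [hH0, indicator_of_mem (show t ∈ Ioi (0 : ℝ) from ht.1)]
  have h3 := hy 0
  rw [hH0, indicator_of_mem (show y ∈ Ioi (0 : ℝ) from hy0)] at h3
  have h4 : HasDerivAt (sinePrim P τ) (H y) y :=
    h3.congr_of_eventuallyEq (by filter_upwards [Ioi_mem_nhds hy0] with z hz using e z hz)
  exact h4.deriv.symm

end SineFamily

/-! ### D'Alembert's formula for free waves. -/

section FreeField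

variable {a b α : ℝ → ℝ}

/-- Bessel's inequality on the half line. -/
theorem lintegral_fourier_freq_le (hα : Integrable α freqMeasure) :
    ∫⁻ t, ENNReal.ofReal ((∫ y, Real.cos (t * y) * α y ∂freqMeasure) ^ 2
        + (∫ y, Real.sin (t * y) * α y ∂freqMeasure) ^ 2)
      ≤ ENNReal.ofReal (2 * Real.pi) * ∫⁻ y, ‖α y‖ₑ ^ 2 ∂freqMeasure := by
  set β := hα.1.mk with hβ
  have hβm : Measurable β := hα.1.stronglyMeasurable_mk.measurable
  have e : α =ᵐ[freqMeasure] β := hα.1.ae_eq_mk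
  have hβi : Integrable β freqMeasure := hα.congr e
  set c := (Ioi (0 : ℝ)).indicator β with hc
  have hcm : Measurable c := hβm.indicator measurableSet_Ioi
  have hci : Integrable c := (integrable_indicator_iff measurableSet_Ioi).2 hβi
  have e1 : ∀ φ : ℝ → ℝ, ∫ y, φ y * α y ∂freqMeasure = ∫ y, φ y * c y := by
    intro φ
    rw [integral_congr_ae (e.mono fun y hy => show φ y * α y = φ y * β y by rw [hy]), freqMeasure,
      ← integral_indicator measurableSet_Ioi]
    congr 1; ext y
    by_cases hy : y ∈ Ioi (0 : ℝ) <;> simp [hc, hy]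
  have e2 : ∫⁻ y, ‖α y‖ₑ ^ 2 ∂freqMeasure = ∫⁻ y, ‖c y‖ₑ ^ 2 := by
    rw [lintegral_congr_ae (e.mono fun y hy => show ‖α y‖ₑ ^ 2 = ‖β y‖ₑ ^ 2 by rw [hy]), freqMeasure,
      ← lintegral_indicator measurableSet_Ioi]
    congr 1; ext y
    by_cases hy : y ∈ Ioi (0 : ℝ) <;> simp [hc, hy]
  simp_rw [e1 fun y => Real.cos (_ * y), e1 fun y => Real.sin (_ * y)]
  rw [e2]
  exact lintegral_fourier_le hcm hci

/-- The free wave with data `(a, b)`, times the radius. -/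
def freeField (a b : ℝ → ℝ) (t ρ : ℝ) : ℝ :=
  sineT (fun y => Real.cos (t * y) * a y) ρ + sineT (fun y => Real.sin (t * y) * (b y / y)) ρ

/-- The outgoing density of the free wave with data `(a, b)`. -/
def freeDens (a b : ℝ → ℝ) (x : ℝ) : ℝ :=
  √(2 / Real.pi) * (∫ y, Real.cos (x * y) * (y * a y) ∂freqMeasure + ∫ y, Real.sin (x * y) * b y ∂freqMeasure)

theorem continuous_integral_mul (hα : Integrable α freqMeasure) {φ : ℝ → ℝ} (hφ : Continuous φ)
    (h1 : ∀ x, |φ x| ≤ 1) : Continuous fun x => ∫ y, φ (x * y) * α y ∂freqMeasure := by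
  refine continuous_of_dominated (bound := fun y => ‖α y‖) (fun x => ?_) (fun x => ae_of_all _ fun y => ?_)
    hα.norm (ae_of_all _ fun y => by fun_prop)
  · exact (by fun_prop : Continuous fun y => φ (x * y)).aestronglyMeasurable.mul hα.1
  · rw [norm_mul]; exact mul_le_of_le_one_left (norm_nonneg _) (h1 _)

theorem continuous_freeDens (ha : Integrable (fun y => y * a y) freqMeasure) (hb : Integrable b freqMeasure) :
    Continuous (freeDens a b) :=
  continuous_const.mul ((continuous_integral_mul ha Real.continuous_cos Real.abs_cos_le_one).add
    (continuous_integral_mul hb Real.continuous_sin Real.abs_sin_le_one))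

/-- Bessel's inequality for the cosine and the sine integral separately; the factor 2 for the square
of their sum turns `2π` into `4π`. -/
theorem lintegral_freeDens_sq_le (ha : Integrable (fun y => y * a y) freqMeasure) (hb : Integrable b freqMeasure) :
    ∫⁻ x, ‖freeDens a b x‖ₑ ^ 2 ≤ ENNReal.ofReal (4 * Real.pi) *
      (eLpNorm (fun y => y * a y) 2 freqMeasure ^ 2 + eLpNorm b 2 freqMeasure ^ 2) := by
  have h1 := lintegral_fourier_freq_le ha
  have h2 := lintegral_fourier_freq_le hb
  set A : ℝ → ℝ := fun x => (∫ y, Real.cos (x * y) * (y * a y) ∂freqMeasure) ^ 2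
    + (∫ y, Real.sin (x * y) * (y * a y) ∂freqMeasure) ^ 2 with hA
  set B : ℝ → ℝ := fun x => (∫ y, Real.cos (x * y) * b y ∂freqMeasure) ^ 2
    + (∫ y, Real.sin (x * y) * b y ∂freqMeasure) ^ 2 with hB
  have hAm : Measurable A :=
    (((continuous_integral_mul ha Real.continuous_cos Real.abs_cos_le_one).pow 2).add
      ((continuous_integral_mul ha Real.continuous_sin Real.abs_sin_le_one).pow 2)).measurable
  have hle : ∀ x, ‖freeDens a b x‖ₑ ^ 2 ≤ 2 * (ENNReal.ofReal (A x) + ENNReal.ofReal (B x)) := by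
    intro x
    have hA0 : 0 ≤ A x := by positivity
    have hB0 : 0 ≤ B x := by positivity
    rw [← ofReal_norm, ← ENNReal.ofReal_pow (norm_nonneg _), Real.norm_eq_abs, sq_abs,
      ← ENNReal.ofReal_add hA0 hB0, show (2 : ℝ≥0∞) = ENNReal.ofReal 2 by norm_num,
      ← ENNReal.ofReal_mul (by norm_num)]
    refine ENNReal.ofReal_le_ofReal ?_
    rw [freeDens, mul_pow]
    set u := ∫ y, Real.cos (x * y) * (y * a y) ∂freqMeasure
    set v := ∫ y, Real.sin (x * y) * b y ∂freqMeasure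
    have hu : u ^ 2 ≤ A x := le_add_of_nonneg_right (sq_nonneg _)
    have hv : v ^ 2 ≤ B x := le_add_of_nonneg_left (sq_nonneg _)
    have h3 : √(2 / Real.pi) ^ 2 ≤ 1 := pow_le_one₀ (Real.sqrt_nonneg _) sqrt_two_div_pi_le_one
    calc _ ≤ 1 * (u + v) ^ 2 := by gcongr
      _ ≤ _ := by nlinarith [sq_nonneg (u - v)]
  calc _ ≤ ∫⁻ x, 2 * (ENNReal.ofReal (A x) + ENNReal.ofReal (B x)) := lintegral_mono hle
    _ = 2 * ((∫⁻ x, ENNReal.ofReal (A x)) + ∫⁻ x, ENNReal.ofReal (B x)) := by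
        rw [lintegral_const_mul' _ _ (by norm_num), lintegral_add_left hAm.ennreal_ofReal]
    _ ≤ 2 * (ENNReal.ofReal (2 * Real.pi) * (∫⁻ y, ‖y * a y‖ₑ ^ 2 ∂freqMeasure)
        + ENNReal.ofReal (2 * Real.pi) * ∫⁻ y, ‖b y‖ₑ ^ 2 ∂freqMeasure) := by gcongr
    _ = _ := by
        rw [eLpNorm_two_sq, eLpNorm_two_sq, ← mul_add, ← mul_assoc, show (2 : ℝ≥0∞) = ENNReal.ofReal 2 by norm_num,
          ← ENNReal.ofReal_mul (by norm_num)]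
        congr 2; ring

theorem setIntegral_cos_mul (t : ℝ) {ρ y : ℝ} (hρ : 0 ≤ ρ) (hy : 0 < y) :
    ∫ x in Ioc (t - ρ) (t + ρ), Real.cos (x * y) = 2 * (Real.cos (t * y) * Real.sin (y * ρ)) / y := by
  rw [← intervalIntegral.integral_of_le (by linarith),
    intervalIntegral.integral_comp_mul_right (fun x => Real.cos x) hy.ne', integral_cos,
    add_mul, sub_mul, Real.sin_add, Real.sin_sub, mul_comm ρ y]
  simp only [smul_eq_mul]
  field_simp
  ring

theorem setIntegral_sin_mul (t : ℝ) {ρ y : ℝ} (hρ : 0 ≤ ρ) (hy : 0 < y) :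
    ∫ x in Ioc (t - ρ) (t + ρ), Real.sin (x * y) = 2 * (Real.sin (t * y) * Real.sin (y * ρ)) / y := by
  rw [← intervalIntegral.integral_of_le (by linarith),
    intervalIntegral.integral_comp_mul_right (fun x => Real.sin x) hy.ne', integral_sin,
    add_mul, sub_mul, Real.cos_add, Real.cos_sub, mul_comm ρ y]
  simp only [smul_eq_mul]
  field_simp
  ring

theorem setIntegral_integral_mul (hα : Integrable α freqMeasure) {φ : ℝ → ℝ} (hφ : Continuous φ)
    (h1 : ∀ x, |φ x| ≤ 1) (c d : ℝ) :
    ∫ x in Ioc c d, ∫ y, φ (x * y) * α y ∂freqMeasure = ∫ y, (∫ x in Ioc c d, φ (x * y)) * α y ∂freqMeasure := by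
  rw [integral_integral_swap]
  · simp_rw [integral_mul_const]
  · have h2 : Integrable (fun p : ℝ × ℝ => (1 : ℝ) * α p.2) ((volume.restrict (Ioc c d)).prod freqMeasure) :=
      Integrable.mul_prod (integrable_const 1) hα
    refine h2.mono ?_ (ae_of_all _ fun p => ?_)
    · exact (by fun_prop : Continuous fun p : ℝ × ℝ => φ (p.1 * p.2)).aestronglyMeasurable.mul hα.1.comp_snd
    · simp only [Function.uncurry, norm_mul, norm_one]
      gcongr
      exact h1 _

/-- D'Alembert's formula. -/
theorem freeField_eq (ha : Integrable (fun y => y * a y) freqMeasure) (hb : Integrable b freqMeasure)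
    (t : ℝ) {ρ : ℝ} (hρ : 0 ≤ ρ) :
    freeField a b t ρ = (1 / 2) * ∫ x in Ioc (t - ρ) (t + ρ), freeDens a b x := by
  have hi : ∀ {f : ℝ → ℝ}, Continuous f → IntegrableOn f (Ioc (t - ρ) (t + ρ)) := fun hf =>
    (hf.integrableOn_Icc).mono_set Ioc_subset_Icc_self
  simp_rw [freeDens]
  rw [integral_const_mul, integral_add
    (hi (continuous_integral_mul ha Real.continuous_cos Real.abs_cos_le_one))
    (hi (continuous_integral_mul hb Real.continuous_sin Real.abs_sin_le_one)),
    setIntegral_integral_mul ha Real.continuous_cos Real.abs_cos_le_one,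
    setIntegral_integral_mul hb Real.continuous_sin Real.abs_sin_le_one]
  have e1 : ∫ y, (∫ x in Ioc (t - ρ) (t + ρ), Real.cos (x * y)) * (y * a y) ∂freqMeasure
      = 2 * ∫ y, Real.sin (y * ρ) * (Real.cos (t * y) * a y) ∂freqMeasure := by
    rw [← integral_const_mul]
    refine integral_congr_ae ?_
    filter_upwards [ae_freqMeasure_pos] with y hy
    rw [setIntegral_cos_mul t hρ hy]
    field_simp
  have e2 : ∫ y, (∫ x in Ioc (t - ρ) (t + ρ), Real.sin (x * y)) * b y ∂freqMeasure
      = 2 * ∫ y, Real.sin (y * ρ) * (Real.sin (t * y) * (b y / y)) ∂freqMeasure := by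
    rw [← integral_const_mul]
    refine integral_congr_ae ?_
    filter_upwards [ae_freqMeasure_pos] with y hy
    rw [setIntegral_sin_mul t hρ hy]
    field_simp
  rw [e1, e2, freeField, sineT, sineT]
  change √(2 / Real.pi) * (∫ y, Real.sin (y * ρ) * (Real.cos (t * y) * a y) ∂freqMeasure)
    + √(2 / Real.pi) * (∫ y, Real.sin (y * ρ) * (Real.sin (t * y) * (b y / y)) ∂freqMeasure) = _
  ring

theorem continuous_freeField_abs (ha : Integrable (fun y => y * a y) freqMeasure) (hb : Integrable b freqMeasure) :
    Continuous fun p : ℝ × ℝ => freeField a b p.1 |p.2| := by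
  have h := continuous_freeDens ha hb
  have e : (fun p : ℝ × ℝ => freeField a b p.1 |p.2|)
      = fun p : ℝ × ℝ => (1 / 2) * ∫ x in (p.1 - |p.2|)..(p.1 + |p.2|), freeDens a b x := by
    ext p
    rw [freeField_eq ha hb p.1 (abs_nonneg _), intervalIntegral.integral_of_le (by linarith [abs_nonneg p.2])]
  rw [e]
  exact continuous_const.mul (continuous_parametric_interval (f := fun (_ : ℝ × ℝ) x => freeDens a b x)
    (by unfold Function.uncurry; fun_prop) (by fun_prop) (by fun_prop))

end FreeField

/-! ### Domination of the retarded integral by one-dimensional averages. -/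

section ConeMaximal

/-- The density dominating the wave generated by the forcing `P`. -/
def coneDens (P : ℝ → ℝ → ℝ) (T y : ℝ) : ℝ≥0∞ := ∫⁻ τ in Ioc 0 T, ‖P τ |y - τ|‖ₑ

variable {P : ℝ → ℝ → ℝ} {T : ℝ}

theorem measurable_coneDens (hP : Measurable (Function.uncurry P)) : Measurable (coneDens P T) := by
  have hP' : Measurable fun q : ℝ × ℝ => P q.1 q.2 := hP
  have h : Measurable fun q : ℝ × ℝ => ‖P q.2 |q.1 - q.2|‖ₑ :=
    (hP'.comp (measurable_snd.prodMk (measurable_fst.sub measurable_snd).abs)).enorm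
  exact Measurable.lintegral_prod_right' h

theorem lintegral_comp_abs {F : ℝ → ℝ≥0∞} :
    ∫⁻ z, F |z| = 2 * ∫⁻ z, F z ∂freqMeasure := by
  have e1 : ∫⁻ z in Ioi (0 : ℝ), F |z| = ∫⁻ z, F z ∂freqMeasure := by
    rw [freqMeasure]
    refine setLIntegral_congr_fun measurableSet_Ioi fun z hz => ?_
    rw [abs_of_pos hz]
  have e2 : ∫⁻ z in (Ioi (0 : ℝ))ᶜ, F |z| = ∫⁻ z, F z ∂freqMeasure := by
    rw [← lintegral_indicator measurableSet_Ioi.compl, ← lintegral_neg_eq_self, ← e1,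
      setLIntegral_congr Ioi_ae_eq_Ici, ← lintegral_indicator measurableSet_Ici]
    refine lintegral_congr fun z => ?_
    by_cases hz : 0 ≤ z
    · rw [indicator_of_mem (show -z ∈ (Ioi (0 : ℝ))ᶜ by simpa using hz), indicator_of_mem (show z ∈ Ici (0 : ℝ) from hz), abs_neg]
    · rw [indicator_of_notMem (show -z ∉ (Ioi (0 : ℝ))ᶜ by simpa using hz), indicator_of_notMem (show z ∉ Ici (0 : ℝ) from hz)]
  rw [← lintegral_add_compl _ (measurableSet_Ioi (a := (0 : ℝ))), e1, e2, two_mul]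

/-- Minkowski's inequality in `τ` and translation invariance in `y`; the 2 comes from the even
extension `|y - τ|`, which covers the half line twice. -/
theorem lintegral_coneDens_sq_le (hP : Measurable (Function.uncurry P)) :
    ∫⁻ y, coneDens P T y ^ 2 ≤ 2 * (∫⁻ τ in Ioc 0 T, eLpNorm (P τ) 2 freqMeasure) ^ 2 := by
  have hP' : Measurable fun q : ℝ × ℝ => P q.1 q.2 := hP
  have h : Measurable fun q : ℝ × ℝ => ‖P q.1 |q.2 - q.1|‖ₑ :=
    (hP'.comp (measurable_fst.prodMk (measurable_snd.sub measurable_fst).abs)).enorm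
  refine (lintegral_sq_lintegral_le (μ := volume.restrict (Ioc 0 T)) (ν := volume)
    (f := fun τ y => ‖P τ |y - τ|‖ₑ) h).trans ?_
  have e : ∀ τ, ∫⁻ y, ‖P τ |y - τ|‖ₑ ^ 2 = 2 * ∫⁻ z, ‖P τ z‖ₑ ^ 2 ∂freqMeasure := by
    intro τ
    rw [lintegral_sub_right_eq_self (fun y => ‖P τ |y|‖ₑ ^ 2) τ]
    exact lintegral_comp_abs (F := fun z => ‖P τ z‖ₑ ^ 2)
  simp_rw [e, ENNReal.mul_rpow_of_nonneg _ _ (show (0 : ℝ) ≤ 1 / 2 by norm_num), ← eLpNorm_two_eq]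
  rw [lintegral_const_mul' _ _ (by finiteness), mul_pow]
  refine mul_le_mul' (le_of_eq ?_) le_rfl
  rw [← ENNReal.rpow_natCast, ← ENNReal.rpow_mul]; norm_num

/-- In the characteristic variable `y = τ + σ` the reflected cone with vertex `(t, ρ)` lies over `(t
- ρ, t + ρ)` for every `τ`. The retarded integral is thus bounded by the same kind of average as a
free wave in d'Alembert's formula. -/
theorem enorm_coneInt_le (hP : Measurable (Function.uncurry P)) {t ρ : ℝ} (htT : t ≤ T) (hρ : 0 ≤ ρ) :
    ‖coneInt P t ρ‖ₑ ≤ ENNReal.ofReal (1 / 2) * ∫⁻ y in Ioc (t - ρ) (t + ρ), coneDens P T y := by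
  have hP' : Measurable fun q : ℝ × ℝ => P q.1 q.2 := hP
  rw [coneInt, enorm_mul, ← ofReal_norm (1 / 2 : ℝ), Real.norm_of_nonneg (by norm_num : (0 : ℝ) ≤ 1 / 2)]
  gcongr
  have h : Measurable fun q : ℝ × ℝ => ‖P q.2 |q.1 - q.2|‖ₑ :=
    (hP'.comp (measurable_snd.prodMk (measurable_fst.sub measurable_snd).abs)).enorm
  unfold coneDens
  rw [lintegral_lintegral_swap h.aemeasurable]
  refine (enorm_integral_le_lintegral_enorm _).trans ?_
  refine le_trans (setLIntegral_mono' measurableSet_Ioc fun τ hτ => ?_)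
    (lintegral_mono_set (Ioc_subset_Ioc_right htT))
  have hle : |ρ - (t - τ)| ≤ ρ + (t - τ) := by
    rw [abs_le]; constructor <;> linarith [hτ.2]
  rw [intervalIntegral.integral_of_le hle]
  refine (enorm_integral_le_lintegral_enorm _).trans ?_
  rw [← lintegral_indicator measurableSet_Ioc, ← lintegral_indicator measurableSet_Ioc,
    ← lintegral_sub_right_eq_self _ τ]
  refine lintegral_mono fun y => ?_
  by_cases hy : y - τ ∈ Ioc |ρ - (t - τ)| (ρ + (t - τ))
  · have h1 : 0 ≤ y - τ := (abs_nonneg _).trans hy.1.le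
    have h2 := neg_abs_le (ρ - (t - τ))
    rw [indicator_of_mem hy, indicator_of_mem (show y ∈ Ioc (t - ρ) (t + ρ) from
      ⟨by linarith [hy.1], by linarith [hy.2]⟩), abs_of_nonneg h1]
  · rw [indicator_of_notMem hy]; exact zero_le

end ConeMaximal

/-! ### The perturbed cubic nonlinearity and its truncation. -/

section Nonlinearity

/-- The radial profile of `-(v + w)³ + w³`, where `x = r v` and `w` stands for `r w`. -/
def perturbedCubic (w x r : ℝ) : ℝ := -((x + w) ^ 3 - w ^ 3) / r ^ 2

/-- The mixed term is split by `2|x w| ≤ x² + w²`, so the forcing quadratic in `v` needs no estimate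
of its own. -/
theorem abs_perturbedCubic_le (w x : ℝ) {r : ℝ} (hr : 0 < r) :
    |perturbedCubic w x r| ≤ |x| * (5 / 2 * x ^ 2 + 9 / 2 * w ^ 2) / r ^ 2 := by
  rw [perturbedCubic, abs_div, abs_neg, abs_of_pos (show 0 < r ^ 2 by positivity),
    show (x + w) ^ 3 - w ^ 3 = x * (x ^ 2 + 3 * x * w + 3 * w ^ 2) by ring, abs_mul]
  gcongr
  rw [abs_le]
  constructor <;> nlinarith [sq_nonneg (x - w), sq_nonneg (x + w)]

theorem abs_perturbedCubic_sub_le {w x x' A r : ℝ} (hr : 0 < r) (hx : |x| + |w| ≤ A) (hx' : |x'| + |w| ≤ A) :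
    |perturbedCubic w x r - perturbedCubic w x' r| ≤ 3 * A ^ 2 / r ^ 2 * |x - x'| := by
  have e : perturbedCubic w x r - perturbedCubic w x' r
      = -(((x + w) ^ 2 + (x + w) * (x' + w) + (x' + w) ^ 2) * (x - x')) / r ^ 2 := by
    unfold perturbedCubic; ring
  rw [e, abs_div, abs_neg, abs_mul, abs_of_pos (show 0 < r ^ 2 by positivity), div_mul_eq_mul_div]
  gcongr
  have h1 : |x + w| ≤ A := (abs_add_le _ _).trans hx
  have h2 : |x' + w| ≤ A := (abs_add_le _ _).trans hx'
  have hA : 0 ≤ A := (abs_nonneg _).trans h1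
  rw [abs_le] at h1 h2 ⊢
  constructor <;> nlinarith [sq_nonneg (x + w + (x' + w)), mul_nonneg (sub_nonneg.2 h1.2) (sub_nonneg.2 h1.1),
    mul_nonneg (sub_nonneg.2 h2.2) (sub_nonneg.2 h2.1), sq_nonneg (x + w - (x' + w))]

theorem perturbedCubic_zero (w r : ℝ) : perturbedCubic w 0 r = 0 := by simp [perturbedCubic]

/-- Truncation at height `B`. -/
def truncAt (B x : ℝ) : ℝ := max (-B) (min x B)

theorem truncAt_of_abs_le {B x : ℝ} (h : |x| ≤ B) : truncAt B x = x := by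
  rw [abs_le] at h
  rw [truncAt, min_eq_left h.2, max_eq_right h.1]

theorem abs_truncAt_le {B : ℝ} (hB : 0 ≤ B) (x : ℝ) : |truncAt B x| ≤ B :=
  abs_le.2 ⟨le_max_left _ _, max_le (by linarith) (min_le_right _ _)⟩

theorem abs_truncAt_sub_le (B x x' : ℝ) : |truncAt B x - truncAt B x'| ≤ |x - x'| := by
  unfold truncAt
  rw [max_comm, max_comm (-B)]
  refine (abs_max_sub_max_le_abs _ _ _).trans ?_
  simpa using abs_min_sub_min_le_max x B x' B

theorem abs_truncAt_le_abs {B : ℝ} (hB : 0 ≤ B) (x : ℝ) : |truncAt B x| ≤ |x| := by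
  have h := abs_truncAt_sub_le B x 0
  rwa [truncAt_of_abs_le (x := 0) (by simpa using hB), sub_zero, sub_zero] at h

end Nonlinearity

/-! ### Energy estimates for the linear wave with forcing. -/

section WaveSolution

/-- The transform of the wave with data `(a, b)` and the forcing with transform `G`. -/
def waveSol (a b : ℝ → ℝ) (G : ℝ → ℝ → ℝ) (t y : ℝ) : ℝ :=
  Real.cos (t * y) * a y + Real.sin (t * y) * (b y / y) + duhamelInt G t y

variable {a b : ℝ → ℝ} {G : ℝ → ℝ → ℝ} {t ρ : ℝ}

theorem memLp_mul_div (hb : MemLp b 2 freqMeasure) : MemLp (fun y => y * (b y / y)) 2 freqMeasure := by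
  refine hb.ae_eq ?_
  filter_upwards [ae_freqMeasure_pos] with y hy
  field_simp

theorem memLp_mul_bdd {h : ℝ → ℝ} (hh : MemLp (fun y => y * h y) 2 freqMeasure) {φ : ℝ → ℝ} (hφ : Measurable φ)
    (h1 : ∀ x, |φ x| ≤ 1) : MemLp (fun y => y * (φ y * h y)) 2 freqMeasure := by
  refine hh.mono ?_ (ae_of_all _ fun y => ?_)
  · have := hφ.aestronglyMeasurable.mul hh.1
    refine this.congr (ae_of_all _ fun y => ?_)
    simp only [Pi.mul_apply]; ring
  · rw [mul_left_comm, norm_mul]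
    exact mul_le_of_le_one_left (norm_nonneg _) (h1 _)

theorem eLpNorm_mul_bdd_le {h : ℝ → ℝ} {φ : ℝ → ℝ} (h1 : ∀ x, |φ x| ≤ 1) :
    eLpNorm (fun y => y * (φ y * h y)) 2 freqMeasure ≤ eLpNorm (fun y => y * h y) 2 freqMeasure := by
  refine eLpNorm_mono fun y => ?_
  rw [mul_left_comm, norm_mul]
  exact mul_le_of_le_one_left (norm_nonneg _) (h1 _)

theorem memLp_waveSol (ha : MemLp (fun y => y * a y) 2 freqMeasure) (hb : MemLp b 2 freqMeasure)
    (hG : Measurable (Function.uncurry G)) (ht : 0 ≤ t) (hfin : ∫⁻ τ in Ioc 0 t, eLpNorm (G τ) 2 freqMeasure < ⊤) :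
    MemLp (fun y => y * waveSol a b G t y) 2 freqMeasure := by
  have := ((memLp_mul_bdd ha (φ := fun y => Real.cos (t * y)) (by fun_prop) fun y => Real.abs_cos_le_one _).add
    (memLp_mul_bdd (memLp_mul_div hb) (φ := fun y => Real.sin (t * y)) (by fun_prop)
      fun y => Real.abs_sin_le_one _)).add (memLp_duhamelInt hG ht hfin)
  refine this.ae_eq (ae_of_all _ fun y => ?_)
  simp only [waveSol, Pi.add_apply]; ring

theorem eLpNorm_mul_div (b : ℝ → ℝ) :
    eLpNorm (fun y => y * (b y / y)) 2 freqMeasure = eLpNorm b 2 freqMeasure := by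
  refine eLpNorm_congr_ae ?_
  filter_upwards [ae_freqMeasure_pos] with y hy
  field_simp

theorem eLpNorm_waveSol_le (ha : MemLp (fun y => y * a y) 2 freqMeasure) (hb : MemLp b 2 freqMeasure)
    (hG : Measurable (Function.uncurry G)) (ht : 0 ≤ t) :
    eLpNorm (fun y => y * waveSol a b G t y) 2 freqMeasure
      ≤ eLpNorm (fun y => y * a y) 2 freqMeasure + eLpNorm b 2 freqMeasure
        + ∫⁻ τ in Ioc 0 t, eLpNorm (G τ) 2 freqMeasure := by
  have m1 := memLp_mul_bdd ha (φ := fun y => Real.cos (t * y)) (by fun_prop) fun y => Real.abs_cos_le_one _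
  have m2 := memLp_mul_bdd (memLp_mul_div hb) (φ := fun y => Real.sin (t * y)) (by fun_prop)
      fun y => Real.abs_sin_le_one _
  have m3 : AEStronglyMeasurable (fun y => y * duhamelInt G t y) freqMeasure :=
    (measurable_id.mul (measurable_duhamelInt hG ht)).aestronglyMeasurable
  have e : (fun y => y * waveSol a b G t y) = ((fun y => y * (Real.cos (t * y) * a y))
      + fun y => y * (Real.sin (t * y) * (b y / y))) + fun y => y * duhamelInt G t y := by
    ext y; simp only [waveSol, Pi.add_apply]; ring
  rw [e]
  refine (eLpNorm_add_le (m1.1.add m2.1) m3 (by norm_num)).trans ?_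
  gcongr
  · refine (eLpNorm_add_le m1.1 m2.1 (by norm_num)).trans ?_
    rw [← eLpNorm_mul_div b]
    gcongr
    · exact eLpNorm_mul_bdd_le (φ := fun y => Real.cos (t * y)) fun y => Real.abs_cos_le_one _
    · exact eLpNorm_mul_bdd_le (φ := fun y => Real.sin (t * y)) fun y => Real.abs_sin_le_one _
  · exact eLpNorm_duhamelInt_le hG ht

theorem sineAdm_cos (ha : MemLp (fun y => y * a y) 2 freqMeasure) (t : ℝ) :
    SineAdm fun y => Real.cos (t * y) * a y :=
  (sineAdm_of_memLp ha).bdd_mul (φ := fun y => Real.cos (t * y)) (by fun_prop) fun y => Real.abs_cos_le_one _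

theorem sineAdm_sin (hb : MemLp b 2 freqMeasure) (t : ℝ) :
    SineAdm fun y => Real.sin (t * y) * (b y / y) :=
  (sineAdm_of_memLp (memLp_mul_div hb)).bdd_mul (φ := fun y => Real.sin (t * y)) (by fun_prop)
    fun y => Real.abs_sin_le_one _

theorem sineT_waveSol (ha : MemLp (fun y => y * a y) 2 freqMeasure) (hb : MemLp b 2 freqMeasure)
    (hG : Measurable (Function.uncurry G)) (ht : 0 ≤ t) (hfin : ∫⁻ τ in Ioc 0 t, eLpNorm (G τ) 2 freqMeasure < ⊤)
    {P : ℝ → ℝ → ℝ} (hP : ∀ τ ∈ Ioc 0 t, AEStronglyMeasurable (P τ) freqMeasure)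
    (hs : ∀ τ ∈ Ioc 0 t, IsSine (P τ) (G τ)) (hρ : 0 ≤ ρ) :
    sineT (waveSol a b G t) ρ = freeField a b t ρ + coneInt P t ρ := by
  have h1 := sineAdm_cos ha t
  have h2 := sineAdm_sin hb t
  have h3 := sineAdm_of_memLp (memLp_duhamelInt hG ht hfin)
  rw [freeField, coneInt, ← sineT_duhamelInt hG ht hfin
    ((ae_restrict_iff' measurableSet_Ioc).2 (ae_of_all _ hP))
    ((ae_restrict_iff' measurableSet_Ioc).2 (ae_of_all _ hs)) hρ, ← h1.sineT_add h2, ← (h1.add h2).sineT_add h3]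
  rfl

theorem lintegral_inv_one_add_sq_lt_top : eLpNorm (fun ρ : ℝ => (1 + ρ)⁻¹) 2 freqMeasure < ⊤ := by
  have h : IntegrableOn (fun x : ℝ => (x + 1) ^ (-2 : ℝ)) (Ioi 0) :=
    integrableOn_add_rpow_Ioi_of_lt (by norm_num) (by norm_num)
  have : eLpNorm (fun ρ : ℝ => (1 + ρ)⁻¹) 2 freqMeasure ^ 2 < ⊤ := by
    rw [eLpNorm_two_sq]
    refine lt_of_le_of_lt (le_of_eq ?_) (Integrable.lintegral_lt_top h)
    refine lintegral_congr_ae ?_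
    filter_upwards [ae_freqMeasure_pos] with ρ hρ
    have h0 : 0 < 1 + ρ := by linarith
    rw [← ofReal_norm, Real.norm_of_nonneg (by positivity), ← ENNReal.ofReal_pow (by positivity), inv_pow,
      Real.rpow_neg (by linarith), Real.rpow_ofNat, add_comm]
  exact (ENNReal.pow_lt_top_iff.1 this).resolve_right (by norm_num)

/-- Hardy's inequality. -/
theorem eLpNorm_sineT_div_le {g : ℝ → ℝ} (hg : AEStronglyMeasurable (fun y => y * g y) freqMeasure) :
    eLpNorm (fun ρ => ρ⁻¹ * sineT g ρ) 2 freqMeasure ≤ 4 * eLpNorm (fun y => y * g y) 2 freqMeasure := by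
  refine (ENNReal.pow_le_pow_left_iff two_ne_zero).1 ?_
  rw [eLpNorm_two_sq, mul_pow]
  refine le_trans (le_of_eq ?_) ((lintegral_sineT_div_sq_le hg).trans (le_of_eq (by norm_num)))
  refine lintegral_congr_ae ?_
  filter_upwards [ae_freqMeasure_pos] with ρ hρ
  rw [enorm_mul, ← ofReal_norm ρ⁻¹, Real.norm_of_nonneg (by positivity)]

end WaveSolution

/-! ### Solution of the truncated equation. -/

section Truncated

variable {a b : ℝ → ℝ} {W : ℝ → ℝ → ℝ} {ν R T : ℝ}

/-- The truncated nonlinearity, as a function of the deviation from the free wave. -/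
def truncCubic (a b : ℝ → ℝ) (W : ℝ → ℝ → ℝ) (R T τ σ x : ℝ) : ℝ :=
  perturbedCubic (W (clampTime T τ) |σ|) (truncAt (R * √(1 + |σ|)) (freeField a b τ |σ| + x)) (1 + |σ|)

theorem continuous_truncCubic (ha : Integrable (fun y => y * a y) freqMeasure) (hb : Integrable b freqMeasure)
    (hW : Continuous (Function.uncurry W)) :
    Continuous fun q : ℝ × ℝ × ℝ => truncCubic a b W R T q.1 q.2.1 q.2.2 := by
  have h1 : Continuous fun q : ℝ × ℝ × ℝ => freeField a b q.1 |q.2.1| := by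
    have hp : Continuous fun q : ℝ × ℝ × ℝ => (q.1, q.2.1) := by fun_prop
    simpa only [Function.comp_def] using (continuous_freeField_abs ha hb).comp hp
  have hW' : Continuous fun p : ℝ × ℝ => W p.1 p.2 := hW
  have hc := continuous_clampTime T
  have h2 : Continuous fun q : ℝ × ℝ × ℝ => W (clampTime T q.1) |q.2.1| :=
    hW'.comp ((hc.comp continuous_fst).prodMk continuous_snd.fst.abs)
  have h3 : Continuous fun q : ℝ × ℝ × ℝ => R * √(1 + |q.2.1|) := by fun_prop
  have h4 : Continuous fun q : ℝ × ℝ × ℝ =>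
      truncAt (R * √(1 + |q.2.1|)) (freeField a b q.1 |q.2.1| + q.2.2) :=
    h3.neg.max ((h1.add continuous_snd.snd).min h3)
  have h5 : Continuous fun q : ℝ × ℝ × ℝ => (1 + |q.2.1|) ^ 2 := by fun_prop
  exact (((h4.add h2).pow 3).sub (h2.pow 3)).neg.div h5 fun q => by positivity

/-- The truncation height and the wave `W` both grow at most like `√(1 + ρ)`, so the square in the
Lipschitz constant cancels one of the two powers of `1 + ρ`. The remaining decay gives boundedness
for Picard's iteration and square integrability of the forcing. -/
theorem abs_truncCubic_sub_le (hR : 0 ≤ R) (hT : 0 ≤ T)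
    (hν : ∀ τ ∈ Icc 0 T, ∀ ρ, 0 ≤ ρ → |W τ ρ| ≤ ν * √(1 + ρ)) (τ σ x x' : ℝ) :
    |truncCubic a b W R T τ σ x - truncCubic a b W R T τ σ x'|
      ≤ 3 * (R + ν) ^ 2 / (1 + |σ|) * |truncAt (R * √(1 + |σ|)) (freeField a b τ |σ| + x)
        - truncAt (R * √(1 + |σ|)) (freeField a b τ |σ| + x')| := by
  have hr : 0 < 1 + |σ| := by positivity
  have hw := hν _ (clampTime_mem hT τ) |σ| (abs_nonneg _)
  have hB : 0 ≤ R * √(1 + |σ|) := by positivity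
  have hA : ∀ x, |truncAt (R * √(1 + |σ|)) (freeField a b τ |σ| + x)| + |W (clampTime T τ) (|σ|)|
      ≤ (R + ν) * √(1 + |σ|) := fun x => by
    rw [add_mul]; exact add_le_add (abs_truncAt_le hB _) hw
  refine (abs_perturbedCubic_sub_le hr (hA x) (hA x')).trans (le_of_eq ?_)
  rw [mul_pow, Real.sq_sqrt hr.le]
  field_simp

theorem abs_truncCubic_le (hR : 0 ≤ R) (hT : 0 ≤ T)
    (hν : ∀ τ ∈ Icc 0 T, ∀ ρ, 0 ≤ ρ → |W τ ρ| ≤ ν * √(1 + ρ)) (τ σ x : ℝ) :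
    |truncCubic a b W R T τ σ x|
      ≤ 3 * (R + ν) ^ 2 / (1 + |σ|) * |truncAt (R * √(1 + |σ|)) (freeField a b τ |σ| + x)| := by
  have h := abs_truncCubic_sub_le (a := a) (b := b) hR hT hν τ σ x (-freeField a b τ |σ|)
  have e : truncAt (R * √(1 + |σ|)) (freeField a b τ |σ| + -freeField a b τ |σ|) = 0 := by
    rw [add_neg_cancel]; exact truncAt_of_abs_le (by rw [abs_zero]; positivity)
  rw [e, sub_zero] at h
  have e2 : truncCubic a b W R T τ σ (-freeField a b τ |σ|) = 0 := by
    rw [truncCubic, e, perturbedCubic_zero]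
  rwa [e2, sub_zero] at h

/-- A finiteness statement, with a constant depending on `ν` that does not enter the final bound.
Hardy's inequality treats the free wave, and square integrability of `(1 + ρ)⁻¹` treats the bounded
deviation `d`. -/
theorem eLpNorm_truncCubic_le (ha : MemLp (fun y => y * a y) 2 freqMeasure) (hb : MemLp b 2 freqMeasure)
    (hR : 0 ≤ R) (hT : 0 ≤ T) (hν : ∀ τ ∈ Icc 0 T, ∀ ρ, 0 ≤ ρ → |W τ ρ| ≤ ν * √(1 + ρ))
    {d : ℝ → ℝ} {C : ℝ} (hC : ∀ ρ, |d ρ| ≤ C) (τ : ℝ) :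
    eLpNorm (fun ρ => truncCubic a b W R T τ ρ (d ρ)) 2 freqMeasure
      ≤ ENNReal.ofReal (3 * (R + ν) ^ 2) * (4 * eLpNorm (fun y => y * a y) 2 freqMeasure
        + 4 * eLpNorm b 2 freqMeasure + ENNReal.ofReal C * eLpNorm (fun ρ : ℝ => (1 + ρ)⁻¹) 2 freqMeasure) := by
  have hC0 : 0 ≤ C := (abs_nonneg _).trans (hC 0)
  have m1 := memLp_mul_bdd ha (φ := fun y => Real.cos (τ * y)) (by fun_prop) fun y => Real.abs_cos_le_one _
  have m2 := memLp_mul_bdd (memLp_mul_div hb) (φ := fun y => Real.sin (τ * y)) (by fun_prop)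
    fun y => Real.abs_sin_le_one _
  have c1 := (sineAdm_cos ha τ).continuous_sineT
  have c2 := (sineAdm_sin hb τ).continuous_sineT
  set f1 : ℝ → ℝ := fun ρ => ρ⁻¹ * sineT (fun y => Real.cos (τ * y) * a y) ρ with hf1
  set f2 : ℝ → ℝ := fun ρ => ρ⁻¹ * sineT (fun y => Real.sin (τ * y) * (b y / y)) ρ with hf2
  have k1 : AEStronglyMeasurable f1 freqMeasure := (measurable_inv.mul c1.measurable).aestronglyMeasurable
  have k2 : AEStronglyMeasurable f2 freqMeasure := (measurable_inv.mul c2.measurable).aestronglyMeasurable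
  have k3 : Measurable (fun ρ : ℝ => (1 + ρ)⁻¹) := by fun_prop
  calc eLpNorm (fun ρ => truncCubic a b W R T τ ρ (d ρ)) 2 freqMeasure
      ≤ eLpNorm (fun ρ => 3 * (R + ν) ^ 2 * (|f1 ρ| + |f2 ρ| + C * |(1 + ρ)⁻¹|)) 2 freqMeasure := by
        refine eLpNorm_mono_ae ?_
        filter_upwards [ae_freqMeasure_pos] with ρ hρ
        have hr0 : 0 < 1 + ρ := by linarith
        have h := abs_truncCubic_le (a := a) (b := b) hR hT hν τ ρ (d ρ)
        rw [abs_of_pos hρ] at h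
        rw [Real.norm_eq_abs, Real.norm_of_nonneg (by positivity)]
        refine h.trans ?_
        rw [div_mul_eq_mul_div, mul_div_assoc]
        gcongr
        rw [div_le_iff₀ hr0]
        refine (abs_truncAt_le_abs (by positivity) _).trans ?_
        have a1 : |sineT (fun y => Real.cos (τ * y) * a y) ρ| ≤ |f1 ρ| * (1 + ρ) := by
          rw [hf1]; dsimp only
          rw [abs_mul, abs_of_pos (inv_pos.2 hρ), mul_right_comm]
          refine le_mul_of_one_le_left (abs_nonneg _) ?_
          rw [inv_mul_eq_div, le_div_iff₀ hρ]; linarith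
        have a2 : |sineT (fun y => Real.sin (τ * y) * (b y / y)) ρ| ≤ |f2 ρ| * (1 + ρ) := by
          rw [hf2]; dsimp only
          rw [abs_mul, abs_of_pos (inv_pos.2 hρ), mul_right_comm]
          refine le_mul_of_one_le_left (abs_nonneg _) ?_
          rw [inv_mul_eq_div, le_div_iff₀ hρ]; linarith
        have a3 : C = C * |(1 + ρ)⁻¹| * (1 + ρ) := by
          rw [abs_of_pos (inv_pos.2 hr0)]; field_simp
        rw [freeField]
        have := abs_add_three (sineT (fun y => Real.cos (τ * y) * a y) ρ)
          (sineT (fun y => Real.sin (τ * y) * (b y / y)) ρ) (d ρ)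
        have := hC ρ
        linarith
    _ ≤ _ := by
        have e : (fun ρ => 3 * (R + ν) ^ 2 * (|f1 ρ| + |f2 ρ| + C * |(1 + ρ)⁻¹|))
            = (3 * (R + ν) ^ 2) • (((fun ρ => ‖f1 ρ‖) + fun ρ => ‖f2 ρ‖) + C • fun ρ : ℝ => ‖(1 + ρ)⁻¹‖) := by
          ext ρ; simp only [Pi.smul_apply, Pi.add_apply, smul_eq_mul, Real.norm_eq_abs]
        rw [e, eLpNorm_const_smul, ← ofReal_norm (3 * (R + ν) ^ 2), Real.norm_of_nonneg (by positivity)]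
        gcongr
        refine (eLpNorm_add_le (k1.norm.add k2.norm) (k3.norm.aestronglyMeasurable.const_smul C) (by norm_num)).trans ?_
        rw [eLpNorm_const_smul, ← ofReal_norm C, Real.norm_of_nonneg hC0, eLpNorm_norm]
        gcongr
        refine (eLpNorm_add_le k1.norm k2.norm (by norm_num)).trans ?_
        rw [eLpNorm_norm, eLpNorm_norm, ← eLpNorm_mul_div b]
        refine add_le_add ((eLpNorm_sineT_div_le m1.1).trans ?_) ((eLpNorm_sineT_div_le m2.1).trans ?_)
        · gcongr 4 * ?_
          exact eLpNorm_mul_bdd_le (φ := fun y => Real.cos (τ * y)) fun y => Real.abs_cos_le_one _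
        · gcongr 4 * ?_
          exact eLpNorm_mul_bdd_le (φ := fun y => Real.sin (τ * y)) fun y => Real.abs_sin_le_one _

/-- The wave equation with the truncated nonlinearity has a solution. -/
theorem exists_truncated_solution (ha : MemLp (fun y => y * a y) 2 freqMeasure)
    (ha1 : Integrable (fun y => y * a y) freqMeasure) (hb : MemLp b 2 freqMeasure) (hb1 : Integrable b freqMeasure)
    (hW : Continuous (Function.uncurry W)) (hR : 0 ≤ R) (hT : 0 ≤ T)
    (hν : ∀ τ ∈ Icc 0 T, ∀ ρ, 0 ≤ ρ → |W τ ρ| ≤ ν * √(1 + ρ)) :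
    ∃ G P : ℝ → ℝ → ℝ, Measurable (Function.uncurry G) ∧ Continuous (Function.uncurry P) ∧
      (∀ τ, IsSine (P τ) (G τ)) ∧ ∫⁻ τ in Ioc 0 T, eLpNorm (G τ) 2 freqMeasure < ⊤ ∧
      ∀ τ ∈ Icc 0 T, ∀ ρ, 0 ≤ ρ →
        P τ ρ = perturbedCubic (W τ ρ) (truncAt (R * √(1 + ρ)) (sineT (waveSol a b G τ) ρ)) (1 + ρ) := by
  set L := 3 * (R + ν) ^ 2 with hL
  have hL0 : 0 ≤ L := by positivity
  have hN := continuous_truncCubic (R := R) (T := T) ha1 hb1 hW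
  have hr : ∀ σ : ℝ, 1 ≤ 1 + |σ| := fun σ => le_add_of_nonneg_right (abs_nonneg _)
  have hB1 : ∀ τ σ x, |truncCubic a b W R T τ σ x| ≤ L * R * (1 + |σ|) ^ (-1 / 2 : ℝ) := by
    intro τ σ x
    have h0 : 0 < 1 + |σ| := by positivity
    refine (abs_truncCubic_le hR hT hν τ σ x).trans ?_
    calc _ ≤ L / (1 + |σ|) * (R * √(1 + |σ|)) := by
          gcongr; exact abs_truncAt_le (by positivity) _
      _ = _ := by
          rw [Real.sqrt_eq_rpow, show (-1 / 2 : ℝ) = 1 / 2 - 1 by norm_num, Real.rpow_sub h0, Real.rpow_one]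
          ring
  -- The unknown is the deviation from the free wave: it is bounded, although the free wave itself
  -- may grow with the radius.
  obtain ⟨D, hD, ⟨C, hC⟩, hDe⟩ := exists_eq_coneInt (N := truncCubic a b W R T) (B := L * R) (L := L) hN
    (fun τ σ x => (hB1 τ σ x).trans (mul_le_of_le_one_right (by positivity)
      (Real.rpow_le_one_of_one_le_of_nonpos (hr σ) (by norm_num)))) hL0
    (fun τ σ x x' => by
      refine (abs_truncCubic_sub_le hR hT hν τ σ x x').trans ?_
      refine mul_le_mul (div_le_self hL0 (hr σ)) ((abs_truncAt_sub_le _ _ _).trans (le_of_eq ?_))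
        (abs_nonneg _) hL0
      congr 1; ring) hT
  have hD' : Continuous fun p : ℝ × ℝ => D p.1 p.2 := hD
  have hC0 : 0 ≤ C := (abs_nonneg _).trans (hC 0 0)
  set P : ℝ → ℝ → ℝ := fun τ σ => truncCubic a b W R T τ σ (D τ σ) with hPdef
  have hP' : Continuous fun p : ℝ × ℝ => truncCubic a b W R T p.1 p.2 (D p.1 p.2) := by
    have hp : Continuous fun p : ℝ × ℝ => (p.1, p.2, D p.1 p.2) := by fun_prop
    simpa only [Function.comp_def] using hN.comp hp
  have hP : Continuous (Function.uncurry P) := hP'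
  have hPτ : ∀ τ, Continuous (P τ) := fun τ => by
    have hp : Continuous fun σ : ℝ => (τ, σ) := by fun_prop
    simpa only [Function.comp_def] using hP'.comp hp
  set K : ℝ≥0∞ := ENNReal.ofReal L * (4 * eLpNorm (fun y => y * a y) 2 freqMeasure + 4 * eLpNorm b 2 freqMeasure
    + ENNReal.ofReal C * eLpNorm (fun ρ : ℝ => (1 + ρ)⁻¹) 2 freqMeasure) with hK
  have hKtop : K < ⊤ := by
    have h1 := ha.2
    have h2 := hb.2
    have h3 := lintegral_inv_one_add_sq_lt_top
    finiteness
  have hPK : ∀ τ, eLpNorm (P τ) 2 freqMeasure ≤ K := fun τ =>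
    eLpNorm_truncCubic_le ha hb hR hT hν (hC τ) τ
  obtain ⟨G, hG, hs⟩ := exists_measurable_isSine (P := P) (C := L * R) hP
    (fun τ x hx => by simpa [abs_of_pos hx] using hB1 τ x (D τ x))
    (fun τ => ⟨(hPτ τ).aestronglyMeasurable, (hPK τ).trans_lt hKtop⟩)
  have hGK : ∀ τ, eLpNorm (G τ) 2 freqMeasure ≤ K := fun τ => by
    rw [(hs τ).eLpNorm_eq (hPτ τ).aestronglyMeasurable (hG.of_uncurry_left.aestronglyMeasurable)]
    exact hPK τ
  have hfin : ∀ t, ∫⁻ τ in Ioc 0 t, eLpNorm (G τ) 2 freqMeasure < ⊤ := by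
    intro t
    refine (lintegral_mono hGK).trans_lt ?_
    rw [lintegral_const, Measure.restrict_apply_univ, Real.volume_Ioc]
    finiteness
  refine ⟨G, P, hG, hP, hs, hfin T, fun τ hτ ρ hρ => ?_⟩
  rw [sineT_waveSol ha hb hG hτ.1 (hfin τ) (fun τ _ => (hPτ τ).aestronglyMeasurable) (fun τ _ => hs τ) hρ,
    ← hDe τ hτ ρ hρ, hPdef]
  simp only [truncCubic]
  rw [clampTime_of_mem hτ, abs_of_nonneg hρ]

end Truncated

/-! ### Elementary inequalities for squares. -/

section Minkowski

theorem sqrt_lintegral_add_sq_le {α : Type*} [MeasurableSpace α] {μ : Measure α} {f g : α → ℝ≥0∞}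
    (hf : AEMeasurable f μ) (hg : AEMeasurable g μ) :
    (∫⁻ x, (f x + g x) ^ 2 ∂μ) ^ (1 / 2 : ℝ)
      ≤ (∫⁻ x, f x ^ 2 ∂μ) ^ (1 / 2 : ℝ) + (∫⁻ x, g x ^ 2 ∂μ) ^ (1 / 2 : ℝ) := by
  have := ENNReal.lintegral_Lp_add_le hf hg (p := 2) (by norm_num)
  simpa only [Pi.add_apply, ENNReal.rpow_ofNat] using this

theorem sqrt_sq_ennreal (x : ℝ≥0∞) : (x ^ 2) ^ (1 / 2 : ℝ) = x := by
  rw [← ENNReal.rpow_natCast, ← ENNReal.rpow_mul]; norm_num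

theorem add_sq_le_ennreal (x y : ℝ≥0∞) : (x + y) ^ 2 ≤ 2 * (x ^ 2 + y ^ 2) := by
  rcases eq_or_ne x ⊤ with rfl | hx
  · simp
  rcases eq_or_ne y ⊤ with rfl | hy
  · simp
  lift x to NNReal using hx
  lift y to NNReal using hy
  norm_cast
  exact add_sq_le

end Minkowski

/-! ### The energy bound and the removal of the truncation. -/

section APriori

variable {a b : ℝ → ℝ} {w G P : ℝ → ℝ → ℝ} {R T : ℝ}

theorem fieldDensity_sq (w : ℝ → ℝ → ℝ) {x : ℝ × ℝ} (hx : 0 ≤ x.2) :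
    fieldDensity w x ^ 2 = ENNReal.ofReal (sineT (w x.1) x.2 ^ 2 / (1 + x.2)) := by
  have h : 0 < 1 + x.2 := by linarith
  rw [fieldDensity, mul_pow, ← ofReal_norm, ← ENNReal.ofReal_pow (norm_nonneg _), ← ENNReal.ofReal_pow (by positivity),
    ← ENNReal.ofReal_mul (by positivity), Real.norm_eq_abs, sq_abs, ← Real.rpow_natCast ((1 + x.2) ^ _),
    ← Real.rpow_mul h.le, show (-1 / 2 : ℝ) * ((2 : ℕ) : ℝ) = -1 by norm_num, Real.rpow_neg_one, div_eq_mul_inv]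

/-- The radial maximal function dominating a wave with data `(a, b)` and forcing profile `P`. -/
def waveMax (a b : ℝ → ℝ) (P : ℝ → ℝ → ℝ) (T τ : ℝ) : ℝ≥0∞ :=
  2 * maxFn (fun y => ‖freeDens a b y‖ₑ + coneDens P T y) τ

theorem measurable_waveDens (ha1 : Integrable (fun y => y * a y) freqMeasure) (hb1 : Integrable b freqMeasure)
    (hP : Measurable (Function.uncurry P)) : Measurable fun y => ‖freeDens a b y‖ₑ + coneDens P T y :=
  (continuous_freeDens ha1 hb1).measurable.enorm.add (measurable_coneDens hP)

/-- Both parts of the wave are bounded by half the integral of a density over `(t - ρ, t + ρ)`.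
Hence `|V| / ρ` is bounded by a maximal function at `t` that does not depend on `ρ`. This is the
radial endpoint Strichartz estimate, `L²` in time and `L^∞` in space. -/
theorem enorm_wave_le (ha1 : Integrable (fun y => y * a y) freqMeasure) (hb1 : Integrable b freqMeasure)
    (hP : Measurable (Function.uncurry P)) {t ρ : ℝ} (htT : t ≤ T) (hρ : 0 < ρ) :
    ‖freeField a b t ρ + coneInt P t ρ‖ₑ ≤ ENNReal.ofReal ρ * waveMax a b P T t := by
  have hf := (continuous_freeDens ha1 hb1).measurable.enorm
  calc _ ≤ ‖freeField a b t ρ‖ₑ + ‖coneInt P t ρ‖ₑ := enorm_add_le _ _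
    _ ≤ ENNReal.ofReal (1 / 2) * (∫⁻ y in Ioc (t - ρ) (t + ρ), ‖freeDens a b y‖ₑ)
        + ENNReal.ofReal (1 / 2) * ∫⁻ y in Ioc (t - ρ) (t + ρ), coneDens P T y := by
        refine add_le_add ?_ (enorm_coneInt_le hP htT hρ.le)
        rw [freeField_eq ha1 hb1 t hρ.le, enorm_mul, ← ofReal_norm (1 / 2 : ℝ),
          Real.norm_of_nonneg (by norm_num : (0 : ℝ) ≤ 1 / 2)]
        gcongr
        exact enorm_integral_le_lintegral_enorm _
    _ = ENNReal.ofReal (1 / 2) * ∫⁻ y in Ioc (t - ρ) (t + ρ), (‖freeDens a b y‖ₑ + coneDens P T y) := by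
        rw [lintegral_add_left hf, mul_add]
    _ ≤ ENNReal.ofReal (1 / 2) * (ENNReal.ofReal (4 * ρ) * maxFn (fun y => ‖freeDens a b y‖ₑ + coneDens P T y) t) := by
        gcongr
        exact setLIntegral_le_maxFn _ t hρ
    _ = _ := by
        rw [waveMax, ← mul_assoc, ← mul_assoc, ← ENNReal.ofReal_mul (by norm_num),
          show (2 : ℝ≥0∞) = ENNReal.ofReal 2 by norm_num, ← ENNReal.ofReal_mul hρ.le]
        congr 2; ring

/-- The maximal inequality in time, with `4π ≤ 13`: the constants multiply to `4 · 40 · 2 · 13 =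
4160`, which is below `65²`. -/
theorem lintegral_waveMax_sq_le (ha1 : Integrable (fun y => y * a y) freqMeasure) (hb1 : Integrable b freqMeasure)
    (hP : Measurable (Function.uncurry P)) :
    ∫⁻ τ, waveMax a b P T τ ^ 2 ≤ (65 * (eLpNorm (fun y => y * a y) 2 freqMeasure + eLpNorm b 2 freqMeasure
      + ∫⁻ τ in Ioc 0 T, eLpNorm (P τ) 2 freqMeasure)) ^ 2 := by
  have hf := (continuous_freeDens ha1 hb1).measurable.enorm
  have hd := measurable_waveDens (T := T) ha1 hb1 hP
  set A := eLpNorm (fun y => y * a y) 2 freqMeasure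
  set B := eLpNorm b 2 freqMeasure
  set Q := ∫⁻ τ in Ioc 0 T, eLpNorm (P τ) 2 freqMeasure
  have hm := measurable_maxFn hd
  calc _ = 4 * ∫⁻ τ, maxFn (fun y => ‖freeDens a b y‖ₑ + coneDens P T y) τ ^ 2 := by
        simp_rw [waveMax, mul_pow]
        rw [lintegral_const_mul' _ _ (by norm_num)]; norm_num
    _ ≤ 4 * (40 * ∫⁻ y, (‖freeDens a b y‖ₑ + coneDens P T y) ^ 2) := by
        gcongr; exact lintegral_maxFn_sq_le hd
    _ ≤ 4 * (40 * ∫⁻ y, 2 * (‖freeDens a b y‖ₑ ^ 2 + coneDens P T y ^ 2)) := by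
        gcongr with y; exact add_sq_le_ennreal _ _
    _ = 4 * (40 * (2 * ((∫⁻ y, ‖freeDens a b y‖ₑ ^ 2) + ∫⁻ y, coneDens P T y ^ 2))) := by
        rw [lintegral_const_mul' _ _ (by norm_num), lintegral_add_left (hf.pow_const 2)]
    _ ≤ 4 * (40 * (2 * (13 * (A ^ 2 + B ^ 2) + 2 * Q ^ 2))) := by
        have h1 : ENNReal.ofReal (4 * Real.pi) ≤ 13 := by
          rw [show (13 : ℝ≥0∞) = ENNReal.ofReal 13 by norm_num]
          exact ENNReal.ofReal_le_ofReal (by linarith [Real.pi_lt_d2])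
        refine mul_le_mul' le_rfl (mul_le_mul' le_rfl (mul_le_mul' le_rfl (add_le_add ?_ (lintegral_coneDens_sq_le hP))))
        exact (lintegral_freeDens_sq_le ha1 hb1).trans (mul_le_mul' h1 le_rfl)
    _ ≤ 4160 * (A ^ 2 + B ^ 2 + Q ^ 2) := by
        have : 4 * (40 * (2 * (13 * (A ^ 2 + B ^ 2) + 2 * Q ^ 2))) = 4160 * (A ^ 2 + B ^ 2) + 640 * Q ^ 2 := by ring
        rw [this, mul_add 4160 (A ^ 2 + B ^ 2)]
        gcongr; norm_num
    _ ≤ 4225 * (A + B + Q) ^ 2 := by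
        have : (A + B + Q) ^ 2 = A ^ 2 + B ^ 2 + Q ^ 2 + 2 * (A * B + A * Q + B * Q) := by ring
        rw [this]
        exact mul_le_mul' (by norm_num) le_self_add
    _ = _ := by rw [mul_pow]; norm_num

/-- In the cubic part the truncation bounds two of the three factors and leaves `V / ρ` for Hardy's
inequality. In the other part `V / ρ` is left for the maximal function and `W² / (1 + ρ)` for the
quartic norm of `w`. -/
theorem abs_truncated_le {W V ρ : ℝ} (hR : 0 ≤ R) (hρ : 0 < ρ) :
    |perturbedCubic W (truncAt (R * √(1 + ρ)) V) (1 + ρ)|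
      ≤ 5 / 2 * R ^ 2 * (ρ⁻¹ * |V|) + 9 / 2 * (ρ⁻¹ * |V| * (W ^ 2 / (1 + ρ))) := by
  have hr : 0 < 1 + ρ := by linarith
  set x := truncAt (R * √(1 + ρ)) V with hx
  have h1 : |x| ≤ |V| := abs_truncAt_le_abs (by positivity) V
  have h2 : x ^ 2 ≤ R ^ 2 * (1 + ρ) := by
    have : |x| ≤ R * √(1 + ρ) := abs_truncAt_le (by positivity) V
    calc x ^ 2 = |x| ^ 2 := (sq_abs x).symm
      _ ≤ (R * √(1 + ρ)) ^ 2 := by gcongr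
      _ = _ := by rw [mul_pow, Real.sq_sqrt hr.le]
  have h3 : |V| / (1 + ρ) ≤ ρ⁻¹ * |V| := by
    rw [div_eq_inv_mul]; gcongr; linarith
  calc _ ≤ |x| * (5 / 2 * x ^ 2 + 9 / 2 * W ^ 2) / (1 + ρ) ^ 2 := abs_perturbedCubic_le W x hr
    _ ≤ |V| * (5 / 2 * (R ^ 2 * (1 + ρ)) + 9 / 2 * W ^ 2) / (1 + ρ) ^ 2 := by gcongr
    _ = 5 / 2 * R ^ 2 * (|V| / (1 + ρ)) + 9 / 2 * (|V| / (1 + ρ) * (W ^ 2 / (1 + ρ))) := by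
        field_simp
    _ ≤ _ := by gcongr

/-- The estimate of the forcing of the truncated problem at a fixed time. -/
theorem eLpNorm_truncated_le {g : ℝ → ℝ} (hg : MemLp (fun y => y * g y) 2 freqMeasure) (hR : 0 ≤ R) {τ : ℝ}
    (hw : Measurable fun ρ => fieldDensity w (τ, ρ)) {S : ℝ≥0∞}
    (hS : ∀ ρ, 0 < ρ → ‖sineT g ρ‖ₑ ≤ ENNReal.ofReal ρ * S) {p : ℝ → ℝ}
    (hp : ∀ ρ, 0 ≤ ρ → p ρ = perturbedCubic (sineT (w τ) ρ) (truncAt (R * √(1 + ρ)) (sineT g ρ)) (1 + ρ)) :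
    eLpNorm p 2 freqMeasure ≤ ENNReal.ofReal (10 * R ^ 2) * eLpNorm (fun y => y * g y) 2 freqMeasure
      + ENNReal.ofReal (9 / 2) * (S * (∫⁻ ρ, fieldDensity w (τ, ρ) ^ 4 ∂freqMeasure) ^ (1 / 2 : ℝ)) := by
  have hgm := ((sineAdm_of_memLp hg).continuous_sineT).measurable
  have hm1 : Measurable fun ρ => ENNReal.ofReal (5 / 2 * R ^ 2) * ‖ρ⁻¹ * sineT g ρ‖ₑ :=
    ((measurable_inv.mul hgm).enorm).const_mul _
  have hm2 : Measurable fun ρ => ENNReal.ofReal (9 / 2) * (S * fieldDensity w (τ, ρ) ^ 2) :=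
    ((hw.pow_const 2).const_mul _).const_mul _
  have hle : ∫⁻ ρ, ‖p ρ‖ₑ ^ 2 ∂freqMeasure ≤ ∫⁻ ρ, (ENNReal.ofReal (5 / 2 * R ^ 2) * ‖ρ⁻¹ * sineT g ρ‖ₑ
      + ENNReal.ofReal (9 / 2) * (S * fieldDensity w (τ, ρ) ^ 2)) ^ 2 ∂freqMeasure := by
    refine lintegral_mono_ae ?_
    filter_upwards [ae_freqMeasure_pos] with ρ hρ
    refine pow_le_pow_left' ?_ 2
    have hr : 0 < 1 + ρ := by linarith
    have hinv : ENNReal.ofReal (ρ⁻¹ * |sineT g ρ|) ≤ S := by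
      rw [ENNReal.ofReal_mul (by positivity), ← Real.norm_eq_abs, ofReal_norm]
      refine (mul_le_mul' le_rfl (hS ρ hρ)).trans ?_
      rw [← mul_assoc, ← ENNReal.ofReal_mul (by positivity), inv_mul_cancel₀ hρ.ne', ENNReal.ofReal_one, one_mul]
    rw [fieldDensity_sq w (x := (τ, ρ)) hρ.le, ← ofReal_norm (p ρ), hp ρ hρ.le, Real.norm_eq_abs]
    refine (ENNReal.ofReal_le_ofReal (abs_truncated_le hR hρ)).trans ?_
    rw [ENNReal.ofReal_add (by positivity) (by positivity), ENNReal.ofReal_mul (by positivity),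
      ENNReal.ofReal_mul (p := 9 / 2) (by positivity), ENNReal.ofReal_mul (p := ρ⁻¹ * |sineT g ρ|) (by positivity)]
    refine add_le_add (mul_le_mul' le_rfl (le_of_eq ?_)) (mul_le_mul' le_rfl (mul_le_mul' hinv le_rfl))
    rw [← ofReal_norm, norm_mul, Real.norm_of_nonneg (inv_nonneg.2 hρ.le), Real.norm_eq_abs]
  rw [eLpNorm_two_eq]
  refine (ENNReal.rpow_le_rpow hle (by norm_num)).trans
    ((sqrt_lintegral_add_sq_le hm1.aemeasurable hm2.aemeasurable).trans (add_le_add ?_ ?_))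
  · simp_rw [mul_pow]
    rw [lintegral_const_mul' _ _ (by finiteness), ENNReal.mul_rpow_of_nonneg _ _ (by norm_num), sqrt_sq_ennreal,
      ← eLpNorm_two_eq, show 10 * R ^ 2 = 5 / 2 * R ^ 2 * 4 by ring,
      ENNReal.ofReal_mul (p := 5 / 2 * R ^ 2) (by positivity), mul_assoc]
    refine mul_le_mul' le_rfl ((eLpNorm_sineT_div_le hg.1).trans (le_of_eq ?_))
    norm_num
  · simp_rw [mul_pow]
    rw [lintegral_const_mul' _ _ (by finiteness), ENNReal.mul_rpow_of_nonneg _ _ (by norm_num), sqrt_sq_ennreal,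
      lintegral_const_mul _ (by fun_prop), ENNReal.mul_rpow_of_nonneg _ _ (by norm_num), sqrt_sq_ennreal]
    simp_rw [← pow_mul]
    exact le_rfl

/-- A solution of the truncated problem obeys the energy bound. -/
theorem truncated_energy_le (ha : MemLp (fun y => y * a y) 2 freqMeasure)
    (ha1 : Integrable (fun y => y * a y) freqMeasure) (hb : MemLp b 2 freqMeasure) (hb1 : Integrable b freqMeasure)
    (hw : Measurable (fieldDensity w)) (hQ : ∫⁻ x, fieldDensity w x ^ 4 ∂(slabMeasure T) ≤ ENNReal.ofReal (1 / 1960000))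
    (hR : 0 ≤ R) (hRT : R ^ 2 * T ≤ 1 / 40) (hG : Measurable (Function.uncurry G))
    (hP : Continuous (Function.uncurry P)) (hs : ∀ τ, IsSine (P τ) (G τ))
    (hfin : ∫⁻ τ in Ioc 0 T, eLpNorm (G τ) 2 freqMeasure < ⊤)
    (hPe : ∀ τ ∈ Icc 0 T, ∀ ρ, 0 ≤ ρ →
        P τ ρ = perturbedCubic (sineT (w τ) ρ) (truncAt (R * √(1 + ρ)) (sineT (waveSol a b G τ) ρ)) (1 + ρ)) :
    ∫⁻ τ in Ioc 0 T, eLpNorm (G τ) 2 freqMeasure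
      ≤ eLpNorm (fun y => y * a y) 2 freqMeasure + eLpNorm b 2 freqMeasure := by
  have hPm : Measurable (Function.uncurry P) := hP.measurable
  have hP' : Continuous fun p : ℝ × ℝ => P p.1 p.2 := hP
  have hPτ : ∀ τ, Continuous (P τ) := fun τ => by
    have hp : Continuous fun σ : ℝ => (τ, σ) := by fun_prop
    simpa only [Function.comp_def] using hP'.comp hp
  have hGP : ∀ τ, eLpNorm (G τ) 2 freqMeasure = eLpNorm (P τ) 2 freqMeasure := fun τ =>
    (hs τ).eLpNorm_eq (hPτ τ).aestronglyMeasurable hG.of_uncurry_left.aestronglyMeasurable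
  have hS := lintegral_waveMax_sq_le (a := a) (b := b) (T := T) ha1 hb1 hPm
  simp_rw [← hGP] at hS
  set M := eLpNorm (fun y => y * a y) 2 freqMeasure + eLpNorm b 2 freqMeasure with hM
  set Q := ∫⁻ τ in Ioc 0 T, eLpNorm (G τ) 2 freqMeasure with hQdef
  have hMtop : M < ⊤ := ENNReal.add_lt_top.2 ⟨ha.2, hb.2⟩
  have hfint : ∀ τ ∈ Icc 0 T, ∫⁻ τ in Ioc 0 τ, eLpNorm (G τ) 2 freqMeasure ≤ Q := fun τ hτ =>
    lintegral_mono_set (Ioc_subset_Ioc_right hτ.2)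
  have hwm : ∀ τ, Measurable fun ρ => fieldDensity w (τ, ρ) := fun τ => hw.comp measurable_prodMk_left
  set q : ℝ → ℝ≥0∞ := fun τ => (∫⁻ ρ, fieldDensity w (τ, ρ) ^ 4 ∂freqMeasure) ^ (1 / 2 : ℝ) with hq
  have hqm : Measurable q := by
    refine Measurable.pow_const ?_ _
    exact Measurable.lintegral_prod_right' (hw.pow_const 4)
  have hSm : Measurable (waveMax a b P T) := (measurable_maxFn (measurable_waveDens ha1 hb1 hPm)).const_mul _
  have hstep : ∀ τ ∈ Ioc 0 T, eLpNorm (G τ) 2 freqMeasure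
      ≤ ENNReal.ofReal (10 * R ^ 2) * (M + Q) + ENNReal.ofReal (9 / 2) * (waveMax a b P T τ * q τ) := by
    intro τ hτ
    have hτ' : τ ∈ Icc 0 T := Ioc_subset_Icc_self hτ
    have hft := (hfint τ hτ').trans_lt hfin
    rw [hGP]
    refine (eLpNorm_truncated_le (memLp_waveSol ha hb hG hτ.1.le hft) hR (hwm τ) (S := waveMax a b P T τ)
      (fun ρ hρ => ?_) (hPe τ hτ')).trans (add_le_add (mul_le_mul' le_rfl ?_) le_rfl)
    · rw [sineT_waveSol ha hb hG hτ.1.le hft (fun τ _ => (hPτ τ).aestronglyMeasurable) (fun τ _ => hs τ) hρ.le]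
      exact enorm_wave_le ha1 hb1 hPm hτ.2 hρ
    · exact (eLpNorm_waveSol_le ha hb hG hτ.1.le).trans (add_le_add le_rfl (hfint τ hτ'))
  -- The first quarter is `10 R² T ≤ 1/4`. The second is Cauchy–Schwarz in time: the maximal
  -- function contributes `65 (M + Q)`, the wave `w` contributes `1/1400 = √(1/1960000)`, and `9/2 ·
  -- 65 / 1400 < 1/4`. As `Q` is finite, `Q ≤ M` follows.
  have hmain : Q ≤ ENNReal.ofReal (1 / 4) * (M + Q) + ENNReal.ofReal (1 / 4) * (M + Q) := by
    calc Q ≤ ∫⁻ τ in Ioc 0 T, (ENNReal.ofReal (10 * R ^ 2) * (M + Q)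
          + ENNReal.ofReal (9 / 2) * (waveMax a b P T τ * q τ)) := setLIntegral_mono' measurableSet_Ioc hstep
      _ = ENNReal.ofReal (10 * R ^ 2) * (M + Q) * ENNReal.ofReal T
          + ENNReal.ofReal (9 / 2) * ∫⁻ τ in Ioc 0 T, waveMax a b P T τ * q τ := by
          rw [lintegral_add_left measurable_const, lintegral_const, Measure.restrict_apply_univ, Real.volume_Ioc,
            sub_zero, lintegral_const_mul' _ _ ENNReal.ofReal_ne_top]
      _ ≤ _ := by
          refine add_le_add ?_ ?_
          · rw [mul_right_comm, ← ENNReal.ofReal_mul (by positivity)]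
            refine mul_le_mul' (ENNReal.ofReal_le_ofReal ?_) le_rfl
            linarith
          · have h1 : (∫⁻ τ in Ioc 0 T, waveMax a b P T τ ^ 2) ^ (1 / 2 : ℝ) ≤ 65 * (M + Q) := by
              rw [← sqrt_sq_ennreal (65 * (M + Q))]
              exact ENNReal.rpow_le_rpow ((setLIntegral_le_lintegral _ _).trans hS) (by norm_num)
            have h2 : (∫⁻ τ in Ioc 0 T, q τ ^ 2) ^ (1 / 2 : ℝ) ≤ ENNReal.ofReal (1 / 1400) := by
              rw [← sqrt_sq_ennreal (ENNReal.ofReal (1 / 1400))]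
              refine ENNReal.rpow_le_rpow ?_ (by norm_num)
              have e : ∀ τ, q τ ^ 2 = ∫⁻ ρ, fieldDensity w (τ, ρ) ^ 4 ∂freqMeasure := fun τ => by
                rw [hq]; dsimp only
                rw [← ENNReal.rpow_natCast, ← ENNReal.rpow_mul]; norm_num
              simp_rw [e]
              rw [← lintegral_slabMeasure T (f := fun x => fieldDensity w x ^ 4) (hw.pow_const 4),
                ← ENNReal.ofReal_pow (by norm_num)]
              exact hQ.trans (ENNReal.ofReal_le_ofReal (by norm_num))
            calc _ ≤ ENNReal.ofReal (9 / 2) * (65 * (M + Q) * ENNReal.ofReal (1 / 1400)) := by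
                  refine mul_le_mul' le_rfl ?_
                  exact (lintegral_mul_le_sqrt hSm.aemeasurable hqm.aemeasurable).trans (mul_le_mul' h1 h2)
              _ = ENNReal.ofReal (9 / 2 * 65 * (1 / 1400)) * (M + Q) := by
                  rw [ENNReal.ofReal_mul (by norm_num), ENNReal.ofReal_mul (by norm_num),
                    show ENNReal.ofReal 65 = 65 by norm_num]
                  ring
              _ ≤ _ := mul_le_mul' (ENNReal.ofReal_le_ofReal (by norm_num)) le_rfl
  have hQtop : Q ≠ ⊤ := hfin.ne
  rw [← ENNReal.toReal_le_toReal hQtop hMtop.ne]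
  have h4 := ENNReal.toReal_mono (by finiteness) hmain
  rw [ENNReal.toReal_add (by finiteness) (by finiteness), ENNReal.toReal_mul, ENNReal.toReal_add hMtop.ne hQtop,
    ENNReal.toReal_ofReal (by norm_num)] at h4
  linarith

/-- The perturbed equation has a solution that obeys the energy bound. -/
theorem exists_wave_solution (ha : MemLp (fun y => y * a y) 2 freqMeasure)
    (ha1 : Integrable (fun y => y * a y) freqMeasure) (hb : MemLp b 2 freqMeasure) (hb1 : Integrable b freqMeasure)
    (hw : Continuous fun p : ℝ × ℝ => sineT (w p.1) p.2) {ν : ℝ}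
    (hν : ∀ τ ∈ Icc 0 T, ∀ ρ, 0 ≤ ρ → |sineT (w τ) ρ| ≤ ν * √(1 + ρ))
    (hQ : ∫⁻ x, fieldDensity w x ^ 4 ∂(slabMeasure T) ≤ ENNReal.ofReal (1 / 1960000)) (hT : 0 ≤ T)
    (hMT : T * (eLpNorm (fun y => y * a y) 2 freqMeasure + eLpNorm b 2 freqMeasure).toReal ^ 2 ≤ 1 / 320) :
    ∃ G P : ℝ → ℝ → ℝ, Measurable (Function.uncurry G) ∧ (∀ τ, Continuous (P τ)) ∧ (∀ τ, IsSine (P τ) (G τ)) ∧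
      ∫⁻ τ in Ioc 0 T, eLpNorm (G τ) 2 freqMeasure
        ≤ eLpNorm (fun y => y * a y) 2 freqMeasure + eLpNorm b 2 freqMeasure ∧
      ∀ τ ∈ Icc 0 T, ∀ ρ, 0 ≤ ρ → P τ ρ = perturbedCubic (sineT (w τ) ρ) (sineT (waveSol a b G τ) ρ) (1 + ρ) := by
  set M := eLpNorm (fun y => y * a y) 2 freqMeasure + eLpNorm b 2 freqMeasure with hM
  have hMtop : M < ⊤ := ENNReal.add_lt_top.2 ⟨ha.2, hb.2⟩
  -- The energy norm stays below `M + Q ≤ 2M`, so `V² ≤ 2ρ (2M)² = 8 M² ρ` and the truncation is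
  -- inactive. With this height the condition `R² T ≤ 1/40` is exactly `T M² ≤ 1/320`.
  set R := √8 * M.toReal with hRdef
  have hR : 0 ≤ R := by positivity
  have hR2 : R ^ 2 = 8 * M.toReal ^ 2 := by rw [hRdef, mul_pow, Real.sq_sqrt (by norm_num)]
  obtain ⟨G, P, hG, hP, hs, hfin, hPe⟩ := exists_truncated_solution (W := fun τ ρ => sineT (w τ) ρ) (R := R)
    ha ha1 hb hb1 hw hR hT hν
  have hP' : Continuous fun p : ℝ × ℝ => P p.1 p.2 := hP
  have hPτ : ∀ τ, Continuous (P τ) := fun τ => by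
    have hp : Continuous fun σ : ℝ => (τ, σ) := by fun_prop
    simpa only [Function.comp_def] using hP'.comp hp
  have hwm : Measurable (fieldDensity w) :=
    hw.measurable.enorm.mul ((measurable_const.add measurable_snd).pow_const _).ennreal_ofReal
  have hE := truncated_energy_le ha ha1 hb hb1 hwm hQ hR (by rw [hR2]; linarith) hG hP hs hfin hPe
  refine ⟨G, P, hG, hPτ, hs, hE, fun τ hτ ρ hρ => ?_⟩
  rw [hPe τ hτ ρ hρ, truncAt_of_abs_le]
  have hft : ∫⁻ τ in Ioc 0 τ, eLpNorm (G τ) 2 freqMeasure ≤ M := (lintegral_mono_set (Ioc_subset_Ioc_right hτ.2)).trans hE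
  have h1 := enorm_sineT_sq_le (memLp_waveSol ha hb hG hτ.1 (hft.trans_lt hMtop)).1 hρ
  have h2 : eLpNorm (fun y => y * waveSol a b G τ y) 2 freqMeasure ≤ ENNReal.ofReal (2 * M.toReal) := by
    refine (eLpNorm_waveSol_le ha hb hG hτ.1).trans ((add_le_add le_rfl hft).trans (le_of_eq ?_))
    rw [← hM, ENNReal.ofReal_mul (by norm_num), ENNReal.ofReal_toReal hMtop.ne, ← two_mul]
    norm_num
  have h3 := h1.trans (mul_le_mul' le_rfl (pow_le_pow_left' h2 2))
  rw [← ofReal_norm, ← ENNReal.ofReal_pow (norm_nonneg _), ← ENNReal.ofReal_pow (by positivity),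
    ← ENNReal.ofReal_mul (by positivity), ENNReal.ofReal_le_ofReal_iff (by positivity), Real.norm_eq_abs] at h3
  refine abs_le_of_sq_le_sq' ?_ (by positivity) |> abs_le.2 |>.trans_eq rfl
  rw [mul_pow, Real.sq_sqrt (by linarith), hR2]
  rw [sq_abs] at h3
  nlinarith [sq_nonneg M.toReal]

end APriori

/-! ### Continuity in time of the energy norm. -/

section Continuity

variable {a b : ℝ → ℝ} {G : ℝ → ℝ → ℝ} {T : ℝ}

theorem tendsto_eLpNorm_osc {h : ℝ → ℝ} (hh : MemLp h 2 freqMeasure) {φ : ℝ → ℝ} (hφ : Continuous φ)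
    (h1 : ∀ x, |φ x| ≤ 1) (t₀ : ℝ) :
    Tendsto (fun t => eLpNorm (fun y => (φ (t * y) - φ (t₀ * y)) * h y) 2 freqMeasure) (𝓝 t₀) (𝓝 0) := by
  have hlim : Tendsto (fun t => ∫⁻ y, ‖(φ (t * y) - φ (t₀ * y)) * h y‖ₑ ^ 2 ∂freqMeasure) (𝓝 t₀)
      (𝓝 (∫⁻ y, 0 ∂freqMeasure)) := by
    refine tendsto_lintegral_filter_of_dominated_convergence' (fun y => ‖(2 * h y)‖ₑ ^ 2) ?_ ?_ ?_ ?_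
    · refine Eventually.of_forall fun t => AEMeasurable.pow_const (AEStronglyMeasurable.enorm ?_) 2
      exact (by fun_prop : Continuous fun y => φ (t * y) - φ (t₀ * y)).aestronglyMeasurable.mul hh.1
    · refine Eventually.of_forall fun t => ae_of_all _ fun y => ?_
      refine pow_le_pow_left' ?_ 2
      rw [← ofReal_norm, ← ofReal_norm]
      refine ENNReal.ofReal_le_ofReal ?_
      rw [norm_mul, norm_mul]
      gcongr
      rw [Real.norm_of_nonneg (by norm_num : (0 : ℝ) ≤ 2)]
      refine (norm_sub_le _ _).trans ?_
      have := h1 (t * y)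
      have := h1 (t₀ * y)
      simp only [Real.norm_eq_abs]
      linarith
    · rw [← eLpNorm_two_sq]
      exact (ENNReal.pow_lt_top (hh.const_mul 2).2).ne
    · refine ae_of_all _ fun y => ?_
      have hc : Continuous fun t => ‖(φ (t * y) - φ (t₀ * y)) * h y‖ₑ ^ 2 := by fun_prop
      simpa using hc.tendsto t₀
  simp_rw [eLpNorm_two_eq]
  rw [lintegral_zero] at hlim
  have h2 := ((ENNReal.continuous_rpow_const (y := (1 / 2 : ℝ))).tendsto 0).comp hlim
  rwa [ENNReal.zero_rpow_of_pos (by norm_num)] at h2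

theorem ae_integrable_of_lintegral_eLpNorm (hG : Measurable (Function.uncurry G)) {s : Set ℝ}
    (hfin : ∫⁻ τ in s, eLpNorm (G τ) 2 freqMeasure < ⊤) :
    ∀ᵐ y ∂freqMeasure, Integrable (fun τ => G τ y) (volume.restrict s) := by
  have hG' : Measurable fun p : ℝ × ℝ => G p.1 p.2 := hG
  have h := lintegral_sq_lintegral_le (μ := volume.restrict s) (ν := freqMeasure) (f := fun τ y => ‖G τ y‖ₑ) hG'.enorm
  simp_rw [← eLpNorm_two_eq] at h
  have hm : Measurable fun y => (∫⁻ τ in s, ‖G τ y‖ₑ) ^ 2 :=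
    Measurable.pow_const (Measurable.lintegral_prod_left' hG'.enorm) 2
  filter_upwards [ae_lt_top hm (h.trans_lt (ENNReal.pow_lt_top hfin)).ne] with y hy
  refine ⟨(hG'.comp (measurable_id.prodMk measurable_const)).aestronglyMeasurable, ?_⟩
  exact (ENNReal.pow_lt_top_iff.1 hy).resolve_right (by norm_num)

theorem mul_duhamelInt_eq_max {t y : ℝ} (ht : t ∈ Icc 0 T) (hy : 0 < y) :
    y * duhamelInt G t y = ∫ τ in Ioc 0 T, Real.sin (max (t - τ) 0 * y) * G τ y := by
  rw [mul_duhamelInt ht.1 hy]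
  refine Eq.trans ?_ (setIntegral_eq_of_subset_of_forall_sdiff_eq_zero measurableSet_Ioc
    (Ioc_subset_Ioc_right ht.2) fun τ hτ => ?_).symm
  · refine setIntegral_congr_fun measurableSet_Ioc fun τ hτ => ?_
    rw [max_eq_left (by linarith [hτ.2])]
  · have : t < τ := by
      by_contra! hc
      exact hτ.2 ⟨hτ.1.1, hc⟩
    rw [max_eq_right (by linarith), zero_mul, Real.sin_zero, zero_mul]

/-- With positive parts of `t - τ` the time integral runs over the fixed interval `[0, T]`.
Minkowski's inequality then reduces the claim to each fixed `τ`, where `tendsto_eLpNorm_osc`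
applies, and dominated convergence in `τ` concludes. -/
theorem tendsto_eLpNorm_duhamelInt (hG : Measurable (Function.uncurry G))
    (hfin : ∫⁻ τ in Ioc 0 T, eLpNorm (G τ) 2 freqMeasure < ⊤) {t₀ : ℝ} (ht₀ : t₀ ∈ Icc 0 T) :
    Tendsto (fun t => eLpNorm (fun y => y * duhamelInt G t y - y * duhamelInt G t₀ y) 2 freqMeasure)
      (𝓝[Icc 0 T] t₀) (𝓝 0) := by
  have hG' : Measurable fun p : ℝ × ℝ => G p.1 p.2 := hG
  set F : ℝ → ℝ → ℝ → ℝ := fun t τ y =>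
    (Real.sin (max (t - τ) 0 * y) - Real.sin (max (t₀ - τ) 0 * y)) * G τ y with hF
  have hFm : ∀ t, Measurable (Function.uncurry (F t)) := fun t => by
    unfold Function.uncurry; simp only [hF]; fun_prop
  have hb : ∀ t τ, eLpNorm (F t τ) 2 freqMeasure ≤ 2 * eLpNorm (G τ) 2 freqMeasure := by
    intro t τ
    refine (eLpNorm_le_mul_eLpNorm_of_ae_le_mul (g := G τ) (c := 2) (ae_of_all _ fun y => ?_) 2).trans
      (by norm_num)
    rw [hF, norm_mul]
    gcongr
    refine (norm_sub_le _ _).trans ?_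
    have := Real.abs_sin_le_one (max (t - τ) 0 * y)
    have := Real.abs_sin_le_one (max (t₀ - τ) 0 * y)
    simp only [Real.norm_eq_abs]
    linarith
  have hlim : Tendsto (fun t => ∫⁻ τ in Ioc 0 T, eLpNorm (F t τ) 2 freqMeasure) (𝓝 t₀)
      (𝓝 (∫⁻ τ in Ioc 0 T, 0)) := by
    have hGm : Measurable fun τ => eLpNorm (G τ) 2 freqMeasure := by
      simp_rw [eLpNorm_two_eq]
      exact Measurable.pow_const (Measurable.lintegral_prod_right' (hG'.enorm.pow_const 2)) _
    refine tendsto_lintegral_filter_of_dominated_convergence (fun τ => 2 * eLpNorm (G τ) 2 freqMeasure) ?_ ?_ ?_ ?_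
    · refine Eventually.of_forall fun t => ?_
      simp_rw [eLpNorm_two_eq]
      have hFm' : Measurable fun p : ℝ × ℝ => F t p.1 p.2 := hFm t
      exact Measurable.pow_const (Measurable.lintegral_prod_right' (hFm'.enorm.pow_const 2)) _
    · exact Eventually.of_forall fun t => ae_of_all _ fun τ => hb t τ
    · rw [lintegral_const_mul _ hGm]
      finiteness
    · filter_upwards [ae_lt_top hGm hfin.ne] with τ hτ
      have hmem : MemLp (G τ) 2 freqMeasure := ⟨hG.of_uncurry_left.aestronglyMeasurable, hτ⟩
      have hm : Tendsto (fun t => max (t - τ) 0) (𝓝 t₀) (𝓝 (max (t₀ - τ) 0)) :=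
        (by fun_prop : Continuous fun t : ℝ => max (t - τ) 0).tendsto t₀
      exact (tendsto_eLpNorm_osc hmem Real.continuous_sin Real.abs_sin_le_one (max (t₀ - τ) 0)).comp hm
  rw [lintegral_zero] at hlim
  refine tendsto_of_tendsto_of_tendsto_of_le_of_le' tendsto_const_nhds (hlim.mono_left nhdsWithin_le_nhds)
    (Eventually.of_forall fun t => zero_le) ?_
  filter_upwards [self_mem_nhdsWithin] with t ht
  refine le_trans (le_of_eq (eLpNorm_congr_ae ?_)) (eLpNorm_integral_le (μ := volume.restrict (Ioc 0 T)) (hFm t))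
  filter_upwards [ae_freqMeasure_pos, ae_integrable_of_lintegral_eLpNorm hG hfin] with y hy hi
  rw [mul_duhamelInt_eq_max ht hy, mul_duhamelInt_eq_max ht₀ hy, ← integral_sub]
  · simp only [hF, sub_mul]
  · exact hi.bdd_mul (c := 1) (by fun_prop) (ae_of_all _ fun τ => Real.abs_sin_le_one _)
  · exact hi.bdd_mul (c := 1) (by fun_prop) (ae_of_all _ fun τ => Real.abs_sin_le_one _)

theorem tendsto_eLpNorm_waveSol (ha : MemLp (fun y => y * a y) 2 freqMeasure) (hb : MemLp b 2 freqMeasure)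
    (hG : Measurable (Function.uncurry G)) (hfin : ∫⁻ τ in Ioc 0 T, eLpNorm (G τ) 2 freqMeasure < ⊤)
    {t₀ : ℝ} (ht₀ : t₀ ∈ Icc 0 T) :
    Tendsto (fun t => eLpNorm (fun y => y * waveSol a b G t y - y * waveSol a b G t₀ y) 2 freqMeasure)
      (𝓝[Icc 0 T] t₀) (𝓝 0) := by
  have l1 := (tendsto_eLpNorm_osc ha Real.continuous_cos Real.abs_cos_le_one t₀).mono_left
    (nhdsWithin_le_nhds (s := Icc 0 T))
  have l2 := (tendsto_eLpNorm_osc (memLp_mul_div hb) Real.continuous_sin Real.abs_sin_le_one t₀).mono_left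
    (nhdsWithin_le_nhds (s := Icc 0 T))
  have l3 := tendsto_eLpNorm_duhamelInt hG hfin ht₀
  have l4 := (l1.add l2).add l3
  simp only [add_zero] at l4
  refine tendsto_of_tendsto_of_tendsto_of_le_of_le' tendsto_const_nhds l4
    (Eventually.of_forall fun t => zero_le) ?_
  filter_upwards [self_mem_nhdsWithin] with t ht
  have m1 : AEStronglyMeasurable (fun y => (Real.cos (t * y) - Real.cos (t₀ * y)) * (y * a y)) freqMeasure :=
    (by fun_prop : Continuous fun y => Real.cos (t * y) - Real.cos (t₀ * y)).aestronglyMeasurable.mul ha.1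
  have m2 : AEStronglyMeasurable (fun y => (Real.sin (t * y) - Real.sin (t₀ * y)) * (y * (b y / y))) freqMeasure :=
    (by fun_prop : Continuous fun y => Real.sin (t * y) - Real.sin (t₀ * y)).aestronglyMeasurable.mul (memLp_mul_div hb).1
  have m3 : AEStronglyMeasurable (fun y => y * duhamelInt G t y - y * duhamelInt G t₀ y) freqMeasure :=
    ((measurable_id.mul (measurable_duhamelInt hG ht.1)).sub
      (measurable_id.mul (measurable_duhamelInt hG ht₀.1))).aestronglyMeasurable
  have e : (fun y => y * waveSol a b G t y - y * waveSol a b G t₀ y)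
      = ((fun y => (Real.cos (t * y) - Real.cos (t₀ * y)) * (y * a y))
        + fun y => (Real.sin (t * y) - Real.sin (t₀ * y)) * (y * (b y / y)))
        + fun y => y * duhamelInt G t y - y * duhamelInt G t₀ y := by
    ext y; simp only [waveSol, Pi.add_apply]; ring
  rw [e]
  exact (eLpNorm_add_le (m1.add m2) m3 (by norm_num)).trans
    (add_le_add (eLpNorm_add_le m1 m2 (by norm_num)) le_rfl)

end Continuity

/-! ### From the integral equation to the perturbed wave equation. -/

section Solution

variable {a b : ℝ → ℝ} {w G P : ℝ → ℝ → ℝ} {T : ℝ}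

/-- The forcing of the perturbed equation in terms of radial profiles. -/
theorem forcing_eq (g h : ℝ → ℝ) {x : E3} (hx : x ∈ Omega) :
    -(invDft g x) ^ 3 - 3 * (invDft g x) ^ 2 * invDft h x - 3 * invDft g x * (invDft h x) ^ 2
      = perturbedCubic (sineT h (‖x‖ - 1)) (sineT g (‖x‖ - 1)) (1 + (‖x‖ - 1)) / ‖x‖ := by
  have hx1 : 1 < ‖x‖ := by simpa [Omega] using hx
  have hx0 : 0 < ‖x‖ := by linarith
  rw [invDft_eq, invDft_eq, perturbedCubic, add_sub_cancel]
  field_simp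
  ring

/-- A solution of the integral equation gives a solution of the perturbed wave equation. -/
theorem exists_isPerturbedSolution (ha : MemLp (fun y => y * a y) 2 freqMeasure) (hb : MemLp b 2 freqMeasure)
    (hw : Continuous fun p : ℝ × ℝ => sineT (w p.1) p.2)
    (hG : Measurable (Function.uncurry G)) (hfin : ∫⁻ τ in Ioc 0 T, eLpNorm (G τ) 2 freqMeasure < ⊤)
    (hs : ∀ τ, IsSine (P τ) (G τ))
    (hPe : ∀ τ ∈ Icc 0 T, ∀ ρ, 0 ≤ ρ →
      P τ ρ = perturbedCubic (sineT (w τ) ρ) (sineT (waveSol a b G τ) ρ) (1 + ρ)) :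
    ∃ v : ℝ → HdotRad 1, IsPerturbedSolution T a b w v ∧
      ∀ t ∈ Ico 0 T, spec (v t) =ᵐ[freqMeasure] waveSol a b G t := by
  classical
  have hft : ∀ t ∈ Icc 0 T, ∫⁻ τ in Ioc 0 t, eLpNorm (G τ) 2 freqMeasure < ⊤ := fun t ht =>
    (lintegral_mono_set (Ioc_subset_Ioc_right ht.2)).trans_lt hfin
  have hmem : ∀ t ∈ Icc 0 T, MemLp (fun y => y * waveSol a b G t y) 2 freqMeasure := fun t ht =>
    memLp_waveSol ha hb hG ht.1 (hft t ht)
  -- The value 0 outside `[0, T]` is a mere default; the equation is tested on `[0, T)` only.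
  set H : ℝ → Lp ℝ 2 freqMeasure := fun t => if ht : t ∈ Icc 0 T then (hmem t ht).toLp else 0 with hH
  have hHe : ∀ t (ht : t ∈ Icc 0 T), H t = (hmem t ht).toLp := fun t ht => by simp only [hH, dif_pos ht]
  have hHc : ContinuousOn H (Icc 0 T) := by
    intro t₀ ht₀
    rw [ContinuousWithinAt, tendsto_iff_edist_tendsto_0]
    refine (tendsto_eLpNorm_waveSol ha hb hG hfin ht₀).congr' ?_
    filter_upwards [self_mem_nhdsWithin] with t ht
    rw [hHe t ht, hHe t₀ ht₀, Lp.edist_toLp_toLp]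
    rfl
  have hspec : ∀ t ∈ Ico 0 T, spec (ofFreq (H t)) =ᵐ[freqMeasure] waveSol a b G t := by
    intro t ht
    have ht' := Ico_subset_Icc_self ht
    have e : H t =ᵐ[freqMeasure] fun y => y * waveSol a b G t y := by
      rw [hHe t ht']; exact (hmem t ht').coeFn_toLp
    filter_upwards [spec_ofFreq (H t), e, ae_freqMeasure_pos] with y h1 h2 hy
    rw [h1, h2]
    field_simp
  refine ⟨fun t => ofFreq (H t), ⟨continuous_ofFreq.comp_continuousOn (hHc.mono Ico_subset_Icc_self), G,
    hG.aestronglyMeasurable, ?_, fun t ht => ?_, fun t ht => ?_⟩, hspec⟩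
  · refine (ae_restrict_iff' measurableSet_Ico).2 (ae_of_all _ fun τ hτ => ?_)
    have c1 := (sineAdm_of_memLp (hmem τ (Ico_subset_Icc_self hτ))).continuous_sineT.measurable
    have c2 : Measurable (sineT (w τ)) := hw.measurable.of_uncurry_left (f := fun τ ρ => sineT (w τ) ρ)
    refine (isDftL2_iff (P := fun ρ => perturbedCubic (sineT (w τ) ρ) (sineT (waveSol a b G τ) ρ) (1 + ρ)) ?_
      fun x hx => ?_).2 ((hs τ).congr ?_ ae_eq_rfl)
    · unfold perturbedCubic
      exact (((c1.add c2).pow_const 3).sub (c2.pow_const 3)).neg.div ((measurable_const.add measurable_id).pow_const 2)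
    · dsimp only
      rw [forcing_eq _ _ hx, sineT_congr (hspec τ hτ)]
    · filter_upwards [ae_freqMeasure_pos] with ρ hρ using hPe τ (Ico_subset_Icc_self hτ) ρ hρ.le
  · rw [uIoc_of_le ht.1]
    exact hft t (Ico_subset_Icc_self ht)
  · filter_upwards [hspec t ht] with y hy
    rw [hy, waveSol, duhamelInt]
    ring

end Solution

/-! ### Uniqueness by Grönwall's argument. -/

section Uniqueness

/-- Let `m` be the maximum of `exp (-2Kt) E t`, attained at `t₁`. Inserting `E τ ≤ m exp (2Kτ)` into
the inequality at `t₁` gives `m exp (2K t₁) ≤ m (exp (2K t₁) - 1) / 2`, which forces `m = 0`. -/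
theorem eq_zero_of_le_lintegral {E : ℝ → ℝ} {K T : ℝ} (hK : 0 < K) (hT : 0 ≤ T) (hE : ContinuousOn E (Icc 0 T))
    (h0 : ∀ t, 0 ≤ E t) (h : ∀ t ∈ Icc 0 T, ENNReal.ofReal (E t) ≤ ENNReal.ofReal K * ∫⁻ τ in Ioc 0 t, ENNReal.ofReal (E τ)) :
    ∀ t ∈ Icc 0 T, E t = 0 := by
  obtain ⟨t₁, ht₁, hmax⟩ := isCompact_Icc.exists_isMaxOn ⟨0, left_mem_Icc.2 hT⟩
    (show ContinuousOn (fun t => Real.exp (-(2 * K * t)) * E t) (Icc 0 T) by fun_prop)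
  set m := Real.exp (-(2 * K * t₁)) * E t₁ with hm
  have hm0 : 0 ≤ m := mul_nonneg (Real.exp_pos _).le (h0 _)
  have hle : ∀ t ∈ Icc 0 T, E t ≤ m * Real.exp (2 * K * t) := by
    intro t ht
    have h1 : Real.exp (-(2 * K * t)) * E t ≤ m := hmax ht
    calc E t = Real.exp (-(2 * K * t)) * E t * Real.exp (2 * K * t) := by
          rw [mul_right_comm, ← Real.exp_add]; simp
      _ ≤ _ := by gcongr
  have hint : ∫⁻ τ in Ioc 0 t₁, ENNReal.ofReal (m * Real.exp (2 * K * τ))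
      = ENNReal.ofReal (m * ((Real.exp (2 * K * t₁) - 1) / (2 * K))) := by
    rw [← ofReal_integral_eq_lintegral_ofReal, integral_const_mul, ← intervalIntegral.integral_of_le ht₁.1,
      intervalIntegral.integral_comp_mul_left (fun x => Real.exp x) (by positivity), integral_exp]
    · congr 2
      simp only [mul_zero, Real.exp_zero, smul_eq_mul]
      field_simp
    · exact ((by fun_prop : Continuous fun τ => m * Real.exp (2 * K * τ)).integrableOn_Icc).mono_set Ioc_subset_Icc_self
    · exact ae_of_all _ fun τ => by positivity
  have h2 : ENNReal.ofReal (E t₁) ≤ ENNReal.ofReal (K * (m * ((Real.exp (2 * K * t₁) - 1) / (2 * K)))) := by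
    rw [ENNReal.ofReal_mul hK.le, ← hint]
    refine (h t₁ ht₁).trans (mul_le_mul' le_rfl (setLIntegral_mono' measurableSet_Ioc fun τ hτ => ?_))
    exact ENNReal.ofReal_le_ofReal (hle τ ⟨hτ.1.le, hτ.2.trans ht₁.2⟩)
  have hexp : 1 ≤ Real.exp (2 * K * t₁) := Real.one_le_exp (by have := ht₁.1; positivity)
  rw [ENNReal.ofReal_le_ofReal_iff (by
    have : 0 ≤ Real.exp (2 * K * t₁) - 1 := by linarith
    positivity)] at h2
  have h3 : E t₁ = m * Real.exp (2 * K * t₁) := by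
    rw [hm, mul_right_comm, ← Real.exp_add]; simp
  have h4 : K * (m * ((Real.exp (2 * K * t₁) - 1) / (2 * K))) = m * (Real.exp (2 * K * t₁) - 1) / 2 := by
    field_simp
  rw [h3, h4] at h2
  have hmz : m = 0 := by nlinarith
  intro t ht
  have := hle t ht
  rw [hmz, zero_mul] at this
  exact le_antisymm this (h0 t)

variable {a b : ℝ → ℝ} {w : ℝ → ℝ → ℝ} {v v' : ℝ → HdotRad 1} {T ν : ℝ}

theorem continuous_field_hdot (u : HdotRad 1) : Continuous (sineT (spec u)) :=
  (sineAdm_of_memLp (memLp_spec_one u)).continuous_sineT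

theorem abs_field_hdot_le (u : HdotRad 1) {ρ : ℝ} (hρ : 0 ≤ ρ) : |sineT (spec u) ρ| ≤ 2 * ‖u‖ * √(1 + ρ) := by
  have h1 := enorm_sineT_sq_le (memLp_spec_one u).1 hρ
  have h2 : eLpNorm (fun y => y * spec u y) 2 freqMeasure ≤ ENNReal.ofReal ‖u‖ := by
    rw [ENNReal.le_ofReal_iff_toReal_le (memLp_spec_one u).2.ne (norm_nonneg _)]
    simpa only [Real.rpow_one] using norm_rpow_spec u
  have h3 := h1.trans (mul_le_mul' le_rfl (pow_le_pow_left' h2 2))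
  rw [← ofReal_norm, ← ENNReal.ofReal_pow (norm_nonneg _), ← ENNReal.ofReal_pow (by positivity),
    ← ENNReal.ofReal_mul (by positivity), ENNReal.ofReal_le_ofReal_iff (by positivity), Real.norm_eq_abs] at h3
  refine le_of_sq_le_sq ?_ (by positivity)
  rw [mul_pow, Real.sq_sqrt (by linarith)]
  nlinarith [sq_nonneg ‖u‖]

/-- The forcing profile of a solution of the perturbed equation. -/
def forcingProfile (w : ℝ → ℝ → ℝ) (v : ℝ → HdotRad 1) (τ ρ : ℝ) : ℝ :=
  perturbedCubic (sineT (w τ) ρ) (sineT (spec (v τ)) ρ) (1 + ρ)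

theorem measurable_forcingProfile (hw : Continuous fun p : ℝ × ℝ => sineT (w p.1) p.2) (τ : ℝ) :
    Measurable (forcingProfile w v τ) := by
  have c1 := (continuous_field_hdot (v τ)).measurable
  have c2 : Measurable (sineT (w τ)) := hw.measurable.of_uncurry_left (f := fun τ ρ => sineT (w τ) ρ)
  exact (((c1.add c2).pow_const 3).sub (c2.pow_const 3)).neg.div ((measurable_const.add measurable_id).pow_const 2)

theorem IsPerturbedSolution.exists_forcing (hv : IsPerturbedSolution T a b w v)
    (hw : Continuous fun p : ℝ × ℝ => sineT (w p.1) p.2) :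
    ∃ G : ℝ → ℝ → ℝ, Measurable (Function.uncurry G) ∧
      (∀ᵐ τ ∂(volume.restrict (Ico 0 T)), IsSine (forcingProfile w v τ) (G τ)) ∧
      (∀ t ∈ Ico 0 T, ∫⁻ τ in Ioc 0 t, eLpNorm (G τ) 2 freqMeasure < ⊤) ∧
      ∀ t ∈ Ico 0 T, spec (v t) =ᵐ[freqMeasure] waveSol a b G t := by
  obtain ⟨G, h1, h2, h3, h4⟩ := hv.duhamel.exists_measurable fun t ht τ hτ => ⟨hτ.1.le, hτ.2.trans_lt ht.2⟩
  refine ⟨G, h1, ?_, fun t ht => h3 t ht ht.1, fun t ht => ?_⟩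
  · filter_upwards [h2] with τ hτ
    exact (isDftL2_iff (measurable_forcingProfile hw τ) fun x hx => forcing_eq _ _ hx).1 hτ
  · filter_upwards [h4 t ht ht.1] with y hy
    rw [hy, waveSol]
    ring

/-- The pointwise Lipschitz bound leaves the difference of the fields divided by `1 + ρ`, to which
Hardy's inequality applies; `12 = 3 · 4` with the Hardy constant 4. -/
theorem eLpNorm_forcingProfile_sub_le {W : ℝ → ℝ} (hν : ∀ ρ, 0 ≤ ρ → |W ρ| ≤ ν * √(1 + ρ)) {Λ : ℝ}
    {u u' : HdotRad 1} (hu : ‖u‖ ≤ Λ) (hu' : ‖u'‖ ≤ Λ) :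
    eLpNorm (fun ρ => perturbedCubic (W ρ) (sineT (spec u) ρ) (1 + ρ) - perturbedCubic (W ρ) (sineT (spec u') ρ) (1 + ρ))
      2 freqMeasure ≤ ENNReal.ofReal (12 * (2 * Λ + ν) ^ 2) *
        eLpNorm (fun y => y * (spec u y - spec u' y)) 2 freqMeasure := by
  have hm : AEStronglyMeasurable (fun y => y * (spec u y - spec u' y)) freqMeasure := by
    simpa only [mul_sub] using! (memLp_spec_one u).1.sub (memLp_spec_one u').1
  have hsub := (sineAdm_of_memLp (memLp_spec_one u)).sineT_sub (sineAdm_of_memLp (memLp_spec_one u'))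
  have hle : eLpNorm (fun ρ => perturbedCubic (W ρ) (sineT (spec u) ρ) (1 + ρ)
      - perturbedCubic (W ρ) (sineT (spec u') ρ) (1 + ρ)) 2 freqMeasure
      ≤ ENNReal.ofReal (3 * (2 * Λ + ν) ^ 2) *
        eLpNorm (fun ρ => ρ⁻¹ * sineT (fun y => spec u y - spec u' y) ρ) 2 freqMeasure := by
    refine eLpNorm_le_mul_eLpNorm_of_ae_le_mul ?_ 2
    filter_upwards [ae_freqMeasure_pos] with ρ hρ
    have hr : 0 < 1 + ρ := by linarith
    have hA : ∀ x : HdotRad 1, ‖x‖ ≤ Λ → |sineT (spec x) ρ| + |W ρ| ≤ (2 * Λ + ν) * √(1 + ρ) := by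
      intro x hx
      rw [add_mul]
      refine add_le_add ((abs_field_hdot_le x hρ.le).trans ?_) (hν ρ hρ.le)
      gcongr
    rw [Real.norm_eq_abs, norm_mul, hsub, Real.norm_of_nonneg (inv_nonneg.2 hρ.le)]
    refine (abs_perturbedCubic_sub_le hr (hA u hu) (hA u' hu')).trans ?_
    rw [mul_pow, Real.sq_sqrt hr.le, ← mul_assoc, ← mul_assoc, Real.norm_eq_abs]
    refine mul_le_mul_of_nonneg_right ?_ (abs_nonneg _)
    rw [pow_two (1 + ρ), mul_div_mul_right _ _ hr.ne', div_eq_mul_inv]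
    gcongr
    linarith
  refine hle.trans ?_
  rw [show 12 * (2 * Λ + ν) ^ 2 = 3 * (2 * Λ + ν) ^ 2 * 4 by ring,
    ENNReal.ofReal_mul (p := 3 * (2 * Λ + ν) ^ 2) (by positivity), mul_assoc]
  refine mul_le_mul' le_rfl ((eLpNorm_sineT_div_le hm).trans (le_of_eq ?_))
  norm_num

theorem eLpNorm_waveSol_sub_le {G G' : ℝ → ℝ → ℝ} (hG : Measurable (Function.uncurry G))
    (hG' : Measurable (Function.uncurry G')) {t : ℝ} (ht : 0 ≤ t)
    (hfin : ∫⁻ τ in Ioc 0 t, eLpNorm (G τ) 2 freqMeasure < ⊤)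
    (hfin' : ∫⁻ τ in Ioc 0 t, eLpNorm (G' τ) 2 freqMeasure < ⊤) :
    eLpNorm (fun y => y * (waveSol a b G t y - waveSol a b G' t y)) 2 freqMeasure
      ≤ ∫⁻ τ in Ioc 0 t, eLpNorm (fun y => G τ y - G' τ y) 2 freqMeasure := by
  have hm : Measurable (Function.uncurry fun τ y => G τ y - G' τ y) := hG.sub hG'
  refine le_trans (le_of_eq (eLpNorm_congr_ae ?_)) (eLpNorm_duhamelInt_le hm ht)
  filter_upwards [ae_freqMeasure_pos, ae_integrable_of_lintegral_eLpNorm hG hfin,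
    ae_integrable_of_lintegral_eLpNorm hG' hfin'] with y hy i1 i2
  have e : y * (waveSol a b G t y - waveSol a b G' t y) = y * duhamelInt G t y - y * duhamelInt G' t y := by
    simp only [waveSol]; ring
  rw [e, mul_duhamelInt ht hy, mul_duhamelInt ht hy, mul_duhamelInt ht hy, ← integral_sub]
  · simp only [mul_sub]
  · exact i1.bdd_mul (c := 1) (by fun_prop) (ae_of_all _ fun τ => Real.abs_sin_le_one _)
  · exact i2.bdd_mul (c := 1) (by fun_prop) (ae_of_all _ fun τ => Real.abs_sin_le_one _)

/-- On `[0, t₁]` with `t₁ < T` both solutions are bounded by compactness, so the nonlinearity is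
Lipschitz in the energy norm there. Plancherel transfers this to the transforms of the forcings, and
Grönwall's argument applies. Neither `T` nor the solutions need be small. -/
theorem IsPerturbedSolution.unique (hv : IsPerturbedSolution T a b w v) (hv' : IsPerturbedSolution T a b w v')
    (hw : Continuous fun p : ℝ × ℝ => sineT (w p.1) p.2)
    (hν : ∀ τ ∈ Icc 0 T, ∀ ρ, 0 ≤ ρ → |sineT (w τ) ρ| ≤ ν * √(1 + ρ)) : EqOn v' v (Ico 0 T) := by
  intro t₁ ht₁
  obtain ⟨G, g1, g2, g3, g4⟩ := hv.exists_forcing hw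
  obtain ⟨G', g1', g2', g3', g4'⟩ := hv'.exists_forcing hw
  have hsub : Icc 0 t₁ ⊆ Ico 0 T := fun τ hτ => ⟨hτ.1, hτ.2.trans_lt ht₁.2⟩
  obtain ⟨Λ₁, hΛ₁⟩ := isCompact_Icc.exists_bound_of_continuousOn (hv.cont.mono hsub)
  obtain ⟨Λ₂, hΛ₂⟩ := isCompact_Icc.exists_bound_of_continuousOn (hv'.cont.mono hsub)
  set Λ := max Λ₁ Λ₂ with hΛ
  -- The summand 1 only ensures that `K` is positive.
  set K := 12 * (2 * Λ + ν) ^ 2 + 1 with hK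
  have hK0 : 0 < K := by positivity
  have heE : ∀ t, eLpNorm (fun y => y * (spec (v' t) y - spec (v t) y)) 2 freqMeasure
      = ENNReal.ofReal ‖toFreq (v' t) - toFreq (v t)‖ := by
    intro t
    rw [ofReal_norm, Lp.enorm_def]
    refine eLpNorm_congr_ae ?_
    filter_upwards [Lp.coeFn_sub (toFreq (v' t)) (toFreq (v t)), toFreq_ae (v' t), toFreq_ae (v t)] with y h1 h2 h3
    rw [h1, Pi.sub_apply, h2, h3]; ring
  have hzero := eq_zero_of_le_lintegral (E := fun t => ‖toFreq (v' t) - toFreq (v t)‖) hK0 ht₁.1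
    (((continuous_toFreq.comp_continuousOn (hv'.cont.mono hsub)).sub
      (continuous_toFreq.comp_continuousOn (hv.cont.mono hsub))).norm) (fun t => norm_nonneg _) (fun t ht => ?_)
    t₁ (right_mem_Icc.2 ht₁.1)
  · exact toFreq_injective (sub_eq_zero.1 (norm_eq_zero.1 hzero))
  have ht' := hsub ht
  simp_rw [← heE]
  calc eLpNorm (fun y => y * (spec (v' t) y - spec (v t) y)) 2 freqMeasure
      = eLpNorm (fun y => y * (waveSol a b G' t y - waveSol a b G t y)) 2 freqMeasure := by
        refine eLpNorm_congr_ae ?_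
        filter_upwards [g4 t ht', g4' t ht'] with y h1 h2
        rw [h1, h2]
    _ ≤ ∫⁻ τ in Ioc 0 t, eLpNorm (fun y => G' τ y - G τ y) 2 freqMeasure :=
        eLpNorm_waveSol_sub_le g1' g1 ht.1 (g3' t ht') (g3 t ht')
    _ ≤ ∫⁻ τ in Ioc 0 t, ENNReal.ofReal K * eLpNorm (fun y => y * (spec (v' τ) y - spec (v τ) y)) 2 freqMeasure := by
        have hmono : volume.restrict (Ioc 0 t) ≤ volume.restrict (Ico 0 T) :=
          Measure.restrict_mono (fun τ (hτ : τ ∈ Ioc 0 t) => show τ ∈ Ico 0 T from ⟨hτ.1.le, hτ.2.trans_lt ht'.2⟩) le_rfl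
        refine lintegral_mono_ae ?_
        filter_upwards [ae_mono hmono g2, ae_mono hmono g2', ae_restrict_mem measurableSet_Ioc] with τ s1 s2 hτ
        have hτ1 : τ ∈ Icc 0 t₁ := ⟨hτ.1.le, hτ.2.trans ht.2⟩
        rw [s2.eLpNorm_sub_eq s1 (measurable_forcingProfile hw τ).aestronglyMeasurable
          (measurable_forcingProfile hw τ).aestronglyMeasurable g1'.of_uncurry_left.aestronglyMeasurable
          g1.of_uncurry_left.aestronglyMeasurable]
        refine (eLpNorm_forcingProfile_sub_le (hν τ (Ico_subset_Icc_self (hsub hτ1)))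
          ((hΛ₂ τ hτ1).trans (le_max_right _ _)) ((hΛ₁ τ hτ1).trans (le_max_left _ _))).trans ?_
        exact mul_le_mul' (ENNReal.ofReal_le_ofReal (by linarith)) le_rfl
    _ = _ := lintegral_const_mul' _ _ ENNReal.ofReal_ne_top

end Uniqueness

/-! ### Low and high frequency parts of the data. -/

section Data

variable {χ : ℝ → ℝ} {J : ℤ} {s : ℝ}

theorem IsCutoff.aestronglyMeasurable (h : IsCutoff χ) (J : ℤ) :
    AEStronglyMeasurable (fun y => χ (y / (2 : ℝ) ^ J)) freqMeasure := by
  refine ContinuousOn.aestronglyMeasurable ?_ measurableSet_Ioi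
  refine h.smooth.continuousOn.comp (by fun_prop) fun y hy => ?_
  have : (0 : ℝ) < y := hy
  exact div_nonneg this.le (by positivity)

/-- The cutoff vanishes beyond `2 · 2^J`, below which `y^{1-s}` is bounded because `s ≤ 1`: low
frequencies of rough data have finite energy. Since the multiplier is also square integrable, the
product is integrable, as d'Alembert's formula requires. -/
theorem IsCutoff.memLp_low (h : IsCutoff χ) (J : ℤ) (hs : s ≤ 1) {g : ℝ → ℝ} (hg : MemLp g 2 freqMeasure) :
    MemLp (fun y => χ (y / (2 : ℝ) ^ J) * y ^ (1 - s) * g y) 2 freqMeasure ∧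
      Integrable (fun y => χ (y / (2 : ℝ) ^ J) * y ^ (1 - s) * g y) freqMeasure := by
  set N : ℝ := (2 : ℝ) ^ J with hN
  have hN0 : 0 < N := by positivity
  set C := (2 * N) ^ (1 - s) with hC
  have hm : AEStronglyMeasurable (fun y => χ (y / N) * y ^ (1 - s)) freqMeasure :=
    (h.aestronglyMeasurable J).mul (Measurable.aestronglyMeasurable (by fun_prop))
  have hb : ∀ y, 0 < y → ‖χ (y / N) * y ^ (1 - s)‖ ≤ ‖(Ioc 0 (2 * N)).indicator (fun _ => C) y‖ := by
    intro y hy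
    by_cases hy2 : y ≤ 2 * N
    · rw [indicator_of_mem (show y ∈ Ioc 0 (2 * N) from ⟨hy, hy2⟩), norm_mul, Real.norm_of_nonneg (Real.rpow_nonneg hy.le _),
        Real.norm_of_nonneg (show 0 ≤ C by positivity)]
      have := h.mem_Icc (y / N) (by positivity)
      rw [Real.norm_of_nonneg this.1, ← one_mul C]
      exact mul_le_mul this.2 (Real.rpow_le_rpow hy.le hy2 (by linarith)) (by positivity) zero_le_one
    · rw [h.eq_zero (y / N) (by rw [le_div_iff₀ hN0]; linarith), zero_mul, norm_zero]
      exact norm_nonneg _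
  constructor
  · refine hg.of_le_mul (c := C) (hm.mul hg.1) ?_
    filter_upwards [ae_freqMeasure_pos] with y hy
    rw [norm_mul]
    gcongr
    refine (hb y hy).trans ((norm_indicator_le_norm_self _ _).trans ?_)
    rw [Real.norm_of_nonneg (show 0 ≤ C by positivity)]
  · have hφ : MemLp (fun y => χ (y / N) * y ^ (1 - s)) 2 freqMeasure := by
      refine MemLp.mono (g := (Ioc 0 (2 * N)).indicator fun _ => C) ?_ hm
        (ae_freqMeasure_pos.mono fun y hy => hb y hy)
      refine memLp_indicator_const 2 measurableSet_Ioc C (Or.inr ?_)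
      exact ((Measure.restrict_apply_le _ _).trans_lt (by rw [Real.volume_Ioc]; finiteness)).ne
    exact hφ.integrable_mul hg

theorem IsCutoff.abs_high_le (h : IsCutoff χ) (J : ℤ) {y : ℝ} (hy : 0 < y) :
    |(1 - χ (y / (2 : ℝ) ^ J)) * y ^ (-s)| ≤ (Ioi ((2 : ℝ) ^ J)).indicator (fun y => y ^ (-s)) y := by
  have hN0 : 0 < (2 : ℝ) ^ J := by positivity
  by_cases hyN : y ∈ Ioi ((2 : ℝ) ^ J)
  · have := h.mem_Icc (y / (2 : ℝ) ^ J) (by positivity)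
    rw [indicator_of_mem hyN, abs_mul, abs_of_nonneg (sub_nonneg.2 this.2), abs_of_nonneg (Real.rpow_nonneg hy.le _)]
    exact mul_le_of_le_one_left (Real.rpow_nonneg hy.le _) (by linarith [this.1])
  · rw [h.eq_one (y / (2 : ℝ) ^ J) (by positivity) (by rw [div_le_one hN0]; simpa using hyN), sub_self, zero_mul, abs_zero,
      indicator_of_notMem hyN]

/-- Frequencies below `2^J` are absent, and above it `y^{1/2-s} ≤ 2^{J(1/2-s)}` because `s > 1/2`.
This passage from order `s` to the scale invariant order `1/2` is the source of the smallness of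
`w`. Integrability holds because `y^{-s}` is square integrable at infinity. -/
theorem IsCutoff.high (h : IsCutoff χ) (J : ℤ) (hs : 1 / 2 < s) {g : ℝ → ℝ} (hg : MemLp g 2 freqMeasure) :
    Integrable (fun y => (1 - χ (y / (2 : ℝ) ^ J)) * y ^ (-s) * g y) freqMeasure ∧
      ∫⁻ y, ENNReal.ofReal y * ‖(1 - χ (y / (2 : ℝ) ^ J)) * y ^ (-s) * g y‖ₑ ^ 2 ∂freqMeasure
        ≤ ENNReal.ofReal (((2 : ℝ) ^ J) ^ (1 / 2 - s) * (eLpNorm g 2 freqMeasure).toReal) ^ 2 := by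
  set N : ℝ := (2 : ℝ) ^ J with hN
  have hN0 : 0 < N := by positivity
  have hm : AEStronglyMeasurable (fun y => (1 - χ (y / N)) * y ^ (-s)) freqMeasure :=
    (aestronglyMeasurable_const.sub (h.aestronglyMeasurable J)).mul (Measurable.aestronglyMeasurable (by fun_prop))
  constructor
  · refine MemLp.integrable_mul ((memLp_rpow_neg_Ioi hs hN0).mono hm ?_) hg
    filter_upwards [ae_freqMeasure_pos] with y hy
    exact (h.abs_high_le J hy).trans (le_abs_self _)
  · rw [ENNReal.ofReal_mul (by positivity), ENNReal.ofReal_toReal hg.2.ne, mul_pow, eLpNorm_two_sq,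
      ← lintegral_const_mul' _ _ (by finiteness)]
    refine lintegral_mono_ae ?_
    filter_upwards [ae_freqMeasure_pos] with y hy
    rw [enorm_mul, mul_pow, ← mul_assoc]
    refine mul_le_mul' ?_ le_rfl
    rw [← ofReal_norm, ← ENNReal.ofReal_pow (norm_nonneg _), ← ENNReal.ofReal_pow (by positivity),
      ← ENNReal.ofReal_mul hy.le]
    refine ENNReal.ofReal_le_ofReal ?_
    have hb := h.abs_high_le (s := s) J hy
    by_cases hyN : y ∈ Ioi N
    · rw [indicator_of_mem hyN] at hb
      have hyN' : N < y := hyN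
      calc _ ≤ y * (y ^ (-s)) ^ 2 := by
            rw [Real.norm_eq_abs]; gcongr
        _ = (y ^ (1 / 2 - s)) ^ 2 := by
            rw [← Real.rpow_natCast, ← Real.rpow_natCast, ← Real.rpow_mul hy.le, ← Real.rpow_mul hy.le,
              ← Real.rpow_one_add' hy.le]
            · congr 1; push_cast; ring
            · push_cast; linarith
        _ ≤ _ := by
            gcongr ?_ ^ 2
            exact Real.rpow_le_rpow_of_nonpos hN0 hyN'.le (by linarith)
    · rw [indicator_of_notMem hyN] at hb
      have := abs_nonpos_iff.1 hb
      rw [this]; simp; positivity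

end Data

/-! ### Numerical constants and conclusion. -/

theorem two_rpow_int_mul (J : ℤ) (x : ℝ) : (2 : ℝ) ^ ((J : ℝ) * x) = ((2 : ℝ) ^ J) ^ x := by
  rw [Real.rpow_mul (by norm_num), Real.rpow_intCast]

theorem hdotNorm_zero (g : ℝ → ℝ) : hdotNorm 0 g = √(4 * Real.pi) * (eLpNorm g 2 freqMeasure).toReal := by
  rw [hdotNorm_eq]; simp only [Real.rpow_zero, one_mul]

theorem hdotNorm_one (g : ℝ → ℝ) :
    hdotNorm 1 g = √(4 * Real.pi) * (eLpNorm (fun y => y * g y) 2 freqMeasure).toReal := by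
  rw [hdotNorm_eq]; simp only [Real.rpow_one]

theorem high_data_le {X Y : ℝ≥0∞} {x y : ℝ} (hx : X ≤ ENNReal.ofReal x ^ 2) (hy : Y ≤ ENNReal.ofReal y ^ 2)
    (hx0 : 0 ≤ x) (hy0 : 0 ≤ y) (hxy : x + y ≤ 1 / 1000) :
    64 * (ENNReal.ofReal (8 * Real.pi) * X ^ 2 + ENNReal.ofReal (8 * Real.pi) * Y ^ 2) ≤ ENNReal.ofReal (1 / 4000000) := by
  have key : ∀ {Z : ℝ≥0∞} {z : ℝ}, Z ≤ ENNReal.ofReal z ^ 2 → 0 ≤ z → z ≤ 1 / 1000 →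
      Z ^ 2 ≤ ENNReal.ofReal (1 / 1000000000000) := by
    intro Z z hZ h0 h1
    have h2 : ENNReal.ofReal z ^ 2 ≤ ENNReal.ofReal (1 / 1000000) := by
      rw [← ENNReal.ofReal_pow h0]
      exact ENNReal.ofReal_le_ofReal (by nlinarith)
    refine (pow_le_pow_left' (hZ.trans h2) 2).trans ?_
    rw [← ENNReal.ofReal_pow (by norm_num)]
    exact ENNReal.ofReal_le_ofReal (by norm_num)
  calc _ ≤ 64 * (ENNReal.ofReal (8 * Real.pi) * ENNReal.ofReal (1 / 1000000000000)
        + ENNReal.ofReal (8 * Real.pi) * ENNReal.ofReal (1 / 1000000000000)) :=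
        mul_le_mul' le_rfl (add_le_add (mul_le_mul' le_rfl (key hx hx0 (by linarith)))
          (mul_le_mul' le_rfl (key hy hy0 (by linarith))))
    _ = ENNReal.ofReal (64 * (8 * Real.pi * (1 / 1000000000000) + 8 * Real.pi * (1 / 1000000000000))) := by
        rw [ENNReal.ofReal_mul (p := 64) (by norm_num), ENNReal.ofReal_add (by positivity) (by positivity),
          ENNReal.ofReal_mul (p := 8 * Real.pi) (q := 1 / 1000000000000) (by positivity),
          show ENNReal.ofReal 64 = 64 by norm_num]
    _ ≤ _ := ENNReal.ofReal_le_ofReal (by linarith [Real.pi_lt_d2])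

end ExteriorWave

end

theorem proposition4p2 :
    ∃ ε₀ : ℝ, 0 < ε₀ ∧ ∃ c : ℝ, 0 < c ∧ ∃ C : ℝ, 0 < C ∧
      ∀ (s : ℝ), 1 / 2 < s → s ≤ 1 →
      ∀ (χ : ℝ → ℝ), ExteriorWave.IsCutoff χ →
      ∀ (u₀ : ExteriorWave.HdotRad s) (u₁ : ExteriorWave.HdotRad (s - 1)) (J : ℤ),
        (2 : ℝ) ^ ((J : ℝ) * (1 / 2 - s)) * (‖u₀‖ + ‖u₁‖) ≤ ε₀ →
      ∀ (w : ℝ → ℝ → ℝ),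
        ExteriorWave.IsGlobalCubicSolution s
          (ExteriorWave.highFreq χ J (ExteriorWave.spec u₀))
          (ExteriorWave.highFreq χ J (ExteriorWave.spec u₁)) w →
      ∀ (v₀ v₁ : ℝ → ℝ),
        v₀ = ExteriorWave.lowFreq χ J (ExteriorWave.spec u₀) →
        v₁ = ExteriorWave.lowFreq χ J (ExteriorWave.spec u₁) →
      ∀ (T : ℝ), 0 < T →
        T * (ExteriorWave.hdotNorm 1 v₀ + ExteriorWave.hdotNorm 0 v₁) ^ 2 ≤ c →
        ∃ v : ℝ → ExteriorWave.HdotRad 1,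
          ExteriorWave.IsPerturbedSolution T v₀ v₁ w v ∧
          (∀ v' : ℝ → ExteriorWave.HdotRad 1,
            ExteriorWave.IsPerturbedSolution T v₀ v₁ w v' → Set.EqOn v' v (Set.Ico 0 T)) ∧
          ∀ t ∈ Set.Ico (0 : ℝ) T,
            ‖v t‖ ≤ C * (ExteriorWave.hdotNorm 1 v₀ + ExteriorWave.hdotNorm 0 v₁) := by
  open ExteriorWave MeasureTheory Set in
  -- With `ε₀ = 1/1000` the quartic bound holds with `D = 1/4000000`, and `2D ≤ 1/1960000`. The
  -- choice `c = 1/400` implies `T M² ≤ 1/320`, since the factor `√(4π) ≥ 1` in the norms only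
  -- helps. The energy is at most `M + Q ≤ 2M`, whence `C = 2`.
  refine ⟨1 / 1000, by norm_num, 1 / 400, by norm_num, 2, by norm_num, ?_⟩
  intro s hs hs1 χ hχ u₀ u₁ J hsmall w hw v₀ v₁ hv₀ hv₁ T hT hTc
  have hg₀ := memLp_spec u₀
  have hg₁ := memLp_spec u₁
  have low₀ := hχ.memLp_low J hs1 hg₀
  have low₁ := hχ.memLp_low J hs1 hg₁
  have e₀ : (fun y => χ (y / (2 : ℝ) ^ J) * y ^ (1 - s) * (y ^ s * spec u₀ y)) =ᵐ[freqMeasure] fun y => y * v₀ y := by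
    filter_upwards [ae_freqMeasure_pos] with y hy
    have : y ^ (1 - s) * y ^ s = y := by rw [← Real.rpow_add hy]; simp
    rw [hv₀, lowFreq]
    linear_combination χ (y / (2 : ℝ) ^ J) * spec u₀ y * this
  have e₁ : (fun y => χ (y / (2 : ℝ) ^ J) * y ^ (1 - s) * (y ^ (s - 1) * spec u₁ y)) =ᵐ[freqMeasure] v₁ := by
    filter_upwards [ae_freqMeasure_pos] with y hy
    have : y ^ (1 - s) * y ^ (s - 1) = 1 := by rw [← Real.rpow_add hy]; simp
    rw [hv₁, lowFreq]
    linear_combination χ (y / (2 : ℝ) ^ J) * spec u₁ y * this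
  have ha := low₀.1.ae_eq e₀
  have ha1 := low₀.2.congr e₀
  have hb := low₁.1.ae_eq e₁
  have hb1 := low₁.2.congr e₁
  have high₀ := hχ.high J hs hg₀
  have high₁ := hχ.high J hs hg₁
  have k₀ : (fun y => (1 - χ (y / (2 : ℝ) ^ J)) * y ^ (-s) * (y ^ s * spec u₀ y))
      =ᵐ[freqMeasure] highFreq χ J (spec u₀) := by
    filter_upwards [ae_freqMeasure_pos] with y hy
    have : y ^ (-s) * y ^ s = 1 := by rw [← Real.rpow_add hy]; simp
    rw [highFreq, lowFreq]
    linear_combination (1 - χ (y / (2 : ℝ) ^ J)) * spec u₀ y * this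
  -- Dividing the velocity by the frequency raises its order from `s - 1` to `s`, so both data fall
  -- under the same high frequency bound.
  have k₁ : (fun y => (1 - χ (y / (2 : ℝ) ^ J)) * y ^ (-s) * (y ^ (s - 1) * spec u₁ y))
      =ᵐ[freqMeasure] fun y => highFreq χ J (spec u₁) y / y := by
    filter_upwards [ae_freqMeasure_pos] with y hy
    have : y ^ (-s) * y ^ (s - 1) = y⁻¹ := by
      rw [← Real.rpow_add hy, ← Real.rpow_neg_one]; congr 1; ring
    rw [highFreq, lowFreq, div_eq_mul_inv (spec u₁ y - _) y]
    linear_combination (1 - χ (y / (2 : ℝ) ^ J)) * spec u₁ y * this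
  rw [two_rpow_int_mul] at hsmall
  set κ : ℝ := ((2 : ℝ) ^ J) ^ (1 / 2 - s) with hκ
  have hκ0 : 0 ≤ κ := by positivity
  have n₀ := norm_rpow_spec u₀
  have n₁ := norm_rpow_spec u₁
  have hQ := hw.lintegral_quartic_le hs (high₀.1.congr k₀) (high₁.1.congr k₁) (D := 1 / 4000000) (by norm_num)
    (by norm_num) (high_data_le
      (le_of_eq_of_le (lintegral_congr_ae (k₀.mono fun y hy => by dsimp only at hy ⊢; rw [hy])) high₀.2)
      (le_of_eq_of_le (lintegral_congr_ae (k₁.mono fun y hy => by dsimp only at hy ⊢; rw [hy])) high₁.2)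
      (by positivity) (by positivity) ?_) hT.le
  swap
  · calc _ ≤ κ * ‖u₀‖ + κ * ‖u₁‖ := by gcongr
      _ ≤ _ := by rw [← mul_add]; exact hsmall
  have hcont := hw.continuous_field hs
  obtain ⟨rough, -, hrough⟩ := hw.rough hs
  obtain ⟨ν, hν0, hν⟩ := hrough T
  -- The growth exponent 1/8 of the field is below the exponent 1/2 admitted by the truncated
  -- problem.
  have hfield : ∀ τ ∈ Icc 0 T, ∀ ρ, 0 ≤ ρ → |sineT (w τ) ρ| ≤ ν * √(1 + ρ) := by
    intro τ hτ ρ hρ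
    refine ((rough τ).abs_sineT_le hρ).trans ?_
    rw [mul_comm, Real.sqrt_eq_rpow]
    gcongr
    · exact hν τ hτ
    · linarith
    · norm_num
  set A := eLpNorm (fun y => y * v₀ y) 2 freqMeasure with hA
  set B := eLpNorm v₁ 2 freqMeasure with hB
  have hAtop : A ≠ ⊤ := ha.2.ne
  have hBtop : B ≠ ⊤ := hb.2.ne
  have hnorm : hdotNorm 1 v₀ + hdotNorm 0 v₁ = √(4 * Real.pi) * (A + B).toReal := by
    rw [hdotNorm_one, hdotNorm_zero, ENNReal.toReal_add hAtop hBtop, mul_add]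
  rw [hnorm] at hTc ⊢
  have hMT : T * (A + B).toReal ^ 2 ≤ 1 / 320 := by
    have : (A + B).toReal ≤ √(4 * Real.pi) * (A + B).toReal :=
      le_mul_of_one_le_left ENNReal.toReal_nonneg one_le_sqrt_four_pi
    calc _ ≤ T * (√(4 * Real.pi) * (A + B).toReal) ^ 2 := by gcongr
      _ ≤ _ := by linarith
  obtain ⟨G, P, hG, -, hGP, hfin, hPe⟩ := exists_wave_solution ha ha1 hb hb1 hcont hfield
    (hQ.trans (ENNReal.ofReal_le_ofReal (by norm_num))) hT.le hMT
  have hfin' := hfin.trans_lt (ENNReal.add_lt_top.2 ⟨ha.2, hb.2⟩)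
  obtain ⟨v, hv, hspec⟩ := exists_isPerturbedSolution ha hb hcont hG hfin' hGP hPe
  refine ⟨v, hv, fun v' hv' => hv.unique hv' hcont hfield, fun t ht => ?_⟩
  rw [norm_hdot, mul_left_comm]
  refine mul_le_mul_of_nonneg_left ?_ (Real.sqrt_nonneg _)
  have h2 : eLpNorm (fun y => y ^ (1 : ℝ) * spec (v t) y) 2 freqMeasure ≤ (A + B) + (A + B) := by
    refine le_trans (le_of_eq (eLpNorm_congr_ae ?_)) ((eLpNorm_waveSol_le ha hb hG ht.1).trans
      (add_le_add le_rfl ((lintegral_mono_set (Ioc_subset_Ioc_right ht.2.le)).trans hfin)))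
    filter_upwards [hspec t ht] with y hy
    rw [hy, Real.rpow_one]
  refine (ENNReal.toReal_mono (by finiteness) h2).trans (le_of_eq ?_)
  rw [ENNReal.toReal_add (by finiteness) (by finiteness), two_mul]
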